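/- **Setting.** Let $\{\mathbf a(n)\}_{n\ge1}$ be non-negative reals, and put $\mathbf a(m)=0$ for integers $m<0$. For $x\ge 0$, $q\ge1$ and $b\in\mathbb Z\setminus\{0\}$ let $$\mathcal A(x)=\sum_{1\le n\le x}\mathbf a(n),\qquad \mathcal A(x;q,b)=\sum_{\substack{1\le n\le x\\ n\equiv b\,(q)}}\mathbf a(n),\qquad \mathcal A^*(x;q,b)=\sum_{\substack{|b|<n\le x\\ n\equiv b\,(q)}}\mathbf a(n).$$ Let $\mathbf h$ be a real-valued multiplicative function. Put $\gamma(q)=\prod_{p\mid q}\frac{1-1/p}{1-\mathbf h(p)/p}$ and $\mathbf f_b(q)=\mathbf g_b(q)\,q\,\gamma(q)$, where $\mathbf g_b$ is the multiplicative function given, for $p^f\parallel b$ ($f\ge0$), by $$\mathbf g_b(p^e)=\frac{\mathbf h(p^e)}{p^e}\ (e\le f),\qquad \mathbf g_b(p^e)=\frac1{\phi(p^e)}\Big(\mathbf h(p^f)-\frac{\mathbf h(p^{f+1})}p\Big)\ (e>f).$$ Assume that for all $b\ne0$ and $q\ge1$ with $\mathbf f_b(q)\neq0$ one has $\mathcal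 A(x;q,b)\sim\frac{\mathbf f_b(q)}{q\gamma(q)}\mathcal A(x)$ as $x\to\infty$. Fix an integer $a\ne0$. Let $\mathbf L:[0,\infty)\to[1,\infty)$ be smooth and increasing, with $\mathbf L(x)\to\infty$, and such that for every $B>0$ one has $(\log \mathbf L(x))^B\le \mathbf L(x/\mathbf L(x))$ for all large $x$. Assume that the following hold, each for some $\delta>0$, with the bounds in 1, 2 and 4 holding for all sufficiently large $x$. 1. There is a positive increasing function $\mathbf R$ with $\mathbf L(x)^{1+\delta}\le\mathbf R(x)\le\sqrt x$ and $$\sum_{q\le2\mathbf R(x)}\max_{0\le y\le x}\Big|\mathcal A(y;q,a)-\frac{\mathbf f_a(q)}{q\gamma(q)}\mathcal A(y)\Big|\ll\frac{\mathcal A(x)}{\mathbf L(x)^{1+\delta}}.$$ 2. Uniformly for $\frac1{\mathbf L(x)}\le z\le1+\frac{|a|}x$ one has $\frac{\mathcal A(zx)}{\mathcal A(x)}=z+O(\mathbf L(x)^{-1-\delta})$; and $\mathbf a(n)\ll\mathcal A(x)\mathbf L(x)^{-1-\delta}$ uniformly for $1\le n\le x$. 3. There is a real $\mathbf k\ge0$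 such that $\sum_p\frac{\mathbf h(p)-\mathbf k}p$ converges (summed over increasing $p$); uniformly in $y\ge 1$ and $t\in\mathbb R$, $$\Big|\Re\sum_{p\le y}\frac{\mathbf h(p)-\mathbf k}{p^{1+it}}\Big|\le(\tfrac12-\delta)\log(|t|+2)+O(1),\qquad \sum_{p\le y}\frac{(\mathbf h(p)-\mathbf k)\log^np}{p^{1+it}}\ll_{n,\epsilon}(|t|+2)^\epsilon$$ for all integers $n\ge1$ and all $\epsilon>0$; $\mathbf h(p)<p$ for every prime $p$; and $\mathbf h(d)\ll_\epsilon d^\epsilon$ for every $\epsilon>0$. 4. With the same $\mathbf R$ as in 1, $\displaystyle\Big|\sum_{q\le x/\mathbf R(x)}\Big(\mathcal A^*(x;q,a)-\frac{\mathbf f_a(q)}{q\gamma(q)}\mathcal A(x)\Big)\Big|\ll\frac{\mathcal A(x)}{\mathbf L(x)^{1+\delta}}.$ Let $\omega_{\mathbf h}(a)$ be the number of prime powers $p^f\parallel a$, $f\ge1$, with $\mathbf h(p^f)=\mathbf h(p^{f+1})/p$, and define $$\mu_{\mathbf k}(a,M)=-\frac12\,\frac{(\log M)^{1-\mathbf k-\omega_{\mathbf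 h}(a)}}{\Gamma(2-\mathbf k-\omega_{\mathbf h}(a))}\prod_{\substack{p^f\parallel a,\ f\ge1\\ \mathbf h(p^f)=\mathbf h(p^{f+1})/p}}\frac{1+\mathbf h(p)+\dots+\mathbf h(p^f)}{(1-1/p)^{\mathbf k-1}}\log p\prod_{\substack{p^f\parallel a,\ f\ge0\\ \mathbf h(p^f)\ne\mathbf h(p^{f+1})/p}}\frac{\mathbf h(p^f)-\mathbf h(p^{f+1})/p}{(1-1/p)^{\mathbf k}},$$ where $1/\Gamma=0$ at the poles of $\Gamma$ and the second product, over all remaining primes (including those not dividing $a$), is the limit of its partial products over $p\le N$ as $N\to\infty$. **Theorem 4.1.** The infinite product in $\mu_{\mathbf k}(a,M)$ converges, and, uniformly for all large $x$ and all real $M$ with $1<M\le\mathbf L(x)$, $$\sum_{q\le x/M}\Big(\mathcal A(x;q,a)-\mathbf a(a)-\frac{\mathbf f_a(q)}{q\gamma(q)}\mathcal A(x)\Big)=\frac{\mathcal A(x)}M\Big(\mu_{\mathbf k}(a,M)\,(1+o(1))+O_A\Big(\frac1{\log^AM}\Big)\Big)$$ for every $A>0$. Here $o(1)$ denotes a quantity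 bounded by a function of $M$ alone that tends to $0$ as $M\to\infty$. The $o(1)$ and the implied constants may depend on $a$, the sequence and the other fixed data; only the constant in $O_A$ depends on $A$. -/

import Mathlib

open Filter Topology

noncomputable section

namespace ArithSeq

/-- `𝒜(x) = ∑_{1 ≤ n ≤ x} s(n)`. -/
def count (s : ℕ → ℝ) (x : ℝ) : ℝ :=
  ∑ n ∈ Finset.Icc 1 ⌊x⌋₊, s n

/-- `𝒜(x; q, a) = ∑_{1 ≤ n ≤ x, n ≡ a mod q} s(n)`. -/
def countAP (s : ℕ → ℝ) (x : ℝ) (q : ℕ) (a : ℤ) : ℝ :=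
  ∑ n ∈ (Finset.Icc 1 ⌊x⌋₊).filter (fun n : ℕ => (n : ℤ) ≡ a [ZMOD (q : ℤ)]), s n

/-- `𝒜*(x; q, a) = ∑_{|a| < n ≤ x, n ≡ a mod q} s(n)`. -/
def countAPStar (s : ℕ → ℝ) (x : ℝ) (q : ℕ) (a : ℤ) : ℝ :=
  ∑ n ∈ (Finset.Icc 1 ⌊x⌋₊).filter
    (fun n : ℕ => |a| < (n : ℤ) ∧ (n : ℤ) ≡ a [ZMOD (q : ℤ)]), s n

/-- The value of the sequence at the integer `a`, set to `0` for negative `a`. -/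
def termAt (s : ℕ → ℝ) (a : ℤ) : ℝ :=
  if 0 < a then s a.toNat else 0

/-- The value of `g_a` at the prime power `p ^ e` when `p ^ f ∥ a`. -/
def gLocal (h : ArithmeticFunction ℝ) (p e f : ℕ) : ℝ :=
  if e ≤ f then h (p ^ e) / (p : ℝ) ^ e
  else (h (p ^ f) - h (p ^ (f + 1)) / p) / (Nat.totient (p ^ e) : ℝ)

/-- The multiplicative function `g_a(q)`. -/
def g (h : ArithmeticFunction ℝ) (a : ℤ) (q : ℕ) : ℝ :=
  ∏ p ∈ q.primeFactors, gLocal h p (q.factorization p) (a.natAbs.factorization p)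

/-- `γ(q) = ∏_{p ∣ q} (1 - 1/p) / (1 - h(p)/p)`. -/
def gam (h : ArithmeticFunction ℝ) (q : ℕ) : ℝ :=
  ∏ p ∈ q.primeFactors, (1 - 1 / (p : ℝ)) / (1 - h p / p)

/-- The multiplicative function `f_a(q) = g_a(q) q γ(q)`. -/
def f (h : ArithmeticFunction ℝ) (a : ℤ) (q : ℕ) : ℝ :=
  g h a q * q * gam h q

/-- Standing assumption: for all `b ≠ 0` and `q ≥ 1`,
`𝒜(x; q, b) ∼ f_b(q) / (q γ(q)) 𝒜(x)` as `x → ∞`, whenever `f_b(q) ≠ 0`. -/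
def Equidistributed (s : ℕ → ℝ) (h : ArithmeticFunction ℝ) : Prop :=
  ∀ (b : ℤ) (q : ℕ), b ≠ 0 → 1 ≤ q → f h b q ≠ 0 →
    Asymptotics.IsEquivalent atTop (fun x : ℝ => countAP s x q b)
      (fun x : ℝ => f h b q / (q * gam h q) * count s x)

/-- The comparison function `L : [0, ∞) → [1, ∞)`: smooth, increasing, tending to infinity, and
without abrupt jumps: `L(x / L(x))` eventually exceeds every fixed power of `log L(x)`. -/
structure IsScale (L : ℝ → ℝ) : Prop where
  one_le : ∀ x, 0 ≤ x → 1 ≤ L x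
  smooth : ContDiffOn ℝ (⊤ : ℕ∞) L (Set.Ici 0)
  mono : MonotoneOn L (Set.Ici 0)
  tendsto : Tendsto L atTop atTop
  regular : ∀ B : ℝ, 0 < B → ∀ᶠ x in atTop, Real.log (L x) ^ B ≤ L (x / L x)

/-- Bombieri–Vinogradov type hypothesis up to level `2 R(x)`. -/
def BombieriVinogradov (s : ℕ → ℝ) (h : ArithmeticFunction ℝ) (a : ℤ) (L R : ℝ → ℝ) : Prop :=
  (∀ x, 0 ≤ x → 0 < R x) ∧ MonotoneOn R (Set.Ici 0) ∧
  ∃ δ : ℝ, 0 < δ ∧ ∃ C : ℝ, ∀ᶠ x in atTop,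
    L x ^ (1 + δ) ≤ R x ∧ R x ≤ √x ∧
    ∑ q ∈ Finset.Icc 1 ⌊2 * R x⌋₊,
        (⨆ y : Set.Icc (0 : ℝ) x,
          |countAP s y q a - f h a q / (q * gam h q) * count s y|)
      ≤ C * (count s x / L x ^ (1 + δ))

/-- Regularity of `𝒜(x)`, and the bound for individual terms. -/
def RegularSize (s : ℕ → ℝ) (a : ℤ) (L : ℝ → ℝ) : Prop :=
  ∃ δ : ℝ, 0 < δ ∧ ∃ C : ℝ, ∀ᶠ x in atTop,
    (∀ z : ℝ, 1 / L x ≤ z → z ≤ 1 + |(a : ℝ)| / x →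
      |count s (z * x) / count s x - z| ≤ C * (1 / L x ^ (1 + δ))) ∧
    (∀ n : ℕ, 1 ≤ n → (n : ℝ) ≤ x → s n ≤ C * (count s x / L x ^ (1 + δ)))

/-- The primes `p ≤ N`. -/
def primesUpTo (N : ℕ) : Finset ℕ :=
  (Finset.Icc 1 N).filter Nat.Prime

/-- `∑_{p ≤ N} (h(p) - k) (log p) ^ n / p ^ (1 + i t)`. -/
def twistedSum (h : ArithmeticFunction ℝ) (k : ℝ) (n : ℕ) (t : ℝ) (N : ℕ) : ℂ :=
  ∑ p ∈ primesUpTo N,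
    (((h p - k) * Real.log p ^ n : ℝ) : ℂ) / (p : ℂ) ^ (1 + (t : ℂ) * Complex.I)

/-- The analytic conditions on `h(p) - k`. -/
def AnalyticCondition (h : ArithmeticFunction ℝ) (k : ℝ) : Prop :=
  0 ≤ k ∧
  (∃ ℓ : ℝ, Tendsto (fun N : ℕ => ∑ p ∈ primesUpTo N, (h p - k) / (p : ℝ)) atTop (𝓝 ℓ)) ∧
  (∃ δ : ℝ, 0 < δ ∧ ∃ C : ℝ, ∀ (t : ℝ) (N : ℕ),
    |(twistedSum h k 0 t N).re| ≤ (1 / 2 - δ) * Real.log (|t| + 2) + C) ∧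
  (∀ n : ℕ, 1 ≤ n → ∀ ε : ℝ, 0 < ε → ∃ C : ℝ, ∀ (t : ℝ) (N : ℕ),
    ‖twistedSum h k n t N‖ ≤ C * (|t| + 2) ^ ε) ∧
  (∀ p : ℕ, p.Prime → h p < p) ∧
  (∀ ε : ℝ, 0 < ε → ∃ C : ℝ, ∀ d : ℕ, 1 ≤ d → |h d| ≤ C * (d : ℝ) ^ ε)

/-- Bombieri–Friedlander–Iwaniec type hypothesis. -/
def BombieriFriedlanderIwaniec (s : ℕ → ℝ) (h : ArithmeticFunction ℝ) (a : ℤ)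
    (L R : ℝ → ℝ) : Prop :=
  ∃ δ : ℝ, 0 < δ ∧ ∃ C : ℝ, ∀ᶠ x in atTop,
    |∑ q ∈ Finset.Icc 1 ⌊x / R x⌋₊,
        (countAPStar s x q a - f h a q / (q * gam h q) * count s x)|
      ≤ C * (count s x / L x ^ (1 + δ))

/-- The primes `p` with `p ^ f ∥ a`, `f ≥ 1` and `h(p ^ f) = h(p ^ (f + 1)) / p`. For `f = 0` the
equation says `h(p) = p`, so it never holds when `h(p) < p` for all primes `p`. -/
def degeneratePrimes (h : ArithmeticFunction ℝ) (a : ℤ) : Finset ℕ :=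
  open Classical in
  a.natAbs.primeFactors.filter (fun p =>
    h (p ^ a.natAbs.factorization p) = h (p ^ (a.natAbs.factorization p + 1)) / p)

/-- `ω_h(a)`. -/
def omegaH (h : ArithmeticFunction ℝ) (a : ℤ) : ℕ :=
  (degeneratePrimes h a).card

/-- The finite product in `μ_k(a, M)`, over the primes counted by `ω_h(a)`. -/
def degenerateProduct (h : ArithmeticFunction ℝ) (k : ℝ) (a : ℤ) : ℝ :=
  ∏ p ∈ degeneratePrimes h a,
    (∑ j ∈ Finset.range (a.natAbs.factorization p + 1), h (p ^ j)) /
      (1 - 1 / (p : ℝ)) ^ (k - 1) * Real.log p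

/-- The part over `p ≤ N` of the infinite product in `μ_k(a, M)`, over all remaining primes
(those not dividing `a` included). -/
def partialProduct (h : ArithmeticFunction ℝ) (k : ℝ) (a : ℤ) (N : ℕ) : ℝ :=
  ∏ p ∈ primesUpTo N \ degeneratePrimes h a,
    (h (p ^ a.natAbs.factorization p) - h (p ^ (a.natAbs.factorization p + 1)) / p) /
      (1 - 1 / (p : ℝ)) ^ k

/-- The infinite product in `μ_k(a, M)`, the limit of its partial products over `p ≤ N`. -/
def singularProduct (h : ArithmeticFunction ℝ) (k : ℝ) (a : ℤ) : ℝ :=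
  limUnder atTop (partialProduct h k a)

/-- `μ_k(a, M)`. The quotient by the Gamma function is `0` at its poles: there
`Real.Gamma` takes the value `0`, and division by `0` gives `0`. -/
def mu (h : ArithmeticFunction ℝ) (k : ℝ) (a : ℤ) (M : ℝ) : ℝ :=
  -(1 / 2) * (Real.log M ^ (1 - k - (omegaH h a : ℝ)) / Real.Gamma (2 - k - (omegaH h a : ℝ))) *
    degenerateProduct h k a * singularProduct h k a

/-- `∑_{q ≤ x/M} (𝒜(x; q, a) - s(a) - f_a(q) / (q γ(q)) 𝒜(x))`. -/
def discrepancy (s : ℕ → ℝ) (h : ArithmeticFunction ℝ) (a : ℤ) (x M : ℝ) : ℝ :=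
  ∑ q ∈ Finset.Icc 1 ⌊x / M⌋₊,
    (countAP s x q a - termAt s a - f h a q / (q * gam h q) * count s x)

end ArithSeq

end

/-! Write g(q) for f_a(q)/(qγ(q)), A for the counting function, c and c' for `resid` and
`constTerm`. The moduli q ≤ x/R(x) are covered by hypothesis 4. For x/R < q ≤ x/M write n - a = qr.
The cofactor r is small, and the count over large q becomes a difference of two counts of n ≡ a mod
r with n > a + rx/R, respectively n > a + rx/M (`sum_countAPStar_eq_switched`). Hypothesis 1
replaces each of them by g(r)(A(x) - A(a + r·)) (`abs_switched_sub_le`). By the regularity of A, the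
sum attached to M is close to A(x) ∑_{r ≤ M} g(r)(1 - r/M). The sum attached to R is evaluated from
∑_{r ≤ t} g(r) = c log t + c' + (power saving) together with ∑ s(n) log(x/n) ≈ A(x)
(`Regular.exists_abs_logSum_sub_le`). All logarithms and constants cancel
(`abs_add_le_of_switched`), and what survives is -A(x)/M · F(log M), where F is `corrRem`, the
remainder in the exact formula `sum_g_mul_one_sub`.

It remains to show F(log M) ≈ -μ. Let b = μ * (r g(r)), with μ the Möbius function. Then F(u) = ∑
b(m) P(e^u/m), where P is `remKernel`, which tends to 1/2 at infinity. The Laplace transform of F is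
therefore the Dirichlet series of b times w⁻¹(1/2 + O(w)). That Dirichlet series behaves like
ζ(1+w)^{1-k} near w = 0, with one additional zero for each prime counted by ω (`LSeries_corr_eq`).
Hence the transform is w^l Q(w) with l = k + ω - 2, where Q(0+) is half the full product occurring
in μ. Since w^l corresponds to u^{-l-1}/Γ(-l), the leading term of F(u) is Q(0+) u^{1-k-ω}/Γ(2-k-ω),
which is -μ (`corrRem_expansion`). If 1/Γ vanishes there, it vanishes in every term of the
expansion, and F decays faster than any power of u.

Nothing is assumed to the left of Re w = 0, so no contour is shifted. Instead every derivative of Q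
is bounded polynomially in the open strip 0 < Re w < 1/2, uniformly up to the axis (`Tame`). After
subtracting truncated powers one may differentiate the transform j times, that is, multiply the
function by u^j. Fourier inversion on short windows then bounds local averages, and a Lipschitz
bound for F turns averages into values (`laplace_expansion`). The delicate analytic input is the
lower bound for |wζ(1+w)| near Re w = 0 (`polyBdd_inv_zetaReg`), which makes the logarithmic
derivative of zeta grow more slowly than any power. -/

noncomputable section
-- Holomorphic functions whose derivatives grow polynomially on a strip
namespace ArithSeq

/-- Growth at most `(2 + |Im w|) ^ (K + ε)` on `Ω`, for every `ε > 0`. -/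
def PolyBdd (Ω : Set ℂ) (K : ℝ) (F : ℂ → ℂ) : Prop :=
  ∀ ε : ℝ, 0 < ε → ∃ C : ℝ, ∀ w ∈ Ω, ‖F w‖ ≤ C * (2 + |w.im|) ^ (K + ε)

/-- All derivatives up to order `n` satisfy `PolyBdd Ω K`. -/
def Tame (Ω : Set ℂ) (K : ℝ) : ℕ → (ℂ → ℂ) → Prop
  | 0, F => PolyBdd Ω K F
  | n + 1, F => PolyBdd Ω K F ∧ Tame Ω K n (deriv F)

theorem one_le_two_add_abs (x : ℝ) : 1 ≤ 2 + |x| := by linarith [abs_nonneg x]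

namespace PolyBdd
variable {Ω : Set ℂ} {K K' : ℝ} {F G : ℂ → ℂ}

theorem exists_nonneg (h : PolyBdd Ω K F) {ε : ℝ} (hε : 0 < ε) :
    ∃ C : ℝ, 0 ≤ C ∧ ∀ w ∈ Ω, ‖F w‖ ≤ C * (2 + |w.im|) ^ (K + ε) := by
  obtain ⟨C, hC⟩ := h ε hε
  refine ⟨max C 0, le_max_right _ _, fun w hw => (hC w hw).trans ?_⟩
  gcongr
  exact le_max_left _ _

theorem congr (h : PolyBdd Ω K F) (hFG : Set.EqOn F G Ω) : PolyBdd Ω K G := by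
  intro ε hε
  obtain ⟨C, hC⟩ := h ε hε
  exact ⟨C, fun w hw => hFG hw ▸ hC w hw⟩

theorem mono (h : PolyBdd Ω K F) (hK : K ≤ K') : PolyBdd Ω K' F := by
  intro ε hε
  obtain ⟨C, hC0, hC⟩ := h.exists_nonneg hε
  refine ⟨C, fun w hw => (hC w hw).trans ?_⟩
  gcongr
  exact one_le_two_add_abs _

theorem subset {Ω' : Set ℂ} (h : PolyBdd Ω K F) (hs : Ω' ⊆ Ω) : PolyBdd Ω' K F := by
  intro ε hε
  obtain ⟨C, hC⟩ := h ε hε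
  exact ⟨C, fun w hw => hC w (hs hw)⟩

theorem add (hF : PolyBdd Ω K F) (hG : PolyBdd Ω K G) : PolyBdd Ω K (fun w => F w + G w) := by
  intro ε hε
  obtain ⟨C, hC⟩ := hF ε hε
  obtain ⟨D, hD⟩ := hG ε hε
  refine ⟨C + D, fun w hw => (norm_add_le _ _).trans ?_⟩
  rw [add_mul]
  exact add_le_add (hC w hw) (hD w hw)

theorem mul (hF : PolyBdd Ω K F) (hG : PolyBdd Ω K' G) :
    PolyBdd Ω (K + K') (fun w => F w * G w) := by
  intro ε hε
  obtain ⟨C, hC0, hC⟩ := hF.exists_nonneg (half_pos hε)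
  obtain ⟨D, hD0, hD⟩ := hG.exists_nonneg (half_pos hε)
  refine ⟨C * D, fun w hw => ?_⟩
  rw [norm_mul]
  have h0 : 0 < 2 + |w.im| := by positivity
  calc ‖F w‖ * ‖G w‖
      ≤ (C * (2 + |w.im|) ^ (K + ε / 2)) * (D * (2 + |w.im|) ^ (K' + ε / 2)) :=
        mul_le_mul (hC w hw) (hD w hw) (norm_nonneg _) (by positivity)
    _ = C * D * (2 + |w.im|) ^ (K + K' + ε) := by
        have h5 : K + K' + ε = (K + ε / 2) + (K' + ε / 2) := by ring
        rw [h5, Real.rpow_add h0 (K + ε / 2)]; generalize (2 + |w.im|) ^ (K + ε / 2) = X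
        generalize (2 + |w.im|) ^ (K' + ε / 2) = X'
        ring

theorem of_bounded {C : ℝ} (h : ∀ w ∈ Ω, ‖F w‖ ≤ C) : PolyBdd Ω 0 F := by
  intro ε hε
  refine ⟨max C 0, fun w hw => (h w hw).trans ?_⟩
  have := Real.one_le_rpow (one_le_two_add_abs w.im) (by linarith : (0 : ℝ) ≤ 0 + ε)
  nlinarith [le_max_left C 0, le_max_right C 0]

end PolyBdd

namespace Tame
variable {Ω : Set ℂ} {K K' : ℝ} {n m : ℕ} {F G : ℂ → ℂ}

theorem bdd (h : Tame Ω K n F) : PolyBdd Ω K F := by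
  cases n with
  | zero => exact h
  | succ n => exact h.1

theorem of_succ (h : Tame Ω K (n + 1) F) : Tame Ω K n F := by
  induction n generalizing F with
  | zero => exact h.1
  | succ n ih => exact ⟨h.1, ih h.2⟩

theorem mono (h : Tame Ω K n F) (hK : K ≤ K') : Tame Ω K' n F := by
  induction n generalizing F with
  | zero => exact PolyBdd.mono h hK
  | succ n ih => exact ⟨h.1.mono hK, ih h.2⟩

theorem subset {Ω' : Set ℂ} (h : Tame Ω K n F) (hs : Ω' ⊆ Ω) : Tame Ω' K n F := by
  induction n generalizing F with
  | zero => exact PolyBdd.subset h hs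
  | succ n ih => exact ⟨h.1.subset hs, ih h.2⟩

theorem congr (hΩ : IsOpen Ω) (h : Tame Ω K n F) (hFG : Set.EqOn F G Ω) : Tame Ω K n G := by
  induction n generalizing F G with
  | zero => exact PolyBdd.congr h hFG
  | succ n ih =>
    refine ⟨h.1.congr hFG, ih h.2 fun w hw => ?_⟩
    exact (hFG.eventuallyEq_of_mem (hΩ.mem_nhds hw)).deriv_eq

theorem add (hΩ : IsOpen Ω) (hFd : DifferentiableOn ℂ F Ω) (hGd : DifferentiableOn ℂ G Ω)
    (hF : Tame Ω K n F) (hG : Tame Ω K n G) : Tame Ω K n (fun w => F w + G w) := by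
  induction n generalizing F G with
  | zero => exact PolyBdd.add hF hG
  | succ n ih =>
    refine ⟨hF.1.add hG.1, (ih (hFd.deriv hΩ) (hGd.deriv hΩ) hF.2 hG.2).congr hΩ fun w hw => ?_⟩
    have h1 := hFd.differentiableAt (hΩ.mem_nhds hw)
    have h2 := hGd.differentiableAt (hΩ.mem_nhds hw)
    exact (deriv_fun_add h1 h2).symm

theorem mul (hΩ : IsOpen Ω) (hFd : DifferentiableOn ℂ F Ω) (hGd : DifferentiableOn ℂ G Ω)
    (hF : Tame Ω K n F) (hG : Tame Ω K' n G) : Tame Ω (K + K') n (fun w => F w * G w) := by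
  induction n generalizing F G with
  | zero => exact PolyBdd.mul hF hG
  | succ n ih =>
    refine ⟨hF.1.mul hG.1, ?_⟩
    have hA := ih (hFd.deriv hΩ) hGd hF.2 hG.of_succ
    have hB := ih hFd (hGd.deriv hΩ) hF.of_succ hG.2
    refine (add hΩ ((hFd.deriv hΩ).mul hGd) (hFd.mul (hGd.deriv hΩ)) hA hB).congr hΩ
      fun w hw => ?_
    have h1 := hFd.differentiableAt (hΩ.mem_nhds hw)
    have h2 := hGd.differentiableAt (hΩ.mem_nhds hw)
    exact (deriv_fun_mul h1 h2).symm

theorem const (c : ℂ) : Tame Ω 0 n (fun _ => c) := by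
  induction n generalizing c with
  | zero => exact PolyBdd.of_bounded (C := ‖c‖) fun _ _ => le_rfl
  | succ n ih =>
    refine ⟨PolyBdd.of_bounded (C := ‖c‖) fun _ _ => le_rfl, ?_⟩
    simpa using ih 0

theorem const_mul (hΩ : IsOpen Ω) (c : ℂ) (hFd : DifferentiableOn ℂ F Ω) (hF : Tame Ω K n F) :
    Tame Ω K n (fun w => c * F w) := by
  have := (const (Ω := Ω) (n := n) c).mul hΩ (differentiableOn_const c) hFd hF
  rwa [zero_add] at this

theorem sub (hΩ : IsOpen Ω) (hFd : DifferentiableOn ℂ F Ω) (hGd : DifferentiableOn ℂ G Ω)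
    (hF : Tame Ω K n F) (hG : Tame Ω K n G) : Tame Ω K n (fun w => F w - G w) := by
  refine (hF.add hΩ hFd (hGd.const_mul (-1)) (hG.const_mul hΩ (-1) hGd)).congr hΩ fun w _ => ?_
  simp [sub_eq_add_neg]

theorem sum {ι : Type*} (s : Finset ι) {F : ι → ℂ → ℂ} (hΩ : IsOpen Ω) (hK : 0 ≤ K)
    (hd : ∀ i ∈ s, DifferentiableOn ℂ (F i) Ω)
    (h : ∀ i ∈ s, Tame Ω K n (F i)) : Tame Ω K n (fun w => ∑ i ∈ s, F i w) := by
  classical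
  induction s using Finset.induction_on with
  | empty => simpa using (const (Ω := Ω) (n := n) 0).mono hK
  | insert a s ha ih =>
    simp only [Finset.sum_insert ha]
    refine (h a (by simp)).add hΩ (hd a (by simp)) ?_
      (ih (fun i hi => hd i (by simp [hi])) fun i hi => h i (by simp [hi]))
    exact DifferentiableOn.fun_sum fun i hi => hd i (by simp [hi])

/-- A solution of `Z' = Z v` with `v` of growth exponent `0` is as tame as `v`. -/
theorem of_deriv_eq_mul (hΩ : IsOpen Ω) {v : ℂ → ℂ} (hFd : DifferentiableOn ℂ F Ω)
    (hvd : DifferentiableOn ℂ v Ω) (hF : PolyBdd Ω K F)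
    (hv : Tame Ω 0 n v) (hder : ∀ w ∈ Ω, deriv F w = F w * v w) : Tame Ω K (n + 1) F := by
  induction n with
  | zero =>
    have h2 := hF.mul hv
    rw [add_zero] at h2
    exact ⟨hF, h2.congr fun w hw => (hder w hw).symm⟩
  | succ n ih =>
    have h2 := (ih hv.of_succ).mul hΩ hFd hvd hv
    rw [add_zero] at h2
    exact ⟨hF, h2.congr hΩ fun w hw => (hder w hw).symm⟩

/-- Since (1/F)' = -F'·F⁻², the exponents combine to -K - K + K = -K. Only the reciprocal itself
needs an independent bound; all its derivatives follow. -/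
theorem inv (hΩ : IsOpen Ω) (hFd : DifferentiableOn ℂ F Ω) (h0 : ∀ w ∈ Ω, F w ≠ 0)
    (hF : Tame Ω K n F) (hb : PolyBdd Ω (-K) (fun w => (F w)⁻¹)) :
    Tame Ω (-K) n (fun w => (F w)⁻¹) := by
  have hid : DifferentiableOn ℂ (fun w => (F w)⁻¹) Ω := hFd.fun_inv h0
  induction n with
  | zero => exact hb
  | succ n ih =>
    have h1 := ih hF.of_succ
    have h2 := ((h1.mul hΩ hid hid h1).mul hΩ (hid.fun_mul hid) (hFd.deriv hΩ) hF.2).const_mul hΩ (-1)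
      ((hid.fun_mul hid).fun_mul (hFd.deriv hΩ))
    rw [show -K + -K + K = -K by ring] at h2
    refine ⟨hb, h2.congr hΩ fun w hw => ?_⟩
    have h3 := hFd.differentiableAt (hΩ.mem_nhds hw)
    have := (h3.hasDerivAt.fun_inv (h0 w hw)).deriv
    rw [this]
    field_simp

end Tame

/-- The open vertical strip `-r < Re w < 1/2 + r`. -/
def wideStrip (r : ℝ) : Set ℂ := {w | -r < w.re ∧ w.re < 1 / 2 + r}

theorem isOpen_wideStrip (r : ℝ) : IsOpen (wideStrip r) :=
  (isOpen_lt continuous_const Complex.continuous_re).inter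
    (isOpen_lt Complex.continuous_re continuous_const)

theorem wideStrip_mono {r r' : ℝ} (h : r ≤ r') : wideStrip r ⊆ wideStrip r' := fun w hw =>
  ⟨by linarith [hw.1], by linarith [hw.2]⟩

theorem closedBall_subset_wideStrip {r r' : ℝ} {w : ℂ} (hw : w ∈ wideStrip r) :
    Metric.closedBall w (r' - r) ⊆ wideStrip r' := by
  intro z hz
  rw [Metric.mem_closedBall, dist_eq_norm] at hz
  have h1 := (Complex.abs_re_le_norm (z - w)).trans hz
  rw [Complex.sub_re, abs_le] at h1
  exact ⟨by linarith [hw.1, h1.1], by linarith [hw.2, h1.2]⟩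

/-- Cauchy's estimate on a circle of radius at most 1 contained in the larger strip. The height
changes by at most 1 on the circle, so the growth exponent is unchanged. -/
theorem PolyBdd.deriv_of_wideStrip {r r' K : ℝ} (h : r < r') {F : ℂ → ℂ}
    (hFd : DifferentiableOn ℂ F (wideStrip r')) (hF : PolyBdd (wideStrip r') K F) :
    PolyBdd (wideStrip r) K (deriv F) := by
  intro ε hε
  obtain ⟨C, hC0, hC⟩ := hF.exists_nonneg hε
  set ρ := min (r' - r) 1 with hρ
  have hρ0 : 0 < ρ := lt_min (by linarith) one_pos
  refine ⟨C * 2 ^ |K + ε| / ρ, fun w hw => ?_⟩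
  have hsub : Metric.closedBall w ρ ⊆ wideStrip r' :=
    (Metric.closedBall_subset_closedBall (min_le_left _ _)).trans (closedBall_subset_wideStrip hw)
  have hd : DiffContOnCl ℂ F (Metric.ball w ρ) := by
    refine DifferentiableOn.diffContOnCl ?_
    rw [closure_ball w hρ0.ne']
    exact hFd.mono hsub
  have key : ∀ z ∈ Metric.sphere w ρ, ‖F z‖ ≤ C * 2 ^ |K + ε| * (2 + |w.im|) ^ (K + ε) := by
    intro z hz
    have hzb := Metric.sphere_subset_closedBall hz
    refine (hC z (hsub hzb)).trans ?_
    rw [mul_assoc]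
    gcongr
    have h1 : |z.im - w.im| ≤ 1 := by
      have h2 := Complex.abs_im_le_norm (z - w)
      rw [Complex.sub_im] at h2
      rw [Metric.mem_closedBall, dist_eq_norm] at hzb
      exact h2.trans (hzb.trans (min_le_right _ _))
    have ha : |z.im| ≤ |w.im| + 1 := by
      have := abs_sub_abs_le_abs_sub z.im w.im; linarith
    have hb : |w.im| ≤ |z.im| + 1 := by
      have := abs_sub_abs_le_abs_sub w.im z.im; rw [abs_sub_comm] at this; linarith
    have hz0 : 0 < 2 + |z.im| := by positivity
    have hw0 : 0 < 2 + |w.im| := by positivity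
    -- The quantities 2 + |Im| at the centre and on the circle differ by a factor at most 2 either
    -- way. The sign of the exponent decides which inequality is used.
    rcases le_total 0 (K + ε) with hk | hk
    · rw [abs_of_nonneg hk, ← Real.mul_rpow (by norm_num) hw0.le]
      exact Real.rpow_le_rpow hz0.le (by linarith [abs_nonneg w.im]) hk
    · rw [abs_of_nonpos hk, Real.rpow_neg (by norm_num), ← Real.inv_rpow (by norm_num),
        ← Real.mul_rpow (by norm_num) hw0.le]
      refine Real.rpow_le_rpow_of_nonpos (by positivity) (by linarith [abs_nonneg z.im]) hk
  calc ‖deriv F w‖ ≤ C * 2 ^ |K + ε| * (2 + |w.im|) ^ (K + ε) / ρ :=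
        Complex.norm_deriv_le_of_forall_mem_sphere_norm_le hρ0 hd key
    _ = C * 2 ^ |K + ε| / ρ * (2 + |w.im|) ^ (K + ε) := by ring

/-- Each derivative uses up half of the remaining gap between the strips, so growth in a wider strip
controls all derivatives. -/
theorem Tame.of_wideStrip {r r' K : ℝ} (h : r < r') {F : ℂ → ℂ} (n : ℕ)
    (hFd : DifferentiableOn ℂ F (wideStrip r')) (hF : PolyBdd (wideStrip r') K F) :
    Tame (wideStrip r) K n F := by
  induction n generalizing F r' with
  | zero => exact hF.subset (wideStrip_mono h.le)
  | succ n ih =>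
    have hm : r < (r + r') / 2 := by linarith
    have hm' : (r + r') / 2 < r' := by linarith
    exact ⟨hF.subset (wideStrip_mono h.le),
      ih hm ((hFd.deriv (isOpen_wideStrip _)).mono (wideStrip_mono hm'.le))
        (hF.deriv_of_wideStrip hm' hFd)⟩

theorem Tame.id {r : ℝ} (n : ℕ) : Tame (wideStrip r) 1 n (fun w => w) := by
  have hb : PolyBdd (wideStrip r) 1 (fun w => w) := by
    intro ε hε
    refine ⟨1 + |r|, fun w hw => ?_⟩
    have h1 : ‖w‖ ≤ |w.re| + |w.im| := Complex.norm_le_abs_re_add_abs_im w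
    have h2 : |w.re| ≤ 1 / 2 + |r| := by
      rw [abs_le]; constructor <;> linarith [hw.1, hw.2, le_abs_self r]
    have h3 : (2 + |w.im|) ≤ (2 + |w.im|) ^ (1 + ε) := by
      conv_lhs => rw [← Real.rpow_one (2 + |w.im|)]
      exact Real.rpow_le_rpow_of_exponent_le (one_le_two_add_abs _) (by linarith)
    have h4 : ‖w‖ ≤ (1 + |r|) * (2 + |w.im|) := by nlinarith [abs_nonneg r, abs_nonneg w.im]
    exact h4.trans (by gcongr)
  cases n with
  | zero => exact hb
  | succ n => exact ⟨hb, by simpa using (Tame.const (1 : ℂ)).mono zero_le_one⟩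

end ArithSeq

end

/-! ### Laplace transforms and the model functions u^(-l-1) -/

noncomputable section
namespace ArithSeq
open MeasureTheory

/-- The two-sided Laplace transform. -/
def laplace (f : ℝ → ℂ) (w : ℂ) : ℂ := ∫ u : ℝ, Complex.exp (-(w * u)) * f u

/-- `f(u) e^{-σu}` is integrable for `0 < σ < 1/2`. -/
def LaplaceAdm (f : ℝ → ℂ) : Prop :=
  ∀ σ : ℝ, 0 < σ → σ < 1 / 2 → Integrable (fun u : ℝ => Complex.exp (-((σ : ℂ) * u)) * f u)

theorem norm_exp_neg_mul (w : ℂ) (u : ℝ) : ‖Complex.exp (-(w * u))‖ = Real.exp (-(w.re * u)) := by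
  rw [Complex.norm_exp]; simp

namespace LaplaceAdm
variable {f g : ℝ → ℂ}

theorem aestronglyMeasurable (hf : LaplaceAdm f) : AEStronglyMeasurable f volume := by
  have h1 := (hf (1 / 4) (by norm_num) (by norm_num)).aestronglyMeasurable
  have h2 : Continuous (fun u : ℝ => Complex.exp (((1 / 4 : ℝ) : ℂ) * u)) := by fun_prop
  refine (h2.aestronglyMeasurable.mul h1).congr (Eventually.of_forall fun u => ?_)
  simp only [Pi.mul_apply]
  rw [← mul_assoc, ← Complex.exp_add, add_neg_cancel, Complex.exp_zero, one_mul]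

theorem integrable (hf : LaplaceAdm f) {w : ℂ} (hw : w ∈ wideStrip 0) :
    Integrable (fun u : ℝ => Complex.exp (-(w * u)) * f u) := by
  have h1 := hf w.re (by linarith [hw.1]) (by linarith [hw.2])
  have h2 : Continuous (fun u : ℝ => Complex.exp (-(w * u))) := by fun_prop
  refine h1.mono (h2.aestronglyMeasurable.mul hf.aestronglyMeasurable)
    (Eventually.of_forall fun u => ?_)
  rw [norm_mul, norm_mul, norm_exp_neg_mul, norm_exp_neg_mul, Complex.ofReal_re]

/-- The exponential is monotone in its rate for each sign of u, so the two edges of a strip dominate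
its interior. This is the majorant for differentiating under the integral. -/
theorem exp_neg_mul_le {ρ σ τ : ℝ} (hτ : |τ - σ| ≤ ρ) (u : ℝ) :
    Real.exp (-(τ * u)) ≤ Real.exp (-((σ - ρ) * u)) + Real.exp (-((σ + ρ) * u)) := by
  rw [abs_le] at hτ
  rcases le_total 0 u with hu | hu
  · have : Real.exp (-(τ * u)) ≤ Real.exp (-((σ - ρ) * u)) := by
      apply Real.exp_le_exp.2; nlinarith
    linarith [Real.exp_pos (-((σ + ρ) * u))]
  · have : Real.exp (-(τ * u)) ≤ Real.exp (-((σ + ρ) * u)) := by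
      apply Real.exp_le_exp.2; nlinarith
    linarith [Real.exp_pos (-((σ - ρ) * u))]

/-- A factor |u| costs an arbitrarily small shift of the line. The admissible interval of σ is open,
so admissibility survives multiplication by u. -/
theorem abs_mul_exp_le {ρ : ℝ} (hρ : 0 < ρ) (σ u : ℝ) :
    |u| * Real.exp (-(σ * u)) ≤
      ρ⁻¹ * (Real.exp (-((σ - ρ) * u)) + Real.exp (-((σ + ρ) * u))) := by
  have h1 : ρ * |u| ≤ Real.exp (ρ * |u|) := by linarith [Real.add_one_le_exp (ρ * |u|)]
  have h2 : Real.exp (ρ * |u|) * Real.exp (-(σ * u)) ≤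
      Real.exp (-((σ - ρ) * u)) + Real.exp (-((σ + ρ) * u)) := by
    rw [← Real.exp_add]
    rcases le_total 0 u with hu | hu
    · rw [abs_of_nonneg hu, show ρ * u + -(σ * u) = -((σ - ρ) * u) by ring]
      linarith [Real.exp_pos (-((σ + ρ) * u))]
    · rw [abs_of_nonpos hu, show ρ * -u + -(σ * u) = -((σ + ρ) * u) by ring]
      linarith [Real.exp_pos (-((σ - ρ) * u))]
  rw [inv_mul_eq_div, le_div_iff₀ hρ]
  calc |u| * Real.exp (-(σ * u)) * ρ = ρ * |u| * Real.exp (-(σ * u)) := by ring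
    _ ≤ Real.exp (ρ * |u|) * Real.exp (-(σ * u)) := by gcongr
    _ ≤ _ := h2

theorem id_mul (hf : LaplaceAdm f) : LaplaceAdm (fun u => (u : ℂ) * f u) := by
  intro σ h0 h1
  obtain ⟨ρ, hρ, h2, h3⟩ : ∃ ρ : ℝ, 0 < ρ ∧ 0 < σ - ρ ∧ σ + ρ < 1 / 2 :=
    ⟨min σ (1 / 2 - σ) / 2, by positivity [sub_pos.2 h1], by
      linarith [min_le_left σ (1 / 2 - σ)], by linarith [min_le_right σ (1 / 2 - σ)]⟩
  have hi := ((hf (σ - ρ) h2 (by linarith)).norm.add (hf (σ + ρ) (by linarith) h3).norm).const_mul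
    ρ⁻¹
  have hm : AEStronglyMeasurable (fun u : ℝ => Complex.exp (-((σ : ℂ) * u)) * ((u : ℂ) * f u))
      volume := by
    refine AEStronglyMeasurable.mul (Continuous.aestronglyMeasurable (by fun_prop)) ?_
    exact (Continuous.aestronglyMeasurable (by fun_prop)).mul hf.aestronglyMeasurable
  refine hi.mono' hm (Eventually.of_forall fun u => ?_)
  simp only [Pi.add_apply, norm_mul, norm_exp_neg_mul, Complex.ofReal_re, Complex.norm_real,
    Real.norm_eq_abs]
  calc Real.exp (-(σ * u)) * (|u| * ‖f u‖) = (|u| * Real.exp (-(σ * u))) * ‖f u‖ := by ring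
    _ ≤ (ρ⁻¹ * (Real.exp (-((σ - ρ) * u)) + Real.exp (-((σ + ρ) * u)))) * ‖f u‖ := by
        exact mul_le_mul_of_nonneg_right (abs_mul_exp_le hρ σ u) (norm_nonneg _)
    _ = _ := by ring

theorem pow_mul (hf : LaplaceAdm f) (n : ℕ) : LaplaceAdm (fun u => (u : ℂ) ^ n * f u) := by
  induction n with
  | zero => simpa using hf
  | succ n ih =>
    have := ih.id_mul
    intro σ h0 h1
    refine (this σ h0 h1).congr (Eventually.of_forall fun u => ?_)
    simp only
    ring

theorem sub (hf : LaplaceAdm f) (hg : LaplaceAdm g) : LaplaceAdm (fun u => f u - g u) := by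
  intro σ h0 h1
  refine ((hf σ h0 h1).sub (hg σ h0 h1)).congr (Eventually.of_forall fun u => ?_)
  simp only [Pi.sub_apply]; ring

theorem const_mul (hf : LaplaceAdm f) (c : ℂ) : LaplaceAdm (fun u => c * f u) := by
  intro σ h0 h1
  refine ((hf σ h0 h1).const_mul c).congr (Eventually.of_forall fun u => ?_)
  simp only; ring

theorem sum {ι : Type*} (s : Finset ι) {F : ι → ℝ → ℂ} (h : ∀ i ∈ s, LaplaceAdm (F i)) :
    LaplaceAdm (fun u => ∑ i ∈ s, F i u) := by
  intro σ h0 h1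
  refine (integrable_finsetSum s fun i hi => h i hi σ h0 h1).congr
    (Eventually.of_forall fun u => ?_)
  simp only [Finset.mul_sum]

theorem laplace_sub (hf : LaplaceAdm f) (hg : LaplaceAdm g) {w : ℂ} (hw : w ∈ wideStrip 0) :
    laplace (fun u => f u - g u) w = laplace f w - laplace g w := by
  unfold laplace
  rw [← integral_sub (hf.integrable hw) (hg.integrable hw)]
  simp only [mul_sub]

theorem laplace_sum {ι : Type*} (s : Finset ι) {F : ι → ℝ → ℂ} (h : ∀ i ∈ s, LaplaceAdm (F i))
    {w : ℂ} (hw : w ∈ wideStrip 0) :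
    laplace (fun u => ∑ i ∈ s, F i u) w = ∑ i ∈ s, laplace (F i) w := by
  unfold laplace
  rw [← integral_finsetSum s fun i hi => (h i hi).integrable hw]
  simp only [Finset.mul_sum]

theorem hasDerivAt (hf : LaplaceAdm f) {w : ℂ} (hw : w ∈ wideStrip 0) :
    HasDerivAt (laplace f) (-laplace (fun u => (u : ℂ) * f u) w) w := by
  have h0 : 0 < w.re := by linarith [hw.1]
  have h1 : w.re < 1 / 2 := by linarith [hw.2]
  obtain ⟨ρ, hρ, h2, h3⟩ : ∃ ρ : ℝ, 0 < ρ ∧ 0 < w.re - ρ ∧ w.re + ρ < 1 / 2 :=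
    ⟨min w.re (1 / 2 - w.re) / 2, by positivity [sub_pos.2 h1], by
      linarith [min_le_left w.re (1 / 2 - w.re)], by linarith [min_le_right w.re (1 / 2 - w.re)]⟩
  have hg := hf.id_mul
  have hb := (hg (w.re - ρ) h2 (by linarith)).norm.add (hg (w.re + ρ) (by linarith) h3).norm
  have key := hasDerivAt_integral_of_dominated_loc_of_deriv_le (μ := volume)
    (F := fun (z : ℂ) (u : ℝ) => Complex.exp (-(z * u)) * f u)
    (F' := fun (z : ℂ) (u : ℝ) => -(Complex.exp (-(z * u)) * ((u : ℂ) * f u))) (x₀ := w)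
    (Metric.ball_mem_nhds w hρ) (Eventually.of_forall fun z =>
      (Continuous.aestronglyMeasurable (by fun_prop)).mul hf.aestronglyMeasurable)
    (hf.integrable hw) (hg.integrable hw).neg.aestronglyMeasurable
    (Eventually.of_forall fun u z hz => ?_) hb (Eventually.of_forall fun u z _ => ?_)
  · have h4 := key.2
    rw [integral_neg] at h4
    exact h4
  · rw [Metric.mem_ball, dist_eq_norm] at hz
    have h5 := (Complex.abs_re_le_norm (z - w)).trans hz.le
    rw [Complex.sub_re] at h5
    simp only [Pi.add_apply, norm_neg, norm_mul, norm_exp_neg_mul, Complex.ofReal_re]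
    rw [← add_mul]
    gcongr
    exact exp_neg_mul_le h5 u
  · have h6 : HasDerivAt (fun z : ℂ => -(z * (u : ℂ))) (-(u : ℂ)) z := by
      simpa using ((hasDerivAt_id z).mul_const (u : ℂ)).fun_neg
    convert! (h6.cexp).mul_const (f u) using 1
    ring

theorem differentiableOn (hf : LaplaceAdm f) : DifferentiableOn ℂ (laplace f) (wideStrip 0) :=
  fun _ hw => (hf.hasDerivAt hw).differentiableAt.differentiableWithinAt

theorem iterate_deriv (hf : LaplaceAdm f) (n : ℕ) :
    Set.EqOn (deriv^[n] (laplace f)) (fun w => (-1) ^ n * laplace (fun u => (u : ℂ) ^ n * f u) w)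
      (wideStrip 0) := by
  induction n with
  | zero => intro w _; simp
  | succ n ih =>
    intro w hw
    rw [Function.iterate_succ_apply']
    rw [(ih.eventuallyEq_of_mem ((isOpen_wideStrip 0).mem_nhds hw)).deriv_eq,
      (((hf.pow_mul n).hasDerivAt hw).const_mul ((-1 : ℂ) ^ n)).deriv]
    have : (fun u : ℝ => (u : ℂ) * ((u : ℂ) ^ n * f u)) = fun u : ℝ => (u : ℂ) ^ (n + 1) * f u := by
      ext u; ring
    rw [this]; ring

end LaplaceAdm

theorem Tame.iterate {Ω : Set ℂ} {K : ℝ} {n : ℕ} {F : ℂ → ℂ} (h : Tame Ω K n F) :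
    PolyBdd Ω K (deriv^[n] F) := by
  induction n generalizing F with
  | zero => exact h
  | succ n ih => rw [Function.iterate_succ_apply]; exact ih h.2

/-- The truncated power `u ^ (-l - 1)` on `[1, ∞)`. -/
def truncPow (l : ℝ) (u : ℝ) : ℂ := if 1 < u then ((u ^ (-l - 1) : ℝ) : ℂ) else 0

theorem integrableOn_rpow_mul_exp {σ : ℝ} (hσ : 0 < σ) (b : ℝ) :
    IntegrableOn (fun u : ℝ => Real.exp (-(σ * u)) * u ^ b) (Set.Ioi 1) := by
  refine integrable_of_isBigO_exp_neg (b := σ / 2) (by positivity) ?_ ?_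
  · refine ContinuousOn.mul (by fun_prop) ?_
    exact ContinuousOn.rpow_const continuousOn_id fun x hx => Or.inl (by
      have : (1 : ℝ) ≤ x := hx
      positivity)
  · have h := (isLittleO_exp_neg_mul_rpow_atTop (half_pos hσ) (-b)).isBigO
    have h2 := h.mul (Asymptotics.isBigO_refl (fun x : ℝ => Real.exp (-(σ / 2) * x) * x ^ b) atTop)
    refine (h2.congr' ?_ ?_)
    · filter_upwards with x
      rw [← mul_assoc, ← Real.exp_add]; ring_nf
    · filter_upwards [eventually_gt_atTop 0] with x hx
      rw [mul_comm, mul_assoc, ← Real.rpow_add hx]; simp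

theorem laplaceAdm_truncPow (l : ℝ) : LaplaceAdm (truncPow l) := by
  intro σ h0 _
  have h := (integrableOn_rpow_mul_exp h0 (-l - 1)).ofReal (𝕜 := ℂ)
  rw [← IntegrableOn, ← integrable_indicator_iff measurableSet_Ioi] at h
  refine h.congr (Eventually.of_forall fun u => ?_)
  simp only [truncPow, Set.indicator, Set.mem_Ioi]
  split_ifs with hu
  · push_cast; simp
  · simp

theorem laplace_truncPow_eq (l : ℝ) (w : ℂ) :
    laplace (truncPow l) w =
      ∫ u in Set.Ioi (1 : ℝ), Complex.exp (-(w * u)) * ((u ^ (-l - 1) : ℝ) : ℂ) := by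
  rw [laplace, ← integral_indicator measurableSet_Ioi]
  congr 1
  ext u
  simp only [truncPow, Set.indicator, Set.mem_Ioi]
  split_ifs <;> simp

theorem integrableOn_truncPow (l : ℝ) {w : ℂ} (hw : 0 < w.re) :
    IntegrableOn (fun u : ℝ => Complex.exp (-(w * u)) * ((u ^ (-l - 1) : ℝ) : ℂ)) (Set.Ioi 1) := by
  refine (integrableOn_rpow_mul_exp hw (-l - 1)).mono' ?_ ?_
  · refine ContinuousOn.aestronglyMeasurable ?_ measurableSet_Ioi
    refine ContinuousOn.mul (by fun_prop) (Complex.continuous_ofReal.comp_continuousOn ?_)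
    exact ContinuousOn.rpow_const continuousOn_id fun x hx => Or.inl (by
      have : (1 : ℝ) < x := hx
      positivity)
  · filter_upwards [ae_restrict_mem measurableSet_Ioi] with u hu
    have : (1 : ℝ) < u := hu
    rw [norm_mul, norm_exp_neg_mul, Complex.norm_real, Real.norm_of_nonneg (by positivity)]

/-- Integration by parts, with boundary term at u = 1. The relation links l to l - 1, so bounds can
be moved through all real l in either direction. -/
theorem laplace_truncPow_recursion (l : ℝ) {w : ℂ} (hw : w ∈ wideStrip 0) :
    l * laplace (truncPow l) w + w * laplace (truncPow (l - 1)) w = Complex.exp (-w) := by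
  have h0 : 0 < w.re := by linarith [hw.1]
  rw [laplace_truncPow_eq, laplace_truncPow_eq, ← integral_const_mul, ← integral_const_mul,
    ← integral_add ((integrableOn_truncPow l h0).const_mul _)
      ((integrableOn_truncPow (l - 1) h0).const_mul _)]
  -- The primitive is e^{-wu} u^{-l}, which vanishes at infinity because Re w > 0.
  have key := integral_Ioi_of_hasDerivAt_of_tendsto (a := 1) (m := 0)
    (f := fun u : ℝ => Complex.exp (-(w * u)) * ((u ^ (-l) : ℝ) : ℂ))
    (f' := fun u : ℝ => -(l * (Complex.exp (-(w * u)) * ((u ^ (-l - 1) : ℝ) : ℂ)) +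
      w * (Complex.exp (-(w * u)) * ((u ^ (-(l - 1) - 1) : ℝ) : ℂ)))) ?_ ?_ ?_ ?_
  · rw [integral_neg] at key
    simp only [Complex.ofReal_one, mul_one, Real.one_rpow, zero_sub, neg_inj] at key
    exact key
  · refine ContinuousAt.continuousWithinAt ?_
    refine ContinuousAt.mul (by fun_prop) (Complex.continuous_ofReal.continuousAt.comp ?_)
    exact Real.continuousAt_rpow_const _ _ (Or.inl one_ne_zero)
  · intro u hu
    have hu0 : (0 : ℝ) < u := lt_trans one_pos hu
    have h1 : HasDerivAt (fun u : ℝ => Complex.exp (-(w * u))) (Complex.exp (-(w * u)) * -w) u := by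
      have := ((Complex.ofRealCLM.hasDerivAt (x := u)).const_mul w).neg.cexp
      simpa using this
    have h2 : HasDerivAt (fun u : ℝ => ((u ^ (-l) : ℝ) : ℂ)) ((-l * u ^ (-l - 1) : ℝ) : ℂ) u :=
      (Real.hasDerivAt_rpow_const (Or.inl hu0.ne')).ofReal_comp
    convert! h1.mul h2 using 1
    rw [show -(l - 1) - 1 = -l by ring]
    push_cast; ring
  · exact (((integrableOn_truncPow l h0).const_mul _).add
      ((integrableOn_truncPow (l - 1) h0).const_mul _)).neg
  · rw [tendsto_zero_iff_norm_tendsto_zero]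
    have h := ((isLittleO_exp_neg_mul_rpow_atTop h0 l).tendsto_div_nhds_zero)
    refine h.congr' ?_
    filter_upwards [eventually_gt_atTop 0] with u hu
    rw [norm_mul, norm_exp_neg_mul, Complex.norm_real, Real.norm_of_nonneg (by positivity),
      Real.rpow_neg hu.le]
    ring_nf

/-- `Γ(-l)⁻¹ u ^ (-l - 1)` has Laplace transform `w ^ l` up to this function. -/
def powDefect (l : ℝ) (w : ℂ) : ℂ :=
  w ^ (l : ℂ) - ((Real.Gamma (-l))⁻¹ : ℝ) * laplace (truncPow l) w

/-- In reciprocal form the functional equation of Γ also holds at the poles, where both sides are 0.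
No case distinction on l is needed later. -/
theorem inv_Gamma_neg (l : ℝ) : (Real.Gamma (-l))⁻¹ = -l * (Real.Gamma (-(l - 1)))⁻¹ := by
  have h := Complex.one_div_Gamma_eq_self_mul_one_div_Gamma_add_one ((-l : ℝ) : ℂ)
  rw [show ((-l : ℝ) : ℂ) + 1 = ((-(l - 1) : ℝ) : ℂ) by push_cast; ring, Complex.Gamma_ofReal,
    Complex.Gamma_ofReal] at h
  exact_mod_cast h

theorem ne_zero_of_mem_wideStrip {w : ℂ} (hw : w ∈ wideStrip 0) : w ≠ 0 := by
  rintro rfl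
  have := hw.1
  simp at this

theorem mem_slitPlane_of_mem_wideStrip {w : ℂ} (hw : w ∈ wideStrip 0) : w ∈ Complex.slitPlane :=
  Or.inl (by linarith [hw.1])

theorem powDefect_recursion (l : ℝ) {w : ℂ} (hw : w ∈ wideStrip 0) :
    powDefect l w = w * powDefect (l - 1) w +
      ((Real.Gamma (-(l - 1)))⁻¹ : ℝ) * Complex.exp (-w) := by
  have h0 := ne_zero_of_mem_wideStrip hw
  have h1 := laplace_truncPow_recursion l hw
  have h2 : w ^ (l : ℂ) = w * w ^ ((l - 1 : ℝ) : ℂ) := by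
    push_cast
    rw [Complex.cpow_sub _ _ h0, Complex.cpow_one]
    field_simp
  rw [powDefect, powDefect, inv_Gamma_neg l, ← h1, h2]
  push_cast
  ring

theorem differentiableOn_cpow (l : ℝ) :
    DifferentiableOn ℂ (fun w : ℂ => w ^ (l : ℂ)) (wideStrip 0) := fun w hw =>
  ((hasDerivAt_id w).cpow_const (mem_slitPlane_of_mem_wideStrip hw)).differentiableAt
    |>.differentiableWithinAt

theorem deriv_cpow (l : ℝ) {w : ℂ} (hw : w ∈ wideStrip 0) :
    deriv (fun w : ℂ => w ^ (l : ℂ)) w = l * w ^ ((l - 1 : ℝ) : ℂ) := by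
  have := ((hasDerivAt_id w).cpow_const (c := (l : ℂ)) (mem_slitPlane_of_mem_wideStrip hw)).deriv
  simp only [id_eq, mul_one] at this
  rw [this]; push_cast; rfl

theorem deriv_laplace_truncPow (l : ℝ) {w : ℂ} (hw : w ∈ wideStrip 0) :
    deriv (laplace (truncPow l)) w = -laplace (truncPow (l - 1)) w := by
  rw [((laplaceAdm_truncPow l).hasDerivAt hw).deriv]
  congr 2
  ext u
  simp only [truncPow]
  split_ifs with hu
  · have hu0 : 0 < u := by linarith
    rw [← Complex.ofReal_mul, show -(l - 1) - 1 = 1 + (-l - 1) by ring, Real.rpow_add hu0,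
      Real.rpow_one]
  · simp

theorem differentiableOn_powDefect (l : ℝ) : DifferentiableOn ℂ (powDefect l) (wideStrip 0) :=
  (differentiableOn_cpow l).fun_sub (((laplaceAdm_truncPow l).differentiableOn).const_mul _)

/-- Differentiation only lowers the index, so bounding the defects themselves for all l bounds every
derivative. -/
theorem deriv_powDefect (l : ℝ) {w : ℂ} (hw : w ∈ wideStrip 0) :
    deriv (powDefect l) w = l * powDefect (l - 1) w := by
  have hn := (isOpen_wideStrip 0).mem_nhds hw
  have h1 := (differentiableOn_cpow l).differentiableAt hn
  have h2 := (laplaceAdm_truncPow l).differentiableOn.differentiableAt hn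
  have h3 : deriv (powDefect l) w = deriv (fun w : ℂ => w ^ (l : ℂ)) w -
      ((Real.Gamma (-l))⁻¹ : ℝ) * deriv (laplace (truncPow l)) w := by
    have := (h1.hasDerivAt.fun_sub (h2.hasDerivAt.const_mul (((Real.Gamma (-l))⁻¹ : ℝ) : ℂ))).deriv
    exact this
  rw [h3, deriv_cpow l hw, deriv_laplace_truncPow l hw, powDefect, inv_Gamma_neg l]
  push_cast; ring

/-- `u ^ (-l - 1)` on `(0, ∞)`. -/
def fullPow (l : ℝ) (u : ℝ) : ℂ := if 0 < u then ((u ^ (-l - 1) : ℝ) : ℂ) else 0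

theorem laplaceAdm_fullPow {l : ℝ} (hl : l < 0) : LaplaceAdm (fullPow l) := by
  intro σ h0 _
  have h := (integrableOn_rpow_mul_exp_neg_mul_rpow (p := 1) (s := -l - 1) (b := σ)
    (by linarith) one_pos h0).ofReal (𝕜 := ℂ)
  rw [← IntegrableOn, ← integrable_indicator_iff measurableSet_Ioi] at h
  refine h.congr (Eventually.of_forall fun u => ?_)
  simp only [fullPow, Set.indicator, Set.mem_Ioi]
  split_ifs with hu
  · push_cast; rw [Real.rpow_one, mul_comm]; simp
  · simp

theorem laplace_fullPow_ofReal {l : ℝ} (hl : l < 0) {σ : ℝ} (hσ : 0 < σ) :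
    laplace (fullPow l) σ = Real.Gamma (-l) * (σ : ℂ) ^ (l : ℂ) := by
  have h := Complex.integral_cpow_mul_exp_neg_mul_Ioi (a := ((-l : ℝ) : ℂ)) (r := σ)
    (by simpa using hl) hσ
  rw [Complex.Gamma_ofReal] at h
  rw [laplace]
  calc (∫ u : ℝ, Complex.exp (-((σ : ℂ) * u)) * fullPow l u)
      = ∫ t in Set.Ioi (0 : ℝ), (t : ℂ) ^ (((-l : ℝ) : ℂ) - 1) * Complex.exp (-(σ * t)) := by
        rw [← integral_indicator measurableSet_Ioi]
        congr 1
        ext u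
        simp only [fullPow, Set.indicator, Set.mem_Ioi]
        split_ifs with hu
        · rw [Complex.ofReal_cpow hu.le]; push_cast; ring
        · simp
    _ = _ := h
    _ = _ := by
      rw [mul_comm]
      congr 1
      rw [one_div, Complex.inv_cpow, ← Complex.cpow_neg]
      · simp
      · rw [Complex.arg_ofReal_of_nonneg hσ.le]; exact Real.pi_pos.ne

theorem isPreconnected_wideStrip (r : ℝ) : IsPreconnected (wideStrip r) := by
  refine Convex.isPreconnected ?_
  exact (convex_halfSpace_re_gt (-r)).inter (convex_halfSpace_re_lt (1 / 2 + r))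

/-- On the real axis this is the Gamma integral. Both sides are analytic in the strip and agree on
real points accumulating at 1/4, so the identity theorem applies. -/
theorem laplace_fullPow {l : ℝ} (hl : l < 0) {w : ℂ} (hw : w ∈ wideStrip 0) :
    laplace (fullPow l) w = Real.Gamma (-l) * w ^ (l : ℂ) := by
  have hA : AnalyticOnNhd ℂ (laplace (fullPow l)) (wideStrip 0) :=
    (laplaceAdm_fullPow hl).differentiableOn.analyticOnNhd (isOpen_wideStrip 0)
  have hB : AnalyticOnNhd ℂ (fun w : ℂ => Real.Gamma (-l) * w ^ (l : ℂ)) (wideStrip 0) :=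
    ((differentiableOn_cpow l).const_mul _).analyticOnNhd (isOpen_wideStrip 0)
  have hmem : ((1 / 4 : ℝ) : ℂ) ∈ wideStrip 0 := by
    constructor <;> simp <;> norm_num
  refine hA.eqOn_of_preconnected_of_frequently_eq hB (isPreconnected_wideStrip 0) hmem ?_ hw
  have ht : Tendsto (fun n : ℕ => (((1 / 4 : ℝ) + 1 / ((n : ℝ) + 1) : ℝ) : ℂ)) atTop
      (𝓝[≠] ((1 / 4 : ℝ) : ℂ)) := by
    refine tendsto_nhdsWithin_iff.2 ⟨?_, Eventually.of_forall fun n => ?_⟩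
    · refine (Complex.continuous_ofReal.tendsto _).comp ?_
      have := (tendsto_one_div_add_atTop_nhds_zero_nat (𝕜 := ℝ)).const_add (1 / 4)
      rwa [add_zero] at this
    · rw [Set.mem_compl_iff, Set.mem_singleton_iff, Complex.ofReal_inj]
      have : 0 < 1 / ((n : ℝ) + 1) := by positivity
      linarith
  refine ht.frequently (Frequently.of_forall fun n => ?_)
  exact laplace_fullPow_ofReal hl (by positivity)

/-- For l < 0 the full power is integrable at 0 and its transform is exactly Γ(-l) w^l. The defect
is then the transform of the piece on (0, 1], bounded by ∫₀¹ u^{-l-1} du up to the factor 1/Γ(-l).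
-/
theorem powDefect_of_neg {l : ℝ} (hl : l < 0) {w : ℂ} (hw : w ∈ wideStrip 0) :
    ‖powDefect l w‖ ≤ (Real.Gamma (-l))⁻¹ * (1 / (-l)) := by
  have hG : Real.Gamma (-l) ≠ 0 := (Real.Gamma_pos_of_pos (by linarith)).ne'
  have h1 : powDefect l w = ((Real.Gamma (-l))⁻¹ : ℝ) *
      laplace (fun u => fullPow l u - truncPow l u) w := by
    rw [(laplaceAdm_fullPow hl).laplace_sub (laplaceAdm_truncPow l) hw, laplace_fullPow hl hw,
      powDefect, mul_sub, ← mul_assoc, ← Complex.ofReal_mul, inv_mul_cancel₀ hG]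
    simp
  rw [h1, norm_mul, Complex.norm_real, Real.norm_of_nonneg
    (inv_nonneg.2 (Real.Gamma_pos_of_pos (by linarith)).le)]
  gcongr
  · exact inv_nonneg.2 (Real.Gamma_pos_of_pos (by linarith)).le
  have hint : IntegrableOn (fun u : ℝ => u ^ (-l - 1)) (Set.Ioc 0 1) := by
    rw [← intervalIntegrable_iff_integrableOn_Ioc_of_le zero_le_one]
    exact intervalIntegral.intervalIntegrable_rpow' (by linarith)
  have h3 : ∫ u in Set.Ioc (0 : ℝ) 1, u ^ (-l - 1) = 1 / (-l) := by
    rw [← intervalIntegral.integral_of_le zero_le_one, integral_rpow (Or.inl (by linarith))]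
    rw [sub_add_cancel, Real.one_rpow, Real.zero_rpow (by linarith), sub_zero]
  rw [← h3, ← integral_indicator measurableSet_Ioc, laplace]
  refine norm_integral_le_of_norm_le (hint.integrable_indicator measurableSet_Ioc)
    (Eventually.of_forall fun u => ?_)
  simp only [fullPow, truncPow, Set.indicator, Set.mem_Ioc]
  by_cases hu : 0 < u
  · by_cases hu1 : 1 < u
    · rw [if_pos hu, if_pos hu1]; simp [not_le.2 hu1]
    · rw [if_pos hu, if_neg hu1, if_pos ⟨hu, not_lt.1 hu1⟩, sub_zero, norm_mul, norm_exp_neg_mul,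
        Complex.norm_real, Real.norm_of_nonneg (by positivity)]
      have : Real.exp (-(w.re * u)) ≤ 1 := by
        apply Real.exp_le_one_iff.2
        nlinarith [hw.1]
      have h5 : 0 ≤ u ^ (-l - 1) := by positivity
      nlinarith
  · rw [if_neg hu, if_neg (by linarith), if_neg (by tauto)]; simp

/-- The part of the strip `0 < Re w < 1/2` near the origin. -/
def nearStrip : Set ℂ := wideStrip 0 ∩ Metric.ball 0 2

/-- The part of the strip `0 < Re w < 1/2` away from the origin. -/
def farStrip : Set ℂ := wideStrip 0 ∩ {w | 1 < ‖w‖}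

theorem isOpen_nearStrip : IsOpen nearStrip := (isOpen_wideStrip 0).inter Metric.isOpen_ball

theorem isOpen_farStrip : IsOpen farStrip :=
  (isOpen_wideStrip 0).inter (isOpen_lt continuous_const continuous_norm)

/-- Induction upwards from negative l: the recursion multiplies by w, which is bounded near the
origin. -/
theorem exists_bound_powDefect (l : ℝ) : ∃ C, ∀ w ∈ nearStrip, ‖powDefect l w‖ ≤ C := by
  have h : ∀ n : ℕ, ∀ l : ℝ, l < n → ∃ C, ∀ w ∈ nearStrip, ‖powDefect l w‖ ≤ C := by
    intro n
    induction n with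
    | zero =>
      intro l hl
      exact ⟨_, fun w hw => powDefect_of_neg (by simpa using hl) hw.1⟩
    | succ n ih =>
      intro l hl
      obtain ⟨C, hC⟩ := ih (l - 1) (by push_cast at hl; linarith)
      refine ⟨2 * C + |(Real.Gamma (-(l - 1)))⁻¹|, fun w hw => ?_⟩
      rw [powDefect_recursion l hw.1]
      refine (norm_add_le _ _).trans ?_
      rw [norm_mul, norm_mul, Complex.norm_real, Real.norm_eq_abs]
      have h1 : ‖w‖ ≤ 2 := (mem_ball_zero_iff.1 hw.2).le
      have h2 : ‖Complex.exp (-w)‖ ≤ 1 := by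
        rw [Complex.norm_exp]
        apply Real.exp_le_one_iff.2
        have := hw.1.1
        simp at this ⊢
        exact this.le
      exact add_le_add (mul_le_mul h1 (hC w hw) (norm_nonneg _) zero_le_two)
        (mul_le_of_le_one_right (abs_nonneg _) h2)
  obtain ⟨n, hn⟩ := exists_nat_gt l
  exact h n l hn

theorem tame_powDefect (l : ℝ) (n : ℕ) : Tame nearStrip 0 n (powDefect l) := by
  induction n generalizing l with
  | zero =>
    obtain ⟨C, hC⟩ := exists_bound_powDefect l
    exact PolyBdd.of_bounded hC
  | succ n ih =>
    obtain ⟨C, hC⟩ := exists_bound_powDefect l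
    refine ⟨PolyBdd.of_bounded hC, ((ih (l - 1)).const_mul isOpen_nearStrip l
      ((differentiableOn_powDefect _).mono Set.inter_subset_left)).congr isOpen_nearStrip ?_⟩
    exact fun w hw => (deriv_powDefect l hw.1).symm

/-- Induction downwards from positive l, where the integral converges absolutely even at Re w = 0.
The recursion divides by w, harmless where |w| > 1. -/
theorem exists_bound_laplace_truncPow (l : ℝ) :
    ∃ C, ∀ w ∈ farStrip, ‖laplace (truncPow l) w‖ ≤ C := by
  have h : ∀ n : ℕ, ∀ l : ℝ, 0 < l + n → ∃ C, ∀ w ∈ farStrip, ‖laplace (truncPow l) w‖ ≤ C := by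
    intro n
    induction n with
    | zero =>
      intro l hl
      have hl0 : 0 < l := by simpa using hl
      refine ⟨∫ u in Set.Ioi (1 : ℝ), u ^ (-l - 1), fun w hw => ?_⟩
      rw [laplace_truncPow_eq]
      refine norm_integral_le_of_norm_le (integrableOn_Ioi_rpow_of_lt (by linarith) one_pos) ?_
      filter_upwards [ae_restrict_mem measurableSet_Ioi] with u hu
      have hu1 : (1 : ℝ) < u := hu
      rw [norm_mul, norm_exp_neg_mul, Complex.norm_real, Real.norm_of_nonneg (by positivity)]
      have : Real.exp (-(w.re * u)) ≤ 1 := by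
        apply Real.exp_le_one_iff.2
        nlinarith [hw.1.1]
      have h5 : 0 ≤ u ^ (-l - 1) := by positivity
      nlinarith
    | succ n ih =>
      intro l hl
      obtain ⟨C, hC⟩ := ih (l + 1) (by push_cast at hl; linarith)
      refine ⟨1 + |l + 1| * C, fun w hw => ?_⟩
      have hr := laplace_truncPow_recursion (l + 1) hw.1
      rw [add_sub_cancel_right] at hr
      have hw1 : 1 < ‖w‖ := hw.2
      have h2 : ‖Complex.exp (-w)‖ ≤ 1 := by
        rw [Complex.norm_exp]
        apply Real.exp_le_one_iff.2
        have := hw.1.1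
        simp at this ⊢
        exact this.le
      have h3 : w * laplace (truncPow l) w =
          Complex.exp (-w) - ((l + 1 : ℝ) : ℂ) * laplace (truncPow (l + 1)) w := by
        rw [← hr]; ring
      have h4 : ‖w‖ * ‖laplace (truncPow l) w‖ ≤ 1 + |l + 1| * C := by
        rw [← norm_mul, h3]
        refine (norm_sub_le _ _).trans (add_le_add h2 ?_)
        rw [norm_mul, Complex.norm_real, Real.norm_eq_abs]
        exact mul_le_mul_of_nonneg_left (hC w hw) (abs_nonneg _)
      nlinarith [norm_nonneg (laplace (truncPow l) w)]
  obtain ⟨n, hn⟩ := exists_nat_gt (-l)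
  exact h n l (by linarith)

theorem tame_laplace_truncPow (l : ℝ) (n : ℕ) : Tame farStrip 0 n (laplace (truncPow l)) := by
  induction n generalizing l with
  | zero =>
    obtain ⟨C, hC⟩ := exists_bound_laplace_truncPow l
    exact PolyBdd.of_bounded hC
  | succ n ih =>
    obtain ⟨C, hC⟩ := exists_bound_laplace_truncPow l
    refine ⟨PolyBdd.of_bounded hC, ((ih (l - 1)).const_mul isOpen_farStrip (-1)
      ((laplaceAdm_truncPow _).differentiableOn.mono Set.inter_subset_left)).congr
        isOpen_farStrip ?_⟩
    intro w hw
    rw [deriv_laplace_truncPow l hw.1]; ring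

end ArithSeq

end

/-! ### Taylor expansion at the boundary point 0 and inversion on short windows -/

noncomputable section
namespace ArithSeq
open MeasureTheory

/-- `∫₀¹ τ ^ j F(τ w) dτ`. -/
def rayMean (j : ℕ) (F : ℂ → ℂ) (w : ℂ) : ℂ :=
  ∫ τ in Set.Ioc (0 : ℝ) 1, (τ : ℂ) ^ j * F (τ * w)

theorem ofReal_mul_mem_wideStrip {w : ℂ} (hw : w ∈ wideStrip 0) {τ : ℝ} (h : τ ∈ Set.Ioc (0 : ℝ) 1) :
    (τ : ℂ) * w ∈ wideStrip 0 := by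
  have h1 : 0 < w.re := by linarith [hw.1]
  have h2 : w.re < 1 / 2 := by linarith [hw.2]
  have h3 : 0 < τ * w.re := mul_pos h.1 h1
  have h4 : τ * w.re ≤ w.re := mul_le_of_le_one_left h1.le h.2
  constructor <;> simp <;> linarith

section rayMean
variable {K : ℝ} {F : ℂ → ℂ}

theorem norm_ray_le (hK : 0 ≤ K) {ε C : ℝ} (hε : 0 < ε) (hC0 : 0 ≤ C)
    (hC : ∀ w ∈ wideStrip 0, ‖F w‖ ≤ C * (2 + |w.im|) ^ (K + ε)) (j : ℕ) {w : ℂ}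
    (hw : w ∈ wideStrip 0) {τ : ℝ} (hτ : τ ∈ Set.Ioc (0 : ℝ) 1) :
    ‖(τ : ℂ) ^ j * F (τ * w)‖ ≤ C * (2 + |w.im|) ^ (K + ε) := by
  rw [norm_mul, norm_pow, Complex.norm_real, Real.norm_of_nonneg hτ.1.le]
  have h1 : τ ^ j ≤ 1 := pow_le_one₀ hτ.1.le hτ.2
  have h2 := hC _ (ofReal_mul_mem_wideStrip hw hτ)
  have h3 : |((τ : ℂ) * w).im| ≤ |w.im| := by
    simp only [Complex.mul_im, Complex.ofReal_re, Complex.ofReal_im, zero_mul, add_zero, abs_mul,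
      abs_of_pos hτ.1]
    exact mul_le_of_le_one_left (abs_nonneg _) hτ.2
  calc τ ^ j * ‖F (τ * w)‖ ≤ 1 * (C * (2 + |((τ : ℂ) * w).im|) ^ (K + ε)) :=
        mul_le_mul h1 h2 (norm_nonneg _) zero_le_one
    _ ≤ C * (2 + |w.im|) ^ (K + ε) := by
        rw [one_mul]; gcongr

theorem aestronglyMeasurable_ray (hFd : DifferentiableOn ℂ F (wideStrip 0)) (j : ℕ) {w : ℂ}
    (hw : w ∈ wideStrip 0) :
    AEStronglyMeasurable (fun τ : ℝ => (τ : ℂ) ^ j * F (τ * w))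
      (volume.restrict (Set.Ioc (0 : ℝ) 1)) := by
  refine ContinuousOn.aestronglyMeasurable ?_ measurableSet_Ioc
  refine ContinuousOn.mul (by fun_prop) ?_
  exact hFd.continuousOn.comp (by fun_prop) fun τ hτ => ofReal_mul_mem_wideStrip hw hτ

theorem integrable_ray (hK : 0 ≤ K) (hFd : DifferentiableOn ℂ F (wideStrip 0))
    (hF : PolyBdd (wideStrip 0) K F) (j : ℕ) {w : ℂ} (hw : w ∈ wideStrip 0) :
    IntegrableOn (fun τ : ℝ => (τ : ℂ) ^ j * F (τ * w)) (Set.Ioc (0 : ℝ) 1) := by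
  obtain ⟨C, hC0, hC⟩ := hF.exists_nonneg one_pos
  refine Integrable.of_bound (aestronglyMeasurable_ray hFd j hw) (C * (2 + |w.im|) ^ (K + 1)) ?_
  filter_upwards [ae_restrict_mem measurableSet_Ioc] with τ hτ
  exact norm_ray_le hK one_pos hC0 hC j hw hτ

theorem PolyBdd.rayMean (hK : 0 ≤ K) (hF : PolyBdd (wideStrip 0) K F) (j : ℕ) :
    PolyBdd (wideStrip 0) K (rayMean j F) := by
  intro ε hε
  obtain ⟨C, hC0, hC⟩ := hF.exists_nonneg hε
  refine ⟨C, fun w hw => ?_⟩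
  have := norm_setIntegral_le_of_norm_le_const (μ := volume) (s := Set.Ioc (0 : ℝ) 1)
    (C := C * (2 + |w.im|) ^ (K + ε)) (by simp)
    (fun τ hτ => norm_ray_le hK hε hC0 hC j hw hτ)
  simpa [ArithSeq.rayMean] using this

theorem hasDerivAt_rayMean (hK : 0 ≤ K) (hFd : DifferentiableOn ℂ F (wideStrip 0))
    (hF : Tame (wideStrip 0) K 1 F) (j : ℕ) {w : ℂ} (hw : w ∈ wideStrip 0) :
    HasDerivAt (rayMean j F) (rayMean (j + 1) (deriv F) w) w := by
  obtain ⟨C, hC0, hC⟩ := (hF.2.bdd).exists_nonneg one_pos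
  obtain ⟨r, hr, hr1⟩ := Metric.mem_nhds_iff.1 ((isOpen_wideStrip 0).mem_nhds hw)
  set ρ := min r 1
  have hρ : 0 < ρ := lt_min hr one_pos
  have hsub : Metric.ball w ρ ⊆ wideStrip 0 :=
    (Metric.ball_subset_ball (min_le_left _ _)).trans hr1
  refine (hasDerivAt_integral_of_dominated_loc_of_deriv_le
    (μ := volume.restrict (Set.Ioc (0 : ℝ) 1))
    (F := fun (z : ℂ) (τ : ℝ) => (τ : ℂ) ^ j * F (τ * z))
    (F' := fun (z : ℂ) (τ : ℝ) => (τ : ℂ) ^ (j + 1) * deriv F (τ * z)) (x₀ := w)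
    (bound := fun _ => C * (3 + |w.im|) ^ (K + 1))
    (Metric.ball_mem_nhds w hρ) ?_ (integrable_ray hK hFd hF.bdd j hw)
    (aestronglyMeasurable_ray (hFd.deriv (isOpen_wideStrip 0)) (j + 1) hw) ?_ (integrable_const _) ?_).2
  · filter_upwards [Metric.ball_mem_nhds w hρ] with z hz
    exact aestronglyMeasurable_ray hFd j (hsub hz)
  · filter_upwards [ae_restrict_mem measurableSet_Ioc] with τ hτ z hz
    refine (norm_ray_le hK one_pos hC0 hC (j + 1) (hsub hz) hτ).trans ?_
    gcongr C * ?_ ^ (K + 1)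
    have h1 := (Complex.abs_im_le_norm (z - w)).trans (mem_ball_iff_norm.1 hz).le
    rw [Complex.sub_im] at h1
    have := abs_sub_abs_le_abs_sub z.im w.im
    linarith [min_le_right r 1]
  · filter_upwards [ae_restrict_mem measurableSet_Ioc] with τ hτ z hz
    have h1 := (hFd.differentiableAt ((isOpen_wideStrip 0).mem_nhds
      (ofReal_mul_mem_wideStrip (hsub hz) hτ))).hasDerivAt
    have h2 : HasDerivAt (fun z : ℂ => (τ : ℂ) * z) (τ : ℂ) z := by
      simpa using (hasDerivAt_id z).const_mul (τ : ℂ)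
    convert! (h1.comp z h2).const_mul ((τ : ℂ) ^ j) using 1
    ring

theorem Tame.rayMean (hK : 0 ≤ K) (hFd : DifferentiableOn ℂ F (wideStrip 0)) {n : ℕ}
    (hF : Tame (wideStrip 0) K (n + 1) F) (j : ℕ) : Tame (wideStrip 0) K n (rayMean j F) := by
  induction n generalizing F j with
  | zero => exact hF.bdd.rayMean hK j
  | succ n ih =>
    refine ⟨hF.bdd.rayMean hK j, (ih (hFd.deriv (isOpen_wideStrip 0)) hF.2 (j + 1)).congr
      (isOpen_wideStrip 0) fun w hw => ?_⟩
    have h1 : Tame (wideStrip 0) K 1 F := ⟨hF.1, hF.2.bdd⟩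
    exact (hasDerivAt_rayMean hK hFd h1 j hw).deriv.symm

end rayMean

/-- The origin lies on the boundary of the strip, not inside it. Values there exist only as limits
from within, and this makes such limits meaningful. -/
instance : (𝓝[wideStrip 0] (0 : ℂ)).NeBot := by
  rw [← mem_closure_iff_nhdsWithin_neBot, Metric.mem_closure_iff]
  intro ε hε
  refine ⟨((min ε (1 / 2) / 2 : ℝ) : ℂ), ⟨?_, ?_⟩, ?_⟩
  · simp only [Complex.ofReal_re]
    have : 0 < min ε (1 / 2) := by positivity
    linarith
  · simp only [Complex.ofReal_re]
    linarith [min_le_right ε (1 / 2 : ℝ)]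
  · rw [dist_comm, dist_zero_right, Complex.norm_real, Real.norm_of_nonneg (by positivity)]
    have : 0 < min ε (1 / 2) := by positivity
    linarith [min_le_left ε (1 / 2 : ℝ)]

/-- A tame function extends continuously to the origin, and its difference quotient there is
again tame. -/
theorem exists_limit_and_quotient {K : ℝ} (hK : 0 ≤ K) {Q : ℂ → ℂ}
    (hQd : DifferentiableOn ℂ Q (wideStrip 0)) (hQ : ∀ n, Tame (wideStrip 0) K n Q) :
    ∃ q : ℂ, Tendsto Q (𝓝[wideStrip 0] 0) (𝓝 q) ∧
      DifferentiableOn ℂ (fun w => (Q w - q) / w) (wideStrip 0) ∧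
      ∀ n, Tame (wideStrip 0) K n (fun w => (Q w - q) / w) := by
  obtain ⟨C, hC0, hC⟩ := (hQ 1).2.bdd.exists_nonneg one_pos
  -- The derivative is bounded on the convex set `nearStrip`, so Q is Lipschitz there and hence
  -- Cauchy at 0.
  have hlip : ∀ z ∈ nearStrip, ∀ w ∈ nearStrip, ‖Q w - Q z‖ ≤ C * 4 ^ (K + 1) * ‖w - z‖ := by
    intro z hz w hw
    refine Convex.norm_image_sub_le_of_norm_deriv_le (s := nearStrip) (𝕜 := ℂ) ?_ ?_ ?_ hz hw
    · intro x hx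
      exact hQd.differentiableAt ((isOpen_wideStrip 0).mem_nhds hx.1)
    · intro x hx
      refine (hC x hx.1).trans ?_
      gcongr C * ?_ ^ (K + 1)
      have := (Complex.abs_im_le_norm x).trans (mem_ball_zero_iff.1 hx.2).le
      linarith
    · exact ((convex_halfSpace_re_gt (-0)).inter (convex_halfSpace_re_lt (1 / 2 + 0))).inter
        (convex_ball _ _)
  have hcau : Cauchy (map Q (𝓝[wideStrip 0] 0)) := by
    rw [Metric.cauchy_iff]
    refine ⟨inferInstance, fun ε hε => ?_⟩
    set M := C * 4 ^ (K + 1) + 1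
    have hM : 0 < M := by positivity
    refine ⟨Q '' (wideStrip 0 ∩ Metric.ball 0 (min 2 (ε / (2 * M)))),
      image_mem_map (inter_mem self_mem_nhdsWithin (mem_nhdsWithin_of_mem_nhds
        (Metric.ball_mem_nhds _ (by positivity)))), ?_⟩
    rintro _ ⟨x, hx, rfl⟩ _ ⟨y, hy, rfl⟩
    have hx2 := mem_ball_zero_iff.1 hx.2
    have hy2 := mem_ball_zero_iff.1 hy.2
    have h1 := hlip y ⟨hy.1, mem_ball_zero_iff.2 (hy2.trans_le (min_le_left _ _))⟩ x
      ⟨hx.1, mem_ball_zero_iff.2 (hx2.trans_le (min_le_left _ _))⟩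
    rw [dist_eq_norm]
    have h2 : ‖x - y‖ < ε / M := by
      have h3 := norm_sub_le x y
      have h4 : ε / M = ε / (2 * M) + ε / (2 * M) := by field_simp; ring
      linarith [min_le_right 2 (ε / (2 * M))]
    rw [lt_div_iff₀ hM] at h2
    have h5 : C * 4 ^ (K + 1) ≤ M := by simp [M]
    nlinarith [norm_nonneg (x - y)]
  obtain ⟨q, hq⟩ := cauchy_map_iff_exists_tendsto.1 hcau
  -- The difference quotient is ∫₀¹ Q'(τw) dτ, so it is as regular as Q' up to the boundary.
  have hray : Set.EqOn (rayMean 0 (deriv Q)) (fun w => (Q w - q) / w) (wideStrip 0) := by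
    intro w hw
    have hw0 := ne_zero_of_mem_wideStrip hw
    have hint := integrable_ray hK (hQd.deriv (isOpen_wideStrip 0)) (hQ 1).2.bdd 0 hw
    have hint2 : IntervalIntegrable (fun τ : ℝ => deriv Q (τ * w) * w) volume 0 1 := by
      rw [intervalIntegrable_iff_integrableOn_Ioc_of_le zero_le_one]
      refine (Integrable.mul_const hint w).congr (Eventually.of_forall fun τ => ?_)
      simp
    have hder : ∀ τ ∈ Set.Ioc (0 : ℝ) 1,
        HasDerivAt (fun τ : ℝ => Q (τ * w)) (deriv Q (τ * w) * w) τ := by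
      intro τ hτ
      have h1 := (hQd.differentiableAt ((isOpen_wideStrip 0).mem_nhds
        (ofReal_mul_mem_wideStrip hw hτ))).hasDerivAt
      have h2 : HasDerivAt (fun τ : ℝ => (τ : ℂ) * w) w τ := by
        simpa using (Complex.ofRealCLM.hasDerivAt (x := τ)).mul_const w
      exact h1.comp τ h2
    have h1 := intervalIntegral.integral_eq_sub_of_hasDerivAt_of_tendsto zero_lt_one
      (fun τ hτ => hder τ ⟨hτ.1, hτ.2.le⟩) hint2 (fa := q) (fb := Q w) ?_ ?_
    · show rayMean 0 (deriv Q) w = (Q w - q) / w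
      rw [eq_div_iff hw0, ← h1, intervalIntegral.integral_of_le zero_le_one, rayMean,
        ← integral_mul_const]
      simp
    · refine hq.comp (tendsto_nhdsWithin_iff.2 ⟨?_, ?_⟩)
      · have : Tendsto (fun τ : ℝ => (τ : ℂ) * w) (𝓝 0) (𝓝 (((0 : ℝ) : ℂ) * w)) :=
          Continuous.tendsto (by fun_prop) 0
        rw [Complex.ofReal_zero, zero_mul] at this
        exact this.mono_left nhdsWithin_le_nhds
      · filter_upwards [Ioo_mem_nhdsGT zero_lt_one] with τ hτ
        exact ofReal_mul_mem_wideStrip hw ⟨hτ.1, hτ.2.le⟩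
    · have := (hder 1 ⟨one_pos, le_rfl⟩).continuousAt.tendsto
      simp only [Complex.ofReal_one, one_mul] at this
      exact this.mono_left nhdsWithin_le_nhds
  refine ⟨q, hq, ?_, fun n => ?_⟩
  · exact (hQd.sub (differentiableOn_const q)).fun_div differentiableOn_id
      fun w hw => ne_zero_of_mem_wideStrip hw
  -- One derivative is spent in passing to Q', a second in differentiating the ray mean under the
  -- integral.
  · exact ((hQ (n + 2)).2.rayMean hK (hQd.deriv (isOpen_wideStrip 0)) 0).congr
      (isOpen_wideStrip 0) hray

/-- The difference quotient is again tame with the same exponent, so the construction can be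
iterated. The coefficients are the successive limits at 0, and the N-th quotient is the remainder.
-/
theorem exists_taylor {K : ℝ} (hK : 0 ≤ K) {Q : ℂ → ℂ}
    (hQd : DifferentiableOn ℂ Q (wideStrip 0)) (hQ : ∀ n, Tame (wideStrip 0) K n Q) :
    ∃ q : ℕ → ℂ, Tendsto Q (𝓝[wideStrip 0] 0) (𝓝 (q 0)) ∧
      ∀ N : ℕ, ∃ R : ℂ → ℂ, DifferentiableOn ℂ R (wideStrip 0) ∧
        (∀ n, Tame (wideStrip 0) K n R) ∧
        ∀ w ∈ wideStrip 0, Q w = (∑ i ∈ Finset.range N, q i * w ^ i) + w ^ N * R w := by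
  let T := {F : ℂ → ℂ // DifferentiableOn ℂ F (wideStrip 0) ∧ ∀ n, Tame (wideStrip 0) K n F}
  have hstep : ∀ F : T, ∃ q : ℂ, Tendsto F.1 (𝓝[wideStrip 0] 0) (𝓝 q) ∧
      DifferentiableOn ℂ (fun w => (F.1 w - q) / w) (wideStrip 0) ∧
      ∀ n, Tame (wideStrip 0) K n (fun w => (F.1 w - q) / w) := fun F =>
    exists_limit_and_quotient hK F.2.1 F.2.2
  choose q hq hqd hqt using hstep
  let nxt : T → T := fun F => ⟨fun w => (F.1 w - q F) / w, hqd F, hqt F⟩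
  let F0 : T := ⟨Q, hQd, hQ⟩
  refine ⟨fun i => q (nxt^[i] F0), hq F0, fun N => ⟨(nxt^[N] F0).1, (nxt^[N] F0).2.1,
    (nxt^[N] F0).2.2, ?_⟩⟩
  intro w hw
  induction N with
  | zero => simp [F0]
  | succ N ih =>
    rw [ih, Finset.sum_range_succ, Function.iterate_succ_apply']
    have hw0 := ne_zero_of_mem_wideStrip hw
    simp only [nxt]
    field_simp
    ring

/-- Derivatives lower the exponent, and for |w| > 1 a lower power is dominated by |w|^κ. -/
theorem tame_cpow_far (μ κ : ℝ) (hκ : 0 ≤ κ) (h : μ ≤ κ) (n : ℕ) :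
    Tame farStrip κ n (fun w : ℂ => w ^ (μ : ℂ)) := by
  have hb : ∀ μ ≤ κ, PolyBdd farStrip κ (fun w : ℂ => w ^ (μ : ℂ)) := by
    intro μ h ε hε
    refine ⟨1, fun w hw => ?_⟩
    have h1 : (1 : ℝ) ≤ ‖w‖ := (show 1 < ‖w‖ from hw.2).le
    rw [Complex.norm_cpow_real, one_mul]
    have h2 : ‖w‖ ≤ 2 + |w.im| := by
      refine (Complex.norm_le_abs_re_add_abs_im w).trans ?_
      have : |w.re| ≤ 2 := by
        rw [abs_le]; constructor <;> linarith [hw.1.1, hw.1.2]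
      linarith
    calc ‖w‖ ^ μ ≤ ‖w‖ ^ (κ + ε) := Real.rpow_le_rpow_of_exponent_le h1 (by linarith)
      _ ≤ _ := Real.rpow_le_rpow (by positivity) h2 (by linarith)
  induction n generalizing μ with
  | zero => exact hb μ h
  | succ n ih =>
    refine ⟨hb μ h, ((ih (μ - 1) (by linarith)).const_mul isOpen_farStrip μ
      ((differentiableOn_cpow _).mono Set.inter_subset_left)).congr isOpen_farStrip ?_⟩
    exact fun w hw => (deriv_cpow μ hw.1).symm

/-- Each derivative lowers the exponent by one, and it has to stay nonnegative to be bounded at the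
origin. This fixes how many Taylor terms must be removed. -/
theorem tame_cpow_near (μ : ℝ) (n : ℕ) (h : n ≤ μ) :
    Tame nearStrip 0 n (fun w : ℂ => w ^ (μ : ℂ)) := by
  have hb : ∀ μ : ℝ, 0 ≤ μ → PolyBdd nearStrip 0 (fun w : ℂ => w ^ (μ : ℂ)) := by
    intro μ h
    refine PolyBdd.of_bounded (C := 2 ^ μ) fun w hw => ?_
    rw [Complex.norm_cpow_real]
    exact Real.rpow_le_rpow (norm_nonneg _) (mem_ball_zero_iff.1 hw.2).le h
  induction n generalizing μ with
  | zero => exact hb μ (by simpa using h)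
  | succ n ih =>
    refine ⟨hb μ ((Nat.cast_nonneg _).trans h), ((ih (μ - 1) (by push_cast at h; linarith)).const_mul
      isOpen_nearStrip μ ((differentiableOn_cpow _).mono Set.inter_subset_left)).congr
        isOpen_nearStrip ?_⟩
    exact fun w hw => (deriv_cpow μ hw.1).symm

/-- A smooth bump supported in `[-1, 1]`. -/
def bump : ContDiffBump (0 : ℝ) := ⟨1 / 2, 1, by norm_num, by norm_num⟩

/-- The bump as a complex Schwartz function. -/
def bumpSchwartz : SchwartzMap ℝ ℂ :=
  HasCompactSupport.toSchwartzMap (f := fun u : ℝ => ((bump u : ℝ) : ℂ))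
    (bump.hasCompactSupport.comp_left (g := fun x : ℝ => (x : ℂ)) (by simp))
    (Complex.ofRealCLM.contDiff.comp bump.contDiff)

open SchwartzMap FourierTransform in
theorem bump_eq_integral (v : ℝ) :
    ((bump v : ℝ) : ℂ) = ∫ ξ : ℝ, Complex.exp (2 * Real.pi * ξ * v * Complex.I) *
      (𝓕 bumpSchwartz) ξ := by
  have h : 𝓕⁻ (𝓕 bumpSchwartz) = bumpSchwartz := by simp
  have h2 : ((bump v : ℝ) : ℂ) = bumpSchwartz v := rfl
  rw [h2]
  conv_lhs => rw [← h]
  rw [SchwartzMap.fourierInv_coe, Real.fourierInv_eq']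
  congr 1; ext ξ
  simp only [RCLike.inner_apply, conj_trivial, Complex.ofReal_mul, Complex.ofReal_ofNat, smul_eq_mul]
  ring_nf

open SchwartzMap FourierTransform in
/-- The local averages of a function whose Laplace transform grows polynomially. -/
theorem exists_window_bound {f : ℝ → ℂ} (hf : LaplaceAdm f) {C : ℝ} {m : ℕ}
    (hb : ∀ w ∈ wideStrip 0, ‖laplace f w‖ ≤ C * (2 + |w.im|) ^ m) :
    ∃ C' : ℝ, ∀ σ : ℝ, 0 < σ → σ < 1 / 2 → ∀ U η : ℝ, 0 < η → η ≤ 1 →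
      ‖∫ u : ℝ, Complex.exp (-((σ : ℂ) * u)) * f u * ((bump ((u - U) / η) : ℝ) : ℂ)‖ ≤
        C' * (η⁻¹) ^ m := by
  set ψ : SchwartzMap ℝ ℂ := 𝓕 bumpSchwartz with hψ
  have hI : Integrable (fun ξ : ℝ => (2 + 2 * Real.pi * |ξ|) ^ m * ‖ψ ξ‖) := by
    have h1 : Integrable (fun ξ : ℝ => ∑ i ∈ Finset.range (m + 1),
        ((2 * Real.pi) ^ i * 2 ^ (m - i) * (m.choose i)) * (‖ξ‖ ^ i * ‖ψ ξ‖)) :=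
      integrable_finsetSum _ fun i _ => (ψ.integrable_pow_mul volume i).const_mul _
    refine h1.congr (Eventually.of_forall fun ξ => ?_)
    simp only
    rw [add_comm (2 : ℝ), add_pow, Finset.sum_mul]
    refine Finset.sum_congr rfl fun i _ => ?_
    rw [mul_pow, Real.norm_eq_abs]; ring
  refine ⟨C * ∫ ξ : ℝ, (2 + 2 * Real.pi * |ξ|) ^ m * ‖ψ ξ‖, fun σ h0 h1 U η hη hη1 => ?_⟩
  have hprod : Integrable (Function.uncurry fun (u ξ : ℝ) =>
      Complex.exp (-((σ : ℂ) * u)) * f u *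
        (Complex.exp (2 * Real.pi * ξ * ((u - U) / η : ℝ) * Complex.I) * ψ ξ))
      ((volume : Measure ℝ).prod volume) := by
    have h2 := (hf σ h0 h1).mul_prod ψ.integrable (μ := volume) (ν := volume)
    have hc : Continuous (fun z : ℝ × ℝ =>
        Complex.exp (2 * Real.pi * z.2 * ((z.1 - U) / η : ℝ) * Complex.I)) := by
      push_cast
      fun_prop
    have h3 := h2.bdd_mul (c := 1) hc.aestronglyMeasurable (Eventually.of_forall fun z => by
      rw [show (2 * Real.pi * z.2 * ((z.1 - U) / η : ℝ) * Complex.I : ℂ) =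
        ((2 * Real.pi * z.2 * ((z.1 - U) / η) : ℝ) : ℂ) * Complex.I by push_cast; ring,
        Complex.norm_exp_ofReal_mul_I])
    refine h3.congr (Eventually.of_forall fun z => ?_)
    simp only [Function.uncurry]
    ring
  -- The window is written as a superposition of frequencies ξ/η. By Fubini, only values of the
  -- transform on the line Re w = σ occur.
  have hswap : (∫ u : ℝ, Complex.exp (-((σ : ℂ) * u)) * f u * ((bump ((u - U) / η) : ℝ) : ℂ)) =
      ∫ ξ : ℝ, ψ ξ * (Complex.exp (-(2 * Real.pi * ξ * (U / η : ℝ) * Complex.I)) *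
        laplace f (σ - ((2 * Real.pi * ξ / η : ℝ) : ℂ) * Complex.I)) := by
    have h2 : ∀ u : ℝ, Complex.exp (-((σ : ℂ) * u)) * f u * ((bump ((u - U) / η) : ℝ) : ℂ) =
        ∫ ξ : ℝ, Complex.exp (-((σ : ℂ) * u)) * f u *
        (Complex.exp (2 * Real.pi * ξ * ((u - U) / η : ℝ) * Complex.I) * ψ ξ) := by
      intro u
      rw [integral_const_mul, bump_eq_integral]
    simp_rw [h2]
    rw [integral_integral_swap hprod]
    congr 1
    ext ξ
    rw [laplace, ← integral_const_mul, ← integral_const_mul]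
    congr 1
    ext u
    have h3 : Complex.exp (2 * Real.pi * ξ * ((u - U) / η : ℝ) * Complex.I) *
        Complex.exp (-((σ : ℂ) * u)) = Complex.exp (-(2 * Real.pi * ξ * (U / η : ℝ) * Complex.I)) *
        Complex.exp (-((σ - ((2 * Real.pi * ξ / η : ℝ) : ℂ) * Complex.I) * u)) := by
      rw [← Complex.exp_add, ← Complex.exp_add]
      congr 1
      have : (η : ℂ) ≠ 0 := by exact_mod_cast hη.ne'
      push_cast
      field_simp
      ring
    calc _ = (Complex.exp (2 * Real.pi * ξ * ((u - U) / η : ℝ) * Complex.I) *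
        Complex.exp (-((σ : ℂ) * u))) * f u * ψ ξ := by ring
      _ = _ := by rw [h3]; ring
  rw [hswap]
  have hbound : ∀ ξ : ℝ, ‖ψ ξ * (Complex.exp (-(2 * Real.pi * ξ * (U / η : ℝ) * Complex.I)) *
        laplace f (σ - ((2 * Real.pi * ξ / η : ℝ) : ℂ) * Complex.I))‖ ≤
      C * (η⁻¹) ^ m * ((2 + 2 * Real.pi * |ξ|) ^ m * ‖ψ ξ‖) := by
    intro ξ
    have hmem : (σ - ((2 * Real.pi * ξ / η : ℝ) : ℂ) * Complex.I : ℂ) ∈ wideStrip 0 := by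
      constructor <;> simp <;> linarith
    have h2 := hb _ hmem
    have him : |(σ - ((2 * Real.pi * ξ / η : ℝ) : ℂ) * Complex.I : ℂ).im| =
        2 * Real.pi * |ξ| / η := by
      simp only [Complex.sub_im, Complex.ofReal_im, Complex.mul_im, Complex.ofReal_re,
        Complex.I_im, mul_one, Complex.I_re, mul_zero, add_zero, zero_sub, abs_neg, abs_div,
        abs_mul, abs_of_pos hη, abs_of_pos Real.pi_pos, abs_two]
    rw [him] at h2
    have hC : 0 ≤ C := by
      by_contra hneg
      have h9 : C * (2 + 2 * Real.pi * |ξ| / η) ^ m < 0 :=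
        mul_neg_of_neg_of_pos (not_le.1 hneg) (by positivity)
      linarith [norm_nonneg (laplace f (σ - ((2 * Real.pi * ξ / η : ℝ) : ℂ) * Complex.I))]
    have h4 : ‖Complex.exp (-(2 * Real.pi * ξ * (U / η : ℝ) * Complex.I))‖ = 1 := by
      rw [show (-(2 * Real.pi * ξ * (U / η : ℝ) * Complex.I) : ℂ) =
        ((-(2 * Real.pi * ξ * (U / η)) : ℝ) : ℂ) * Complex.I by push_cast; ring,
        Complex.norm_exp_ofReal_mul_I]
    rw [norm_mul, norm_mul, h4, one_mul]
    -- A window of width η probes heights of order 1/η, which is the origin of the loss η^(-m). The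
    -- remaining ξ-integral converges by Schwartz decay and depends on neither σ nor U.
    have h5 : 2 + 2 * Real.pi * |ξ| / η ≤ η⁻¹ * (2 + 2 * Real.pi * |ξ|) := by
      have : 1 ≤ η⁻¹ := (one_le_inv₀ hη).2 hη1
      rw [mul_add, div_eq_inv_mul]
      linarith
    calc ‖ψ ξ‖ * ‖laplace f (σ - ((2 * Real.pi * ξ / η : ℝ) : ℂ) * Complex.I)‖
        ≤ ‖ψ ξ‖ * (C * (η⁻¹ * (2 + 2 * Real.pi * |ξ|)) ^ m) := by
          gcongr
          exact h2.trans (by gcongr)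
      _ = _ := by rw [mul_pow]; ring
  calc _ ≤ ∫ ξ : ℝ, C * (η⁻¹) ^ m * ((2 + 2 * Real.pi * |ξ|) ^ m * ‖ψ ξ‖) :=
        norm_integral_le_of_norm_le (hI.const_mul _) (Eventually.of_forall hbound)
    _ = _ := by rw [integral_const_mul]; ring

end ArithSeq

end

/-! ### Asymptotic expansion of a function with Laplace transform w^l Q(w) -/

noncomputable section
namespace ArithSeq
open MeasureTheory

theorem integrable_bump_mul {g : ℝ → ℝ} (hg : Continuous g) (U : ℝ) {η : ℝ} (hη : 0 < η) :
    Integrable (fun u : ℝ => g u * bump ((u - U) / η)) := by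
  refine Continuous.integrable_of_hasCompactSupport ?_ ?_
  · exact hg.mul (bump.continuous.comp (by fun_prop))
  · refine HasCompactSupport.intro (isCompact_closedBall U η) fun u hu => ?_
    rw [Metric.mem_closedBall, not_le, Real.dist_eq] at hu
    rw [bump.zero_of_le_dist, mul_zero]
    rw [dist_zero_right, norm_div, Real.norm_eq_abs, Real.norm_of_nonneg hη.le]
    exact (one_le_div hη).2 hu.le

/-- A slowly varying function is controlled by its local averages against a weight. -/
theorem norm_le_of_window {F : ℝ → ℂ} {g : ℝ → ℝ} (hg : Continuous g) {U η o B c : ℝ} (hη : 0 < η)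
    (hc : 0 < c)
    (hg0 : ∀ u, |u - U| ≤ η → c ≤ g u)
    (ho : ∀ u, |u - U| ≤ η → ‖F u - F U‖ ≤ o)
    (hI : Integrable (fun u : ℝ => (g u : ℂ) * F u * ((bump ((u - U) / η) : ℝ) : ℂ)))
    (hB : ‖∫ u : ℝ, (g u : ℂ) * F u * ((bump ((u - U) / η) : ℝ) : ℂ)‖ ≤ B) :
    ‖F U‖ ≤ B / (c * η) + o := by
  set W := ∫ u : ℝ, g u * bump ((u - U) / η) with hW
  have hWi := integrable_bump_mul hg U hη
  have hout : ∀ u, η < |u - U| → bump ((u - U) / η) = 0 := by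
    intro u hu
    rw [bump.zero_of_le_dist]
    rw [dist_zero_right, norm_div, Real.norm_eq_abs, Real.norm_of_nonneg hη.le]
    exact (one_le_div hη).2 hu.le
  have hnn : ∀ u, 0 ≤ g u * bump ((u - U) / η) := by
    intro u
    rcases le_or_gt |u - U| η with h | h
    · exact mul_nonneg (hc.le.trans (hg0 u h)) bump.nonneg
    · rw [hout u h, mul_zero]
  -- The bump equals 1 on the half window |u - U| ≤ η/2, which has length η.
  have hWlow : c * η ≤ W := by
    have h1 : ∫ u in Set.Icc (U - η / 2) (U + η / 2), c = c * η := by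
      simp only [integral_const, MeasurableSet.univ, measureReal_restrict_apply, Set.univ_inter,
        Real.volume_real_Icc, smul_eq_mul]
      rw [max_eq_left (by linarith)]; ring
    rw [← h1, ← integral_indicator measurableSet_Icc]
    refine integral_mono_of_nonneg (Eventually.of_forall fun u => ?_) hWi
      (Eventually.of_forall fun u => ?_)
    · exact Set.indicator_nonneg (fun _ _ => hc.le) u
    · simp only [Set.indicator]
      split_ifs with h
      · have h2 : |u - U| ≤ η / 2 := by
          rw [abs_le]; constructor <;> linarith [h.1, h.2]
        have h3 : bump ((u - U) / η) = 1 := by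
          refine bump.one_of_mem_closedBall ?_
          rw [mem_closedBall_zero_iff, norm_div, Real.norm_eq_abs, Real.norm_of_nonneg hη.le,
            div_le_iff₀ hη]
          show |u - U| ≤ 1 / 2 * η
          linarith
        rw [h3, mul_one]
        exact hg0 u (h2.trans (by linarith))
      · exact hnn u
  have hWpos : 0 < W := lt_of_lt_of_le (by positivity) hWlow
  have hWc : (W : ℂ) = ∫ u : ℝ, (g u : ℂ) * ((bump ((u - U) / η) : ℝ) : ℂ) := by
    rw [hW, ← integral_complex_ofReal]; congr 1; ext u; push_cast; rfl
  have hWic : Integrable (fun u : ℝ => (g u : ℂ) * ((bump ((u - U) / η) : ℝ) : ℂ)) := by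
    refine hWi.ofReal.congr (Eventually.of_forall fun u => ?_)
    simp
  have hdiff : ‖(∫ u : ℝ, (g u : ℂ) * F u * ((bump ((u - U) / η) : ℝ) : ℂ)) - F U * W‖ ≤ o * W := by
    rw [hWc, ← integral_const_mul, ← integral_sub hI (hWic.const_mul _), hW, ← integral_const_mul]
    refine norm_integral_le_of_norm_le (hWi.const_mul o) (Eventually.of_forall fun u => ?_)
    have h4 : (g u : ℂ) * F u * ((bump ((u - U) / η) : ℝ) : ℂ) -
        F U * ((g u : ℂ) * ((bump ((u - U) / η) : ℝ) : ℂ)) =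
        (F u - F U) * ((g u * bump ((u - U) / η) : ℝ) : ℂ) := by push_cast; ring
    rw [h4, norm_mul, Complex.norm_real, Real.norm_of_nonneg (hnn u)]
    rcases le_or_gt |u - U| η with h | h
    · exact mul_le_mul_of_nonneg_right (ho u h) (hnn u)
    · rw [hout u h]; simp
  have h5 : ‖F U‖ * W ≤ B + o * W := by
    have h6 : ‖F U * (W : ℂ)‖ = ‖F U‖ * W := by
      rw [norm_mul, Complex.norm_real, Real.norm_of_nonneg hWpos.le]
    rw [← h6]
    have h7 := norm_sub_norm_le (F U * (W : ℂ))
      (∫ u : ℝ, (g u : ℂ) * F u * ((bump ((u - U) / η) : ℝ) : ℂ))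
    rw [norm_sub_rev] at h7
    linarith
  have hB0 : 0 ≤ B := (norm_nonneg _).trans hB
  have h8 : ‖F U‖ ≤ B / W + o := by
    rw [← sub_le_iff_le_add, le_div_iff₀ hWpos]; linarith
  refine h8.trans ?_
  gcongr

/-- The derivative is of size u^{-l-2}, at most 1 for u ≥ 2 exactly because l ≥ -2. The points stay
away from the jump at u = 1. -/
theorem norm_truncPow_sub_le {l : ℝ} (hl : -2 ≤ l) {u v : ℝ} (hu : 2 ≤ u) (hv : 2 ≤ v) :
    ‖truncPow l u - truncPow l v‖ ≤ |l + 1| * |u - v| := by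
  rw [truncPow, truncPow, if_pos (by linarith), if_pos (by linarith), ← Complex.ofReal_sub,
    Complex.norm_real]
  have := Convex.norm_image_sub_le_of_norm_hasDerivWithin_le (s := Set.Ici (2 : ℝ))
    (f := fun u : ℝ => u ^ (-l - 1)) (f' := fun u : ℝ => (-l - 1) * u ^ (-l - 1 - 1))
    (C := |l + 1|) (x := v) (y := u) ?_ ?_ (convex_Ici _) hv hu
  · simpa [Real.norm_eq_abs] using this
  · intro x hx
    have : (2 : ℝ) ≤ x := hx
    exact (Real.hasDerivAt_rpow_const (Or.inl (by positivity))).hasDerivWithinAt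
  · intro x hx
    have h2 : (2 : ℝ) ≤ x := hx
    rw [norm_mul, Real.norm_eq_abs, show -l - 1 = -(l + 1) by ring, abs_neg,
      Real.norm_of_nonneg (by positivity)]
    refine mul_le_of_le_one_right (abs_nonneg _) ?_
    exact Real.rpow_le_one_of_one_le_of_nonpos (by linarith) (by linarith)

/-- Asymptotic expansion of a slowly varying function whose Laplace transform is `w ^ l Q(w)` with
`Q` smooth up to the imaginary axis. -/
theorem laplace_expansion {f : ℝ → ℂ} {Q : ℂ → ℂ} {l K : ℝ} (hl : -2 ≤ l) (hK : 0 ≤ K)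
    (hf : LaplaceAdm f)
    (hlip : ∃ C D : ℝ, ∀ u v : ℝ, 2 ≤ u → 2 ≤ v → |u - v| ≤ 1 →
      ‖f u - f v‖ ≤ C * u ^ D * |u - v|)
    (hQd : DifferentiableOn ℂ Q (wideStrip 0)) (hQ : ∀ n, Tame (wideStrip 0) K n Q)
    (hΨ : ∀ w ∈ wideStrip 0, laplace f w = w ^ (l : ℂ) * Q w) :
    ∃ q : ℕ → ℂ, Tendsto Q (𝓝[wideStrip 0] 0) (𝓝 (q 0)) ∧
      ∀ A : ℝ, ∃ N : ℕ, ∃ C : ℝ, ∀ u : ℝ, 3 ≤ u →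
        ‖f u - ∑ i ∈ Finset.range (N + 1),
          q i * (((Real.Gamma (-(l + i)))⁻¹ * u ^ (-(l + i) - 1) : ℝ) : ℂ)‖ ≤ C * u ^ (-A) := by
  obtain ⟨q, hq0, hq⟩ := exists_taylor hK hQd hQ
  refine ⟨q, hq0, ?_⟩
  suffices H : ∀ A : ℝ, 0 ≤ A → ∃ N : ℕ, ∃ C : ℝ, ∀ u : ℝ, 3 ≤ u →
        ‖f u - ∑ i ∈ Finset.range (N + 1),
          q i * (((Real.Gamma (-(l + i)))⁻¹ * u ^ (-(l + i) - 1) : ℝ) : ℂ)‖ ≤ C * u ^ (-A) by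
    intro A
    obtain ⟨N, C, hC⟩ := H (max A 0) (le_max_right _ _)
    refine ⟨N, max C 0, fun u hu => (hC u hu).trans ?_⟩
    gcongr
    · exact le_max_left _ _
    · linarith
    · exact le_max_left _ _
  intro A hA
  obtain ⟨C₁, D₁, hCD⟩ := hlip
  set D := max D₁ 0
  have hD0 : 0 ≤ D := le_max_right _ _
  obtain ⟨m, hm⟩ := exists_nat_ge (|l| + K + 1)
  -- With window width η = U^{-(A+D)}, the averages will contribute η^{-(m+1)} U^{-j}. This j makes
  -- that at most U^{-A}.
  obtain ⟨j, hj⟩ := exists_nat_ge (A + (A + D) * (m + 1))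
  -- Since l ≥ -2, the remainder w^{l+j+2} R(w) has exponent at least j, hence j bounded derivatives
  -- near 0.
  obtain ⟨R, hRd, hRt, hR⟩ := hq (j + 2)
  refine ⟨j + 1, ?_⟩
  rw [show j + 1 + 1 = j + 2 from rfl]
  set N := j + 2 with hN
  set c : ℕ → ℂ := fun i => q i * (((Real.Gamma (-(l + i)))⁻¹ : ℝ) : ℂ) with hc
  -- The model for f: for u > 1 it is exactly the claimed expansion, and its transform matches the
  -- Taylor polynomial of Q up to the functions `powDefect`.
  set T : ℝ → ℂ := fun u => ∑ i ∈ Finset.range N, c i * truncPow (l + i) u with hT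
  have hTadm : ∀ i ∈ Finset.range N, LaplaceAdm (fun u => c i * truncPow (l + i) u) :=
    fun i _ => (laplaceAdm_truncPow _).const_mul _
  set r : ℝ → ℂ := fun u => f u - T u with hr
  have hradm : LaplaceAdm r := hf.sub (LaplaceAdm.sum _ hTadm)
  have hrl : ∀ w ∈ wideStrip 0, laplace r w = w ^ (l : ℂ) * Q w -
      ∑ i ∈ Finset.range N, c i * laplace (truncPow (l + i)) w := by
    intro w hw
    rw [hr, hf.laplace_sub (LaplaceAdm.sum _ hTadm) hw, LaplaceAdm.laplace_sum _ hTadm hw, hΨ w hw]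
    congr 1
    refine Finset.sum_congr rfl fun i _ => ?_
    rw [laplace, laplace, ← integral_const_mul]
    congr 1; ext u; ring
  set κ := |l| + K with hκ
  have hκ0 : 0 ≤ κ := by positivity
  -- Away from 0 no cancellation is needed: the transform of f and that of the model are each tame.
  have hfar : Tame farStrip κ j (laplace r) := by
    have hi : farStrip ⊆ wideStrip 0 := Set.inter_subset_left
    have hs : ∀ i ∈ Finset.range N,
        DifferentiableOn ℂ (fun w => c i * laplace (truncPow (l + i)) w) farStrip := fun i _ =>
      ((laplaceAdm_truncPow _).differentiableOn.const_mul _).mono hi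
    refine Tame.congr isOpen_farStrip ?_ fun w hw => (hrl w (hi hw)).symm
    refine Tame.sub isOpen_farStrip (((differentiableOn_cpow l).mono hi).mul (hQd.mono hi))
      (DifferentiableOn.fun_sum hs) ?_ ?_
    · exact (tame_cpow_far l |l| (abs_nonneg _) (le_abs_self _) j).mul isOpen_farStrip
        ((differentiableOn_cpow l).mono hi) (hQd.mono hi) ((hQ j).subset hi)
    · refine Tame.sum _ isOpen_farStrip hκ0 hs fun i _ => Tame.mono ?_ hκ0
      exact (tame_laplace_truncPow _ j).const_mul isOpen_farStrip _
        ((laplaceAdm_truncPow _).differentiableOn.mono hi)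
  -- Near 0 the singular powers cancel, leaving w^{l+N} R(w) and the bounded defects.
  have hnear : Tame nearStrip κ j (laplace r) := by
    have hi : nearStrip ⊆ wideStrip 0 := Set.inter_subset_left
    have hs : ∀ i ∈ Finset.range N,
        DifferentiableOn ℂ (fun w => q i * powDefect (l + i) w) nearStrip := fun i _ =>
      ((differentiableOn_powDefect _).const_mul _).mono hi
    have heq : Set.EqOn (fun w => w ^ ((l + N : ℝ) : ℂ) * R w +
        ∑ i ∈ Finset.range N, q i * powDefect (l + i) w) (laplace r) nearStrip := by
      intro w hw
      have hw0 := ne_zero_of_mem_wideStrip (hi hw)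
      simp only
      rw [hrl w (hi hw), hR w (hi hw), mul_add, Finset.mul_sum, add_sub_right_comm,
        ← Finset.sum_sub_distrib, add_comm]
      congr 1
      · refine Finset.sum_congr rfl fun i _ => ?_
        rw [powDefect, hc]
        push_cast
        rw [Complex.cpow_add _ _ hw0, Complex.cpow_natCast]
        ring
      · push_cast
        rw [Complex.cpow_add _ _ hw0, Complex.cpow_natCast]
        ring
    refine Tame.congr isOpen_nearStrip ?_ heq
    refine Tame.add isOpen_nearStrip (((differentiableOn_cpow _).mono hi).mul (hRd.mono hi))
      (DifferentiableOn.fun_sum hs) ?_ ?_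
    · refine Tame.mono ((tame_cpow_near (l + N) j ?_).mul isOpen_nearStrip
        ((differentiableOn_cpow _).mono hi) (hRd.mono hi) ((hRt j).subset hi)) ?_
      · rw [hN]; push_cast; linarith
      · rw [hκ]; linarith [abs_nonneg l]
    · refine Tame.sum _ isOpen_nearStrip hκ0 hs fun i _ => Tame.mono ?_ hκ0
      exact (tame_powDefect _ j).const_mul isOpen_nearStrip _
        ((differentiableOn_powDefect _).mono hi)
  obtain ⟨Cf, hCf0, hCf⟩ := hfar.iterate.exists_nonneg one_pos
  obtain ⟨Cn, hCn0, hCn⟩ := hnear.iterate.exists_nonneg one_pos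
  have hbound : ∀ w ∈ wideStrip 0,
      ‖laplace (fun u => (u : ℂ) ^ j * r u) w‖ ≤ (Cf + Cn) * (2 + |w.im|) ^ m := by
    intro w hw
    have h1 := hradm.iterate_deriv j hw
    have h2 : ‖laplace (fun u => (u : ℂ) ^ j * r u) w‖ = ‖deriv^[j] (laplace r) w‖ := by
      rw [h1, norm_mul, norm_pow, norm_neg, norm_one, one_pow, one_mul]
    have h3 : (2 + |w.im|) ^ (κ + 1) ≤ (2 + |w.im|) ^ m := by
      rw [← Real.rpow_natCast]
      exact Real.rpow_le_rpow_of_exponent_le (one_le_two_add_abs _) hm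
    have h4 : ‖deriv^[j] (laplace r) w‖ ≤ (Cf + Cn) * (2 + |w.im|) ^ (κ + 1) := by
      have h0 : 0 ≤ (2 + |w.im|) ^ (κ + 1) := by positivity
      rcases lt_or_ge 1 ‖w‖ with h | h
      · exact (hCf w ⟨hw, h⟩).trans (by nlinarith)
      · exact (hCn w ⟨hw, mem_ball_zero_iff.2 (by linarith)⟩).trans (by nlinarith)
    rw [h2]
    exact h4.trans (by gcongr)
  obtain ⟨C', hC'⟩ := exists_window_bound (hradm.pow_mul j) hbound
  set L₀ := |C₁| + ∑ i ∈ Finset.range N, ‖c i‖ * |l + i + 1| with hL₀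
  have hrlip : ∀ u v : ℝ, 2 ≤ u → 2 ≤ v → |u - v| ≤ 1 → ‖r u - r v‖ ≤ L₀ * u ^ D * |u - v| := by
    intro u v hu hv huv
    have hu1 : 1 ≤ u := by linarith
    have hD1 : 1 ≤ u ^ D := Real.one_le_rpow hu1 hD0
    have h1 : ‖f u - f v‖ ≤ |C₁| * u ^ D * |u - v| := by
      refine (hCD u v hu hv huv).trans ?_
      gcongr
      · exact le_abs_self _
      · exact le_max_left _ _
    have h2 : ‖T u - T v‖ ≤ (∑ i ∈ Finset.range N, ‖c i‖ * |l + i + 1|) * |u - v| := by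
      rw [hT, ← Finset.sum_sub_distrib, Finset.sum_mul]
      refine (norm_sum_le _ _).trans (Finset.sum_le_sum fun i _ => ?_)
      rw [← mul_sub, norm_mul, mul_assoc]
      gcongr
      exact norm_truncPow_sub_le (by linarith [(Nat.cast_nonneg i : (0 : ℝ) ≤ i)]) hu hv
    have h3 : r u - r v = (f u - f v) - (T u - T v) := by simp only [hr]; ring
    have h4 : 0 ≤ (∑ i ∈ Finset.range N, ‖c i‖ * |l + i + 1|) * |u - v| := by positivity
    rw [h3]
    calc _ ≤ ‖f u - f v‖ + ‖T u - T v‖ := norm_sub_le _ _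
      _ ≤ |C₁| * u ^ D * |u - v| +
        ((∑ i ∈ Finset.range N, ‖c i‖ * |l + i + 1|) * |u - v|) * u ^ D :=
          add_le_add h1 (h2.trans (le_mul_of_one_le_right h4 hD1))
      _ = _ := by rw [hL₀]; ring
  refine ⟨|C'| * (2 ^ j * Real.exp 1) + L₀, fun U hU => ?_⟩
  have hU0 : 0 < U := by linarith
  have hU1 : 1 ≤ U := by linarith
  have hfr : f U - ∑ i ∈ Finset.range N,
      q i * (((Real.Gamma (-(l + i)))⁻¹ * U ^ (-(l + i) - 1) : ℝ) : ℂ) = r U := by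
    simp only [hr, hT, hc, truncPow, if_pos (show 1 < U by linarith)]
    congr 1
    refine Finset.sum_congr rfl fun i _ => ?_
    push_cast; ring
  rw [hfr]
  -- Over such a window the remainder varies by at most a constant times U^D η = U^{-A}.
  set η := U ^ (-(A + D)) with hη
  have hη0 : 0 < η := by positivity
  have hη1 : η ≤ 1 := Real.rpow_le_one_of_one_le_of_nonpos hU1 (by linarith)
  -- A line so close to the axis that e^{-σu} is bounded below on the window. It may depend on U
  -- because the window bound is uniform in σ.
  set σ := 1 / (4 * U) with hσ
  have hσ0 : 0 < σ := by positivity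
  have hσ1 : σ < 1 / 2 := by
    rw [hσ, div_lt_div_iff₀ (by positivity) (by norm_num)]; linarith
  have hw := hC' σ hσ0 hσ1 U η hη0 hη1
  have hconv : ∀ u : ℝ, Complex.exp (-((σ : ℂ) * u)) * ((u : ℂ) ^ j * r u) *
      ((bump ((u - U) / η) : ℝ) : ℂ) =
      ((Real.exp (-(σ * u)) * u ^ j : ℝ) : ℂ) * r u * ((bump ((u - U) / η) : ℝ) : ℂ) := by
    intro u; push_cast; ring
  simp_rw [hconv] at hw
  have hI : Integrable (fun u : ℝ => ((Real.exp (-(σ * u)) * u ^ j : ℝ) : ℂ) * r u *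
      ((bump ((u - U) / η) : ℝ) : ℂ)) := by
    have hbc : Continuous (fun u : ℝ => ((bump ((u - U) / η) : ℝ) : ℂ)) :=
      Complex.continuous_ofReal.comp (bump.continuous.comp (by fun_prop))
    have h1 := (hradm.pow_mul j σ hσ0 hσ1).mul_bdd (c := 1) hbc.aestronglyMeasurable
      (Eventually.of_forall fun u => by
        rw [Complex.norm_real, Real.norm_of_nonneg bump.nonneg]; exact bump.le_one)
    exact h1.congr (Eventually.of_forall fun u => hconv u)
  have hfin := norm_le_of_window (F := r) (g := fun u => Real.exp (-(σ * u)) * u ^ j)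
    (by fun_prop) (U := U) (η := η) (o := L₀ * U ^ D * η) (B := |C'| * η⁻¹ ^ m)
    (c := (Real.exp 1)⁻¹ * (U / 2) ^ j) hη0 (by positivity) ?_ ?_ hI
    (hw.trans (by gcongr; exact le_abs_self _))
  · refine hfin.trans ?_
    rw [add_mul (|C'| * (2 ^ j * Real.exp 1)) L₀]
    have hstep : |C'| * η⁻¹ ^ m / ((Real.exp 1)⁻¹ * (U / 2) ^ j * η) =
        |C'| * (2 ^ j * Real.exp 1) * (η⁻¹ ^ (m + 1) * (U ^ j)⁻¹) := by
      rw [div_pow, pow_succ]; field_simp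
    rw [hstep]
    have he : η⁻¹ ^ (m + 1) * (U ^ j)⁻¹ ≤ U ^ (-A) := by
      rw [hη, ← Real.rpow_neg hU0.le, neg_neg, ← Real.rpow_natCast, ← Real.rpow_natCast,
        ← Real.rpow_mul hU0.le, ← Real.rpow_neg hU0.le, ← Real.rpow_add hU0]
      refine Real.rpow_le_rpow_of_exponent_le hU1 ?_
      push_cast; linarith
    have he2 : L₀ * U ^ D * η = L₀ * U ^ (-A) := by
      rw [hη, mul_assoc, ← Real.rpow_add hU0]; congr 2; ring
    rw [he2]
    gcongr
  · intro u hu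
    have hu2 := abs_le.1 hu
    have h1 : U / 2 ≤ u := by linarith
    have h2 : σ * u ≤ 1 := by
      rw [hσ, one_div, inv_mul_le_iff₀ (by positivity)]; linarith
    rw [← Real.exp_neg]
    gcongr
  · intro u hu
    have hu2 := abs_le.1 hu
    rw [norm_sub_rev]
    refine (hrlip U u (by linarith) (by linarith) ?_).trans ?_
    · rw [abs_sub_comm]; linarith
    · rw [abs_sub_comm]; gcongr

end ArithSeq

end

/-! ### Upper and lower bounds for wζ(1+w) up to the line Re w = 0 -/

noncomputable section
namespace ArithSeq

theorem PolyBdd.of_forall_gt {Ω : Set ℂ} {K ε₀ : ℝ} (hε₀ : 0 < ε₀) {F : ℂ → ℂ}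
    (h : ∀ ε, 0 < ε → ε ≤ ε₀ → PolyBdd Ω (K + ε) F) : PolyBdd Ω K F := by
  intro ε hε
  have hm : 0 < min (ε / 2) ε₀ := lt_min (by linarith) hε₀
  obtain ⟨C, hC⟩ := h (min (ε / 2) ε₀) hm (min_le_right _ _) (ε - min (ε / 2) ε₀)
    (by linarith [min_le_left (ε / 2) ε₀])
  refine ⟨C, fun w hw => (hC w hw).trans_eq ?_⟩
  congr 2; ring

theorem Tame.of_forall_gt {Ω : Set ℂ} {K ε₀ : ℝ} (hε₀ : 0 < ε₀) {n : ℕ} {F : ℂ → ℂ}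
    (h : ∀ ε, 0 < ε → ε ≤ ε₀ → Tame Ω (K + ε) n F) : Tame Ω K n F := by
  induction n generalizing F with
  | zero => exact PolyBdd.of_forall_gt hε₀ h
  | succ n ih =>
    exact ⟨PolyBdd.of_forall_gt hε₀ fun ε h1 h2 => (h ε h1 h2).1,
      ih fun ε h1 h2 => (h ε h1 h2).2⟩

/-- The summands of `w ζ(1 + w) - 1`. -/
def zetaTerm (n : ℕ) (w : ℂ) : ℂ :=
  w * ((n + 1 : ℝ) : ℂ) ^ (-1 - w) + ((n + 1 + 1 : ℝ) : ℂ) ^ (-w) - ((n + 1 : ℝ) : ℂ) ^ (-w)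

/-- The regularised zeta function `w ζ(1 + w)`, defined for `Re w > -1`. -/
def zetaReg (w : ℂ) : ℂ := 1 + ∑' n, zetaTerm n w

theorem norm_ofReal_cpow_le {N x : ℝ} (hN : 0 < N) (hx : N ≤ x) {z : ℂ} (hz : z.re ≤ 0) :
    ‖(x : ℂ) ^ z‖ ≤ N ^ z.re := by
  rw [Complex.norm_cpow_eq_rpow_re_of_pos (hN.trans_le hx)]
  exact Real.rpow_le_rpow_of_nonpos hN hx hz

theorem hasDerivAt_ofReal_cpow_neg {x : ℝ} (hx : 0 < x) (z : ℂ) :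
    HasDerivAt (fun x : ℝ => (x : ℂ) ^ z) (z * (x : ℂ) ^ (z - 1)) x := by
  have h1 : HasDerivAt (fun y : ℂ => y ^ z) (z * (x : ℂ) ^ (z - 1)) (x : ℂ) := by
    simpa using (hasDerivAt_id (x : ℂ)).cpow_const (c := z) (Or.inl (by simpa using hx))
  exact h1.comp_ofReal

/-- The term equals w ∫ (N^{-1-w} - x^{-1-w}) dx over [N, N+1], with N = n + 1. The two entries of
the minimum bound the integrand trivially and by the mean value theorem. -/
theorem norm_zetaTerm_le_mul (n : ℕ) {w : ℂ} (hw : -1 < w.re) :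
    ‖zetaTerm n w‖ ≤ ‖w‖ * min (2 * (n + 1 : ℝ) ^ (-1 - w.re))
      (‖1 + w‖ * (n + 1 : ℝ) ^ (-2 - w.re)) := by
  set N : ℝ := n + 1 with hN
  have hN0 : 0 < N := by positivity
  have hdiff : ∀ x ∈ Set.Icc N (N + 1), ‖(N : ℂ) ^ (-1 - w) - (x : ℂ) ^ (-1 - w)‖ ≤
      min (2 * N ^ (-1 - w.re)) (‖1 + w‖ * N ^ (-2 - w.re)) := by
    intro x hx
    refine le_min ?_ ?_
    · refine (norm_sub_le _ _).trans ?_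
      have h1 := norm_ofReal_cpow_le hN0 le_rfl (z := -1 - w) (by simp; linarith)
      have h2 := norm_ofReal_cpow_le hN0 hx.1 (z := -1 - w) (by simp; linarith)
      simp only [Complex.sub_re, Complex.neg_re, Complex.one_re] at h1 h2
      linarith
    · have h := Convex.norm_image_sub_le_of_norm_hasDerivWithin_le (s := Set.Icc N (N + 1))
        (f := fun x : ℝ => (x : ℂ) ^ (-1 - w)) (f' := fun x : ℝ => (-1 - w) * (x : ℂ) ^ (-1 - w - 1))
        (C := ‖1 + w‖ * N ^ (-2 - w.re)) (x := x) (y := N) ?_ ?_ (convex_Icc _ _) hx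
        ⟨le_rfl, by linarith⟩
      · refine h.trans ?_
        have : ‖N - x‖ ≤ 1 := by
          rw [Real.norm_eq_abs, abs_le]; constructor <;> linarith [hx.1, hx.2]
        exact mul_le_of_le_one_right (by positivity) this
      · intro y hy
        exact (hasDerivAt_ofReal_cpow_neg (hN0.trans_le hy.1) _).hasDerivWithinAt
      · intro y hy
        rw [norm_mul, show -1 - w = -(1 + w) by ring, norm_neg]
        gcongr
        have h1 := norm_ofReal_cpow_le hN0 hy.1 (z := -(1 + w) - 1) (by simp; linarith)
        refine h1.trans_eq ?_
        congr 1; simp; ring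
  have h := Convex.norm_image_sub_le_of_norm_hasDerivWithin_le (s := Set.Icc N (N + 1))
    (f := fun x : ℝ => (x : ℂ) ^ (-w) + w * (N : ℂ) ^ (-1 - w) * x)
    (f' := fun x : ℝ => -w * (x : ℂ) ^ (-w - 1) + w * (N : ℂ) ^ (-1 - w))
    (C := ‖w‖ * min (2 * N ^ (-1 - w.re)) (‖1 + w‖ * N ^ (-2 - w.re))) (x := N) (y := N + 1)
    ?_ ?_ (convex_Icc _ _) ⟨le_rfl, by linarith⟩ ⟨by linarith, le_rfl⟩
  · simp only [add_sub_cancel_left, norm_one, mul_one] at h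
    refine le_trans (le_of_eq ?_) h
    congr 1
    rw [zetaTerm, ← hN]
    push_cast
    ring
  · intro y hy
    have h1 := hasDerivAt_ofReal_cpow_neg (hN0.trans_le hy.1) (-w)
    have h2 : HasDerivAt (fun x : ℝ => w * (N : ℂ) ^ (-1 - w) * (x : ℂ)) (w * (N : ℂ) ^ (-1 - w)) y := by
      simpa using (Complex.ofRealCLM.hasDerivAt (x := y)).const_mul (w * (N : ℂ) ^ (-1 - w))
    exact (h1.add h2).hasDerivWithinAt
  · intro y hy
    have h3 : -w * (y : ℂ) ^ (-w - 1) + w * (N : ℂ) ^ (-1 - w) =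
        w * ((N : ℂ) ^ (-1 - w) - (y : ℂ) ^ (-1 - w)) := by
      rw [show -w - 1 = -1 - w by ring]; ring
    rw [h3, norm_mul]
    gcongr
    exact hdiff y hy

/-- Interpolating the two bounds with weight 2ε gains n^{-2ε} at the price of |1+w|^{2ε}. That is
enough for summability even when Re w is slightly negative. -/
theorem norm_zetaTerm_le {ε : ℝ} (hε : 0 < ε) (hε1 : ε ≤ 1 / 4) (n : ℕ) {w : ℂ}
    (hw : -ε < w.re) :
    ‖zetaTerm n w‖ ≤ 2 * (1 + ‖w‖) ^ (1 + 2 * ε) * (n + 1 : ℝ) ^ (-1 - ε) := by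
  have h := norm_zetaTerm_le_mul n (w := w) (by linarith)
  set N : ℝ := n + 1 with hN
  have hN1 : 1 ≤ N := by simp [hN]
  have hN0 : 0 < N := by positivity
  have hx0 : 0 ≤ ‖1 + w‖ / N := by positivity
  have hmin : min (2 * N ^ (-1 - w.re)) (‖1 + w‖ * N ^ (-2 - w.re)) ≤
      2 * N ^ (-1 - w.re) * (‖1 + w‖ / N) ^ (2 * ε) := by
    rcases le_total 1 (‖1 + w‖ / N) with hx | hx
    · refine (min_le_left _ _).trans ?_
      exact le_mul_of_one_le_right (by positivity) (Real.one_le_rpow hx (by linarith))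
    · refine (min_le_right _ _).trans ?_
      have h1 : ‖1 + w‖ / N ≤ (‖1 + w‖ / N) ^ (2 * ε) := by
        rcases hx0.eq_or_lt with h0 | h0
        · rw [← h0]; positivity
        · conv_lhs => rw [← Real.rpow_one (‖1 + w‖ / N)]
          exact Real.rpow_le_rpow_of_exponent_ge h0 hx (by linarith)
      have h2 : ‖1 + w‖ * N ^ (-2 - w.re) = N ^ (-1 - w.re) * (‖1 + w‖ / N) := by
        rw [show -2 - w.re = (-1 - w.re) - 1 by ring, Real.rpow_sub_one hN0.ne']; ring
      rw [h2]
      have h3 : 0 ≤ N ^ (-1 - w.re) := by positivity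
      have h4 : 0 ≤ (‖1 + w‖ / N) ^ (2 * ε) := by positivity
      nlinarith [mul_le_mul_of_nonneg_left h1 h3, mul_nonneg h3 h4]
  have hw1 : ‖1 + w‖ ≤ 1 + ‖w‖ := (norm_add_le _ _).trans (by simp)
  have h5 : N ^ (-1 - w.re) * (‖1 + w‖ / N) ^ (2 * ε) ≤
      (1 + ‖w‖) ^ (2 * ε) * N ^ (-1 - ε) := by
    rw [Real.div_rpow (norm_nonneg _) hN0.le, div_eq_mul_inv, ← Real.rpow_neg hN0.le,
      mul_left_comm, ← Real.rpow_add hN0]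
    refine mul_le_mul (Real.rpow_le_rpow (norm_nonneg _) hw1 (by linarith))
      (Real.rpow_le_rpow_of_exponent_le hN1 (by linarith)) (by positivity) (by positivity)
  calc ‖zetaTerm n w‖ ≤ ‖w‖ * (2 * N ^ (-1 - w.re) * (‖1 + w‖ / N) ^ (2 * ε)) :=
        h.trans (mul_le_mul_of_nonneg_left hmin (norm_nonneg _))
    _ ≤ (1 + ‖w‖) * (2 * ((1 + ‖w‖) ^ (2 * ε) * N ^ (-1 - ε))) := by
        rw [mul_assoc 2]
        gcongr
        linarith
    _ = _ := by rw [Real.rpow_add (by positivity), Real.rpow_one]; ring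

theorem summable_add_one_rpow {ε : ℝ} (hε : 0 < ε) :
    Summable (fun n : ℕ => ((n : ℝ) + 1) ^ (-1 - ε)) := by
  have h := (Real.summable_nat_rpow (p := -1 - ε)).2 (by linarith)
  simpa using (summable_nat_add_iff 1).2 h

theorem summable_zetaTerm {w : ℂ} (hw : -(1 / 4) < w.re) : Summable (fun n => zetaTerm n w) := by
  obtain ⟨ε, h0, h1, h2⟩ : ∃ ε : ℝ, 0 < ε ∧ ε ≤ 1 / 4 ∧ -ε < w.re :=
    ⟨1 / 4, by norm_num, le_rfl, by linarith⟩
  exact Summable.of_norm_bounded ((summable_add_one_rpow h0).mul_left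
    (2 * (1 + ‖w‖) ^ (1 + 2 * ε))) fun n => norm_zetaTerm_le h0 h1 n h2

theorem differentiableOn_zetaReg : DifferentiableOn ℂ zetaReg (wideStrip (1 / 4)) := by
  intro w hw
  have hopen : IsOpen (wideStrip (1 / 4) ∩ Metric.ball 0 (‖w‖ + 1)) :=
    (isOpen_wideStrip _).inter Metric.isOpen_ball
  have hd : DifferentiableOn ℂ (fun w => ∑' n, zetaTerm n w)
      (wideStrip (1 / 4) ∩ Metric.ball 0 (‖w‖ + 1)) := by
    refine Complex.differentiableOn_tsum_of_summable_norm
      (u := fun n : ℕ => 2 * (2 + ‖w‖) ^ (1 + 2 * (1 / 4 : ℝ)) * ((n : ℝ) + 1) ^ (-1 - (1 / 4 : ℝ)))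
      ((summable_add_one_rpow (by norm_num)).mul_left _) (fun n => ?_) hopen fun n z hz => ?_
    · have h1 : ((n + 1 : ℝ) : ℂ) ≠ 0 := by norm_cast
      have h2 : ((n + 1 + 1 : ℝ) : ℂ) ≠ 0 := by norm_cast
      refine Differentiable.differentiableOn ?_
      unfold zetaTerm
      refine ((differentiable_id.mul ?_).add ?_).sub ?_
      · exact Differentiable.const_cpow (by fun_prop) (Or.inl h1)
      · exact Differentiable.const_cpow (by fun_prop) (Or.inl h2)
      · exact Differentiable.const_cpow (by fun_prop) (Or.inl h1)
    · refine (norm_zetaTerm_le (by norm_num) le_rfl n (by linarith [hz.1.1])).trans ?_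
      have := (mem_ball_zero_iff.1 hz.2).le
      gcongr ?_ * _
      gcongr 2 * ?_ ^ _
      linarith
  exact ((hd.differentiableAt (hopen.mem_nhds ⟨hw, by simp⟩)).const_add 1).differentiableWithinAt

theorem polyBdd_zetaReg {ε : ℝ} (hε : 0 < ε) (hε1 : ε ≤ 1 / 4) :
    PolyBdd (wideStrip ε) (1 + 2 * ε) zetaReg := by
  intro δ hδ
  set S := ∑' n : ℕ, ((n : ℝ) + 1) ^ (-1 - ε) with hS
  have hS0 : 0 ≤ S := tsum_nonneg fun n => by positivity
  refine ⟨1 + 2 * S, fun w hw => ?_⟩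
  have h1 : ‖∑' n, zetaTerm n w‖ ≤ 2 * (1 + ‖w‖) ^ (1 + 2 * ε) * S := by
    rw [hS, ← tsum_mul_left]
    exact tsum_of_norm_bounded ((summable_add_one_rpow hε).mul_left _).hasSum
      fun n => norm_zetaTerm_le hε hε1 n hw.1
  have hwn : 1 + ‖w‖ ≤ 2 + |w.im| := by
    have h2 := Complex.norm_le_abs_re_add_abs_im w
    have h3 : |w.re| ≤ 1 := by
      rw [abs_le]; constructor <;> linarith [hw.1, hw.2]
    linarith
  have h4 : (1 + ‖w‖) ^ (1 + 2 * ε) ≤ (2 + |w.im|) ^ (1 + 2 * ε + δ) :=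
    (Real.rpow_le_rpow (by positivity) hwn (by linarith)).trans
      (Real.rpow_le_rpow_of_exponent_le (one_le_two_add_abs _) (by linarith))
  have h5 : 1 ≤ (2 + |w.im|) ^ (1 + 2 * ε + δ) :=
    Real.one_le_rpow (one_le_two_add_abs _) (by linarith)
  calc ‖zetaReg w‖ ≤ 1 + 2 * (1 + ‖w‖) ^ (1 + 2 * ε) * S := by
        rw [zetaReg]
        refine (norm_add_le _ _).trans ?_
        rw [norm_one]; linarith
    _ ≤ (2 + |w.im|) ^ (1 + 2 * ε + δ) + 2 * (2 + |w.im|) ^ (1 + 2 * ε + δ) * S := by gcongr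
    _ = _ := by ring

/-- The exponent 1 + 2ε on a strip of overhang ε becomes 1 on the common inner strip as ε tends to
0, since `PolyBdd` tolerates arbitrarily small losses. -/
theorem tame_zetaReg (n : ℕ) : Tame (wideStrip 0) 1 n zetaReg := by
  refine Tame.of_forall_gt (ε₀ := 1 / 2) (by norm_num) fun ε h0 h1 => ?_
  have := Tame.of_wideStrip (r := 0) (r' := ε / 2) (by linarith) n
    (differentiableOn_zetaReg.mono (wideStrip_mono (by linarith)))
    (polyBdd_zetaReg (ε := ε / 2) (by linarith) (by linarith))
  convert this using 1; ring

/-- The part of the terms without the factor w telescopes to -1, cancelling the initial 1. -/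
theorem zetaReg_eq {w : ℂ} (hw : 0 < w.re) : zetaReg w = w * riemannZeta (1 + w) := by
  have h1 : 1 < (1 + w).re := by simp [hw]
  have hz := zeta_eq_tsum_one_div_nat_add_one_cpow h1
  have hsz : Summable (fun n : ℕ => 1 / ((n : ℂ) + 1) ^ (1 + w)) := by
    have := (Complex.summable_one_div_nat_cpow (p := 1 + w)).2 h1
    simpa using (summable_nat_add_iff 1).2 this
  have hs1 : Summable (fun n : ℕ => w * (1 / ((n : ℂ) + 1) ^ (1 + w))) := hsz.mul_left w
  have hst := summable_zetaTerm (w := w) (by linarith)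
  have hdiff : ∀ n : ℕ, zetaTerm n w - w * (1 / ((n : ℂ) + 1) ^ (1 + w)) =
      (((n + 1 : ℕ) : ℂ) + 1) ^ (-w) - ((n : ℂ) + 1) ^ (-w) := by
    intro n
    rw [zetaTerm, one_div, ← Complex.cpow_neg]
    push_cast
    rw [show -(1 + w) = -1 - w by ring]; ring
  have hs2 := hst.sub hs1
  have htend := hs2.hasSum.tendsto_sum_nat
  have hpart : ∀ M : ℕ, ∑ n ∈ Finset.range M,
      (zetaTerm n w - w * (1 / ((n : ℂ) + 1) ^ (1 + w))) = ((M : ℂ) + 1) ^ (-w) - 1 := by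
    intro M
    rw [Finset.sum_congr rfl fun n _ => hdiff n,
      Finset.sum_range_sub (fun n : ℕ => ((n : ℂ) + 1) ^ (-w))]
    simp
  have hlim : Tendsto (fun M : ℕ => ((M : ℂ) + 1) ^ (-w) - 1) atTop (𝓝 (0 - 1)) := by
    refine Tendsto.sub_const ?_ 1
    rw [tendsto_zero_iff_norm_tendsto_zero]
    have h3 : ∀ M : ℕ, ‖((M : ℂ) + 1) ^ (-w)‖ = ((M : ℝ) + 1) ^ (-w.re) := by
      intro M
      rw [show ((M : ℂ) + 1) = (((M : ℝ) + 1 : ℝ) : ℂ) by push_cast; ring,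
        Complex.norm_cpow_eq_rpow_re_of_pos (by positivity), Complex.neg_re]
    simp_rw [h3]
    exact (tendsto_rpow_neg_atTop hw).comp
      (tendsto_atTop_add_const_right _ _ tendsto_natCast_atTop_atTop)
  have huniq := tendsto_nhds_unique (htend.congr hpart) hlim
  rw [hst.tsum_sub hs1, tsum_mul_left, ← hz] at huniq
  rw [zetaReg]
  linear_combination huniq

theorem zetaReg_zero : zetaReg 0 = 1 := by
  simp [zetaReg, zetaTerm]

theorem continuousOn_zetaReg : ContinuousOn zetaReg (wideStrip (1 / 4)) :=
  differentiableOn_zetaReg.continuousOn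

/-- The formula with ζ extends by continuity to Re w = 0, w ≠ 0, where ζ does not vanish. At w = 0
the pole is cancelled and the value is 1. -/
theorem zetaReg_ne_zero {w : ℂ} (hw : 0 ≤ w.re) (hw1 : w.re ≤ 1 / 2) : zetaReg w ≠ 0 := by
  by_cases h0 : w = 0
  · rw [h0, zetaReg_zero]; exact one_ne_zero
  have hmem : w ∈ wideStrip (1 / 4) := ⟨by linarith, by linarith⟩
  have heq : zetaReg w = w * riemannZeta (1 + w) := by
    have ht : Tendsto (fun n : ℕ => w + ((1 / ((n : ℝ) + 1) : ℝ) : ℂ)) atTop (𝓝 w) := by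
      have := ((Complex.continuous_ofReal.tendsto 0).comp
        (tendsto_one_div_add_atTop_nhds_zero_nat (𝕜 := ℝ))).const_add w
      simpa using this
    have hA := ((continuousOn_zetaReg.continuousAt ((isOpen_wideStrip _).mem_nhds hmem)).tendsto).comp ht
    have hz : ContinuousAt (fun w => w * riemannZeta (1 + w)) w := by
      refine continuousAt_id.mul ?_
      have h1 : (1 : ℂ) + w ≠ 1 := by simpa using h0
      exact (differentiableAt_riemannZeta h1).continuousAt.comp (by fun_prop)
    have hB := hz.tendsto.comp ht
    refine tendsto_nhds_unique (hA.congr fun n => ?_) hB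
    refine zetaReg_eq ?_
    have : 0 < 1 / ((n : ℝ) + 1) := by positivity
    simp only [Complex.add_re, Complex.ofReal_re]
    linarith
  rw [heq]
  exact mul_ne_zero h0 (riemannZeta_ne_zero_of_one_le_re (by simp [hw]))

theorem one_le_norm_zeta_product {x : ℝ} (hx : 0 < x) (y : ℝ) :
    1 ≤ ‖riemannZeta (1 + x)‖ ^ 3 * ‖riemannZeta (1 + x + Complex.I * y)‖ ^ 4 *
      ‖riemannZeta (1 + x + 2 * Complex.I * y)‖ := by
  have h := DirichletCharacter.norm_LFunction_product_ge_one (N := 1) 1 hx y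
  rw [DirichletCharacter.LFunctionTrivChar, DirichletCharacter.LFunction_modOne_eq,
    DirichletCharacter.LFunction_modOne_eq] at h
  simpa [norm_mul, norm_pow] using h

/-- The reciprocal of `w ζ(1 + w)` is `≪ |w| ^ (-1 + ε)` to the right of the imaginary axis. -/
theorem polyBdd_inv_zetaReg : PolyBdd (wideStrip 0) (-1) (fun w => (zetaReg w)⁻¹) := by
  intro ε hε
  -- The lower bound obtained below loses (2+|y|)^{7δ}.
  set δ := ε / 7 with hδ
  have hδ0 : 0 < δ := by positivity
  obtain ⟨C₀, hC₀0, hC₀⟩ := (tame_zetaReg 0).bdd.exists_nonneg hδ0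
  obtain ⟨C₁, hC₁0, hC₁⟩ := ((tame_zetaReg 1).2 : PolyBdd _ _ _).exists_nonneg hδ0
  set C := C₀ + C₁ + 1 with hC
  have hC1 : 1 ≤ C := by linarith
  have hpow : ∀ T : ℝ, 1 ≤ T → T ^ (1 + δ) = T * T ^ δ := fun T hT => by
    rw [Real.rpow_add (by positivity), Real.rpow_one]
  have hY : ∀ w ∈ wideStrip 0, ‖zetaReg w‖ ≤ C * ((2 + |w.im|) * (2 + |w.im|) ^ δ) := fun w hw => by
    refine (hC₀ w hw).trans ?_
    rw [hpow _ (one_le_two_add_abs _)]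
    gcongr; linarith
  have hY' : ∀ w ∈ wideStrip 0, ‖deriv zetaReg w‖ ≤ C * ((2 + |w.im|) * (2 + |w.im|) ^ δ) :=
    fun w hw => by
      refine (hC₁ w hw).trans ?_
      rw [hpow _ (one_le_two_add_abs _)]
      gcongr; linarith
  -- the consequence of the `3-4-1` inequality
  set c : ℝ := ((C * (2 * 2 ^ δ)) ^ 3 * (C * (4 * 2 ^ δ)) * 3 ^ 4)⁻¹ with hc
  have hc0 : 0 < c := by positivity
  have h341 : ∀ x y : ℝ, 0 < x → x < 1 / 2 → 1 ≤ |y| →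
      c * x ^ 3 * (2 + |y|) ^ 4 * ((2 + |y|) ^ δ)⁻¹ ≤ ‖zetaReg (x + Complex.I * y)‖ ^ 4 := by
    intro x y hx hx1 hy
    have h := one_le_norm_zeta_product hx y
    have e1 : zetaReg (x : ℂ) = x * riemannZeta (1 + x) := zetaReg_eq (by simpa using hx)
    have e2 : zetaReg (x + Complex.I * y) =
        (x + Complex.I * y) * riemannZeta (1 + x + Complex.I * y) := by
      rw [zetaReg_eq (by simpa using hx), add_assoc]
    have e3 : zetaReg (x + 2 * Complex.I * y) =
        (x + 2 * Complex.I * y) * riemannZeta (1 + x + 2 * Complex.I * y) := by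
      rw [zetaReg_eq (by simpa using hx), add_assoc]
    have n1 : ‖riemannZeta (1 + x)‖ * x ≤ C * (2 * 2 ^ δ) := by
      have h1 := hY (x : ℂ) ⟨by simp [hx], by simpa using hx1⟩
      rw [e1, norm_mul, Complex.norm_real, Real.norm_of_nonneg hx.le] at h1
      simp only [Complex.ofReal_im, abs_zero, add_zero] at h1
      linarith
    set T := 2 + |y| with hT
    have hT0 : 0 < T := by positivity
    have n3 : ‖riemannZeta (1 + x + 2 * Complex.I * y)‖ ≤ C * (4 * 2 ^ δ) * T ^ δ := by
      have h1 := hY (x + 2 * Complex.I * y : ℂ) ⟨by simp [hx], by simpa using hx1⟩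
      have him : (x + 2 * Complex.I * y : ℂ).im = 2 * y := by simp
      rw [him, abs_mul, abs_two] at h1
      have hn : T / 2 ≤ ‖(x + 2 * Complex.I * y : ℂ)‖ := by
        have h2 := Complex.abs_im_le_norm (x + 2 * Complex.I * y : ℂ)
        rw [him, abs_mul, abs_two] at h2
        linarith
      rw [e3, norm_mul] at h1
      have h2 : 2 + 2 * |y| ≤ 2 * T := by rw [hT]; linarith
      have h3 : T / 2 * ‖riemannZeta (1 + x + 2 * Complex.I * y)‖ ≤
          C * ((2 * T) * (2 * T) ^ δ) := by
        calc _ ≤ _ := mul_le_mul_of_nonneg_right hn (norm_nonneg _)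
          _ ≤ _ := h1
          _ ≤ _ := by gcongr
      rw [Real.mul_rpow zero_le_two hT0.le] at h3
      have h4 : C * ((2 * T) * (2 ^ δ * T ^ δ)) = T / 2 * (C * (4 * 2 ^ δ) * T ^ δ) := by ring
      rw [h4] at h3
      exact le_of_mul_le_mul_left h3 (by positivity)
    have n2 : T / 3 * ‖riemannZeta (1 + x + Complex.I * y)‖ ≤ ‖zetaReg (x + Complex.I * y)‖ := by
      rw [e2, norm_mul]
      gcongr
      have h2 := Complex.abs_im_le_norm (x + Complex.I * y : ℂ)
      have him : (x + Complex.I * y : ℂ).im = y := by simp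
      rw [him] at h2
      rw [hT]; linarith
    have hTδ : 0 < T ^ δ := by positivity
    set z1 := ‖riemannZeta (1 + x)‖
    set z2 := ‖riemannZeta (1 + x + Complex.I * y)‖
    set z3 := ‖riemannZeta (1 + x + 2 * Complex.I * y)‖
    have p1 : (z1 * x) ^ 3 ≤ (C * (2 * 2 ^ δ)) ^ 3 := by gcongr
    have p2 : (T / 3 * z2) ^ 4 ≤ ‖zetaReg (x + Complex.I * y)‖ ^ 4 := by gcongr
    refine le_trans ?_ p2
    have p3 : x ^ 3 ≤ (z1 * x) ^ 3 * z2 ^ 4 * z3 := by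
      calc x ^ 3 = x ^ 3 * 1 := by ring
        _ ≤ x ^ 3 * (z1 ^ 3 * z2 ^ 4 * z3) := by gcongr
        _ = _ := by ring
    have p4 : (z1 * x) ^ 3 * z2 ^ 4 * z3 ≤
        (C * (2 * 2 ^ δ)) ^ 3 * z2 ^ 4 * (C * (4 * 2 ^ δ) * T ^ δ) := by gcongr
    have p5 : c * x ^ 3 * T ^ 4 * (T ^ δ)⁻¹ ≤
        c * ((C * (2 * 2 ^ δ)) ^ 3 * z2 ^ 4 * (C * (4 * 2 ^ δ) * T ^ δ)) * T ^ 4 * (T ^ δ)⁻¹ := by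
      gcongr
      exact p3.trans p4
    refine p5.trans_eq ?_
    rw [hc]
    field_simp
  -- So small that, at distance x₀ from the axis, the lower bound is twice the possible variation of
  -- `zetaReg` between the axis and x₀.
  set κ : ℝ := min (c / (16 * C ^ 4)) (1 / 4) with hκ
  have hκ0 : 0 < κ := by positivity
  have hκ1 : κ ≤ 1 / 4 := min_le_right _ _
  have hκ2 : 16 * C ^ 4 * κ ≤ c := by
    have := min_le_left (c / (16 * C ^ 4)) (1 / 4)
    rw [← hκ, le_div_iff₀ (by positivity)] at this
    linarith
  obtain ⟨c₁, hc₁0, hc₁⟩ : ∃ c₁ : ℝ, 0 < c₁ ∧ c₁ ^ 4 = c * κ ^ 3 :=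
    ⟨(c * κ ^ 3) ^ ((4 : ℕ) : ℝ)⁻¹, by positivity,
      Real.rpow_inv_natCast_pow (by positivity) (by norm_num)⟩
  have hlow : ∀ σ y : ℝ, 0 < σ → σ < 1 / 2 → 1 ≤ |y| →
      c₁ / 2 * ((2 + |y|) * ((2 + |y|) ^ δ)⁻¹ ^ 7) ≤ ‖zetaReg (σ + Complex.I * y)‖ := by
    intro σ y hσ hσ1 hy
    set T := 2 + |y| with hT
    have hT1 : 1 ≤ T := one_le_two_add_abs _
    set τ := T ^ δ with hτ
    have hτ1 : 1 ≤ τ := Real.one_le_rpow hT1 hδ0.le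
    have hτ0 : 0 < τ := by positivity
    -- The exponent 8 balances two bounds, both of order Tτ⁻⁷: the 3-4-1 inequality gives at least
    -- (x₀³T⁴τ⁻¹)^{1/4}, and the derivative bound allows a variation of x₀Tτ.
    set x₀ := κ * τ⁻¹ ^ 8 with hx₀
    have hx₀0 : 0 < x₀ := by positivity
    have hτi : τ⁻¹ ≤ 1 := inv_le_one_of_one_le₀ hτ1
    have hτi0 : 0 < τ⁻¹ := by positivity
    have hx₀1 : x₀ ≤ 1 / 4 := by
      have : τ⁻¹ ^ 8 ≤ 1 := pow_le_one₀ hτi0.le hτi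
      nlinarith
    have hbig : ∀ x : ℝ, x₀ ≤ x → x < 1 / 2 → c₁ * (T * τ⁻¹ ^ 7) ≤ ‖zetaReg (x + Complex.I * y)‖ := by
      intro x hx hx1
      have h1 := h341 x y (hx₀0.trans_le hx) hx1 hy
      refine le_of_pow_le_pow_left₀ (n := 4) (by norm_num) (norm_nonneg _) (le_trans ?_ h1)
      calc (c₁ * (T * τ⁻¹ ^ 7)) ^ 4 = c * κ ^ 3 * T ^ 4 * (τ⁻¹ ^ 25 * τ⁻¹ ^ 3) := by
            rw [mul_pow, hc₁]; ring
        _ ≤ c * κ ^ 3 * T ^ 4 * (τ⁻¹ ^ 25 * 1) := by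
            gcongr
            exact pow_le_one₀ hτi0.le hτi
        _ = c * x₀ ^ 3 * T ^ 4 * τ⁻¹ := by rw [hx₀]; ring
        _ ≤ _ := by gcongr
    rcases le_or_gt x₀ σ with hcase | hcase
    · refine le_trans ?_ (hbig σ hcase hσ1)
      gcongr; linarith
    · have hx₀2 : x₀ < 1 / 2 := by linarith
      have h2 : 2 * (C * x₀ * (T * τ)) ≤ ‖zetaReg (x₀ + Complex.I * y)‖ := by
        have h1 := h341 x₀ y hx₀0 hx₀2 hy
        refine le_of_pow_le_pow_left₀ (n := 4) (by norm_num) (norm_nonneg _) (le_trans ?_ h1)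
        have hττ : τ⁻¹ * τ = 1 := inv_mul_cancel₀ hτ0.ne'
        calc (2 * (C * x₀ * (T * τ))) ^ 4 =
              (16 * C ^ 4 * κ) * κ ^ 3 * T ^ 4 * τ⁻¹ ^ 28 * (τ⁻¹ * τ) ^ 4 := by rw [hx₀]; ring
          _ = (16 * C ^ 4 * κ) * κ ^ 3 * T ^ 4 * (τ⁻¹ ^ 25 * τ⁻¹ ^ 3) := by rw [hττ]; ring
          _ ≤ c * κ ^ 3 * T ^ 4 * (τ⁻¹ ^ 25 * 1) := by
            gcongr
            exact pow_le_one₀ hτi0.le hτi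
          _ = c * x₀ ^ 3 * T ^ 4 * τ⁻¹ := by rw [hx₀]; ring
      -- To the left of x₀ the 3-4-1 inequality is too weak, so the lower bound is carried
      -- horizontally from x₀ by the mean value inequality.
      have h3 : ‖zetaReg (x₀ + Complex.I * y) - zetaReg (σ + Complex.I * y)‖ ≤
          C * (T * τ) * x₀ := by
        have hder : ∀ x ∈ Set.Icc σ x₀, HasDerivWithinAt
            (fun x : ℝ => zetaReg (x + Complex.I * y)) (deriv zetaReg (x + Complex.I * y))
            (Set.Icc σ x₀) x := by
          intro x hx
          have hm : (x + Complex.I * y : ℂ) ∈ wideStrip (1 / 4) := by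
            constructor <;> simp <;> linarith [hx.1, hx.2]
          have h4 := (differentiableOn_zetaReg.differentiableAt
            ((isOpen_wideStrip _).mem_nhds hm)).hasDerivAt
          have h5 : HasDerivAt (fun x : ℝ => (x : ℂ) + Complex.I * y) 1 x := by
            simpa using (Complex.ofRealCLM.hasDerivAt (x := x)).add_const (Complex.I * (y : ℂ))
          have h6 := (h4.comp x h5).hasDerivWithinAt (s := Set.Icc σ x₀)
          rw [mul_one] at h6
          exact h6
        have := Convex.norm_image_sub_le_of_norm_hasDerivWithin_le (C := C * (T * τ)) hder
          (fun x hx => ?_) (convex_Icc _ _) (⟨le_rfl, hcase.le⟩ : σ ∈ Set.Icc σ x₀)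
          (⟨hcase.le, le_rfl⟩ : x₀ ∈ Set.Icc σ x₀)
        · refine this.trans ?_
          gcongr
          rw [Real.norm_of_nonneg (by linarith)]; linarith
        · have h6 := hY' (x + Complex.I * y) (by
            constructor <;> simp <;> linarith [hx.1, hx.2])
          simpa using h6
      have h7 := hbig x₀ le_rfl hx₀2
      have h8 := norm_sub_norm_le (zetaReg (x₀ + Complex.I * y)) (zetaReg (σ + Complex.I * y))
      linarith
  -- the compact part
  obtain ⟨m, hm0, hm⟩ : ∃ m : ℝ, 0 < m ∧ ∀ w : ℂ, w ∈ wideStrip 0 → |w.im| ≤ 1 →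
      m ≤ ‖zetaReg w‖ := by
    set S : Set ℂ := Set.Icc (0 : ℝ) (1 / 2) ×ℂ Set.Icc (-1 : ℝ) 1
    have hcomp : IsCompact S := isCompact_Icc.reProdIm isCompact_Icc
    have hne : S.Nonempty := ⟨0, by simp [S, Complex.mem_reProdIm]⟩
    have hcont : ContinuousOn (fun w => ‖zetaReg w‖) S := by
      refine (continuousOn_zetaReg.mono fun w hw => ?_).norm
      have h1 := hw.1
      simp only [Set.mem_preimage, Set.mem_Icc] at h1
      exact ⟨by linarith, by linarith⟩
    obtain ⟨w₀, hw₀, hmin⟩ := hcomp.exists_isMinOn hne hcont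
    refine ⟨‖zetaReg w₀‖, ?_, fun w hw hi => hmin ?_⟩
    · have h1 := hw₀.1
      simp only [Set.mem_preimage, Set.mem_Icc] at h1
      exact norm_pos_iff.2 (zetaReg_ne_zero h1.1 h1.2)
    · exact ⟨⟨by linarith [hw.1], by linarith [hw.2]⟩, abs_le.1 hi⟩
  refine ⟨2 / c₁ + 3 / m, fun w hw => ?_⟩
  rw [norm_inv]
  set T := 2 + |w.im| with hT
  have hT1 : 1 ≤ T := one_le_two_add_abs _
  have hTp : T ^ (-1 + ε) = T⁻¹ * (T ^ δ) ^ 7 := by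
    rw [Real.rpow_add (by positivity), Real.rpow_neg_one, ← Real.rpow_natCast, ← Real.rpow_mul
      (by positivity)]
    congr 2
    rw [hδ]; push_cast; ring
  have hTδ1 : 1 ≤ T ^ δ := Real.one_le_rpow hT1 hδ0.le
  rw [hTp]
  have hX0 : 0 ≤ T⁻¹ * (T ^ δ) ^ 7 := by positivity
  rcases le_total |w.im| 1 with h | h
  · have h1 : ‖zetaReg w‖⁻¹ ≤ m⁻¹ := inv_anti₀ hm0 (hm w hw h)
    have h2 : 1 / 3 ≤ T⁻¹ * (T ^ δ) ^ 7 := by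
      have h3 : (1 : ℝ) / 3 ≤ T⁻¹ := by
        rw [one_div]; exact inv_anti₀ (by positivity) (by linarith)
      have h4 : 1 ≤ (T ^ δ) ^ 7 := one_le_pow₀ hTδ1
      nlinarith
    calc ‖zetaReg w‖⁻¹ ≤ 3 / m * (1 / 3) := by rw [div_mul_div_comm, mul_one, mul_comm m 3,
            div_mul_eq_div_div, div_self (by norm_num), one_div]; exact h1
      _ ≤ 3 / m * (T⁻¹ * (T ^ δ) ^ 7) := by gcongr
      _ ≤ _ := by
        rw [add_mul]
        have : 0 ≤ 2 / c₁ * (T⁻¹ * (T ^ δ) ^ 7) := by positivity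
        linarith
  · have h0 : 0 < w.re := by linarith [hw.1]
    have h1 := hlow w.re w.im h0 (by linarith [hw.2]) h
    have h2 : (w.re : ℂ) + Complex.I * w.im = w := by
      rw [mul_comm]; exact Complex.re_add_im w
    rw [h2] at h1
    have h3 : ‖zetaReg w‖⁻¹ ≤ (c₁ / 2 * (T * (T ^ δ)⁻¹ ^ 7))⁻¹ := inv_anti₀ (by positivity) h1
    have h4 : (c₁ / 2 * (T * (T ^ δ)⁻¹ ^ 7))⁻¹ = 2 / c₁ * (T⁻¹ * (T ^ δ) ^ 7) := by
      rw [mul_inv, mul_inv, inv_pow, inv_inv, inv_div]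
    rw [h4] at h3
    refine h3.trans ?_
    rw [add_mul]
    have : 0 ≤ 3 / m * (T⁻¹ * (T ^ δ) ^ 7) := by positivity
    linarith

end ArithSeq

end

/-! ### Dirichlet series over primes controlled by their partial sums on the axis -/

noncomputable section
namespace ArithSeq

section Abel
variable {E : Type*} [NormedAddCommGroup E] [NormedSpace ℝ E]

/-- Summation by parts: the decrements of the weights are nonnegative and telescope. Applied with
weights n^{-Re w}, it carries bounds from the line Re w = 0 into the half-plane. -/
theorem norm_sum_smul_le_of_antitone {a : ℕ → ℝ} (ha : Antitone a) (ha0 : ∀ n, 0 ≤ a n)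
    {c : ℕ → E} {B : ℝ} (hB : ∀ N, ‖∑ n ∈ Finset.range N, c n‖ ≤ B) (N : ℕ) :
    ‖∑ n ∈ Finset.range N, a n • c n‖ ≤ a 0 * B := by
  have hB0 : 0 ≤ B := (norm_nonneg _).trans (hB 0)
  rcases Nat.eq_zero_or_pos N with rfl | hN
  · simpa using mul_nonneg (ha0 0) hB0
  rw [Finset.sum_range_by_parts]
  have h1 : ‖∑ i ∈ Finset.range (N - 1), (a (i + 1) - a i) • ∑ j ∈ Finset.range (i + 1), c j‖ ≤
      (a 0 - a (N - 1)) * B := by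
    rw [← Finset.sum_range_sub' a (N - 1), Finset.sum_mul]
    refine norm_sum_le_of_le _ fun i _ => ?_
    rw [norm_smul, Real.norm_eq_abs, abs_of_nonpos (sub_nonpos.2 (ha (Nat.le_succ i))), neg_sub]
    exact mul_le_mul_of_nonneg_left (hB _) (sub_nonneg.2 (ha (Nat.le_succ i)))
  have h2 : ‖a (N - 1) • ∑ i ∈ Finset.range N, c i‖ ≤ a (N - 1) * B := by
    rw [norm_smul, Real.norm_of_nonneg (ha0 _)]
    exact mul_le_mul_of_nonneg_left (hB _) (ha0 _)
  calc _ ≤ a (N - 1) * B + (a 0 - a (N - 1)) * B := (norm_sub_le _ _).trans (add_le_add h2 h1)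
    _ = a 0 * B := by ring

theorem sum_range_term_succ (c : ℕ → ℂ) (w : ℂ) (N : ℕ) :
    ∑ n ∈ Finset.range (N + 1), LSeries.term c w n =
      ∑ n ∈ Finset.range N, ((n + 1 : ℝ) ^ (-w.re)) •
        (c (n + 1) / ((n + 1 : ℕ) : ℂ) ^ (w.im * Complex.I)) := by
  rw [Finset.sum_range_succ', LSeries.term_zero, add_zero]
  refine Finset.sum_congr rfl fun n _ => ?_
  have hn : ((n + 1 : ℕ) : ℂ) ≠ 0 := by exact_mod_cast n.succ_ne_zero
  have h0 : (0 : ℝ) < n + 1 := by positivity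
  rw [LSeries.term_of_ne_zero n.succ_ne_zero, Complex.real_smul]
  conv_lhs => rw [← Complex.re_add_im w, Complex.cpow_add _ _ hn]
  rw [Complex.ofReal_cpow h0.le]
  push_cast
  rw [Complex.cpow_neg]
  field_simp

/-- A Dirichlet series in the half-plane of absolute convergence is bounded by the partial sums at
the projection to the imaginary axis. -/
theorem norm_LSeries_le (φ : ℂ →L[ℝ] E) {c : ℕ → ℂ} {w : ℂ} (hs : LSeriesSummable c w)
    (hw : 0 ≤ w.re) {B : ℝ}
    (hB : ∀ N, ‖φ (∑ n ∈ Finset.range N, c (n + 1) / ((n + 1 : ℕ) : ℂ) ^ (w.im * Complex.I))‖ ≤ B) :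
    ‖φ (LSeries c w)‖ ≤ B := by
  have ht := (hs.hasSum.tendsto_sum_nat).comp (tendsto_add_atTop_nat 1)
  have ht2 := ((φ.continuous.tendsto _).comp ht).norm
  refine le_of_tendsto' ht2 fun N => ?_
  simp only [Function.comp]
  rw [sum_range_term_succ, map_sum]
  simp only [map_smul]
  have := norm_sum_smul_le_of_antitone (a := fun n : ℕ => ((n : ℝ) + 1) ^ (-w.re))
    (c := fun n : ℕ => φ (c (n + 1) / ((n + 1 : ℕ) : ℂ) ^ (w.im * Complex.I))) (B := B) ?_ ?_ ?_ N
  · simpa using this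
  · intro m n hmn
    exact Real.rpow_le_rpow_of_nonpos (by positivity) (by simpa using hmn) (by linarith)
  · intro n; positivity
  · intro N
    rw [← map_sum]
    exact hB N

/-- Abel's theorem for Dirichlet series. -/
theorem tendsto_LSeries_zero {c : ℕ → ℂ} (hs : ∀ σ : ℝ, 0 < σ → LSeriesSummable c σ) {ℓ : ℂ}
    (hℓ : Tendsto (fun N => ∑ n ∈ Finset.range N, c (n + 1)) atTop (𝓝 ℓ)) :
    Tendsto (fun σ : ℝ => LSeries c σ) (𝓝[>] 0) (𝓝 ℓ) := by
  rw [Metric.tendsto_nhds]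
  intro ε hε
  obtain ⟨N₀, hN₀⟩ := (Metric.tendsto_atTop.1 hℓ) (ε / 5) (by positivity)
  -- The tail series has all partial sums at most 2ε/5, a bound that persists for every σ > 0. The
  -- finite head is continuous in σ.
  set c' : ℕ → ℂ := fun n => if n ≤ N₀ then 0 else c n with hc'
  have hfin : Tendsto (fun σ : ℝ => ∑ n ∈ Finset.range (N₀ + 1), LSeries.term c σ n) (𝓝[>] 0)
      (𝓝 (∑ n ∈ Finset.range N₀, c (n + 1))) := by
    simp_rw [sum_range_term_succ]
    refine tendsto_finsetSum _ fun n _ => ?_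
    have h1 : Tendsto (fun σ : ℝ => ((n : ℝ) + 1) ^ (-σ)) (𝓝[>] 0) (𝓝 (((n : ℝ) + 1) ^ (-(0 : ℝ)))) := by
      refine Tendsto.mono_left ?_ nhdsWithin_le_nhds
      refine Continuous.tendsto ?_ 0
      exact Real.continuous_const_rpow (by positivity : (n : ℝ) + 1 ≠ 0) |>.comp continuous_neg
    rw [neg_zero, Real.rpow_zero] at h1
    simpa using h1.smul_const (c (n + 1))
  have hev := (Metric.tendsto_nhds.1 hfin) (ε / 5) (by positivity)
  filter_upwards [hev, self_mem_nhdsWithin] with σ h1 hσ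
  have hσ0 : (0 : ℝ) < σ := hσ
  have hs' : LSeriesSummable c' σ := by
    refine (hs σ hσ0).norm.of_norm_bounded fun n => ?_
    rcases Nat.eq_zero_or_pos n with rfl | hn
    · simp
    · rw [LSeries.term_of_ne_zero hn.ne', LSeries.term_of_ne_zero hn.ne', norm_div, norm_div]
      gcongr
      simp only [hc']
      split_ifs <;> simp
  have hsplit : LSeries c σ = (∑ n ∈ Finset.range (N₀ + 1), LSeries.term c σ n) + LSeries c' σ := by
    rw [LSeries, LSeries, ← (hs σ hσ0).sum_add_tsum_nat_add (N₀ + 1),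
      ← hs'.sum_add_tsum_nat_add (N₀ + 1)]
    have h2 : ∑ n ∈ Finset.range (N₀ + 1), LSeries.term c' σ n = 0 := by
      refine Finset.sum_eq_zero fun n hn => ?_
      rcases Nat.eq_zero_or_pos n with rfl | hn0
      · simp
      · rw [LSeries.term_of_ne_zero hn0.ne']
        simp only [hc']
        rw [if_pos (by simpa [Nat.lt_succ_iff] using hn), zero_div]
    rw [h2, zero_add]
    congr 2
    ext n
    rw [LSeries.term_of_ne_zero (by omega), LSeries.term_of_ne_zero (by omega)]
    simp only [hc']
    rw [if_neg (by omega)]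
  have htail : ‖LSeries c' σ‖ ≤ 2 * ε / 5 := by
    refine norm_LSeries_le (ContinuousLinearMap.id ℝ ℂ) hs' (by simpa using hσ0.le) fun N => ?_
    simp only [Complex.ofReal_im, Complex.ofReal_zero, zero_mul, Complex.cpow_zero, div_one,
      ContinuousLinearMap.id_apply]
    rcases le_or_gt N N₀ with h | h
    · rw [Finset.sum_eq_zero]
      · simp; positivity
      · intro n hn
        simp only [hc']
        rw [if_pos (by have := Finset.mem_range.1 hn; omega)]
    · have h2 : ∑ n ∈ Finset.range N, c' (n + 1) =
          (∑ n ∈ Finset.range N, c (n + 1)) - ∑ n ∈ Finset.range N₀, c (n + 1) := by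
        rw [← Finset.sum_range_add_sum_Ico _ h.le, ← Finset.sum_range_add_sum_Ico (fun n => c (n + 1)) h.le,
          add_sub_cancel_left, Finset.sum_eq_zero, zero_add]
        · refine Finset.sum_congr rfl fun n hn => ?_
          simp only [hc']
          rw [if_neg (by have := (Finset.mem_Ico.1 hn).1; omega)]
        · intro n hn
          simp only [hc']
          rw [if_pos (by have := Finset.mem_range.1 hn; omega)]
      rw [h2]
      have h3 := hN₀ N h.le
      have h4 := hN₀ N₀ le_rfl
      rw [dist_eq_norm] at h3 h4
      calc _ = ‖((∑ n ∈ Finset.range N, c (n + 1)) - ℓ) - ((∑ n ∈ Finset.range N₀, c (n + 1)) - ℓ)‖ := by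
            congr 1; ring
        _ ≤ _ := (norm_sub_le _ _).trans (by linarith)
  have h4 := hN₀ N₀ le_rfl
  rw [dist_eq_norm] at h1 h4 ⊢
  rw [hsplit]
  calc _ = ‖((∑ n ∈ Finset.range (N₀ + 1), LSeries.term c σ n) - ∑ n ∈ Finset.range N₀, c (n + 1)) +
        ((∑ n ∈ Finset.range N₀, c (n + 1)) - ℓ) + LSeries c' σ‖ := by congr 1; ring
    _ ≤ ‖_‖ + ‖_‖ + ‖LSeries c' σ‖ := norm_add₃_le
    _ < ε := by linarith

end Abel

/-- The coefficients `x(p) / p` at the primes. -/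
def primeCoeff (x : ℕ → ℝ) (n : ℕ) : ℂ := if n.Prime then ((x n / n : ℝ) : ℂ) else 0

/-- `x(n) ≪ n ^ ε` for every `ε > 0`. -/
def SubPoly (x : ℕ → ℝ) : Prop :=
  ∀ ε : ℝ, 0 < ε → ∃ C : ℝ, ∀ d : ℕ, 1 ≤ d → |x d| ≤ C * (d : ℝ) ^ ε

theorem SubPoly.const (c : ℝ) : SubPoly fun _ => c := fun ε hε => ⟨|c|, fun d hd => by
  have : (1 : ℝ) ≤ (d : ℝ) ^ ε := Real.one_le_rpow (by exact_mod_cast hd) hε.le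
  nlinarith [abs_nonneg c]⟩

theorem SubPoly.add {x y : ℕ → ℝ} (hx : SubPoly x) (hy : SubPoly y) :
    SubPoly fun n => x n + y n := fun ε hε => by
  obtain ⟨C, hC⟩ := hx ε hε
  obtain ⟨D, hD⟩ := hy ε hε
  refine ⟨C + D, fun d hd => (abs_add_le _ _).trans ?_⟩
  rw [add_mul]
  exact add_le_add (hC d hd) (hD d hd)

theorem SubPoly.neg {x : ℕ → ℝ} (hx : SubPoly x) : SubPoly fun n => -x n := fun ε hε => by
  obtain ⟨C, hC⟩ := hx ε hε
  exact ⟨C, fun d hd => by rw [abs_neg]; exact hC d hd⟩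

theorem SubPoly.sub {x y : ℕ → ℝ} (hx : SubPoly x) (hy : SubPoly y) :
    SubPoly fun n => x n - y n := by
  simpa [sub_eq_add_neg] using hx.add hy.neg

section primeCoeff
variable {x : ℕ → ℝ}

theorem abscissa_primeCoeff (hx : SubPoly x) : LSeries.abscissaOfAbsConv (primeCoeff x) ≤ 0 := by
  refine LSeries.abscissaOfAbsConv_le_of_forall_lt_LSeriesSummable' fun y hy => ?_
  have hy0 : 0 < y := by exact_mod_cast hy
  obtain ⟨C, hC⟩ := hx (y / 2) (by positivity)
  have h := LSeries.abscissaOfAbsConv_le_of_le_const_mul_rpow (f := primeCoeff x) (x := y / 2 - 1)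
    ⟨|C|, fun n hn => ?_⟩
  · refine LSeriesSummable_of_abscissaOfAbsConv_lt_re (h.trans_lt ?_)
    rw [Complex.ofReal_re]
    have : y / 2 - 1 + 1 < y := by linarith
    exact_mod_cast this
  · have hn1 : 1 ≤ n := Nat.one_le_iff_ne_zero.2 hn
    have hn0 : (0 : ℝ) < n := by exact_mod_cast hn1
    rw [primeCoeff]
    split_ifs
    · rw [Complex.norm_real, norm_div, Real.norm_eq_abs, Real.norm_of_nonneg hn0.le,
        div_le_iff₀ hn0, mul_assoc, ← Real.rpow_add_one hn0.ne', sub_add_cancel]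
      exact (hC n hn1).trans (by gcongr; exact le_abs_self _)
    · simp; positivity

theorem abscissa_lt_re (hx : SubPoly x) {w : ℂ} (hw : 0 < w.re) :
    LSeries.abscissaOfAbsConv (primeCoeff x) < w.re :=
  (abscissa_primeCoeff hx).trans_lt (by exact_mod_cast hw)

theorem hasSum_primeCoeff (hx : SubPoly x) {w : ℂ} (hw : 0 < w.re) :
    HasSum (fun p : Nat.Primes => ((x p : ℝ) : ℂ) * ((p : ℕ) : ℂ) ^ (-1 - w))
      (LSeries (primeCoeff x) w) := by
  have hs := (LSeriesSummable_of_abscissaOfAbsConv_lt_re (abscissa_lt_re hx hw)).hasSum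
  have hsup : Function.support (LSeries.term (primeCoeff x) w) ⊆ {p : ℕ | p.Prime} := by
    intro n hn
    by_contra hp
    refine hn ?_
    rcases Nat.eq_zero_or_pos n with rfl | hn0
    · simp
    · rw [LSeries.term_of_ne_zero hn0.ne', primeCoeff, if_neg (by simpa using hp), zero_div]
  have h2 := (hasSum_subtype_iff_of_support_subset hsup).2 hs
  refine h2.congr_fun fun p => ?_
  have hp : (p : ℕ).Prime := p.2
  have hp0 : ((p : ℕ) : ℂ) ≠ 0 := by exact_mod_cast hp.ne_zero
  simp only [Function.comp]
  rw [LSeries.term_of_ne_zero hp.ne_zero, primeCoeff, if_pos hp, Complex.cpow_sub _ _ hp0,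
    Complex.cpow_neg_one]
  push_cast
  field_simp

theorem differentiableOn_LSeries_primeCoeff (hx : SubPoly x) :
    DifferentiableOn ℂ (LSeries (primeCoeff x)) (wideStrip 0) := fun _ hw =>
  (LSeries_hasDerivAt (abscissa_lt_re hx
    (by linarith [hw.1]))).differentiableAt.differentiableWithinAt

end primeCoeff

theorem iterate_logMul (c : ℕ → ℂ) (j n : ℕ) :
    (LSeries.logMul^[j] c) n = (Complex.log n) ^ j * c n := by
  induction j with
  | zero => simp
  | succ j ih => rw [Function.iterate_succ_apply', LSeries.logMul, ih]; ring

theorem sum_range_primesUpTo {E : Type*} [AddCommMonoid E] (F : ℕ → E) (N : ℕ) :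
    ∑ n ∈ Finset.range N, (if (n + 1).Prime then F (n + 1) else 0) = ∑ p ∈ primesUpTo N, F p := by
  rw [primesUpTo, Finset.sum_filter, ← Finset.Ico_add_one_right_eq_Icc, Finset.sum_Ico_eq_sum_range]
  simp only [Nat.add_sub_cancel, add_comm]

variable {h : ArithmeticFunction ℝ} {k : ℝ}

theorem sum_range_logMul_primeCoeff (h : ArithmeticFunction ℝ) (k : ℝ) (j : ℕ) (t : ℝ) (N : ℕ) :
    ∑ n ∈ Finset.range N, (LSeries.logMul^[j] (primeCoeff fun n => h n - k)) (n + 1) /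
      ((n + 1 : ℕ) : ℂ) ^ (t * Complex.I) = twistedSum h k j t N := by
  rw [twistedSum, ← sum_range_primesUpTo]
  refine Finset.sum_congr rfl fun n _ => ?_
  rw [iterate_logMul, primeCoeff]
  split_ifs with hp
  · have hp0 : ((n + 1 : ℕ) : ℂ) ≠ 0 := by exact_mod_cast n.succ_ne_zero
    rw [Complex.cpow_add _ _ hp0, Complex.cpow_one, ← Complex.natCast_log]
    push_cast
    field_simp
  · simp

theorem AnalyticCondition.subPoly (hA : AnalyticCondition h k) : SubPoly fun n => h n :=
  hA.2.2.2.2.2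

theorem AnalyticCondition.subPoly_sub (hA : AnalyticCondition h k) : SubPoly fun n => h n - k :=
  hA.subPoly.sub (SubPoly.const k)

/-- The Dirichlet series `∑ (h(p) - k) / p ^ (1 + w)`. -/
def devSeries (h : ArithmeticFunction ℝ) (k : ℝ) : ℂ → ℂ := LSeries (primeCoeff fun n => h n - k)

/-- Hypothesis 3 bounds the partial sums at height t = Im w by (|t|+2)^ε, uniformly in their length.
Abel summation transfers this to Re w > 0. -/
theorem norm_LSeries_logMul_le (hA : AnalyticCondition h k) {j : ℕ} (hj : 1 ≤ j) :
    PolyBdd (wideStrip 0) 0 (LSeries (LSeries.logMul^[j] (primeCoeff fun n => h n - k))) := by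
  intro ε hε
  obtain ⟨C, hC⟩ := hA.2.2.2.1 j hj ε hε
  refine ⟨C, fun w hw => ?_⟩
  have hw0 : 0 < w.re := by linarith [hw.1]
  have hs : LSeriesSummable (LSeries.logMul^[j] (primeCoeff fun n => h n - k)) w := by
    refine LSeriesSummable_of_abscissaOfAbsConv_lt_re ?_
    rw [LSeries.absicssaOfAbsConv_logPowMul]
    exact abscissa_lt_re hA.subPoly_sub hw0
  rw [zero_add]
  refine norm_LSeries_le (ContinuousLinearMap.id ℝ ℂ) hs hw0.le fun N => ?_
  rw [ContinuousLinearMap.id_apply, sum_range_logMul_primeCoeff, add_comm 2]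
  exact hC w.im N

theorem deriv_LSeries_logMul (hA : AnalyticCondition h k) (j : ℕ) {w : ℂ} (hw : w ∈ wideStrip 0) :
    HasDerivAt (LSeries (LSeries.logMul^[j] (primeCoeff fun n => h n - k)))
      (-LSeries (LSeries.logMul^[j + 1] (primeCoeff fun n => h n - k)) w) w := by
  rw [Function.iterate_succ_apply']
  refine LSeries_hasDerivAt ?_
  rw [LSeries.absicssaOfAbsConv_logPowMul]
  exact abscissa_lt_re hA.subPoly_sub (by linarith [hw.1])

theorem tame_LSeries_logMul (hA : AnalyticCondition h k) {j : ℕ} (hj : 1 ≤ j) (n : ℕ) :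
    Tame (wideStrip 0) 0 n (LSeries (LSeries.logMul^[j] (primeCoeff fun n => h n - k))) := by
  induction n generalizing j with
  | zero => exact norm_LSeries_logMul_le hA hj
  | succ n ih =>
    refine ⟨norm_LSeries_logMul_le hA hj, ((ih (j := j + 1) (by omega)).const_mul
      (isOpen_wideStrip 0) (-1) ?_).congr (isOpen_wideStrip 0) fun w hw => ?_⟩
    · exact fun w hw => (deriv_LSeries_logMul hA _ hw).differentiableAt.differentiableWithinAt
    · rw [(deriv_LSeries_logMul hA j hw).deriv]; ring

theorem hasDerivAt_devSeries (hA : AnalyticCondition h k) {w : ℂ} (hw : w ∈ wideStrip 0) :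
    HasDerivAt (devSeries h k)
      (-LSeries (LSeries.logMul^[1] (primeCoeff fun n => h n - k)) w) w :=
  deriv_LSeries_logMul hA 0 hw

/-- Without a logarithm only the real part is controlled, hence the real-linear functional in
`norm_LSeries_le`. A real part is all that is needed to bound an exponential, and the coefficient
1/2 - δ may be weakened to 1. -/
theorem abs_re_devSeries_le (hA : AnalyticCondition h k) :
    ∃ C : ℝ, ∀ w : ℂ, 0 < w.re → |(devSeries h k w).re| ≤ C + Real.log (2 + |w.im|) := by
  obtain ⟨δ, hδ, C, hC⟩ := hA.2.2.1
  refine ⟨C, fun w hw => ?_⟩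
  have hs := LSeriesSummable_of_abscissaOfAbsConv_lt_re (abscissa_lt_re hA.subPoly_sub hw)
  have := norm_LSeries_le Complex.reCLM hs hw.le (B := C + Real.log (2 + |w.im|)) fun N => ?_
  · simpa [devSeries] using this
  · have h2 := sum_range_logMul_primeCoeff h k 0 w.im N
    rw [Function.iterate_zero, id_eq] at h2
    rw [h2, Complex.reCLM_apply, Real.norm_eq_abs]
    refine (hC w.im N).trans ?_
    have h3 : 0 ≤ Real.log (|w.im| + 2) := Real.log_nonneg (by linarith [abs_nonneg w.im])
    rw [add_comm 2]
    nlinarith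

theorem tendsto_devSeries (hA : AnalyticCondition h k) {ℓ : ℝ}
    (hℓ : Tendsto (fun N : ℕ => ∑ p ∈ primesUpTo N, (h p - k) / (p : ℝ)) atTop (𝓝 ℓ)) :
    Tendsto (fun σ : ℝ => devSeries h k σ) (𝓝[>] 0) (𝓝 (ℓ : ℂ)) := by
  refine tendsto_LSeries_zero (fun σ hσ => LSeriesSummable_of_abscissaOfAbsConv_lt_re
    (abscissa_lt_re hA.subPoly_sub (by simpa using hσ))) ?_
  refine ((Complex.continuous_ofReal.tendsto _).comp hℓ).congr fun N => ?_
  simp only [Function.comp]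
  rw [← sum_range_primesUpTo, Complex.ofReal_sum]
  refine Finset.sum_congr rfl fun n _ => ?_
  rw [primeCoeff]
  split_ifs <;> simp

end ArithSeq

end

/-! ### The prime zeta function and the singular factor of the Dirichlet series -/

noncomputable section
namespace ArithSeq

theorem norm_prime_cpow (p : Nat.Primes) (w : ℂ) :
    ‖((p : ℕ) : ℂ) ^ (-1 - w)‖ = ((p : ℕ) : ℝ) ^ (-1 - w.re) := by
  rw [Complex.norm_natCast_cpow_of_pos p.2.pos]; simp

theorem norm_prime_cpow_le {r : ℝ} (p : Nat.Primes) {w : ℂ} (hw : -r ≤ w.re) :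
    ‖((p : ℕ) : ℂ) ^ (-1 - w)‖ ≤ ((p : ℕ) : ℝ) ^ (r - 1) := by
  rw [norm_prime_cpow]
  exact Real.rpow_le_rpow_of_exponent_le (by exact_mod_cast p.2.one_le) (by linarith)

theorem prime_rpow_le_of_quarter (p : Nat.Primes) : ((p : ℕ) : ℝ) ^ (1 / 4 - 1 : ℝ) ≤ 3 / 4 := by
  have h2 : (2 : ℝ) ≤ (p : ℕ) := by exact_mod_cast p.2.two_le
  calc ((p : ℕ) : ℝ) ^ (1 / 4 - 1 : ℝ) ≤ (2 : ℝ) ^ (1 / 4 - 1 : ℝ) :=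
        Real.rpow_le_rpow_of_nonpos (by norm_num) h2 (by norm_num)
    _ ≤ (2 : ℝ) ^ (-(1 / 2) : ℝ) :=
        Real.rpow_le_rpow_of_exponent_le (by norm_num) (by norm_num)
    _ ≤ 3 / 4 := by
        rw [Real.rpow_neg (by norm_num), ← Real.sqrt_eq_rpow]
        have : (4 / 3 : ℝ) ≤ √2 := Real.le_sqrt_of_sq_le (by norm_num)
        calc (√2)⁻¹ ≤ (4 / 3 : ℝ)⁻¹ := by gcongr
          _ = 3 / 4 := by norm_num

/-- The term `log (1 - p ^ (-1 - w)) + p ^ (-1 - w)`. -/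
def primeLogTerm (p : Nat.Primes) (w : ℂ) : ℂ :=
  Complex.log (1 - ((p : ℕ) : ℂ) ^ (-1 - w)) + ((p : ℕ) : ℂ) ^ (-1 - w)

/-- The prime power contribution to `-log ζ(1 + w)`. -/
def primeLogSum (w : ℂ) : ℂ := ∑' p : Nat.Primes, primeLogTerm p w

/-- The linear term of the logarithm has been removed. What remains is quadratic in p^{-1-w}, hence
summable with Re w slightly below 0. -/
theorem norm_primeLogTerm_le (p : Nat.Primes) {w : ℂ} (hw : w ∈ wideStrip (1 / 4)) :
    ‖primeLogTerm p w‖ ≤ 2 * ((p : ℕ) : ℝ) ^ (-(3 / 2) : ℝ) := by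
  have h1 := norm_prime_cpow_le p hw.1.le
  have h2 := prime_rpow_le_of_quarter p
  set z := ((p : ℕ) : ℂ) ^ (-1 - w) with hz
  have h3 : ‖-z‖ < 1 := by rw [norm_neg]; linarith
  have h4 := Complex.norm_log_one_add_sub_self_le h3
  rw [norm_neg, sub_neg_eq_add, ← sub_eq_add_neg] at h4
  have h5 : ‖z‖ ^ 2 ≤ ((p : ℕ) : ℝ) ^ (-(3 / 2) : ℝ) := by
    calc ‖z‖ ^ 2 ≤ (((p : ℕ) : ℝ) ^ (1 / 4 - 1 : ℝ)) ^ 2 := by gcongr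
      _ = _ := by
        rw [← Real.rpow_natCast, ← Real.rpow_mul (Nat.cast_nonneg _)]; norm_num
  have h6 : (1 - ‖z‖)⁻¹ ≤ 4 := by
    rw [inv_le_comm₀ (by linarith) (by norm_num)]; linarith
  rw [primeLogTerm, ← hz]
  refine h4.trans ?_
  have h7 : 0 ≤ (1 - ‖z‖)⁻¹ := inv_nonneg.2 (by linarith)
  nlinarith [sq_nonneg ‖z‖]

theorem summable_primes_three_halves :
    Summable fun p : Nat.Primes => 2 * ((p : ℕ) : ℝ) ^ (-(3 / 2) : ℝ) :=
  (Nat.Primes.summable_rpow.2 (by norm_num)).mul_left 2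

theorem differentiableOn_primeLogSum : DifferentiableOn ℂ primeLogSum (wideStrip (1 / 4)) := by
  refine Complex.differentiableOn_tsum_of_summable_norm summable_primes_three_halves (fun p => ?_)
    (isOpen_wideStrip _) fun p w hw => norm_primeLogTerm_le p hw
  have hp0 : ((p : ℕ) : ℂ) ≠ 0 := by exact_mod_cast p.2.ne_zero
  have hd : Differentiable ℂ fun w : ℂ => ((p : ℕ) : ℂ) ^ (-1 - w) := fun w =>
    (DifferentiableAt.const_cpow (by fun_prop) (Or.inl hp0))
  refine DifferentiableOn.fun_add (fun w hw => ?_) hd.differentiableOn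
  refine DifferentiableAt.differentiableWithinAt (DifferentiableAt.clog
    ((differentiableAt_const _).fun_sub (hd w)) ?_)
  have h1 : ‖-((p : ℕ) : ℂ) ^ (-1 - w)‖ < 1 := by
    rw [norm_neg]
    linarith [norm_prime_cpow_le p hw.1.le, prime_rpow_le_of_quarter p]
  rw [sub_eq_add_neg]
  exact Complex.mem_slitPlane_of_norm_lt_one h1

theorem norm_primeLogSum_le {w : ℂ} (hw : w ∈ wideStrip (1 / 4)) :
    ‖primeLogSum w‖ ≤ ∑' p : Nat.Primes, 2 * ((p : ℕ) : ℝ) ^ (-(3 / 2) : ℝ) :=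
  tsum_of_norm_bounded summable_primes_three_halves.hasSum fun p => norm_primeLogTerm_le p hw

theorem summable_primeLogTerm {w : ℂ} (hw : w ∈ wideStrip (1 / 4)) :
    Summable fun p => primeLogTerm p w :=
  summable_primes_three_halves.of_norm_bounded fun p => norm_primeLogTerm_le p hw

theorem tame_primeLogSum (n : ℕ) : Tame (wideStrip 0) 0 n primeLogSum :=
  Tame.of_wideStrip (by norm_num) n differentiableOn_primeLogSum
    (PolyBdd.of_bounded fun _ hw => norm_primeLogSum_le hw)

/-- The prime zeta function `∑ p ^ (-1 - w)`. -/
def primeZeta : ℂ → ℂ := LSeries (primeCoeff fun _ => 1)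

theorem hasSum_primeZeta {w : ℂ} (hw : 0 < w.re) :
    HasSum (fun p : Nat.Primes => ((p : ℕ) : ℂ) ^ (-1 - w)) (primeZeta w) := by
  simpa [primeZeta] using hasSum_primeCoeff (SubPoly.const 1) hw

/-- `∑ p ^ (-1 - w) + log w`, which continues to a neighbourhood of `0`. -/
def primeZetaReg (w : ℂ) : ℂ := primeZeta w + Complex.log w

theorem wideStrip_zero_subset : wideStrip 0 ⊆ wideStrip (1 / 4) := wideStrip_mono (by norm_num)

theorem re_pos_of_mem {w : ℂ} (hw : w ∈ wideStrip 0) : 0 < w.re := by linarith [hw.1]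

/-- The logarithm of the Euler product of ζ, written after exponentiation so that no branch of log ζ
has to be chosen. -/
theorem exp_primeZetaReg {w : ℂ} (hw : w ∈ wideStrip 0) :
    Complex.exp (primeZetaReg w - primeLogSum w) = zetaReg w := by
  have hw0 := re_pos_of_mem hw
  rw [zetaReg_eq hw0, ← riemannZeta_eulerProduct_exp_log (by simpa using hw0)]
  have h1 : ∑' p : Nat.Primes, -Complex.log (1 - ((p : ℕ) : ℂ) ^ (-(1 + w))) =
      primeZeta w - primeLogSum w := by
    rw [← (hasSum_primeZeta hw0).tsum_eq, primeLogSum,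
      ← (hasSum_primeZeta hw0).summable.tsum_sub (summable_primeLogTerm (wideStrip_zero_subset hw))]
    refine tsum_congr fun p => ?_
    rw [primeLogTerm, show -(1 + w) = -1 - w by ring]
    ring
  rw [h1, primeZetaReg, add_sub_right_comm, Complex.exp_add, Complex.exp_log
    (by intro h; rw [h] at hw0; simp at hw0), mul_comm]

theorem differentiableOn_primeZetaReg : DifferentiableOn ℂ primeZetaReg (wideStrip 0) :=
  (differentiableOn_LSeries_primeCoeff (SubPoly.const 1)).fun_add fun _ hw =>
    (Complex.differentiableAt_log (mem_slitPlane_of_mem_wideStrip hw)).differentiableWithinAt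

theorem zetaReg_ne_zero_of_mem {w : ℂ} (hw : w ∈ wideStrip 0) : zetaReg w ≠ 0 :=
  zetaReg_ne_zero (re_pos_of_mem hw).le (by linarith [hw.2])

theorem deriv_primeZetaReg {w : ℂ} (hw : w ∈ wideStrip 0) :
    deriv primeZetaReg w = deriv zetaReg w * (zetaReg w)⁻¹ + deriv primeLogSum w := by
  have hn : wideStrip 0 ∈ 𝓝 w := (isOpen_wideStrip 0).mem_nhds hw
  have h1 := (differentiableOn_primeZetaReg.differentiableAt hn).hasDerivAt
  have h2 := ((differentiableOn_primeLogSum.mono wideStrip_zero_subset).differentiableAt hn).hasDerivAt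
  have h3 := (h1.fun_sub h2).cexp
  have h4 : deriv zetaReg w = _ := (h3.congr_of_eventuallyEq
    (Filter.mem_of_superset hn fun z hz => (exp_primeZetaReg hz).symm)).deriv
  rw [h4, exp_primeZetaReg hw]
  field_simp [zetaReg_ne_zero_of_mem hw]
  ring

/-- The growth exponent 1 of `deriv zetaReg` is cancelled exactly by the exponent -1 of the
reciprocal. Exponent 0 is what allows derivatives of `mainFactor` to be taken without further
growth. -/
theorem tame_deriv_primeZetaReg (n : ℕ) : Tame (wideStrip 0) 0 n (deriv primeZetaReg) := by
  have hO := isOpen_wideStrip 0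
  have hz := differentiableOn_zetaReg.mono wideStrip_zero_subset
  have h1 : Tame (wideStrip 0) 1 n (deriv zetaReg) := (tame_zetaReg (n + 1)).2
  have h2 : Tame (wideStrip 0) (-1) n fun w => (zetaReg w)⁻¹ :=
    Tame.inv hO hz (fun w hw => zetaReg_ne_zero_of_mem hw) (tame_zetaReg n) polyBdd_inv_zetaReg
  have hi : DifferentiableOn ℂ (fun w => (zetaReg w)⁻¹) (wideStrip 0) :=
    hz.fun_inv fun w hw => zetaReg_ne_zero_of_mem hw
  have h3 := h1.mul hO (hz.deriv hO) hi h2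
  rw [add_neg_cancel] at h3
  exact (h3.add hO ((hz.deriv hO).fun_mul hi) ((differentiableOn_primeLogSum.mono
    wideStrip_zero_subset).deriv hO) (tame_primeLogSum (n + 1)).2).congr hO
    fun w hw => (deriv_primeZetaReg hw).symm

theorem re_primeZetaReg {w : ℂ} (hw : w ∈ wideStrip 0) :
    (primeZetaReg w).re = Real.log ‖zetaReg w‖ + (primeLogSum w).re := by
  rw [← exp_primeZetaReg hw, Complex.norm_exp, Real.log_exp]; simp

theorem abs_re_primeZetaReg_le :
    ∃ C : ℝ, ∀ w ∈ wideStrip 0, |(primeZetaReg w).re| ≤ C + 2 * Real.log (2 + |w.im|) := by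
  obtain ⟨C₁, hC₁, h1⟩ := (tame_zetaReg 0).bdd.exists_nonneg (ε := 1) one_pos
  obtain ⟨C₂, hC₂, h2⟩ := polyBdd_inv_zetaReg.exists_nonneg (ε := 1) one_pos
  refine ⟨Real.log (C₁ + 1) + Real.log (C₂ + 1) +
    ∑' p : Nat.Primes, 2 * ((p : ℕ) : ℝ) ^ (-(3 / 2) : ℝ), fun w hw => ?_⟩
  have hpos : 0 < ‖zetaReg w‖ := norm_pos_iff.2 (zetaReg_ne_zero_of_mem hw)
  have ht : 0 < 2 + |w.im| := by positivity
  have hl : 0 ≤ Real.log (2 + |w.im|) := Real.log_nonneg (one_le_two_add_abs _)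
  have hc1 : 0 ≤ Real.log (C₁ + 1) := Real.log_nonneg (by linarith)
  have hc2 : 0 ≤ Real.log (C₂ + 1) := Real.log_nonneg (by linarith)
  have h3 := (Complex.abs_re_le_norm _).trans (norm_primeLogSum_le (wideStrip_zero_subset hw))
  have h4 : Real.log ‖zetaReg w‖ ≤ Real.log (C₁ + 1) + 2 * Real.log (2 + |w.im|) := by
    calc _ ≤ Real.log ((C₁ + 1) * (2 + |w.im|) ^ (1 + 1 : ℝ)) := by
          refine Real.log_le_log hpos ((h1 w hw).trans ?_)
          gcongr; linarith
      _ = _ := by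
          rw [Real.log_mul (by positivity) (by positivity), Real.log_rpow ht]; norm_num
  have h5 : -Real.log ‖zetaReg w‖ ≤ Real.log (C₂ + 1) := by
    rw [← Real.log_inv, ← norm_inv]
    refine Real.log_le_log (by rw [norm_inv]; positivity) ?_
    have := h2 w hw
    norm_num at this
    rw [norm_inv]; linarith
  rw [re_primeZetaReg hw]
  rw [abs_le] at h3 ⊢
  constructor <;> linarith [h3.1, h3.2]

/-- On the real segment every quantity is real, which removes the 2πi ambiguity of the exponential
identity and gives the limit at 0. -/
theorem primeZetaReg_sub_ofReal {σ : ℝ} (h0 : 0 < σ) (h1 : σ < 1 / 2) :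
    primeZetaReg σ = primeLogSum σ + (Real.log ‖zetaReg σ‖ : ℝ) := by
  have hw : (σ : ℂ) ∈ wideStrip 0 := ⟨by simpa using h0, by simpa using h1⟩
  have him : (primeZetaReg σ - primeLogSum σ).im = 0 := by
    have e1 : (primeZeta σ).im = 0 := by
      have := Complex.hasSum_im (hasSum_primeZeta (w := σ) (by simpa using h0))
      refine this.unique ?_
      convert hasSum_zero with p
      rw [show (-1 - σ : ℂ) = ((-1 - σ : ℝ) : ℂ) by push_cast; ring, ← Complex.ofReal_natCast,
        ← Complex.ofReal_cpow (Nat.cast_nonneg _), Complex.ofReal_im]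
    have e2 : (primeLogSum σ).im = 0 := by
      have := Complex.hasSum_im (summable_primeLogTerm (wideStrip_zero_subset hw)).hasSum
      refine this.unique ?_
      convert hasSum_zero with p
      have hlt := (norm_prime_cpow_le p (wideStrip_zero_subset hw).1.le).trans
        (prime_rpow_le_of_quarter p)
      rw [primeLogTerm]
      rw [show (-1 - σ : ℂ) = ((-1 - σ : ℝ) : ℂ) by push_cast; ring, ← Complex.ofReal_natCast,
        ← Complex.ofReal_cpow (Nat.cast_nonneg _)] at hlt ⊢
      rw [Complex.norm_real, Real.norm_eq_abs, abs_le] at hlt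
      rw [← Complex.ofReal_one, ← Complex.ofReal_sub, ← Complex.ofReal_log (by linarith),
        ← Complex.ofReal_add, Complex.ofReal_im]
    have e3 : (Complex.log σ).im = 0 := by
      rw [← Complex.ofReal_log h0.le, Complex.ofReal_im]
    rw [primeZetaReg, Complex.sub_im, Complex.add_im, e1, e2, e3]; simp
  have hre := re_primeZetaReg hw
  rw [← sub_eq_iff_eq_add']
  refine Complex.ext ?_ ?_
  · rw [Complex.ofReal_re, Complex.sub_re, hre]; ring
  · rw [him, Complex.ofReal_im]

theorem tendsto_ofReal_wideStrip : Tendsto (fun σ : ℝ => (σ : ℂ)) (𝓝[>] 0) (𝓝[wideStrip 0] 0) := by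
  refine tendsto_nhdsWithin_iff.2 ⟨?_, ?_⟩
  · have : Tendsto (fun σ : ℝ => (σ : ℂ)) (𝓝 0) (𝓝 ((0 : ℝ) : ℂ)) :=
      Complex.continuous_ofReal.tendsto _
    simpa using this.mono_left nhdsWithin_le_nhds
  · filter_upwards [Ioo_mem_nhdsGT (show (0 : ℝ) < 1 / 2 by norm_num)] with σ hσ
    exact ⟨by simpa using hσ.1, by simpa using hσ.2⟩

theorem zero_mem_wideStrip {r : ℝ} (hr : 0 < r) : (0 : ℂ) ∈ wideStrip r :=
  ⟨by simpa using hr, by simp; linarith⟩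

theorem tendsto_primeZetaReg :
    Tendsto (fun σ : ℝ => primeZetaReg σ) (𝓝[>] 0) (𝓝 (primeLogSum 0)) := by
  have hn : wideStrip (1 / 4) ∈ 𝓝 (0 : ℂ) :=
    (isOpen_wideStrip _).mem_nhds (zero_mem_wideStrip (by norm_num))
  have ht := tendsto_ofReal_wideStrip.mono_right nhdsWithin_le_nhds
  have h1 := ((differentiableOn_primeLogSum.differentiableAt hn).continuousAt.tendsto).comp ht
  have h2 := ((continuousOn_zetaReg.continuousAt hn).tendsto.comp ht).norm
  rw [zetaReg_zero, norm_one] at h2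
  have h3 := (Complex.continuous_ofReal.tendsto _).comp
    (((Real.continuousAt_log one_ne_zero).tendsto).comp h2)
  rw [Real.log_one, Complex.ofReal_zero] at h3
  have h4 := h1.add h3
  rw [add_zero] at h4
  refine h4.congr' ?_
  filter_upwards [Ioo_mem_nhdsGT (show (0 : ℝ) < 1 / 2 by norm_num)] with σ hσ
  rw [primeZetaReg_sub_ofReal hσ.1 hσ.2]; rfl

variable {h : ArithmeticFunction ℝ} {k : ℝ}

/-- `w ^ (1 - k) * exp (∑ (1 - h(p)) / p ^ (1 + w))`, regularised. -/
def mainFactor (h : ArithmeticFunction ℝ) (k : ℝ) (w : ℂ) : ℂ :=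
  Complex.exp ((1 - k) * primeZetaReg w - devSeries h k w)

theorem differentiableOn_devSeries (hA : AnalyticCondition h k) :
    DifferentiableOn ℂ (devSeries h k) (wideStrip 0) :=
  differentiableOn_LSeries_primeCoeff hA.subPoly_sub

theorem differentiableOn_mainFactor (hA : AnalyticCondition h k) :
    DifferentiableOn ℂ (mainFactor h k) (wideStrip 0) :=
  ((differentiableOn_primeZetaReg.const_mul _).fun_sub (differentiableOn_devSeries hA)).cexp

/-- The size comes from the real parts in the exponent, which are O(log |w|) at large height. The
logarithmic derivative is tame of exponent 0, so all derivatives obey the same bound. -/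
theorem tame_mainFactor (hA : AnalyticCondition h k) :
    ∃ K : ℝ, 0 ≤ K ∧ ∀ n, Tame (wideStrip 0) K n (mainFactor h k) := by
  have hO := isOpen_wideStrip 0
  obtain ⟨C₁, h1⟩ := abs_re_primeZetaReg_le
  obtain ⟨C₂, h2⟩ := abs_re_devSeries_le hA
  refine ⟨|1 - k| * 2 + 1, by positivity, fun n => Tame.mono (n := n + 1) ?_ le_rfl |>.of_succ⟩
  have hP : PolyBdd (wideStrip 0) (|1 - k| * 2 + 1) (mainFactor h k) := by
    intro ε hε
    refine ⟨Real.exp (|1 - k| * C₁ + C₂), fun w hw => ?_⟩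
    have ht : 0 < 2 + |w.im| := by positivity
    have hl : 0 ≤ Real.log (2 + |w.im|) := Real.log_nonneg (one_le_two_add_abs _)
    rw [mainFactor, Complex.norm_exp, Real.rpow_def_of_pos ht, ← Real.exp_add]
    refine Real.exp_le_exp.2 ?_
    have e1 : ((1 - k) * primeZetaReg w - devSeries h k w).re =
        (1 - k) * (primeZetaReg w).re - (devSeries h k w).re := by
      rw [Complex.sub_re, show (1 - k : ℂ) = ((1 - k : ℝ) : ℂ) by push_cast; ring,
        Complex.re_ofReal_mul]
    rw [e1]
    have e2 : (1 - k) * (primeZetaReg w).re ≤ |1 - k| * (C₁ + 2 * Real.log (2 + |w.im|)) := by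
      refine (le_abs_self _).trans ?_
      rw [abs_mul]
      exact mul_le_mul_of_nonneg_left (h1 w hw) (abs_nonneg _)
    have e3 := neg_abs_le (devSeries h k w).re
    have e4 := h2 w (re_pos_of_mem hw)
    nlinarith
  set v : ℂ → ℂ := fun w => (1 - k) * deriv primeZetaReg w +
    LSeries (LSeries.logMul^[1] (primeCoeff fun n => h n - k)) w with hv
  have hd1 := (differentiableOn_primeZetaReg.deriv hO).const_mul (1 - k : ℂ)
  have hd2 : DifferentiableOn ℂ
      (LSeries (LSeries.logMul^[1] (primeCoeff fun n => h n - k))) (wideStrip 0) := fun w hw =>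
    (deriv_LSeries_logMul hA 1 hw).differentiableAt.differentiableWithinAt
  refine Tame.of_deriv_eq_mul hO (v := v) (differentiableOn_mainFactor hA) (hd1.fun_add hd2) hP
    (((tame_deriv_primeZetaReg n).const_mul hO _ (differentiableOn_primeZetaReg.deriv hO)).add hO
      hd1 hd2 (tame_LSeries_logMul hA le_rfl n)) fun w hw => ?_
  have h1 := (differentiableOn_primeZetaReg.differentiableAt (hO.mem_nhds hw)).hasDerivAt
  have := ((h1.const_mul (1 - k : ℂ)).fun_sub (hasDerivAt_devSeries hA hw)).cexp.deriv
  rw [show mainFactor h k = fun w => Complex.exp ((1 - k) * primeZetaReg w - devSeries h k w) from rfl,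
    this, hv]
  ring

theorem tendsto_mainFactor (hA : AnalyticCondition h k) {ℓ : ℝ}
    (hℓ : Tendsto (fun N : ℕ => ∑ p ∈ primesUpTo N, (h p - k) / (p : ℝ)) atTop (𝓝 ℓ)) :
    Tendsto (fun σ : ℝ => mainFactor h k σ) (𝓝[>] 0)
      (𝓝 (Complex.exp ((1 - k) * primeLogSum 0 - ℓ))) :=
  (Complex.continuous_exp.tendsto _).comp
    ((tendsto_primeZetaReg.const_mul _).sub (tendsto_devSeries hA hℓ))

/-- Splitting 1 - h(p) = (1 - k) - (h(p) - k) isolates the multiple of the prime zeta function that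
produces the power of w. -/
theorem mainFactor_eq (hA : AnalyticCondition h k) {w : ℂ} (hw : w ∈ wideStrip 0) :
    mainFactor h k w = w ^ (1 - k : ℂ) *
      Complex.exp (LSeries (primeCoeff fun n => 1 - h n) w) := by
  have hw0 := re_pos_of_mem hw
  have h1 := (hasSum_primeZeta hw0).mul_left (1 - k : ℂ)
  have h2 := h1.sub (hasSum_primeCoeff hA.subPoly_sub hw0)
  have h3 := (hasSum_primeCoeff ((SubPoly.const 1).sub hA.subPoly) hw0).unique
    (h2.congr_fun fun p => by push_cast; ring)
  rw [h3, Complex.cpow_def_of_ne_zero (ne_zero_of_mem_wideStrip hw), ← Complex.exp_add, mainFactor,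
    primeZetaReg, devSeries]
  congr 1
  ring

/-- A Mertens type bound: `∑ (1 + h(p)) / p ^ (1 + σ) ≤ (1 + k) log (1 / σ) + O(1)`. -/
theorem exists_sum_primes_le (hA : AnalyticCondition h k) :
    ∃ C : ℝ, ∀ σ : ℝ, 0 < σ → σ < 1 / 2 → ∀ s : Finset Nat.Primes,
      (∀ p : Nat.Primes, 0 ≤ h p) →
      ∑ p ∈ s, (1 + h p) * ((p : ℕ) : ℝ) ^ (-1 - σ) ≤ C - (1 + k) * Real.log σ := by
  obtain ⟨C₁, h1⟩ := abs_re_primeZetaReg_le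
  obtain ⟨C₂, h2⟩ := abs_re_devSeries_le hA
  refine ⟨(1 + k) * (C₁ + 2 * Real.log 2) + (C₂ + Real.log 2), fun σ h0 hσ s hpos => ?_⟩
  have hk := hA.1
  have hw : (σ : ℂ) ∈ wideStrip 0 := ⟨by simpa using h0, by simpa using hσ⟩
  have hw0 := re_pos_of_mem hw
  -- Here 1 + h = (1 + k) + (h - k). The first part contributes -(1 + k) log σ, the second is
  -- bounded on the real axis.
  have hs := Complex.hasSum_re (((hasSum_primeZeta hw0).mul_left (1 + k : ℂ)).add
    (hasSum_primeCoeff hA.subPoly_sub hw0))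
  have hs2 : HasSum (fun p : Nat.Primes => (1 + h p) * ((p : ℕ) : ℝ) ^ (-1 - σ)) _ :=
    hs.congr_fun fun p => by
      rw [show (-1 - σ : ℂ) = ((-1 - σ : ℝ) : ℂ) by push_cast; ring, ← Complex.ofReal_natCast,
        ← Complex.ofReal_cpow (Nat.cast_nonneg _), ← Complex.ofReal_one, ← Complex.ofReal_add,
        ← Complex.ofReal_mul, ← Complex.ofReal_mul, ← Complex.ofReal_add, Complex.ofReal_re]
      ring
  refine (sum_le_hasSum s (fun p _ => ?_) hs2).trans ?_
  · have := hpos p; positivity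
  have e1 : (primeZeta σ).re = (primeZetaReg σ).re - Real.log σ := by
    rw [primeZetaReg, Complex.add_re, Complex.log_ofReal_re]; ring
  have e2 := (abs_le.1 (h1 σ hw)).2
  have e3 := (abs_le.1 (h2 σ hw0)).2
  rw [show (1 + k : ℂ) = ((1 + k : ℝ) : ℂ) by push_cast; ring, Complex.add_re,
    Complex.re_ofReal_mul, e1]
  simp only [Complex.ofReal_im, abs_zero, add_zero] at e2 e3
  rw [devSeries] at e3
  nlinarith

end ArithSeq

end

/-! ### Nonnegativity of h at prime powers, and the convolution b = μ * (r g(r)) -/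

noncomputable section
namespace ArithSeq

section Positivity
variable {s : ℕ → ℝ} {h : ArithmeticFunction ℝ} {a : ℤ} {L : ℝ → ℝ}

theorem count_nonneg (hs : ∀ n, 1 ≤ n → 0 ≤ s n) (x : ℝ) : 0 ≤ count s x :=
  Finset.sum_nonneg fun n hn => hs n (Finset.mem_Icc.1 hn).1

theorem countAP_nonneg (hs : ∀ n, 1 ≤ n → 0 ≤ s n) (x : ℝ) (q : ℕ) (b : ℤ) :
    0 ≤ countAP s x q b :=
  Finset.sum_nonneg fun n hn => hs n (Finset.mem_Icc.1 (Finset.mem_filter.1 hn).1).1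

/-- If the count were 0, the ratio in hypothesis 2 at z = 1 would be 0/0 = 0 by convention, at
distance 1 from z. That contradicts the error bound once L(x) is large. -/
theorem eventually_count_pos (hs : ∀ n, 1 ≤ n → 0 ≤ s n) (hL : IsScale L)
    (hr : RegularSize s a L) : ∀ᶠ x in atTop, 0 < count s x := by
  obtain ⟨δ, hδ, C, hC⟩ := hr
  have h1 : Tendsto (fun x => C * (1 / L x ^ (1 + δ))) atTop (𝓝 (C * 0)) := by
    refine Tendsto.const_mul _ ?_
    simp only [one_div]
    exact tendsto_inv_atTop_zero.comp
      ((tendsto_rpow_atTop (by linarith : 0 < 1 + δ)).comp hL.tendsto)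
  rw [mul_zero] at h1
  filter_upwards [hC, h1.eventually_lt_const one_pos, eventually_gt_atTop 0] with x hx hx1 hx0
  have hLx := hL.one_le x hx0.le
  have := hx.1 1 (by rw [one_div]; exact inv_le_one_of_one_le₀ hLx)
    (by have : 0 ≤ |(a : ℝ)| / x := by positivity
        linarith)
  rw [one_mul] at this
  refine lt_of_le_of_ne (count_nonneg hs x) fun h0 => ?_
  rw [← h0] at this
  norm_num at this hx1
  linarith

theorem gam_ne_zero (hlt : ∀ p : ℕ, p.Prime → h p < p) (q : ℕ) : gam h q ≠ 0 := by
  refine Finset.prod_ne_zero_iff.2 fun p hp => ?_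
  have hp' := Nat.prime_of_mem_primeFactors hp
  have h1 : (1 : ℝ) < p := by exact_mod_cast hp'.one_lt
  refine div_ne_zero ?_ ?_
  · rw [sub_ne_zero, ne_eq, eq_comm, div_eq_one_iff_eq (by positivity)]; exact h1.ne
  · rw [sub_ne_zero, ne_eq, eq_comm, div_eq_one_iff_eq (by positivity)]; exact (hlt p hp').ne

theorem f_div_eq_g (hlt : ∀ p : ℕ, p.Prime → h p < p) {q : ℕ} (hq : 1 ≤ q) :
    f h a q / (q * gam h q) = g h a q := by
  have h1 := gam_ne_zero hlt q
  have h2 : (q : ℝ) ≠ 0 := by exact_mod_cast (by omega : q ≠ 0)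
  rw [f]; field_simp

theorem g_prime_pow_self {p : ℕ} (hp : p.Prime) (e : ℕ) :
    g h ((p ^ e : ℕ) : ℤ) (p ^ e) = if e = 0 then 1 else h (p ^ e) / (p : ℝ) ^ e := by
  rcases Nat.eq_zero_or_pos e with rfl | he
  · simp [g]
  · rw [if_neg he.ne', g, Nat.primeFactors_prime_pow he.ne' hp, Finset.prod_singleton,
      Int.natAbs_natCast, hp.factorization_pow]
    simp [gLocal]

/-- Equidistribution with b = q = p^e has density h(p^e)/p^e. A negative value would be a negative
density for a nonnegative sequence. -/
theorem nonneg_prime_pow (hs : ∀ n, 1 ≤ n → 0 ≤ s n) (hmul : h.IsMultiplicative)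
    (heq : Equidistributed s h) (hlt : ∀ p : ℕ, p.Prime → h p < p)
    (hpos : ∀ᶠ x in atTop, 0 < count s x) {p : ℕ} (hp : p.Prime) (e : ℕ) : 0 ≤ h (p ^ e) := by
  rcases Nat.eq_zero_or_pos e with rfl | he
  · rw [pow_zero, hmul.map_one]; exact zero_le_one
  by_contra! hneg
  have hpe : 1 ≤ p ^ e := Nat.one_le_pow _ _ hp.pos
  have hg : g h ((p ^ e : ℕ) : ℤ) (p ^ e) < 0 := by
    rw [g_prime_pow_self hp, if_neg he.ne']
    have : (0 : ℝ) < (p : ℝ) ^ e := by have := hp.pos; positivity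
    exact div_neg_of_neg_of_pos hneg this
  have hf : f h ((p ^ e : ℕ) : ℤ) (p ^ e) ≠ 0 := by
    rw [f]
    exact mul_ne_zero (mul_ne_zero hg.ne (by exact_mod_cast (by omega : p ^ e ≠ 0)))
      (gam_ne_zero hlt _)
  have h1 := heq ((p ^ e : ℕ) : ℤ) (p ^ e) (by exact_mod_cast (by omega : p ^ e ≠ 0)) hpe hf
  rw [f_div_eq_g hlt hpe] at h1
  obtain ⟨φ, hφ, hφe⟩ := h1.exists_eq_mul
  obtain ⟨x, hx1, hx2, hx3⟩ := (hφe.and ((hφ.eventually_const_lt one_half_lt_one).and hpos)).exists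
  have h2 := countAP_nonneg hs x (p ^ e) ((p ^ e : ℕ) : ℤ)
  simp only [Pi.mul_apply] at hx1
  rw [hx1] at h2
  have : φ x * (g h ((p ^ e : ℕ) : ℤ) (p ^ e) * count s x) < 0 :=
    mul_neg_of_pos_of_neg (by linarith) (mul_neg_of_neg_of_pos hg hx3)
  linarith

end Positivity

variable {h : ArithmeticFunction ℝ} {k : ℝ} {a : ℤ}

/-- `h(p ^ f) - h(p ^ (f + 1)) / p` for `p ^ f ∥ a`. -/
def localGap (h : ArithmeticFunction ℝ) (a : ℤ) (p : ℕ) : ℝ :=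
  h (p ^ a.natAbs.factorization p) - h (p ^ (a.natAbs.factorization p + 1)) / p

/-- The function `r g_a(r)`. -/
def weight (h : ArithmeticFunction ℝ) (a : ℤ) : ArithmeticFunction ℝ :=
  ⟨fun r => r * g h a r, by simp⟩

theorem weight_apply (r : ℕ) : weight h a r = r * g h a r := rfl

theorem weight_isMultiplicative : (weight h a).IsMultiplicative := by
  refine ⟨by simp [weight_apply, g], fun {m n} hmn => ?_⟩
  rw [weight_apply, weight_apply, weight_apply]
  have : g h a (m * n) = g h a m * g h a n := by
    rw [g, g, g, hmn.primeFactors_mul, Finset.prod_union hmn.disjoint_primeFactors]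
    congr 1
    · refine Finset.prod_congr rfl fun p hp => ?_
      rw [Nat.factorization_eq_of_coprime_left hmn (Nat.mem_primeFactors_iff_mem_primeFactorsList.1 hp)]
    · refine Finset.prod_congr rfl fun p hp => ?_
      rw [Nat.factorization_eq_of_coprime_right hmn (Nat.mem_primeFactors_iff_mem_primeFactorsList.1 hp)]
  rw [this]; push_cast; ring

theorem weight_prime_pow (hmul : h.IsMultiplicative) {p : ℕ} (hp : p.Prime) (e : ℕ) :
    weight h a (p ^ e) = if e ≤ a.natAbs.factorization p then h (p ^ e) else
      localGap h a p * (p / (p - 1)) := by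
  have hp0 : (p : ℝ) ≠ 0 := by exact_mod_cast hp.ne_zero
  have hp1 : (p : ℝ) - 1 ≠ 0 := sub_ne_zero.2 (by exact_mod_cast hp.one_lt.ne')
  rcases Nat.eq_zero_or_pos e with rfl | he
  · simp [weight_apply, g, hmul.map_one]
  rw [weight_apply, g, Nat.primeFactors_prime_pow he.ne' hp, Finset.prod_singleton,
    hp.factorization_pow]
  simp only [Finsupp.single_eq_same, gLocal]
  split_ifs with h1
  · push_cast; field_simp
  · rw [Nat.totient_prime_pow hp he, localGap]
    obtain ⟨e, rfl⟩ : ∃ n, e = n + 1 := ⟨e - 1, by omega⟩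
    have hpp : ((p - 1 : ℕ) : ℝ) = p - 1 := by rw [Nat.cast_sub hp.one_le]; simp
    push_cast
    rw [hpp]
    field_simp
    ring

/-- The convolution `b = μ * (r g_a(r))`. -/
def corr (h : ArithmeticFunction ℝ) (a : ℤ) : ArithmeticFunction ℝ :=
  ((ArithmeticFunction.moebius : ArithmeticFunction ℤ) : ArithmeticFunction ℝ) * weight h a

theorem corr_isMultiplicative : (corr h a).IsMultiplicative :=
  ArithmeticFunction.isMultiplicative_moebius.intCast.mul weight_isMultiplicative

theorem sum_divisors_corr (r : ℕ) : ∑ d ∈ r.divisors, corr h a d = weight h a r := by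
  rw [← ArithmeticFunction.coe_zeta_mul_apply, corr, ← mul_assoc,
    ArithmeticFunction.coe_zeta_mul_coe_moebius, one_mul]

theorem sum_corr_prime_pow {p : ℕ} (hp : p.Prime) (e : ℕ) :
    ∑ i ∈ Finset.range (e + 1), corr h a (p ^ i) = weight h a (p ^ e) := by
  rw [← sum_divisors_corr, Nat.sum_divisors_prime_pow hp]

/-- For p^f ∥ a the weight r g(r) is constant along p^e with e > f, and b is its increment. Local
factors are thus polynomials in p^{-w}. -/
theorem corr_prime_pow_eq_zero (hmul : h.IsMultiplicative) {p : ℕ} (hp : p.Prime) {e : ℕ}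
    (he : a.natAbs.factorization p + 2 ≤ e) : corr h a (p ^ e) = 0 := by
  obtain ⟨n, rfl⟩ : ∃ n, e = n + 1 := ⟨e - 1, by omega⟩
  have h1 := sum_corr_prime_pow (h := h) (a := a) hp (n + 1)
  rw [Finset.sum_range_succ, sum_corr_prime_pow hp, weight_prime_pow hmul hp,
    weight_prime_pow hmul hp, if_neg (by omega), if_neg (by omega)] at h1
  linarith

theorem sum_range_mul_pow {R : Type*} [CommRing R] (u : ℕ → R) (z : R) (n : ℕ) :
    ∑ e ∈ Finset.range (n + 1), u e * z ^ e =
      (1 - z) * ∑ e ∈ Finset.range n, (∑ i ∈ Finset.range (e + 1), u i) * z ^ e +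
        (∑ i ∈ Finset.range (n + 1), u i) * z ^ n := by
  induction n with
  | zero => simp
  | succ n ih =>
    rw [Finset.sum_range_succ, ih,
      Finset.sum_range_succ (fun e => (∑ i ∈ Finset.range (e + 1), u i) * z ^ e) n,
      Finset.sum_range_succ u (n + 1)]
    ring

/-- The local factor at `p` of the Dirichlet series of `corr`, as a function of `z = p ^ (-w)`. -/
def localFactor (h : ArithmeticFunction ℝ) (a : ℤ) (p : ℕ) (z : ℂ) : ℂ :=
  (1 - z) * ∑ e ∈ Finset.range (a.natAbs.factorization p + 1), (h (p ^ e) : ℂ) * z ^ e +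
    ((localGap h a p * (p / (p - 1)) : ℝ) : ℂ) * z ^ (a.natAbs.factorization p + 1)

/-- Summation by parts expresses the polynomial through the partial sums of b at powers of p, which
are the known weights. It also exhibits the factor 1 - z that vanishes at w = 0. -/
theorem hasSum_localFactor (hmul : h.IsMultiplicative) {p : ℕ} (hp : p.Prime) (z : ℂ) :
    HasSum (fun e => (corr h a (p ^ e) : ℂ) * z ^ e) (localFactor h a p z) := by
  have h1 : localFactor h a p z = ∑ e ∈ Finset.range (a.natAbs.factorization p + 1 + 1),
      (corr h a (p ^ e) : ℂ) * z ^ e := by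
    rw [sum_range_mul_pow, localFactor]
    congr 1
    · congr 1
      refine Finset.sum_congr rfl fun e he => ?_
      rw [← Complex.ofReal_sum, sum_corr_prime_pow hp, weight_prime_pow hmul hp,
        if_pos (by have := Finset.mem_range.1 he; omega)]
    · rw [← Complex.ofReal_sum, sum_corr_prime_pow hp, weight_prime_pow hmul hp,
        if_neg (by omega)]
  rw [h1]
  refine hasSum_sum_of_ne_finset_zero fun e he => ?_
  rw [corr_prime_pow_eq_zero hmul hp (by rw [Finset.mem_range] at he; omega)]; simp

theorem localFactor_of_not_dvd (hmul : h.IsMultiplicative) {p : ℕ} (hp : p.Prime)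
    (hpa : a.natAbs.factorization p = 0) (z : ℂ) :
    localFactor h a p z = 1 + ((1 - h p : ℝ) : ℂ) / (p - 1) * z := by
  have hp1 : (p : ℂ) - 1 ≠ 0 := sub_ne_zero.2 (by exact_mod_cast hp.one_lt.ne')
  have hp0 : (p : ℂ) ≠ 0 := by exact_mod_cast hp.ne_zero
  rw [localFactor, localGap, hpa]
  simp only [zero_add, Finset.sum_range_one, pow_zero, pow_one, hmul.map_one]
  push_cast
  field_simp
  ring

theorem corr_prime (hmul : h.IsMultiplicative) {p : ℕ} (hp : p.Prime)
    (hpa : a.natAbs.factorization p = 0) : corr h a p = (1 - h p) / (p - 1) := by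
  have hp1 : (p : ℝ) - 1 ≠ 0 := sub_ne_zero.2 (by exact_mod_cast hp.one_lt.ne')
  have hp0 : (p : ℝ) ≠ 0 := by exact_mod_cast hp.ne_zero
  have h1 := sum_corr_prime_pow (h := h) (a := a) hp 1
  rw [weight_prime_pow hmul hp, hpa, if_neg (by omega), localGap, hpa] at h1
  simp only [Finset.sum_range_succ, Finset.sum_range_zero, zero_add, pow_zero, pow_one,
    hmul.map_one, corr_isMultiplicative.map_one] at h1
  rw [← sub_eq_iff_eq_add'.2 h1.symm]
  field_simp
  ring

/-- For p not dividing a only b(p) = (1 - h(p))/(p - 1) contributes, and 1/(p - 1) ≤ 2/p. The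
finitely many p dividing a get a bound independent of σ. -/
theorem tsum_abs_corr_le (hmul : h.IsMultiplicative) {p : ℕ} (hp : p.Prime) (hp0 : 0 ≤ h p)
    {σ : ℝ} (hσ : 0 < σ) :
    ∑' e, |corr h a (p ^ e)| * ((p ^ e : ℕ) : ℝ) ^ (-σ) ≤
      Real.exp ((if p ∈ a.natAbs.primeFactors then
        ∑ e ∈ Finset.range (a.natAbs.factorization p + 2), |corr h a (p ^ e)| else 0) +
        2 * ((1 + h p) * (p : ℝ) ^ (-1 - σ))) := by
  have h1 : ∑' e, |corr h a (p ^ e)| * ((p ^ e : ℕ) : ℝ) ^ (-σ) =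
      ∑ e ∈ Finset.range (a.natAbs.factorization p + 2),
        |corr h a (p ^ e)| * ((p ^ e : ℕ) : ℝ) ^ (-σ) := by
    refine tsum_eq_sum fun e he => ?_
    rw [corr_prime_pow_eq_zero hmul hp (by simpa using he)]; simp
  rw [h1]
  have hpr : (2 : ℝ) ≤ p := by exact_mod_cast hp.two_le
  split_ifs with hpa
  · refine (Finset.sum_le_sum (g := fun e => |corr h a (p ^ e)|) fun e _ => ?_).trans ?_
    · refine mul_le_of_le_one_right (abs_nonneg _) (Real.rpow_le_one_of_one_le_of_nonpos ?_ (by linarith))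
      exact_mod_cast Nat.one_le_pow _ _ hp.pos
    · refine le_trans ?_ (Real.add_one_le_exp _)
      have : 0 ≤ 2 * ((1 + h p) * (p : ℝ) ^ (-1 - σ)) := by positivity
      linarith
  · have hF : a.natAbs.factorization p = 0 := by
      rwa [← Nat.support_factorization, Finsupp.notMem_support_iff] at hpa
    rw [hF, zero_add, zero_add]
    simp only [Finset.sum_range_succ, Finset.sum_range_zero, zero_add, pow_zero, pow_one,
      corr_isMultiplicative.map_one, Nat.cast_one, Real.one_rpow, abs_one, mul_one]
    refine le_trans ?_ (Real.add_one_le_exp _)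
    rw [add_comm 1]
    refine add_le_add_left ?_ 1
    rw [corr_prime hmul hp hF, abs_div, abs_of_pos (by linarith : (0 : ℝ) < p - 1)]
    have h2 : |1 - h p| ≤ 1 + h p := by rw [abs_le]; constructor <;> linarith
    have h3 : ((p : ℝ) - 1)⁻¹ ≤ 2 * (p : ℝ) ^ (-1 : ℝ) := by
      rw [Real.rpow_neg_one, ← div_eq_mul_inv, inv_le_comm₀ (by linarith) (by positivity), inv_div]
      linarith
    rw [show -1 - σ = -1 + -σ by ring, Real.rpow_add (by linarith)]
    calc |1 - h p| / (p - 1) * (p : ℝ) ^ (-σ) = |1 - h p| * ((p : ℝ) - 1)⁻¹ * (p : ℝ) ^ (-σ) := by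
          rw [div_eq_mul_inv]
      _ ≤ (1 + h p) * (2 * (p : ℝ) ^ (-1 : ℝ)) * (p : ℝ) ^ (-σ) := by
          have h4 : 0 ≤ ((p : ℝ) - 1)⁻¹ := inv_nonneg.2 (by linarith)
          gcongr
      _ = _ := by ring

/-- A Rankin type bound for the absolute sums of `corr`. -/
theorem exists_sum_abs_corr_le (hmul : h.IsMultiplicative) (hA : AnalyticCondition h k)
    (hpos : ∀ p : ℕ, p.Prime → 0 ≤ h p) :
    ∃ C D : ℝ, 0 ≤ C ∧ 0 ≤ D ∧ ∀ σ : ℝ, 0 < σ → σ < 1 / 2 → ∀ s : Finset ℕ,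
      ∑ m ∈ s, |corr h a m| * (m : ℝ) ^ (-σ) ≤ C * σ ^ (-D) := by
  obtain ⟨C₀, hC₀⟩ := exists_sum_primes_le hA
  set d : ℕ → ℝ := fun p => if p ∈ a.natAbs.primeFactors then
        ∑ e ∈ Finset.range (a.natAbs.factorization p + 2), |corr h a (p ^ e)| else 0 with hd
  have hd0 : ∀ p, 0 ≤ d p := fun p => by
    simp only [hd]; split_ifs
    · exact Finset.sum_nonneg fun _ _ => abs_nonneg _
    · exact le_rfl
  refine ⟨Real.exp (∑ p ∈ a.natAbs.primeFactors, d p + 2 * C₀), 2 * (1 + k), (Real.exp_pos _).le,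
    by have := hA.1; linarith, fun σ hσ hσ1 s => ?_⟩
  set F : ℕ → ℝ := fun m => |corr h a m| * (m : ℝ) ^ (-σ) with hF
  have hF0 : ∀ m, 0 ≤ F m := fun m => by positivity
  have hF1 : F 1 = 1 := by simp [hF, corr_isMultiplicative.map_one]
  have hFm : ∀ {m n : ℕ}, m.Coprime n → F (m * n) = F m * F n := fun {m n} hmn => by
    simp only [hF]
    rw [corr_isMultiplicative.map_mul_of_coprime hmn, abs_mul, Nat.cast_mul,
      Real.mul_rpow (Nat.cast_nonneg _) (Nat.cast_nonneg _)]
    ring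
  have hsum : ∀ {p : ℕ}, p.Prime → Summable fun n => ‖F (p ^ n)‖ := fun {p} hp => by
    refine summable_of_ne_finset_zero (s := Finset.range (a.natAbs.factorization p + 2)) fun e he => ?_
    simp only [hF]
    rw [corr_prime_pow_eq_zero hmul hp (by simpa using he)]; simp
  obtain ⟨N, hN⟩ : ∃ N : ℕ, ∀ m ∈ s, m < N := ⟨s.sup id + 1, fun m hm =>
    Nat.lt_succ_of_le (Finset.le_sup (f := id) hm)⟩
  -- A finite sum of nonnegative terms is majorised by the Euler product over the primes below N,
  -- with N exceeding every element of the set.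
  obtain ⟨h1, h2⟩ := EulerProduct.summable_and_hasSum_smoothNumbers_prod_primesBelow_tsum hF1 hFm hsum N
  have h3 : ∑ m ∈ s, F m ≤ ∏ p ∈ N.primesBelow, ∑' n, F (p ^ n) := by
    have e1 : ∑ m ∈ s, F m = ∑ m ∈ s.filter (· ∈ N.smoothNumbers), F m := by
      classical
      rw [Finset.sum_filter_of_ne]
      intro m hm hne
      have hm0 : m ≠ 0 := by rintro rfl; simp [hF] at hne
      exact Nat.mem_smoothNumbers_of_lt (Nat.pos_of_ne_zero hm0) (hN m hm)
    rw [e1, ← Finset.sum_subtype_eq_sum_filter]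
    exact sum_le_hasSum _ (fun _ _ => hF0 _) h2
  refine h3.trans ?_
  calc ∏ p ∈ N.primesBelow, ∑' n, F (p ^ n)
      ≤ ∏ p ∈ N.primesBelow, Real.exp (d p + 2 * ((1 + h p) * (p : ℝ) ^ (-1 - σ))) := by
        refine Finset.prod_le_prod (fun p _ => tsum_nonneg fun _ => hF0 _) fun p hp => ?_
        have hp' := Nat.prime_of_mem_primesBelow hp
        exact tsum_abs_corr_le hmul hp' (hpos p hp') hσ
    _ = Real.exp (∑ p ∈ N.primesBelow, d p +
          2 * ∑ p ∈ N.primesBelow, (1 + h p) * (p : ℝ) ^ (-1 - σ)) := by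
        rw [← Real.exp_sum, Finset.sum_add_distrib, Finset.mul_sum]
    _ ≤ Real.exp ((∑ p ∈ a.natAbs.primeFactors, d p + 2 * C₀) + Real.log σ * -(2 * (1 + k))) := by
        refine Real.exp_le_exp.2 ?_
        have e1 : ∑ p ∈ N.primesBelow, d p ≤ ∑ p ∈ a.natAbs.primeFactors, d p :=
          (Finset.sum_filter_of_ne (p := (· ∈ a.natAbs.primeFactors)) fun p _ hp => by
            by_contra hc; exact hp (by simp only [hd]; rw [if_neg hc])).symm.le.trans
            (Finset.sum_le_sum_of_subset_of_nonneg
              (fun p hp => (Finset.mem_filter.1 hp).2) fun p _ _ => hd0 p)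
        have e2 : ∑ p ∈ N.primesBelow, (1 + h p) * (p : ℝ) ^ (-1 - σ) ≤
            C₀ - (1 + k) * Real.log σ := by
          have := hC₀ σ hσ hσ1 (N.primesBelow.subtype Nat.Prime) fun p => hpos p p.2
          refine le_trans (le_of_eq ?_) this
          exact (Finset.sum_subtype_of_mem (fun p : ℕ => (1 + h p) * (p : ℝ) ^ (-1 - σ))
            fun p hp => Nat.prime_of_mem_primesBelow hp).symm
        linarith
    _ = _ := by rw [Real.exp_add, ← Real.rpow_def_of_pos hσ]

theorem summable_corr (hmul : h.IsMultiplicative) (hA : AnalyticCondition h k)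
    (hpos : ∀ p : ℕ, p.Prime → 0 ≤ h p) {σ : ℝ} (hσ : 0 < σ) :
    Summable fun m : ℕ => |corr h a m| * (m : ℝ) ^ (-σ) := by
  obtain ⟨C, D, hC, hD, hb⟩ := exists_sum_abs_corr_le (a := a) hmul hA hpos
  have h1 : Summable fun m : ℕ => |corr h a m| * (m : ℝ) ^ (-(min σ (1 / 4))) :=
    summable_of_sum_le (fun m => by positivity) fun s =>
      hb _ (by positivity) (lt_of_le_of_lt (min_le_right _ _) (by norm_num)) s
  refine h1.of_nonneg_of_le (fun m => by positivity) fun m => ?_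
  rcases Nat.eq_zero_or_pos m with rfl | hm
  · simp
  · gcongr
    · exact_mod_cast hm
    · exact min_le_left _ _

end ArithSeq

end

/-! ### Euler product of the Dirichlet series of b, and its value at 0 -/

noncomputable section
namespace ArithSeq

/-- The exponential removes the linear term u, leaving a quadratic error. This makes the normalised
Euler product converge beyond Re w = 0. -/
theorem norm_one_add_mul_exp_neg_sub_one_le (u d : ℂ) :
    ‖(1 + u + d) * Complex.exp (-u) - 1‖ ≤ (2 * ‖u‖ ^ 2 + ‖d‖) * Real.exp ‖u‖ := by
  have h1 := Complex.norm_exp_sub_sum_le_norm_mul_exp (-u) 1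
  have h2 := Complex.norm_exp_sub_sum_le_norm_mul_exp (-u) 2
  simp only [Finset.sum_range_succ, Finset.sum_range_zero, zero_add, pow_zero, Nat.factorial_zero,
    Nat.cast_one, div_one, pow_one, Nat.factorial_one, norm_neg] at h1 h2
  have h3 : ‖Complex.exp (-u)‖ ≤ Real.exp ‖u‖ := by
    rw [Complex.norm_exp]
    exact Real.exp_le_exp.2 ((Complex.re_le_norm _).trans (norm_neg u).le)
  calc ‖(1 + u + d) * Complex.exp (-u) - 1‖
      = ‖(Complex.exp (-u) - (1 + -u)) + u * (Complex.exp (-u) - 1) + d * Complex.exp (-u)‖ := by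
        congr 1; ring
    _ ≤ ‖Complex.exp (-u) - (1 + -u)‖ + ‖u * (Complex.exp (-u) - 1)‖ + ‖d * Complex.exp (-u)‖ :=
        norm_add₃_le
    _ ≤ ‖u‖ ^ 2 * Real.exp ‖u‖ + ‖u‖ * (‖u‖ * Real.exp ‖u‖) + ‖d‖ * Real.exp ‖u‖ := by
        rw [norm_mul, norm_mul]; gcongr
    _ = _ := by ring

section TProd
variable {ι : Type} {F : ι → ℂ → ℂ} {Ω : Set ℂ} {u : ι → ℝ}

theorem differentiableOn_tprod_one_add (hu : Summable u) (hΩ : IsOpen Ω)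
    (hF : ∀ i, DifferentiableOn ℂ (F i) Ω) (hb : ∀ i, ∀ w ∈ Ω, ‖F i w - 1‖ ≤ u i) :
    DifferentiableOn ℂ (fun w => ∏' i, F i w) Ω := by
  have h1 := Summable.hasProdLocallyUniformlyOn_one_add (f := fun i w => F i w - 1) hΩ hu
    (Eventually.of_forall fun i w hw => hb i w hw)
    (fun i => ((hF i).continuousOn.sub continuousOn_const))
  simp only [add_sub_cancel] at h1
  exact h1.differentiableOn (Eventually.of_forall fun s => by
    simpa [Finset.prod_fn] using DifferentiableOn.finsetProd fun i _ => hF i) hΩ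

theorem multipliable_of_norm_sub_one_le (hu : Summable u) {G : ι → ℂ}
    (hb : ∀ i, ‖G i - 1‖ ≤ u i) : Multipliable G := by
  have := multipliable_one_add_of_summable (f := fun i => G i - 1)
    (hu.of_nonneg_of_le (fun _ => norm_nonneg _) hb)
  simpa using this

theorem norm_tprod_le (hu : Summable u) {G : ι → ℂ} (hb : ∀ i, ‖G i - 1‖ ≤ u i) :
    ‖∏' i, G i‖ ≤ Real.exp (∑' i, u i) := by
  have h1 := (multipliable_of_norm_sub_one_le hu hb).hasProd
  refine le_of_tendsto h1.norm (Eventually.of_forall fun s => ?_)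
  have h2 := Finset.norm_prod_one_add_sub_one_le s fun i => G i - 1
  simp only [add_sub_cancel] at h2
  have h3 : ∑ i ∈ s, ‖G i - 1‖ ≤ ∑' i, u i := (Finset.sum_le_sum fun i _ => hb i).trans
    (hu.sum_le_tsum s fun i _ => (norm_nonneg _).trans (hb i))
  have h4 : ‖∏ i ∈ s, G i‖ ≤ ‖∏ i ∈ s, G i - 1‖ + ‖(1 : ℂ)‖ := by
    simpa using norm_add_le (∏ i ∈ s, G i - 1) 1
  rw [norm_one] at h4
  change ∏ i ∈ s, ‖G i‖ ≤ _
  rw [← norm_prod]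
  linarith [Real.exp_le_exp.2 h3]

theorem tprod_ne_zero_of_norm_sub_one_le (hu : Summable u) {G : ι → ℂ}
    (hb : ∀ i, ‖G i - 1‖ ≤ u i) (h0 : ∀ i, G i ≠ 0) : ∏' i, G i ≠ 0 := by
  have := tprod_one_add_ne_zero_of_summable (f := fun i => G i - 1) (by simpa using h0)
    (hu.of_nonneg_of_le (fun _ => norm_nonneg _) hb)
  simpa using this

end TProd

theorem tendsto_primesUpTo_subtype :
    Tendsto (fun N => (primesUpTo N).subtype Nat.Prime) atTop atTop := by
  refine tendsto_atTop_finset_of_monotone (fun m n hmn p hp => ?_) fun p => ⟨p, ?_⟩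
  · rw [Finset.mem_subtype, primesUpTo, Finset.mem_filter, Finset.mem_Icc] at hp ⊢
    exact ⟨⟨hp.1.1, hp.1.2.trans hmn⟩, hp.2⟩
  · rw [Finset.mem_subtype, primesUpTo, Finset.mem_filter, Finset.mem_Icc]
    exact ⟨⟨p.2.one_le, le_rfl⟩, p.2⟩

theorem prime_of_mem_primesUpTo {N p : ℕ} (hp : p ∈ primesUpTo N) : p.Prime :=
  (Finset.mem_filter.1 hp).2

theorem tendsto_prod_primesUpTo {F : ℕ → ℂ} {y : ℂ} (hF : HasProd (fun p : Nat.Primes => F p) y) :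
    Tendsto (fun N => ∏ p ∈ primesUpTo N, F p) atTop (𝓝 y) :=
  (hF.comp tendsto_primesUpTo_subtype).congr fun _ =>
    Finset.prod_subtype_of_mem F fun _ hp => prime_of_mem_primesUpTo hp

theorem tendsto_sum_primesUpTo {F : ℕ → ℂ} {y : ℂ} (hF : HasSum (fun p : Nat.Primes => F p) y) :
    Tendsto (fun N => ∑ p ∈ primesUpTo N, F p) atTop (𝓝 y) :=
  (hF.comp tendsto_primesUpTo_subtype).congr fun _ =>
    Finset.sum_subtype_of_mem F fun _ hp => prime_of_mem_primesUpTo hp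

variable {h : ArithmeticFunction ℝ} {k : ℝ} {a : ℤ}

/-- The local factor at `p`, divided by `w` when it vanishes identically at `w = 0`. -/
def regFactor (h : ArithmeticFunction ℝ) (a : ℤ) (p : ℕ) (w : ℂ) : ℂ :=
  if p ∈ degeneratePrimes h a then
    dslope (fun w : ℂ => 1 - (p : ℂ) ^ (-w)) 0 w *
      ∑ e ∈ Finset.range (a.natAbs.factorization p + 1), (h (p ^ e) : ℂ) * ((p : ℂ) ^ (-w)) ^ e
  else localFactor h a p ((p : ℂ) ^ (-w))

/-- The regularised local factor, normalised to be close to `1`. -/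
def eulerTerm (h : ArithmeticFunction ℝ) (a : ℤ) (p : ℕ) (w : ℂ) : ℂ :=
  regFactor h a p w * Complex.exp (-(((1 - h p : ℝ) : ℂ) * (p : ℂ) ^ (-1 - w)))

/-- The convergent part of the Dirichlet series of `corr`. -/
def eulerProd (h : ArithmeticFunction ℝ) (a : ℤ) (w : ℂ) : ℂ :=
  ∏' p : Nat.Primes, eulerTerm h a p w

theorem mem_degeneratePrimes {p : ℕ} :
    p ∈ degeneratePrimes h a ↔ p ∈ a.natAbs.primeFactors ∧ localGap h a p = 0 := by
  rw [degeneratePrimes, Finset.mem_filter, localGap, sub_eq_zero]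

theorem prime_of_mem_degeneratePrimes {p : ℕ} (hp : p ∈ degeneratePrimes h a) : p.Prime :=
  Nat.prime_of_mem_primeFactors (mem_degeneratePrimes.1 hp).1

/-- At a degenerate prime the gap is zero, so the local factor is a multiple of 1 - p^{-w} and has a
zero at w = 0. Collecting these zeros gives the power w^ω. -/
theorem localFactor_eq_regFactor (p : ℕ) (w : ℂ) :
    localFactor h a p ((p : ℂ) ^ (-w)) =
      (if p ∈ degeneratePrimes h a then w else 1) * regFactor h a p w := by
  rw [regFactor]
  split_ifs with hp
  · have h1 := sub_smul_dslope (fun w : ℂ => 1 - (p : ℂ) ^ (-w)) 0 w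
    simp only [sub_zero, smul_eq_mul, neg_zero, Complex.cpow_zero, sub_self] at h1
    rw [localFactor, (mem_degeneratePrimes.1 hp).2, zero_mul, Complex.ofReal_zero, zero_mul,
      add_zero, ← mul_assoc, h1]
  · rw [one_mul]

theorem differentiable_prime_cpow_neg {p : ℕ} (hp : p.Prime) :
    Differentiable ℂ fun w : ℂ => (p : ℂ) ^ (-w) := fun w =>
  DifferentiableAt.const_cpow (by fun_prop) (Or.inl (by exact_mod_cast hp.ne_zero))

theorem differentiable_localFactor (p : ℕ) : Differentiable ℂ (localFactor h a p) := by
  unfold localFactor; fun_prop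

theorem differentiableOn_eulerTerm {p : ℕ} (hp : p.Prime) :
    DifferentiableOn ℂ (eulerTerm h a p) (wideStrip (1 / 4)) := by
  have hz := differentiable_prime_cpow_neg hp
  have hv : Differentiable ℂ fun w : ℂ => (p : ℂ) ^ (-1 - w) := fun w =>
    DifferentiableAt.const_cpow (by fun_prop) (Or.inl (by exact_mod_cast hp.ne_zero))
  refine DifferentiableOn.fun_mul ?_ (hv.differentiableOn.const_mul _).fun_neg.cexp
  unfold regFactor
  split_ifs with hd
  · refine DifferentiableOn.fun_mul ?_ (DifferentiableOn.fun_sum fun e _ =>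
      (hz.differentiableOn.fun_pow e).const_mul _)
    rw [Complex.differentiableOn_dslope ((isOpen_wideStrip _).mem_nhds
      (zero_mem_wideStrip (by norm_num)))]
    exact hz.differentiableOn.const_sub 1
  · exact ((differentiable_localFactor p).comp hz).differentiableOn

theorem norm_prime_cpow_neg_le {p : ℕ} (hp : p.Prime) {w : ℂ} (hw : w ∈ wideStrip (1 / 4)) :
    ‖(p : ℂ) ^ (-w)‖ ≤ p := by
  rw [Complex.norm_natCast_cpow_of_pos hp.pos]
  calc ((p : ℝ)) ^ (-w).re ≤ (p : ℝ) ^ (1 : ℝ) :=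
        Real.rpow_le_rpow_of_exponent_le (by exact_mod_cast hp.one_le)
          (by rw [Complex.neg_re]; linarith [hw.1])
    _ = p := Real.rpow_one _

/-- The divided difference is bounded by the supremum of the derivative, by the mean value
inequality on the convex strip. At w = 0 it is the derivative itself. -/
theorem norm_dslope_le {p : ℕ} (hp : p.Prime) {w : ℂ} (hw : w ∈ wideStrip (1 / 4)) :
    ‖dslope (fun w : ℂ => 1 - (p : ℂ) ^ (-w)) 0 w‖ ≤ p * Real.log p := by
  have hp0 : (p : ℂ) ≠ 0 := by exact_mod_cast hp.ne_zero
  have hlog : ‖Complex.log p‖ = Real.log p := by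
    rw [← Complex.natCast_log, Complex.norm_real, Real.norm_of_nonneg (Real.log_natCast_nonneg p)]
  have hd : ∀ z : ℂ, HasDerivAt (fun w : ℂ => 1 - (p : ℂ) ^ (-w))
      ((p : ℂ) ^ (-z) * Complex.log p) z := fun z => by
    have := ((hasDerivAt_neg z).const_cpow (c := (p : ℂ)) (Or.inl hp0)).const_sub 1
    simpa using this
  have hb : ∀ z ∈ wideStrip (1 / 4), ‖(p : ℂ) ^ (-z) * Complex.log p‖ ≤ p * Real.log p := by
    intro z hz
    rw [norm_mul, hlog]
    exact mul_le_mul_of_nonneg_right (norm_prime_cpow_neg_le hp hz) (Real.log_natCast_nonneg p)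
  rcases eq_or_ne w 0 with rfl | h0
  · rw [dslope_same, (hd 0).deriv]
    exact hb _ hw
  · have hconv : Convex ℝ (wideStrip (1 / 4)) := by
      have : wideStrip (1 / 4) = Complex.re ⁻¹' Set.Ioo (-(1 / 4)) (1 / 2 + 1 / 4) := rfl
      rw [this]
      exact (convex_Ioo _ _).linear_preimage Complex.reLm
    have h1 := hconv.norm_image_sub_le_of_norm_hasDerivWithin_le
      (fun z _ => (hd z).hasDerivWithinAt) hb (zero_mem_wideStrip (by norm_num)) hw
    rw [dslope_of_ne _ h0, slope_def_field, norm_div, div_le_iff₀ (by simpa using h0)]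
    exact h1

theorem exists_norm_regFactor_le {p : ℕ} (hp : p.Prime) :
    ∃ C : ℝ, ∀ w ∈ wideStrip (1 / 4), ‖regFactor h a p w‖ ≤ C := by
  have hK := isCompact_closedBall (0 : ℂ) (p : ℝ)
  obtain ⟨C₁, h1⟩ := hK.exists_bound_of_continuousOn
    (differentiable_localFactor (h := h) (a := a) p).continuous.continuousOn
  obtain ⟨C₂, h2⟩ := hK.exists_bound_of_continuousOn
    (f := fun z : ℂ => ∑ e ∈ Finset.range (a.natAbs.factorization p + 1), (h (p ^ e) : ℂ) * z ^ e)
    (by fun_prop)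
  refine ⟨max (p * Real.log p * C₂) C₁, fun w hw => ?_⟩
  have hz : (p : ℂ) ^ (-w) ∈ Metric.closedBall (0 : ℂ) (p : ℝ) := by
    simpa using norm_prime_cpow_neg_le hp hw
  rw [regFactor]
  split_ifs
  · refine le_trans ?_ (le_max_left _ _)
    rw [norm_mul]
    refine mul_le_mul (norm_dslope_le hp hw) (h2 _ hz) (norm_nonneg _) ?_
    have := Real.log_natCast_nonneg p
    positivity
  · exact (h1 _ hz).trans (le_max_right _ _)

theorem exists_norm_eulerTerm_le {p : ℕ} (hp : p.Prime) :
    ∃ C : ℝ, ∀ w ∈ wideStrip (1 / 4), ‖eulerTerm h a p w - 1‖ ≤ C := by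
  obtain ⟨C, hC⟩ := exists_norm_regFactor_le (h := h) (a := a) hp
  refine ⟨C * Real.exp |1 - h p| + 1, fun w hw => (norm_sub_le _ _).trans ?_⟩
  rw [norm_one, eulerTerm, norm_mul]
  have h1 : ‖(p : ℂ) ^ (-1 - w)‖ ≤ 1 :=
    (norm_prime_cpow_le ⟨p, hp⟩ hw.1.le).trans
      ((prime_rpow_le_of_quarter ⟨p, hp⟩).trans (by norm_num))
  have h2 : ‖Complex.exp (-(((1 - h p : ℝ) : ℂ) * (p : ℂ) ^ (-1 - w)))‖ ≤ Real.exp |1 - h p| := by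
    rw [Complex.norm_exp]
    refine Real.exp_le_exp.2 ((Complex.re_le_norm _).trans ?_)
    rw [norm_neg, norm_mul, Complex.norm_real, Real.norm_eq_abs]
    exact mul_le_of_le_one_right (abs_nonneg _) h1
  have h3 := hC w hw
  gcongr
  exact (norm_nonneg _).trans h3

/-- With |1 - h(p)| ≪ p^{1/8} and |p^{-1-w}| ≤ p^{-3/4}, the linear term is O(p^{-5/8}). Its square,
and the correction from 1/(p - 1) in place of 1/p, are then O(p^{-5/4}), which is summable. -/
theorem exists_norm_eulerTerm_le_of_not_dvd (hmul : h.IsMultiplicative) (hA : AnalyticCondition h k) :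
    ∃ C : ℝ, ∀ p : ℕ, p.Prime → a.natAbs.factorization p = 0 → ∀ w ∈ wideStrip (1 / 4),
      ‖eulerTerm h a p w - 1‖ ≤ C * (p : ℝ) ^ (-(5 / 4) : ℝ) := by
  obtain ⟨C, hC⟩ := ((SubPoly.const 1).sub hA.subPoly) (1 / 8) (by norm_num)
  have hC0 : 0 ≤ C := by simpa using (abs_nonneg _).trans (hC 1 le_rfl)
  refine ⟨(2 * C ^ 2 + 2 * C) * Real.exp C, fun p hp hF w hw => ?_⟩
  have hpr : (2 : ℝ) ≤ p := by exact_mod_cast hp.two_le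
  have hp0 : (p : ℂ) ≠ 0 := by exact_mod_cast hp.ne_zero
  have hp1 : (p : ℂ) - 1 ≠ 0 := sub_ne_zero.2 (by exact_mod_cast hp.one_lt.ne')
  have hdeg : p ∉ degeneratePrimes h a := fun hd => by
    have := (mem_degeneratePrimes.1 hd).1
    rw [← Nat.support_factorization, Finsupp.mem_support_iff] at this
    exact this hF
  set u : ℂ := ((1 - h p : ℝ) : ℂ) * (p : ℂ) ^ (-1 - w) with hu
  have hun : ‖u‖ ≤ C * (p : ℝ) ^ (-(5 / 8) : ℝ) := by
    rw [hu, norm_mul, Complex.norm_real, Real.norm_eq_abs]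
    calc _ ≤ (C * (p : ℝ) ^ (1 / 8 : ℝ)) * (p : ℝ) ^ (1 / 4 - 1 : ℝ) :=
          mul_le_mul (hC p hp.one_le) (norm_prime_cpow_le ⟨p, hp⟩ hw.1.le) (norm_nonneg _)
            (by positivity)
      _ = _ := by rw [mul_assoc, ← Real.rpow_add (by linarith)]; norm_num
  have hu1 : ‖u‖ ≤ C := hun.trans (mul_le_of_le_one_right hC0
    (Real.rpow_le_one_of_one_le_of_nonpos (by linarith) (by norm_num)))
  have hE : regFactor h a p w = 1 + u + u / (p - 1) := by
    rw [regFactor, if_neg hdeg, localFactor_of_not_dvd hmul hp hF, hu, Complex.cpow_sub _ _ hp0,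
      Complex.cpow_neg_one, Complex.cpow_neg]
    field_simp
    ring
  have hd : ‖u / (p - 1)‖ ≤ 2 * C * (p : ℝ) ^ (-(5 / 4) : ℝ) := by
    have e1 : ‖(p : ℂ) - 1‖ = p - 1 := by
      rw [← Complex.ofReal_natCast, ← Complex.ofReal_one, ← Complex.ofReal_sub, Complex.norm_real,
        Real.norm_of_nonneg (by linarith)]
    have h3 : ((p : ℝ) - 1)⁻¹ ≤ 2 * (p : ℝ) ^ (-(5 / 8) : ℝ) := by
      have : ((p : ℝ) - 1)⁻¹ ≤ 2 * (p : ℝ) ^ (-1 : ℝ) := by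
        rw [Real.rpow_neg_one, ← div_eq_mul_inv, inv_le_comm₀ (by linarith) (by positivity), inv_div]
        linarith
      exact this.trans (by gcongr <;> linarith)
    have h4 : 0 ≤ ((p : ℝ) - 1)⁻¹ := inv_nonneg.2 (by linarith)
    rw [norm_div, e1, div_eq_mul_inv]
    calc _ ≤ (C * (p : ℝ) ^ (-(5 / 8) : ℝ)) * (2 * (p : ℝ) ^ (-(5 / 8) : ℝ)) := by gcongr
      _ = 2 * C * ((p : ℝ) ^ (-(5 / 8) : ℝ) * (p : ℝ) ^ (-(5 / 8) : ℝ)) := by ring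
      _ = _ := by rw [← Real.rpow_add (by linarith)]; norm_num
  have hsq : ‖u‖ ^ 2 ≤ C ^ 2 * (p : ℝ) ^ (-(5 / 4) : ℝ) := by
    calc ‖u‖ ^ 2 ≤ (C * (p : ℝ) ^ (-(5 / 8) : ℝ)) ^ 2 := by gcongr
      _ = C ^ 2 * ((p : ℝ) ^ (-(5 / 8) : ℝ) * (p : ℝ) ^ (-(5 / 8) : ℝ)) := by ring
      _ = _ := by rw [← Real.rpow_add (by linarith)]; norm_num
  rw [eulerTerm, hE, ← hu]
  refine (norm_one_add_mul_exp_neg_sub_one_le u _).trans ?_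
  calc _ ≤ (2 * (C ^ 2 * (p : ℝ) ^ (-(5 / 4) : ℝ)) + 2 * C * (p : ℝ) ^ (-(5 / 4) : ℝ)) * Real.exp C := by
        gcongr
    _ = _ := by ring

theorem exists_summable_eulerTerm (hmul : h.IsMultiplicative) (hA : AnalyticCondition h k) :
    ∃ u : Nat.Primes → ℝ, Summable u ∧ ∀ p : Nat.Primes, ∀ w ∈ wideStrip (1 / 4),
      ‖eulerTerm h a p w - 1‖ ≤ u p := by
  classical
  obtain ⟨C, hC⟩ := exists_norm_eulerTerm_le_of_not_dvd (a := a) hmul hA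
  choose D hD using fun p : Nat.Primes => exists_norm_eulerTerm_le (h := h) (a := a) p.2
  have hs : Summable fun p : Nat.Primes => C * ((p : ℕ) : ℝ) ^ (-(5 / 4) : ℝ) :=
    (Nat.Primes.summable_rpow.2 (by norm_num)).mul_left C
  refine ⟨fun p => if (p : ℕ) ∈ a.natAbs.primeFactors then D p else
    C * ((p : ℕ) : ℝ) ^ (-(5 / 4) : ℝ), ?_, fun p w hw => ?_⟩
  · refine (summable_congr_cofinite ?_).2 hs
    refine Set.Finite.subset (Finset.finite_toSet (a.natAbs.primeFactors.subtype Nat.Prime)) ?_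
    intro p hp
    by_contra hc
    simp only [Finset.mem_coe, Finset.mem_subtype] at hc
    exact hp (if_neg hc)
  · dsimp only
    split_ifs with hp
    · exact hD p w hw
    · refine hC p p.2 ?_ w hw
      rwa [← Nat.support_factorization, Finsupp.notMem_support_iff] at hp

theorem differentiableOn_eulerProd (hmul : h.IsMultiplicative) (hA : AnalyticCondition h k) :
    DifferentiableOn ℂ (eulerProd h a) (wideStrip (1 / 4)) := by
  obtain ⟨u, hu, hb⟩ := exists_summable_eulerTerm (a := a) hmul hA
  exact differentiableOn_tprod_one_add hu (isOpen_wideStrip _)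
    (fun p => differentiableOn_eulerTerm p.2) hb

theorem tame_eulerProd (hmul : h.IsMultiplicative) (hA : AnalyticCondition h k) (n : ℕ) :
    Tame (wideStrip 0) 0 n (eulerProd h a) := by
  obtain ⟨u, hu, hb⟩ := exists_summable_eulerTerm (a := a) hmul hA
  exact Tame.of_wideStrip (by norm_num) n (differentiableOn_eulerProd hmul hA)
    (PolyBdd.of_bounded fun w hw => norm_tprod_le hu fun p => hb p w hw)

theorem hasProd_eulerProd (hmul : h.IsMultiplicative) (hA : AnalyticCondition h k) {w : ℂ}
    (hw : w ∈ wideStrip (1 / 4)) :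
    HasProd (fun p : Nat.Primes => eulerTerm h a p w) (eulerProd h a w) := by
  obtain ⟨u, hu, hb⟩ := exists_summable_eulerTerm (a := a) hmul hA
  exact (multipliable_of_norm_sub_one_le hu fun p => hb p w hw).hasProd

theorem regFactor_zero {p : ℕ} (hp : p.Prime) :
    regFactor h a p 0 = ((if p ∈ degeneratePrimes h a then
      Real.log p * ∑ e ∈ Finset.range (a.natAbs.factorization p + 1), h (p ^ e) else
      localGap h a p / (1 - 1 / p) : ℝ) : ℂ) := by
  have hp0 : (p : ℂ) ≠ 0 := by exact_mod_cast hp.ne_zero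
  have hp1 : (p : ℂ) - 1 ≠ 0 := sub_ne_zero.2 (by exact_mod_cast hp.one_lt.ne')
  rw [regFactor]
  split_ifs with hd
  · have h1 := ((hasDerivAt_neg (0 : ℂ)).const_cpow (c := (p : ℂ)) (Or.inl hp0)).const_sub 1
    rw [dslope_same, h1.deriv]
    push_cast
    simp
  · rw [localFactor]
    push_cast
    simp only [neg_zero, Complex.cpow_zero, sub_self, zero_mul, zero_add, one_pow, mul_one]
    field_simp

theorem one_le_sum_prime_pow (hmul : h.IsMultiplicative)
    (hpp : ∀ p : ℕ, p.Prime → ∀ e, 0 ≤ h (p ^ e)) {p : ℕ} (hp : p.Prime) (n : ℕ) :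
    1 ≤ ∑ e ∈ Finset.range (n + 1), h (p ^ e) := by
  rw [Finset.sum_range_succ', pow_zero, hmul.map_one]
  have : 0 ≤ ∑ e ∈ Finset.range n, h (p ^ (e + 1)) := Finset.sum_nonneg fun e _ => hpp p hp _
  linarith

theorem localGap_ne_zero (hmul : h.IsMultiplicative) (hA : AnalyticCondition h k) {p : ℕ}
    (hp : p.Prime) (hd : p ∉ degeneratePrimes h a) : localGap h a p ≠ 0 := by
  by_cases hpa : p ∈ a.natAbs.primeFactors
  · exact fun h0 => hd (mem_degeneratePrimes.2 ⟨hpa, h0⟩)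
  · rw [← Nat.support_factorization, Finsupp.notMem_support_iff] at hpa
    have hpr : (0 : ℝ) < p := by exact_mod_cast hp.pos
    rw [localGap, hpa, pow_zero, hmul.map_one, zero_add, pow_one, sub_ne_zero, ne_eq, eq_comm,
      div_eq_one_iff_eq hpr.ne']
    exact (hA.2.2.2.2.1 p hp).ne

/-- A convergent product without zero factors. Nonvanishing keeps the leading coefficient of the
expansion away from 0, so that lower order terms are relatively small. -/
theorem eulerProd_zero_ne_zero (hmul : h.IsMultiplicative) (hA : AnalyticCondition h k)
    (hpp : ∀ p : ℕ, p.Prime → ∀ e, 0 ≤ h (p ^ e)) : eulerProd h a 0 ≠ 0 := by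
  obtain ⟨u, hu, hb⟩ := exists_summable_eulerTerm (a := a) hmul hA
  refine tprod_ne_zero_of_norm_sub_one_le hu
    (fun p => hb p 0 (zero_mem_wideStrip (by norm_num))) fun p => ?_
  refine mul_ne_zero ?_ (Complex.exp_ne_zero _)
  have h1 : (1 : ℝ) < (p : ℕ) := by exact_mod_cast p.2.one_lt
  rw [regFactor_zero p.2, Complex.ofReal_ne_zero]
  split_ifs with hd
  · exact mul_ne_zero (Real.log_pos h1).ne'
      (by linarith [one_le_sum_prime_pow hmul hpp p.2 (a.natAbs.factorization p)] : (0 : ℝ) < _).ne'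
  · refine div_ne_zero (localGap_ne_zero hmul hA p.2 hd) ?_
    rw [sub_ne_zero, ne_eq, eq_comm, div_eq_one_iff_eq (by positivity)]; exact h1.ne

theorem hasProd_primes_ite (d : Finset ℕ) (hdp : ∀ p ∈ d, p.Prime) (w : ℂ) :
    HasProd (fun p : Nat.Primes => if (p : ℕ) ∈ d then w else 1) (w ^ d.card) := by
  have h1 : HasProd (fun p : Nat.Primes => if (p : ℕ) ∈ d then w else 1)
      (∏ p ∈ d.subtype Nat.Prime, if (p : ℕ) ∈ d then w else 1) :=
    hasProd_prod_of_ne_finset_one fun p hp => if_neg fun hc => hp (Finset.mem_subtype.2 hc)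
  have h2 : (∏ p ∈ d.subtype Nat.Prime, if (p : ℕ) ∈ d then w else 1) = w ^ d.card := by
    rw [Finset.prod_subtype_of_mem (fun p : ℕ => if p ∈ d then w else 1) hdp, ← Finset.prod_const]
    exact Finset.prod_congr rfl fun p hp => if_pos hp
  rwa [h2] at h1

/-- The Dirichlet series of `corr` in its half-plane of absolute convergence. -/
theorem LSeries_corr_eq (hmul : h.IsMultiplicative) (hA : AnalyticCondition h k)
    (hpos : ∀ p : ℕ, p.Prime → 0 ≤ h p) {w : ℂ} (hw : w ∈ wideStrip 0) :
    LSeries (fun m => (corr h a m : ℂ)) w =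
      w ^ ((k - 1 + omegaH h a : ℝ) : ℂ) * (mainFactor h k w * eulerProd h a w) := by
  classical
  have hw0 := re_pos_of_mem hw
  have hwne : w ≠ 0 := by rintro rfl; simp at hw0
  set F : ℕ → ℂ := fun m => (corr h a m : ℂ) * (m : ℂ) ^ (-w) with hF
  have hFs : Summable fun m => ‖F m‖ := by
    refine (summable_corr (a := a) hmul hA hpos hw0).congr fun m => ?_
    rcases Nat.eq_zero_or_pos m with rfl | hm
    · simp [hF]
    · simp only [hF]
      rw [norm_mul, Complex.norm_real, Real.norm_eq_abs, Complex.norm_natCast_cpow_of_pos hm,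
        Complex.neg_re]
  have hF0 : F 0 = 0 := by simp [hF]
  have hF1 : F 1 = 1 := by simp [hF, corr_isMultiplicative.map_one]
  have hFm : ∀ {m n : ℕ}, m.Coprime n → F (m * n) = F m * F n := fun {m n} hmn => by
    simp only [hF]
    rw [corr_isMultiplicative.map_mul_of_coprime hmn, Nat.cast_mul, Complex.natCast_mul_natCast_cpow]
    push_cast; ring
  have hL : LSeries (fun m => (corr h a m : ℂ)) w = ∑' n, F n := by
    rw [LSeries]
    refine tsum_congr fun m => ?_
    rcases Nat.eq_zero_or_pos m with rfl | hm
    · simp [hF]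
    · rw [LSeries.term_of_ne_zero hm.ne']
      simp only [hF]
      rw [Complex.cpow_neg, div_eq_mul_inv]
  have h1 := EulerProduct.eulerProduct_hasProd hF1 hFm hFs hF0
  have h2 : ∀ p : Nat.Primes, ∑' e, F ((p : ℕ) ^ e) = localFactor h a p (((p : ℕ) : ℂ) ^ (-w)) := by
    intro p
    rw [← (hasSum_localFactor hmul p.2 _).tsum_eq]
    refine tsum_congr fun e => ?_
    simp only [hF]
    rw [Nat.cast_pow, ← Complex.natCast_cpow_natCast_mul, ← Complex.cpow_nat_mul]
  have h3 := hasProd_eulerProd (a := a) hmul hA (wideStrip_zero_subset hw)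
  have h4 := (hasSum_primeCoeff ((SubPoly.const 1).sub hA.subPoly) hw0).cexp
  have h5 := hasProd_primes_ite (degeneratePrimes h a)
    (fun p hp => prime_of_mem_degeneratePrimes hp) w
  -- Three products are combined: the zeros at degenerate primes, the normalised factors, and the
  -- exponentials that undo the normalisation.
  have h6 := ((h5.mul h3).mul h4)
  have h7 := h1.unique (h6.congr_fun fun p => by
    rw [h2 p, localFactor_eq_regFactor, eulerTerm, Function.comp_apply, mul_assoc, mul_assoc,
      ← Complex.exp_add, neg_add_cancel, Complex.exp_zero, mul_one])
  rw [hL, h7, mainFactor_eq hA hw, ← omegaH]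
  have h8 : w ^ ((k - 1 + omegaH h a : ℝ) : ℂ) * w ^ (1 - k : ℂ) = w ^ omegaH h a := by
    rw [← Complex.cpow_add _ _ hwne, ← Complex.cpow_natCast]
    congr 1; push_cast; ring
  rw [← h8]; ring

/-- The infinite product, together with the finite one, is the value at `0` of the analytic part of
the Dirichlet series of `corr`. -/
theorem tendsto_partialProduct_mul (hmul : h.IsMultiplicative) (hA : AnalyticCondition h k) {ℓ : ℝ}
    (hℓ : Tendsto (fun N : ℕ => ∑ p ∈ primesUpTo N, (h p - k) / (p : ℝ)) atTop (𝓝 ℓ)) :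
    Tendsto (fun N => ((partialProduct h k a N * degenerateProduct h k a : ℝ) : ℂ)) atTop
      (𝓝 (eulerProd h a 0 * Complex.exp ((1 - k) * primeLogSum 0 - ℓ))) := by
  have h0 := zero_mem_wideStrip (r := 1 / 4) (by norm_num)
  have h1 := tendsto_prod_primesUpTo (F := fun p => eulerTerm h a p 0)
    (hasProd_eulerProd (a := a) hmul hA h0)
  have h2 := tendsto_sum_primesUpTo
    (F := fun p => Complex.log (1 - (p : ℂ) ^ (-1 - (0 : ℂ))) + (p : ℂ) ^ (-1 - (0 : ℂ)))
    (summable_primeLogTerm h0).hasSum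
  have h3 := h1.mul (((Complex.continuous_exp.tendsto _).comp
    ((h2.const_mul (1 - k : ℂ)).sub ((Complex.continuous_ofReal.tendsto _).comp hℓ))))
  refine h3.congr' ?_
  -- From here on every degenerate prime, being a divisor of a, is among the primes up to N.
  filter_upwards [eventually_ge_atTop a.natAbs] with N hN
  have hsub : degeneratePrimes h a ⊆ primesUpTo N := fun p hp => by
    have hp1 := (mem_degeneratePrimes.1 hp).1
    rw [primesUpTo, Finset.mem_filter, Finset.mem_Icc]
    exact ⟨⟨(Nat.prime_of_mem_primeFactors hp1).one_le, (Nat.le_of_mem_primeFactors hp1).trans hN⟩,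
      Nat.prime_of_mem_primeFactors hp1⟩
  -- Both kinds of factor become the regularised factor at w = 0 times (1 - 1/p)^{1-k}. This
  -- explains the different exponents k and k - 1 in μ.
  have e1 : partialProduct h k a N * degenerateProduct h k a = ∏ p ∈ primesUpTo N,
      ((if p ∈ degeneratePrimes h a then
        Real.log p * ∑ e ∈ Finset.range (a.natAbs.factorization p + 1), h (p ^ e) else
        localGap h a p / (1 - 1 / p)) * (1 - 1 / (p : ℝ)) ^ (1 - k)) := by
    rw [partialProduct, degenerateProduct, ← Finset.prod_sdiff hsub]
    congr 1
    · refine Finset.prod_congr rfl fun p hp => ?_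
      obtain ⟨hp1, hp2⟩ := Finset.mem_sdiff.1 hp
      have h1p : (1 : ℝ) < p := by exact_mod_cast (prime_of_mem_primesUpTo hp1).one_lt
      have hpos : 0 < 1 - 1 / (p : ℝ) := by
        rw [sub_pos, div_lt_one (by linarith)]; exact h1p
      rw [if_neg hp2, ← localGap, Real.rpow_sub hpos, Real.rpow_one, div_mul_div_cancel₀ hpos.ne']
    · refine Finset.prod_congr rfl fun p hp => ?_
      have h1p : (1 : ℝ) < p := by exact_mod_cast (prime_of_mem_degeneratePrimes hp).one_lt
      have hpos : 0 < 1 - 1 / (p : ℝ) := by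
        rw [sub_pos, div_lt_one (by linarith)]; exact h1p
      rw [if_pos hp, show 1 - k = -(k - 1) by ring, Real.rpow_neg hpos.le]
      field_simp
  simp only [Function.comp]
  rw [e1, Finset.mul_sum, Complex.ofReal_sum, ← Finset.sum_sub_distrib,
    Complex.exp_sum, ← Finset.prod_mul_distrib, Complex.ofReal_prod]
  refine Finset.prod_congr rfl fun p hp => ?_
  have hpp := prime_of_mem_primesUpTo hp
  have h1p : (1 : ℝ) < p := by exact_mod_cast hpp.one_lt
  have hpos : 0 < 1 - 1 / (p : ℝ) := by
    rw [sub_pos, div_lt_one (by linarith)]; exact h1p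
  rw [eulerTerm, regFactor_zero hpp, Complex.ofReal_mul, mul_assoc, ← Complex.exp_add,
    Real.rpow_def_of_pos hpos, Complex.ofReal_exp, sub_zero, Complex.cpow_neg_one]
  -- The terms in 1/p cancel because -(1 - h(p)) + (1 - k) - (h(p) - k) = 0, leaving (1 - k) log(1 -
  -- 1/p).
  congr 2
  rw [show (1 : ℂ) - (p : ℂ)⁻¹ = ((1 - 1 / (p : ℝ) : ℝ) : ℂ) by push_cast; ring,
    ← Complex.ofReal_log hpos.le]
  push_cast
  field_simp
  ring

theorem degenerateProduct_pos (hmul : h.IsMultiplicative)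
    (hpp : ∀ p : ℕ, p.Prime → ∀ e, 0 ≤ h (p ^ e)) : 0 < degenerateProduct h k a := by
  refine Finset.prod_pos fun p hp => ?_
  have hp' := prime_of_mem_degeneratePrimes hp
  have h1p : (1 : ℝ) < p := by exact_mod_cast hp'.one_lt
  have hpos : 0 < 1 - 1 / (p : ℝ) := by
    rw [sub_pos, div_lt_one (by linarith)]; exact h1p
  have := one_le_sum_prime_pow hmul hpp hp' (a.natAbs.factorization p)
  exact mul_pos (div_pos (by linarith) (Real.rpow_pos_of_pos hpos _)) (Real.log_pos h1p)

theorem tendsto_partialProduct (hmul : h.IsMultiplicative) (hA : AnalyticCondition h k)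
    (hpp : ∀ p : ℕ, p.Prime → ∀ e, 0 ≤ h (p ^ e)) :
    Tendsto (partialProduct h k a) atTop (𝓝 (singularProduct h k a)) := by
  obtain ⟨ℓ, hℓ⟩ := hA.2.1
  have h1 := (Complex.continuous_re.tendsto _).comp (tendsto_partialProduct_mul (a := a) hmul hA hℓ)
  have h2 := h1.mul_const (degenerateProduct h k a)⁻¹
  have hd := (degenerateProduct_pos (k := k) (a := a) hmul hpp).ne'
  have h3 : Tendsto (partialProduct h k a) atTop _ := h2.congr fun N => by
    simp only [Function.comp, Complex.ofReal_re]
    field_simp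
  rw [singularProduct, h3.limUnder_eq]
  exact h3

theorem ofReal_degenerateProduct_mul (hmul : h.IsMultiplicative) (hA : AnalyticCondition h k)
    (hpp : ∀ p : ℕ, p.Prime → ∀ e, 0 ≤ h (p ^ e)) {ℓ : ℝ}
    (hℓ : Tendsto (fun N : ℕ => ∑ p ∈ primesUpTo N, (h p - k) / (p : ℝ)) atTop (𝓝 ℓ)) :
    ((degenerateProduct h k a * singularProduct h k a : ℝ) : ℂ) =
      eulerProd h a 0 * Complex.exp ((1 - k) * primeLogSum 0 - ℓ) := by
  refine tendsto_nhds_unique ?_ (tendsto_partialProduct_mul (a := a) hmul hA hℓ)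
  refine (Complex.continuous_ofReal.tendsto _).comp ?_
  rw [mul_comm]
  exact (tendsto_partialProduct hmul hA hpp).mul_const _

theorem singularProduct_ne_zero (hmul : h.IsMultiplicative) (hA : AnalyticCondition h k)
    (hpp : ∀ p : ℕ, p.Prime → ∀ e, 0 ≤ h (p ^ e)) : singularProduct h k a ≠ 0 := by
  obtain ⟨ℓ, hℓ⟩ := hA.2.1
  intro h0
  have := ofReal_degenerateProduct_mul (a := a) hmul hA hpp hℓ
  rw [h0, mul_zero, Complex.ofReal_zero, eq_comm] at this
  exact mul_ne_zero (eulerProd_zero_ne_zero hmul hA hpp) (Complex.exp_ne_zero _) this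

end ArithSeq

end

/-! ### Harmonic sums and the kernel P, with its limit 1/2 -/

noncomputable section
namespace ArithSeq

section Harmonic

/-- The harmonic sum `∑_{1 ≤ n ≤ u} 1 / n`. -/
def harm (N : ℕ) : ℝ := ∑ n ∈ Finset.Icc 1 N, (1 : ℝ) / n

theorem harm_succ (N : ℕ) : harm (N + 1) = harm N + 1 / ((N : ℝ) + 1) := by
  rw [harm, harm, Finset.sum_Icc_succ_top (by omega)]; push_cast; rfl

theorem tendsto_harm : Tendsto (fun N : ℕ => harm N - Real.log N) atTop
    (𝓝 Real.eulerMascheroniConstant) := by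
  refine Real.tendsto_harmonic_sub_log.congr fun N => ?_
  rw [harm, harmonic_eq_sum_Icc]; push_cast; simp

/-- This is y ≤ sinh y at y = log(1 + x). -/
theorem log_one_add_le {x : ℝ} (hx : 0 ≤ x) :
    Real.log (1 + x) ≤ x * (2 + x) / (2 * (1 + x)) := by
  have h1 := Real.self_le_sinh_iff.2 (Real.log_nonneg (by linarith : 1 ≤ 1 + x))
  rw [Real.sinh_log (by linarith)] at h1
  refine h1.trans_eq ?_
  field_simp
  ring

/-- The trapezoidal rule for 1/t overestimates by convexity. The defect is bounded by a telescoping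
difference, in the form needed for `harm_bounds`. -/
theorem log_succ_sub_bounds {N : ℕ} (hN : 1 ≤ N) :
    Real.log ((N : ℝ) + 1) - Real.log N ≤ 1 / 2 * (1 / (N : ℝ) + 1 / ((N : ℝ) + 1)) ∧
    1 / 2 * (1 / (N : ℝ) + 1 / ((N : ℝ) + 1)) - 1 / 8 * (1 / (N : ℝ) ^ 2 - 1 / ((N : ℝ) + 1) ^ 2) ≤
      Real.log ((N : ℝ) + 1) - Real.log N := by
  have hN0 : (1 : ℝ) ≤ N := by exact_mod_cast hN
  have e1 : Real.log ((N : ℝ) + 1) - Real.log N = Real.log (1 + 1 / (N : ℝ)) := by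
    rw [← Real.log_div (by positivity) (by positivity)]; congr 1; field_simp
  rw [e1]
  constructor
  · refine (log_one_add_le (by positivity)).trans_eq ?_
    field_simp; ring
  · refine le_trans ?_ (Real.le_log_one_add_of_nonneg (by positivity))
    have e2 : 2 * (1 / (N : ℝ)) / (1 / (N : ℝ) + 2) = 2 / (1 + 2 * N) := by field_simp
    rw [e2, ← sub_nonneg]
    have e3 : 2 / (1 + 2 * (N : ℝ)) - (1 / 2 * (1 / (N : ℝ) + 1 / ((N : ℝ) + 1)) -
        1 / 8 * (1 / (N : ℝ) ^ 2 - 1 / ((N : ℝ) + 1) ^ 2)) =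
        1 / (8 * N ^ 2 * (N + 1) ^ 2 * (1 + 2 * N)) := by
      field_simp; ring
    rw [e3]; positivity

/-- The sequence H_N - log N - 1/(2N) increases, and it decreases after 1/(8N²) is added. Both
converge to γ. -/
theorem harm_bounds {N : ℕ} (hN : 1 ≤ N) :
    harm N - Real.log N - 1 / (2 * N) ≤ Real.eulerMascheroniConstant ∧
    Real.eulerMascheroniConstant ≤ harm N - Real.log N - 1 / (2 * N) + 1 / (8 * (N : ℝ) ^ 2) := by
  have ht : Tendsto (fun n : ℕ => 1 / (2 * ((n : ℝ)))) atTop (𝓝 0) := by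
    simpa using (tendsto_one_div_atTop_nhds_zero_nat (𝕜 := ℝ)).mul_const (2⁻¹)
  have ht2 : Tendsto (fun n : ℕ => 1 / (8 * (n : ℝ) ^ 2)) atTop (𝓝 0) := by
    have := ((tendsto_one_div_atTop_nhds_zero_nat (𝕜 := ℝ)).pow 2).const_mul (1 / 8)
    simp only [ne_eq, OfNat.ofNat_ne_zero, not_false_eq_true, zero_pow, mul_zero] at this
    refine this.congr fun n => ?_
    rw [div_pow, one_pow, div_mul_div_comm, one_mul]
  have h1 := tendsto_harm.sub ht
  rw [sub_zero] at h1
  have h2 := h1.add ht2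
  rw [add_zero] at h2
  constructor
  · refine ge_of_tendsto h1 ?_
    filter_upwards [eventually_ge_atTop N] with m hm
    induction m, hm using Nat.le_induction with
    | base => exact le_rfl
    | succ m hm ih =>
      refine ih.trans ?_
      have := (log_succ_sub_bounds (hN.trans hm)).1
      have e1 : 1 / (2 * (m : ℝ)) = 1 / 2 * (1 / (m : ℝ)) := by rw [div_mul_div_comm, one_mul]
      have e2 : 1 / (2 * ((m : ℝ) + 1)) = 1 / 2 * (1 / ((m : ℝ) + 1)) := by
        rw [div_mul_div_comm, one_mul]
      rw [harm_succ]; push_cast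
      rw [e1, e2]; linarith
  · refine le_of_tendsto h2 ?_
    filter_upwards [eventually_ge_atTop N] with m hm
    induction m, hm using Nat.le_induction with
    | base => exact le_rfl
    | succ m hm ih =>
      refine le_trans ?_ ih
      have := (log_succ_sub_bounds (hN.trans hm)).2
      have e1 : 1 / (2 * (m : ℝ)) = 1 / 2 * (1 / (m : ℝ)) := by rw [div_mul_div_comm, one_mul]
      have e2 : 1 / (2 * ((m : ℝ) + 1)) = 1 / 2 * (1 / ((m : ℝ) + 1)) := by
        rw [div_mul_div_comm, one_mul]
      have e3 : 1 / (8 * (m : ℝ) ^ 2) = 1 / 8 * (1 / (m : ℝ) ^ 2) := by rw [div_mul_div_comm, one_mul]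
      have e4 : 1 / (8 * ((m : ℝ) + 1) ^ 2) = 1 / 8 * (1 / ((m : ℝ) + 1) ^ 2) := by
        rw [div_mul_div_comm, one_mul]
      rw [harm_succ]; push_cast
      rw [e1, e2, e3, e4]; linarith

end Harmonic

/-- `∑_{n ≤ u} (u / n - 1)`. -/
def hypSum (u : ℝ) : ℝ := ∑ n ∈ Finset.Icc 1 ⌊u⌋₊, (u / n - 1)

/-- `∑_{n ≤ u} (u / n - 1) - u log u + (1 - γ) u`. -/
def remKernel (u : ℝ) : ℝ :=
  hypSum u - u * Real.log u + (1 - Real.eulerMascheroniConstant) * u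

theorem hypSum_eq (u : ℝ) : hypSum u = u * harm ⌊u⌋₊ - ⌊u⌋₊ := by
  rw [hypSum, Finset.sum_sub_distrib, harm, Finset.mul_sum]; simp [div_eq_mul_inv]

theorem hypSum_of_lt_one {u : ℝ} (hu : u < 1) : hypSum u = 0 := by
  rw [hypSum, Nat.floor_eq_zero.2 hu]; simp

/-- The limit 1/2 comes from the term 1/(2N) in the harmonic sum, multiplied by u. It is the factor
1/2 in μ. Fractional parts of u cancel up to O(1/u). -/
theorem abs_remKernel_sub_half_le {u : ℝ} (hu : 1 ≤ u) : |remKernel u - 1 / 2| ≤ 4 / u := by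
  have hu0 : 0 < u := by linarith
  have hN : 1 ≤ ⌊u⌋₊ := (Nat.one_le_floor_iff u).2 hu
  set N := ⌊u⌋₊ with hNdef
  have h1 : (N : ℝ) ≤ u := Nat.floor_le hu0.le
  have h2 : u < N + 1 := Nat.lt_floor_add_one u
  have hN0 : (1 : ℝ) ≤ N := by exact_mod_cast hN
  obtain ⟨hb1, hb2⟩ := harm_bounds hN
  set γ := Real.eulerMascheroniConstant with hγ
  have hlog1 : u * (Real.log u - Real.log N) ≤ u * (u - N) / N := by
    rw [← Real.log_div hu0.ne' (by positivity), mul_div_assoc]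
    have := Real.log_le_sub_one_of_pos (by positivity : 0 < u / N)
    have e : u / N - 1 = (u - N) / N := by field_simp
    rw [e] at this
    exact mul_le_mul_of_nonneg_left this hu0.le
  have hlog2 : u - N ≤ u * (Real.log u - Real.log N) := by
    rw [← Real.log_div hu0.ne' (by positivity)]
    have := Real.one_sub_inv_le_log_of_pos (by positivity : 0 < u / N)
    calc u - N = u * (1 - (u / N)⁻¹) := by field_simp
      _ ≤ _ := mul_le_mul_of_nonneg_left this hu0.le
  have e0 : remKernel u = u * (harm N - Real.log N - 1 / (2 * N) - γ) + u / (2 * N) -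
      u * (Real.log u - Real.log N) + (u - N) := by
    rw [remKernel, hypSum_eq]; ring
  have hA1 : u * (harm N - Real.log N - 1 / (2 * N) - γ) ≤ 0 :=
    mul_nonpos_of_nonneg_of_nonpos hu0.le (by linarith)
  have hA2 : -(u * (1 / (8 * (N : ℝ) ^ 2))) ≤ u * (harm N - Real.log N - 1 / (2 * N) - γ) := by
    rw [← mul_neg]
    exact mul_le_mul_of_nonneg_left (by linarith) hu0.le
  have h3 : u ≤ 2 * N := by linarith
  have hA3 : u * (1 / (8 * (N : ℝ) ^ 2)) ≤ 1 / 2 * (1 / N) := by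
    rw [mul_one_div, div_le_iff₀ (by positivity)]
    calc u ≤ 2 * N := h3
      _ ≤ _ := by field_simp; norm_num
  have hB : u / (2 * N) - 1 / 2 ≤ 1 / 2 * (1 / (N : ℝ)) := by
    rw [sub_le_iff_le_add, div_le_iff₀ (by positivity)]
    have : (1 / 2 * (1 / (N : ℝ)) + 1 / 2) * (2 * N) = 1 + N := by field_simp
    rw [this]; linarith
  have hB' : 0 ≤ u / (2 * N) - 1 / 2 := by
    rw [sub_nonneg, le_div_iff₀ (by positivity)]; linarith
  have hC : u * (u - N) / N - (u - N) ≤ 1 / N := by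
    have : u * (u - N) / N - (u - N) = (u - N) ^ 2 / N := by field_simp
    rw [this]
    gcongr
    nlinarith
  have hD : 1 / (N : ℝ) ≤ 2 / u := by
    rw [div_le_div_iff₀ (by positivity) hu0]; linarith
  have hE : 4 / u = 2 * (2 / u) := by ring
  rw [e0, abs_le, hE]
  constructor <;> linarith

theorem abs_harm_sub_le {u : ℝ} (hu : 1 ≤ u) :
    |harm ⌊u⌋₊ - Real.log u - Real.eulerMascheroniConstant| ≤ 6 / u := by
  have hu0 : 0 < u := by linarith
  have h1 := abs_le.1 (abs_remKernel_sub_half_le hu)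
  have h2 := Nat.floor_le hu0.le
  have h3 := Nat.lt_floor_add_one u
  have h4 : 4 / u ≤ 4 := div_le_self (by norm_num) hu
  have e0 : harm ⌊u⌋₊ - Real.log u - Real.eulerMascheroniConstant = (remKernel u - (u - ⌊u⌋₊)) / u := by
    rw [remKernel, hypSum_eq]; field_simp; ring
  rw [e0, abs_div, abs_of_pos hu0]
  gcongr
  rw [abs_le]; constructor <;> linarith

/-- `hypSum` is continuous and piecewise linear, with nondecreasing slope given by the harmonic sum;
each new term enters with value 0. -/
theorem hypSum_sub_bounds {U V : ℝ} (hU : 0 < U) (hUV : U ≤ V) :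
    (V - U) * harm ⌊U⌋₊ ≤ hypSum V - hypSum U ∧ hypSum V - hypSum U ≤ (V - U) * harm ⌊V⌋₊ := by
  have hsub : Finset.Icc 1 ⌊U⌋₊ ⊆ Finset.Icc 1 ⌊V⌋₊ :=
    Finset.Icc_subset_Icc_right (Nat.floor_le_floor hUV)
  have e : ∀ N : ℕ, (V - U) * harm N = ∑ n ∈ Finset.Icc 1 N, (V / n - 1) -
      ∑ n ∈ Finset.Icc 1 N, (U / n - 1) := fun N => by
    rw [harm, Finset.mul_sum, ← Finset.sum_sub_distrib]
    exact Finset.sum_congr rfl fun n _ => by ring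
  rw [e, e]
  constructor
  · refine sub_le_sub_right (Finset.sum_le_sum_of_subset_of_nonneg hsub fun n hn _ => ?_) _
    have hn0 : (0 : ℝ) < n := by exact_mod_cast (Finset.mem_Icc.1 hn).1
    have := (Nat.le_floor_iff (by linarith)).1 (Finset.mem_Icc.1 hn).2
    rw [sub_nonneg, le_div_iff₀ hn0]; linarith
  · refine sub_le_sub_left ?_ _
    rw [hypSum, ← Finset.sum_sdiff hsub, add_comm]
    refine add_le_of_nonpos_right (Finset.sum_nonpos fun n hn => ?_)
    obtain ⟨h1, h2⟩ := Finset.mem_sdiff.1 hn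
    have hn0 : (0 : ℝ) < n := by exact_mod_cast (Finset.mem_Icc.1 h1).1
    rw [sub_nonpos, div_le_one hn0]
    by_contra! hc
    exact h2 (Finset.mem_Icc.2 ⟨(Finset.mem_Icc.1 h1).1, Nat.le_floor hc.le⟩)

/-- For V - U ≤ 1 the slope of `hypSum` is compared with that of the subtracted smooth function. For
longer steps both values are already within O(1/U) of 1/2. -/
theorem abs_remKernel_sub_le {U V : ℝ} (hU : 1 ≤ U) (hUV : U ≤ V) :
    |remKernel V - remKernel U| ≤ 8 * ((V - U) / U) := by
  have hU0 : 0 < U := by linarith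
  have hV0 : 0 < V := by linarith
  rcases le_or_gt (V - U) 1 with h1 | h1
  · obtain ⟨a1, a2⟩ := hypSum_sub_bounds hU0 hUV
    have b1 := abs_le.1 (abs_harm_sub_le hU)
    have b2 := abs_le.1 (abs_harm_sub_le (hU.trans hUV))
    have b3 : 6 / V ≤ 6 / U := by gcongr
    have hlog : Real.log V - Real.log U ≤ 1 / U := by
      rw [← Real.log_div hV0.ne' hU0.ne']
      refine (Real.log_le_sub_one_of_pos (by positivity)).trans ?_
      rw [div_sub_one hU0.ne']; gcongr
    have c1 : (V - U) * (Real.log U + 1) ≤ V * Real.log V - U * Real.log U := by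
      have := Real.one_sub_inv_le_log_of_pos (by positivity : 0 < V / U)
      rw [Real.log_div hV0.ne' hU0.ne', inv_div] at this
      have e : V * (1 - U / V) = V - U := by field_simp
      nlinarith [mul_le_mul_of_nonneg_left this hV0.le]
    have c2 : V * Real.log V - U * Real.log U ≤ (V - U) * (Real.log V + 1) := by
      have := Real.log_le_sub_one_of_pos (by positivity : 0 < V / U)
      rw [Real.log_div hV0.ne' hU0.ne'] at this
      have e : U * (V / U - 1) = V - U := by field_simp
      nlinarith [mul_le_mul_of_nonneg_left this hU0.le]
    have d : 0 ≤ V - U := by linarith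
    have e8 : 8 * ((V - U) / U) = (V - U) * (8 / U) := by ring
    have e7 : 8 / U = 6 / U + 2 * (1 / U) := by ring
    have p1 : 0 ≤ 1 / U := by positivity
    rw [e8, e7, remKernel, remKernel, abs_le]
    constructor
    · have := mul_le_mul_of_nonneg_left
        (by linarith : -(6 / U + 2 * (1 / U)) ≤ harm ⌊U⌋₊ - Real.log V - Real.eulerMascheroniConstant) d
      nlinarith
    · have := mul_le_mul_of_nonneg_left
        (by linarith : harm ⌊V⌋₊ - Real.log U - Real.eulerMascheroniConstant ≤ 6 / U + 2 * (1 / U)) d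
      nlinarith
  · have b1 := abs_le.1 (abs_remKernel_sub_half_le hU)
    have b2 := abs_le.1 (abs_remKernel_sub_half_le (hU.trans hUV))
    have b3 : 4 / V ≤ 4 / U := by gcongr
    have b4 : 4 / U + 4 / U ≤ 8 * ((V - U) / U) := by
      have : 1 / U ≤ (V - U) / U := by gcongr
      have e : 4 / U = 4 * (1 / U) := by ring
      rw [e]; linarith
    rw [abs_le]; constructor <;> linarith

/-- `remKernel` in the logarithmic variable. -/
def remExp (x : ℝ) : ℝ := remKernel (Real.exp x)

theorem remExp_of_neg {x : ℝ} (hx : x < 0) :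
    remExp x = (1 - Real.eulerMascheroniConstant - x) * Real.exp x := by
  rw [remExp, remKernel, hypSum_of_lt_one (Real.exp_lt_one_iff.2 hx), Real.log_exp]; ring

theorem remExp_of_nonpos {x : ℝ} (hx : x ≤ 0) :
    remExp x = (1 - Real.eulerMascheroniConstant - x) * Real.exp x := by
  rcases hx.lt_or_eq with h | rfl
  · exact remExp_of_neg h
  · simp [remExp, remKernel, hypSum]

theorem abs_remExp_sub_half_le {x : ℝ} (hx : 0 ≤ x) : |remExp x - 1 / 2| ≤ 4 * Real.exp (-x) := by
  rw [Real.exp_neg, ← div_eq_mul_inv]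
  exact abs_remKernel_sub_half_le (Real.one_le_exp hx)

theorem eulerMascheroni_mem : 0 < Real.eulerMascheroniConstant ∧ Real.eulerMascheroniConstant < 1 :=
  ⟨by linarith [Real.one_half_lt_eulerMascheroniConstant],
    by linarith [Real.eulerMascheroniConstant_lt_two_thirds]⟩

/-- For x < 0 the sum is empty and only an elementary function remains. The rate 3/4 absorbs its
linear factor and still exceeds the largest Re w = 1/2 in use. -/
theorem abs_remExp_le_of_nonpos {x : ℝ} (hx : x ≤ 0) : |remExp x| ≤ 4 * Real.exp (3 / 4 * x) := by
  obtain ⟨h1, h2⟩ := eulerMascheroni_mem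
  rw [remExp_of_nonpos hx, abs_of_nonneg (mul_nonneg (by linarith) (Real.exp_pos _).le)]
  have h3 := Real.add_one_le_exp (-x / 4)
  have h4 : Real.exp x = Real.exp (3 / 4 * x) * Real.exp (x / 4) := by rw [← Real.exp_add]; ring_nf
  have h5 : Real.exp (-x / 4) * Real.exp (x / 4) = 1 := by rw [← Real.exp_add]; ring_nf; simp
  have h6 : 1 - Real.eulerMascheroniConstant - x ≤ 4 * Real.exp (-x / 4) := by linarith
  calc _ ≤ 4 * Real.exp (-x / 4) * (Real.exp (3 / 4 * x) * Real.exp (x / 4)) := by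
        rw [h4]; gcongr
    _ = 4 * Real.exp (3 / 4 * x) * (Real.exp (-x / 4) * Real.exp (x / 4)) := by ring
    _ = _ := by rw [h5, mul_one]

/-- Uniformity in σ permits Rankin's trick in the sum over m: at x = u - log m the bound factors as
e^{σu} m^{-σ}. -/
theorem abs_remExp_le {x σ : ℝ} (h0 : 0 ≤ σ) (h1 : σ ≤ 1 / 2) :
    |remExp x| ≤ 5 * Real.exp (σ * x) := by
  rcases le_total 0 x with hx | hx
  · have h2 := abs_le.1 (abs_remExp_sub_half_le hx)
    have h3 : Real.exp (-x) ≤ 1 := Real.exp_le_one_iff.2 (by linarith)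
    have h4 : 1 ≤ Real.exp (σ * x) := Real.one_le_exp (by positivity)
    rw [abs_le]; constructor <;> linarith
  · have h2 : Real.exp (3 / 4 * x) ≤ Real.exp (σ * x) := Real.exp_le_exp.2 (by nlinarith)
    linarith [abs_remExp_le_of_nonpos hx, Real.exp_pos (σ * x)]

theorem abs_remExp_sub_le_of_nonneg {x y : ℝ} (hy : 0 ≤ y) (hxy : y ≤ x) (h1 : x - y ≤ 1) :
    |remExp x - remExp y| ≤ 24 * (x - y) := by
  refine (abs_remKernel_sub_le (Real.one_le_exp hy) (Real.exp_le_exp.2 hxy)).trans ?_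
  have e : (Real.exp x - Real.exp y) / Real.exp y = Real.exp (x - y) - 1 := by
    rw [Real.exp_sub]; field_simp
  have h2 := Real.add_one_le_exp (-(x - y))
  have h3 : Real.exp (x - y) * Real.exp (-(x - y)) = 1 := by rw [← Real.exp_add]; simp
  have h4 : Real.exp (x - y) ≤ 3 :=
    (Real.exp_le_exp.2 h1).trans Real.exp_one_lt_three.le
  rw [e]
  have h5 : Real.exp (x - y) - 1 ≤ Real.exp (x - y) * (x - y) := by
    nlinarith [Real.exp_pos (x - y)]
  nlinarith [mul_le_mul_of_nonneg_right h4 (by linarith : 0 ≤ x - y)]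

theorem abs_remExp_sub_le_of_nonpos {x y : ℝ} (hx : x ≤ 0) (hxy : y ≤ x) :
    |remExp x - remExp y| ≤ 24 * (x - y) * Real.exp (x / 2) := by
  obtain ⟨g1, g2⟩ := eulerMascheroni_mem
  set γ := Real.eulerMascheroniConstant
  have hd : ∀ z ∈ Set.Iic x, HasDerivWithinAt (fun z => (1 - γ - z) * Real.exp z)
      (-(γ + z) * Real.exp z) (Set.Iic x) z := fun z _ => by
    have := (((hasDerivAt_id z).const_sub (1 - γ)).mul (Real.hasDerivAt_exp z)).hasDerivWithinAt
      (s := Set.Iic x)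
    convert! this using 1
    simp; ring
  have hb : ∀ z ∈ Set.Iic x, ‖-(γ + z) * Real.exp z‖ ≤ 24 * Real.exp (x / 2) := fun z hz => by
    have hz' : z ≤ x := hz
    have h3 := Real.add_one_le_exp (-z / 2)
    have h4 : Real.exp z = Real.exp (z / 2) * Real.exp (z / 2) := by rw [← Real.exp_add]; ring_nf
    have h5 : Real.exp (-z / 2) * Real.exp (z / 2) = 1 := by rw [← Real.exp_add]; ring_nf; simp
    have h6 : |-(γ + z)| ≤ 4 * Real.exp (-z / 2) := by
      rw [abs_le]; constructor <;> linarith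
    rw [Real.norm_eq_abs, abs_mul, abs_of_pos (Real.exp_pos z), h4]
    calc _ ≤ 4 * Real.exp (-z / 2) * (Real.exp (z / 2) * Real.exp (z / 2)) := by gcongr
      _ = 4 * Real.exp (z / 2) * (Real.exp (-z / 2) * Real.exp (z / 2)) := by ring
      _ ≤ 24 * Real.exp (x / 2) := by
        rw [h5, mul_one]
        have : Real.exp (z / 2) ≤ Real.exp (x / 2) := Real.exp_le_exp.2 (by linarith)
        linarith [Real.exp_pos (x / 2)]
  have := (convex_Iic x).norm_image_sub_le_of_norm_hasDerivWithin_le hd hb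
    (Set.mem_Iic.2 hxy) (Set.mem_Iic.2 le_rfl)
  rw [remExp_of_nonpos hx, remExp_of_nonpos (hxy.trans hx)]
  rw [Real.norm_eq_abs, Real.norm_eq_abs, abs_of_nonneg (by linarith : 0 ≤ x - y)] at this
  linarith

theorem abs_remExp_sub_le {x y σ : ℝ} (h0 : 0 ≤ σ) (h1 : σ ≤ 1 / 2) (hxy : |x - y| ≤ 1) :
    |remExp x - remExp y| ≤ 100 * |x - y| * Real.exp (σ * x) := by
  have hE : ∀ z w : ℝ, z ≤ w → w ≤ 0 → w - z ≤ 1 →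
      Real.exp (w / 2) ≤ 2 * Real.exp (σ * z) ∧ Real.exp (w / 2) ≤ 2 * Real.exp (σ * w) := by
    intro z w hzw hw hwz
    have h2 : Real.exp (w / 2) ≤ Real.exp (1 / 2) * Real.exp (σ * z) := by
      rw [← Real.exp_add]; exact Real.exp_le_exp.2 (by nlinarith)
    have h3 : Real.exp (1 / 2) ≤ 2 := by
      have e : Real.exp (1 / 2) ^ 2 = Real.exp 1 := by rw [← Real.exp_nat_mul]; norm_num
      nlinarith [Real.exp_one_lt_three, Real.exp_pos (1 / 2)]
    have h4 : Real.exp (σ * z) ≤ Real.exp (σ * w) := Real.exp_le_exp.2 (by nlinarith)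
    constructor <;> nlinarith [Real.exp_pos (σ * z), Real.exp_pos (σ * w)]
  rw [abs_le] at hxy
  rcases le_total y x with hle | hle
  · rw [abs_of_nonneg (by linarith : 0 ≤ x - y)]
    rcases le_total 0 y with hy | hy
    · have h2 := abs_remExp_sub_le_of_nonneg hy hle hxy.2
      have h3 : 1 ≤ Real.exp (σ * x) := Real.one_le_exp (mul_nonneg h0 (hy.trans hle))
      nlinarith
    rcases le_total x 0 with hx | hx
    · have h2 := abs_remExp_sub_le_of_nonpos hx hle
      have h3 := (hE y x hle hx hxy.2).2
      nlinarith [mul_le_mul_of_nonneg_left h3 (by linarith : 0 ≤ 24 * (x - y)), Real.exp_pos (σ * x)]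
    · have h2 := abs_remExp_sub_le_of_nonneg le_rfl hx (by linarith)
      have h3 := abs_remExp_sub_le_of_nonpos le_rfl hy
      have h4 := abs_sub_le (remExp x) (remExp 0) (remExp y)
      rw [zero_div, Real.exp_zero] at h3
      have h5 : 1 ≤ Real.exp (σ * x) := Real.one_le_exp (mul_nonneg h0 hx)
      nlinarith
  · rw [abs_sub_comm, abs_of_nonpos (by linarith : x - y ≤ 0), neg_sub]
    rcases le_total 0 x with hx | hx
    · have h2 := abs_remExp_sub_le_of_nonneg hx hle (by linarith)
      have h3 : 1 ≤ Real.exp (σ * x) := Real.one_le_exp (mul_nonneg h0 hx)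
      nlinarith
    rcases le_total y 0 with hy | hy
    · have h2 := abs_remExp_sub_le_of_nonpos hy hle
      have h3 := (hE x y hle hy (by linarith)).1
      nlinarith [mul_le_mul_of_nonneg_left h3 (by linarith : 0 ≤ 24 * (y - x)), Real.exp_pos (σ * x)]
    · have h2 := abs_remExp_sub_le_of_nonneg le_rfl hy (by linarith)
      have h3 := abs_remExp_sub_le_of_nonpos le_rfl hx
      have h4 := abs_sub_le (remExp y) (remExp 0) (remExp x)
      rw [zero_div, Real.exp_zero] at h3
      have h5 := (hE x 0 hx le_rfl (by linarith)).1
      rw [zero_div, Real.exp_zero] at h5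
      nlinarith [mul_le_mul_of_nonneg_left h5 (by linarith : 0 ≤ 24 * (y - x)), Real.exp_pos (σ * x)]

theorem continuous_remExp : Continuous remExp := by
  rw [Metric.continuous_iff]
  intro x ε hε
  refine ⟨min 1 (ε / 101), by positivity, fun y hy => ?_⟩
  rw [Real.dist_eq] at hy ⊢
  have h1 : |y - x| < 1 := hy.trans_le (min_le_left _ _)
  have h2 : |y - x| < ε / 101 := hy.trans_le (min_le_right _ _)
  have := abs_remExp_sub_le le_rfl (by norm_num) h1.le
  rw [zero_mul, Real.exp_zero] at this
  linarith

end ArithSeq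

end

/-! ### Laplace transform and expansion of the remainder F -/

noncomputable section
namespace ArithSeq
open MeasureTheory

section Decay

/-- Uniform exponential decay of `e^{-σu} φ(u)`, `0 ≤ σ ≤ 1/2`. -/
def ExpDecay (c : ℝ) (φ : ℝ → ℂ) : Prop :=
  ∃ C : ℝ, ∀ u σ : ℝ, 0 ≤ σ → σ ≤ 1 / 2 → Real.exp (-(σ * u)) * ‖φ u‖ ≤ C * Real.exp (-(c * |u|))

variable {c : ℝ} {φ : ℝ → ℂ}

theorem integrable_exp_neg_mul_abs (hc : 0 < c) : Integrable fun u : ℝ => Real.exp (-(c * |u|)) := by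
  rw [← integrableOn_univ, ← Set.Iic_union_Ioi (a := (0 : ℝ)), integrableOn_union]
  constructor
  · refine (integrableOn_exp_mul_Iic hc 0).congr_fun (fun u hu => ?_) measurableSet_Iic
    have : u ≤ 0 := hu
    simp only [abs_of_nonpos this]; ring_nf
  · refine (integrableOn_exp_mul_Ioi (neg_lt_zero.2 hc) 0).congr_fun (fun u hu => ?_) measurableSet_Ioi
    have : 0 < u := hu
    simp only [abs_of_pos this]; ring_nf

theorem ExpDecay.norm_le {C : ℝ} (hC : ∀ u σ : ℝ, 0 ≤ σ → σ ≤ 1 / 2 →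
    Real.exp (-(σ * u)) * ‖φ u‖ ≤ C * Real.exp (-(c * |u|))) {w : ℂ} (h0 : 0 ≤ w.re)
    (h1 : w.re ≤ 1 / 2) (u : ℝ) :
    ‖Complex.exp (-(w * u)) * φ u‖ ≤ C * Real.exp (-(c * |u|)) := by
  rw [norm_mul, norm_exp_neg_mul]; exact hC u _ h0 h1

theorem ExpDecay.laplaceAdm (hφ : ExpDecay c φ) (hc : 0 < c) (hm : AEStronglyMeasurable φ volume) :
    LaplaceAdm φ := by
  intro σ h0 h1
  obtain ⟨C, hC⟩ := hφ
  have hexp : Continuous fun u : ℝ => Complex.exp (-((σ : ℂ) * u)) := by fun_prop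
  exact ((integrable_exp_neg_mul_abs hc).const_mul C).mono' (hexp.aestronglyMeasurable.mul hm)
    (Eventually.of_forall fun u => ExpDecay.norm_le hC (by simpa using h0.le) (by simpa using h1.le) u)

theorem ExpDecay.id_mul (hφ : ExpDecay c φ) (hc : 0 < c) :
    ExpDecay (c / 2) fun u => (u : ℂ) * φ u := by
  obtain ⟨C, hC⟩ := hφ
  have hC0 : 0 ≤ C := by
    have := hC 0 0 le_rfl (by norm_num)
    simp at this; exact (norm_nonneg _).trans this
  refine ⟨2 / c * C, fun u σ h0 h1 => ?_⟩
  rw [norm_mul, Complex.norm_real, Real.norm_eq_abs]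
  have h2 := Real.add_one_le_exp (c / 2 * |u|)
  have h3 : |u| ≤ 2 / c * Real.exp (c / 2 * |u|) := by
    rw [div_mul_eq_mul_div, le_div_iff₀ hc]; linarith
  calc _ = |u| * (Real.exp (-(σ * u)) * ‖φ u‖) := by ring
    _ ≤ (2 / c * Real.exp (c / 2 * |u|)) * (C * Real.exp (-(c * |u|))) := by
        exact mul_le_mul h3 (hC u σ h0 h1) (by positivity) (by positivity)
    _ = 2 / c * C * (Real.exp (c / 2 * |u|) * Real.exp (-(c * |u|))) := by ring
    _ = _ := by rw [← Real.exp_add]; ring_nf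

/-- A derivative multiplies the function by -u, which only halves the decay rate, and the transform
of a decaying function is bounded up to both edges. -/
theorem tame_laplace_of_expDecay (hφ : ExpDecay c φ) (hc : 0 < c)
    (hm : AEStronglyMeasurable φ volume) (n : ℕ) : Tame (wideStrip 0) 0 n (laplace φ) := by
  induction n generalizing c φ with
  | zero =>
    obtain ⟨C, hC⟩ := hφ
    refine PolyBdd.of_bounded (C := ∫ u : ℝ, C * Real.exp (-(c * |u|))) fun w hw => ?_
    exact norm_integral_le_of_norm_le ((integrable_exp_neg_mul_abs hc).const_mul C)
      (Eventually.of_forall fun u => ExpDecay.norm_le hC (re_pos_of_mem hw).le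
        (by linarith [hw.2]) u)
  | succ n ih =>
    have hadm := hφ.laplaceAdm hc hm
    have hm' : AEStronglyMeasurable (fun u : ℝ => (u : ℂ) * φ u) volume :=
      Complex.continuous_ofReal.aestronglyMeasurable.mul hm
    have h2 := hφ.id_mul hc
    have h3 := (ih h2 (by positivity) hm').const_mul (isOpen_wideStrip 0) (-1)
      (h2.laplaceAdm (by positivity) hm').differentiableOn
    refine ⟨?_, h3.congr (isOpen_wideStrip 0) fun w hw => ?_⟩
    · exact (ih hφ hc hm).bdd
    · have := hadm.iterate_deriv 1 hw
      simp only [Function.iterate_one, pow_one] at this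
      rw [this]

end Decay

/-- `remExp` with its limit at infinity removed. -/
def remDefect (u : ℝ) : ℂ := (remExp u : ℂ) - if 0 < u then 1 / 2 else 0

theorem aestronglyMeasurable_remDefect : AEStronglyMeasurable remDefect volume := by
  refine (Complex.continuous_ofReal.comp continuous_remExp).aestronglyMeasurable.sub ?_
  exact (Measurable.ite measurableSet_Ioi measurable_const measurable_const).aestronglyMeasurable

/-- On the negative side the rate 3/4 loses at most 1/2 to e^{-σu}; on the positive side the
distance to the limit decays like e^{-u}. -/
theorem expDecay_remDefect : ExpDecay (1 / 4) remDefect := by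
  refine ⟨4, fun u σ h0 h1 => ?_⟩
  rw [remDefect]
  split_ifs with hu
  · have h2 := abs_remExp_sub_half_le hu.le
    rw [show (remExp u : ℂ) - 1 / 2 = ((remExp u - 1 / 2 : ℝ) : ℂ) by push_cast; ring,
      Complex.norm_real, Real.norm_eq_abs, abs_of_pos hu]
    calc _ ≤ Real.exp (-(σ * u)) * (4 * Real.exp (-u)) := by gcongr
      _ = 4 * Real.exp (-(σ * u) + -u) := by rw [Real.exp_add]; ring
      _ ≤ _ := by gcongr; nlinarith
  · rw [not_lt] at hu
    have h2 := abs_remExp_le_of_nonpos hu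
    rw [sub_zero, Complex.norm_real, Real.norm_eq_abs, abs_of_nonpos hu]
    calc _ ≤ Real.exp (-(σ * u)) * (4 * Real.exp (3 / 4 * u)) := by gcongr
      _ = 4 * Real.exp (-(σ * u) + 3 / 4 * u) := by rw [Real.exp_add]; ring
      _ ≤ _ := by gcongr; nlinarith

theorem laplaceAdm_remDefect : LaplaceAdm remDefect :=
  expDecay_remDefect.laplaceAdm (by norm_num) aestronglyMeasurable_remDefect

theorem laplaceAdm_remExp : LaplaceAdm fun u => (remExp u : ℂ) := by
  have h1 := laplaceAdm_remDefect.sub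
    ((laplaceAdm_fullPow (l := -1) (by norm_num)).const_mul (-(1 / 2)))
  refine fun σ h0 hσ => (h1 σ h0 hσ).congr (Eventually.of_forall fun u => ?_)
  simp only [remDefect, fullPow]
  split_ifs <;> simp

/-- The limit 1/2 contributes half the transform of the unit step, which is `fullPow (-1)`, with
transform 1/w. This is the only singularity at 0. -/
theorem laplace_remExp {w : ℂ} (hw : w ∈ wideStrip 0) :
    laplace (fun u => (remExp u : ℂ)) w = w⁻¹ * (1 / 2 + w * laplace remDefect w) := by
  have hf := (laplaceAdm_fullPow (l := -1) (by norm_num)).const_mul (1 / 2)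
  have h1 := laplaceAdm_remExp.laplace_sub hf hw
  have h2 : laplace (fun u => 1 / 2 * fullPow (-1) u) w = 1 / 2 * w⁻¹ := by
    have h3 := laplace_fullPow (l := -1) (by norm_num) hw
    simp only [neg_neg, Real.Gamma_one, Complex.ofReal_one, one_mul, Complex.ofReal_neg,
      Complex.cpow_neg_one] at h3
    rw [← h3, laplace, laplace, ← integral_const_mul]
    congr 1; ext u; ring
  rw [h2] at h1
  have h4 : (fun u : ℝ => (remExp u : ℂ) - 1 / 2 * fullPow (-1) u) = remDefect := by
    ext u
    simp only [remDefect, fullPow]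
    split_ifs <;> simp
  rw [h4] at h1
  have hw0 := ne_zero_of_mem_wideStrip hw
  rw [h1]; field_simp; ring

variable {h : ArithmeticFunction ℝ} {k : ℝ} {a : ℤ}

/-- `∑ b(m) P(e^u / m)`. -/
def corrRem (h : ArithmeticFunction ℝ) (a : ℤ) (u : ℝ) : ℝ :=
  ∑' m : ℕ, corr h a m * remExp (u - Real.log m)

theorem exp_mul_sub_log {m : ℕ} (hm : 0 < m) (σ u : ℝ) :
    Real.exp (σ * (u - Real.log m)) = Real.exp (σ * u) * (m : ℝ) ^ (-σ) := by
  rw [Real.rpow_def_of_pos (by exact_mod_cast hm), ← Real.exp_add]; ring_nf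

theorem abs_corr_mul_remExp_le {σ : ℝ} (h0 : 0 ≤ σ) (h1 : σ ≤ 1 / 2) (m : ℕ) (u : ℝ) :
    |corr h a m * remExp (u - Real.log m)| ≤
      5 * Real.exp (σ * u) * (|corr h a m| * (m : ℝ) ^ (-σ)) := by
  rcases Nat.eq_zero_or_pos m with rfl | hm
  · simp
  rw [abs_mul]
  calc _ ≤ |corr h a m| * (5 * Real.exp (σ * (u - Real.log m))) := by
        gcongr; exact abs_remExp_le h0 h1
    _ = _ := by rw [exp_mul_sub_log hm]; ring

theorem summable_corrRem (hmul : h.IsMultiplicative) (hA : AnalyticCondition h k)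
    (hpos : ∀ p : ℕ, p.Prime → 0 ≤ h p) (u : ℝ) :
    Summable fun m : ℕ => corr h a m * remExp (u - Real.log m) :=
  ((summable_corr (a := a) hmul hA hpos (σ := 1 / 4) (by norm_num)).mul_left _).of_norm_bounded
    fun m => abs_corr_mul_remExp_le (by norm_num) (by norm_num) m u

theorem abs_corrRem_le (hmul : h.IsMultiplicative) (hA : AnalyticCondition h k)
    (hpos : ∀ p : ℕ, p.Prime → 0 ≤ h p) {σ : ℝ} (h0 : 0 < σ) (h1 : σ ≤ 1 / 2) (u : ℝ) :
    |corrRem h a u| ≤ (5 * ∑' m : ℕ, |corr h a m| * (m : ℝ) ^ (-σ)) * Real.exp (σ * u) := by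
  have h2 := tsum_of_norm_bounded ((summable_corr (a := a) hmul hA hpos h0).hasSum.mul_left
    (5 * Real.exp (σ * u))) fun m => (Real.norm_eq_abs _).trans_le
      (abs_corr_mul_remExp_le (h := h) (a := a) h0.le h1 m u)
  rw [Real.norm_eq_abs] at h2
  exact h2.trans_eq (by ring)

theorem abs_corrRem_sub_le (hmul : h.IsMultiplicative) (hA : AnalyticCondition h k)
    (hpos : ∀ p : ℕ, p.Prime → 0 ≤ h p) {u v σ : ℝ} (huv : |u - v| ≤ 1) (h0 : 0 < σ)
    (h1 : σ ≤ 1 / 2) :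
    |corrRem h a u - corrRem h a v| ≤
      100 * |u - v| * Real.exp (σ * u) * ∑' m : ℕ, |corr h a m| * (m : ℝ) ^ (-σ) := by
  rw [← Real.norm_eq_abs, corrRem, corrRem, ← (summable_corrRem hmul hA hpos u).tsum_sub (summable_corrRem hmul hA hpos v)]
  have hs := summable_corr (a := a) hmul hA hpos h0
  refine tsum_of_norm_bounded (hs.hasSum.mul_left (100 * |u - v| * Real.exp (σ * u))) fun m => ?_
  rcases Nat.eq_zero_or_pos m with rfl | hm
  · simp
  have h2 := abs_remExp_sub_le (x := u - Real.log m) (y := v - Real.log m) h0.le h1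
    (by rwa [sub_sub_sub_cancel_right])
  rw [sub_sub_sub_cancel_right, exp_mul_sub_log hm] at h2
  rw [← mul_sub, Real.norm_eq_abs, abs_mul]
  calc _ ≤ |corr h a m| * (100 * |u - v| * (Real.exp (σ * u) * (m : ℝ) ^ (-σ))) := by gcongr
    _ = _ := by ring

theorem continuous_corrRem (hmul : h.IsMultiplicative) (hA : AnalyticCondition h k)
    (hpos : ∀ p : ℕ, p.Prime → 0 ≤ h p) : Continuous (corrRem h a) := by
  rw [Metric.continuous_iff]
  intro x ε hε
  set S := ∑' m : ℕ, |corr h a m| * (m : ℝ) ^ (-(1 / 4) : ℝ) with hS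
  have hS0 : 0 ≤ S := by positivity
  set B := 100 * Real.exp (1 / 4 * (x + 1)) * S with hB
  have hB0 : 0 ≤ B := by positivity
  refine ⟨min 1 (ε / (B + 1)), by positivity, fun y hy => ?_⟩
  rw [Real.dist_eq] at hy ⊢
  have h1 : |y - x| < 1 := hy.trans_le (min_le_left _ _)
  have h2 : |y - x| < ε / (B + 1) := hy.trans_le (min_le_right _ _)
  have h3 := abs_corrRem_sub_le (a := a) hmul hA hpos h1.le (σ := 1 / 4) (by norm_num) (by norm_num)
  rw [lt_div_iff₀ (by positivity)] at h2
  have h4 : Real.exp (1 / 4 * y) ≤ Real.exp (1 / 4 * (x + 1)) :=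
    Real.exp_le_exp.2 (by linarith [(abs_lt.1 h1).2])
  calc _ ≤ 100 * |y - x| * Real.exp (1 / 4 * y) * S := h3
    _ ≤ 100 * |y - x| * Real.exp (1 / 4 * (x + 1)) * S := by gcongr
    _ = |y - x| * B := by rw [hB]; ring
    _ < ε := by linarith [abs_nonneg (y - x)]

theorem laplaceAdm_corrRem (hmul : h.IsMultiplicative) (hA : AnalyticCondition h k)
    (hpos : ∀ p : ℕ, p.Prime → 0 ≤ h p) : LaplaceAdm fun u => (corrRem h a u : ℂ) := by
  intro σ h0 h1
  set c := min (σ / 2) ((1 / 2 - σ) / 2) with hc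
  have hc0 : 0 < c := by have : 0 < 1 / 2 - σ := by linarith
                         positivity
  have hb := fun σ' (h0' : 0 < σ') h1' => abs_corrRem_le (a := a) hmul hA hpos (σ := σ') h0' h1'
  set C₁ := 5 * ∑' m : ℕ, |corr h a m| * (m : ℝ) ^ (-(σ - c)) with hC₁
  set C₂ := 5 * ∑' m : ℕ, |corr h a m| * (m : ℝ) ^ (-(σ + c)) with hC₂
  have hC₁0 : 0 ≤ C₁ := by positivity
  have hC₂0 : 0 ≤ C₂ := by positivity
  have hcl : c ≤ σ / 2 := min_le_left _ _
  have hcr : c ≤ (1 / 2 - σ) / 2 := min_le_right _ _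
  have hcont : Continuous fun u : ℝ => Complex.exp (-((σ : ℂ) * u)) * (corrRem h a u : ℂ) := by
    have := continuous_corrRem (a := a) hmul hA hpos
    fun_prop
  refine ((integrable_exp_neg_mul_abs hc0).const_mul (C₁ + C₂)).mono' hcont.aestronglyMeasurable
    (Eventually.of_forall fun u => ?_)
  rw [norm_mul, norm_exp_neg_mul, Complex.ofReal_re, Complex.norm_real, Real.norm_eq_abs]
  rcases le_total 0 u with hu | hu
  · calc _ ≤ Real.exp (-(σ * u)) * (C₁ * Real.exp ((σ - c) * u)) := by
          gcongr; exact hb _ (by linarith) (by linarith) u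
      _ = C₁ * (Real.exp (-(σ * u)) * Real.exp ((σ - c) * u)) := by ring
      _ = C₁ * Real.exp (-(c * |u|)) := by rw [← Real.exp_add, abs_of_nonneg hu]; ring_nf
      _ ≤ _ := by gcongr; linarith
  · calc _ ≤ Real.exp (-(σ * u)) * (C₂ * Real.exp ((σ + c) * u)) := by
          gcongr; exact hb _ (by linarith) (by linarith) u
      _ = C₂ * (Real.exp (-(σ * u)) * Real.exp ((σ + c) * u)) := by ring
      _ = C₂ * Real.exp (-(c * |u|)) := by rw [← Real.exp_add, abs_of_nonpos hu]; ring_nf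
      _ ≤ _ := by gcongr; linarith

/-- Translation by log m multiplies a transform by m^{-w}, so the convolution over m becomes a
product with the Dirichlet series of b. -/
theorem laplace_corrRem (hmul : h.IsMultiplicative) (hA : AnalyticCondition h k)
    (hpos : ∀ p : ℕ, p.Prime → 0 ≤ h p) {w : ℂ} (hw : w ∈ wideStrip 0) :
    laplace (fun u => (corrRem h a u : ℂ)) w =
      LSeries (fun m => (corr h a m : ℂ)) w * laplace (fun u => (remExp u : ℂ)) w := by
  have hw0 := re_pos_of_mem hw
  set G : ℝ → ℂ := fun u => Complex.exp (-(w * u)) * (remExp u : ℂ) with hG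
  have hGi : Integrable G := laplaceAdm_remExp.integrable hw
  set F : ℕ → ℝ → ℂ := fun m u => LSeries.term (fun m => (corr h a m : ℂ)) w m * G (u - Real.log m)
    with hF
  have hFi : ∀ m, Integrable (F m) := fun m => (hGi.comp_sub_right _).const_mul _
  have hFeq : ∀ m u, F m u = Complex.exp (-(w * u)) *
      ((corr h a m * remExp (u - Real.log m) : ℝ) : ℂ) := fun m u => by
    simp only [hF, hG]
    rcases Nat.eq_zero_or_pos m with rfl | hm
    · simp
    have hm0 : (m : ℂ) ≠ 0 := by exact_mod_cast hm.ne'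
    rw [LSeries.term_of_ne_zero hm.ne', Complex.cpow_def_of_ne_zero hm0, ← Complex.natCast_log]
    have : Complex.exp (-(w * ((u - Real.log m : ℝ) : ℂ))) =
        Complex.exp (-(w * u)) * Complex.exp ((Real.log m : ℂ) * w) := by
      rw [← Complex.exp_add]; congr 1; push_cast; ring
    rw [this]
    have := Complex.exp_ne_zero ((Real.log m : ℂ) * w)
    push_cast at this ⊢
    field_simp
  have hsum : Summable fun m => ‖LSeries.term (fun m => (corr h a m : ℂ)) w m‖ := by
    refine (summable_corr (a := a) hmul hA hpos hw0).congr fun m => ?_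
    rcases Nat.eq_zero_or_pos m with rfl | hm
    · simp
    · rw [LSeries.term_of_ne_zero hm.ne', norm_div, Complex.norm_real, Real.norm_eq_abs,
        Complex.norm_natCast_cpow_of_pos hm, Real.rpow_neg (Nat.cast_nonneg _), div_eq_mul_inv]
  have hint : Summable fun m => ∫ u, ‖F m u‖ := by
    refine (hsum.mul_right (∫ u, ‖G u‖)).congr fun m => ?_
    simp only [hF, norm_mul]
    rw [integral_const_mul, integral_sub_right_eq_self (fun u => ‖G u‖)]
  have h1 := hasSum_integral_of_summable_integral_norm hFi hint
  have h2 : ∀ m, ∫ u, F m u = LSeries.term (fun m => (corr h a m : ℂ)) w m *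
      laplace (fun u => (remExp u : ℂ)) w := fun m => by
    simp only [hF]
    rw [integral_const_mul, integral_sub_right_eq_self G]; rfl
  simp only [h2] at h1
  have h3 := hsum.of_norm.hasSum.mul_right (laplace (fun u => (remExp u : ℂ)) w)
  rw [LSeries, h3.unique h1, laplace]
  congr 1
  ext u
  rw [tsum_congr (fun m => hFeq m u), tsum_mul_left, corrRem, Complex.ofReal_tsum]

/-- Take σ = 1/(u+1) in the termwise estimate: e^{σu} stays bounded, and the Rankin bound for ∑
|b(m)| m^{-σ} is polynomial in u. -/
theorem exists_lipschitz_corrRem (hmul : h.IsMultiplicative) (hA : AnalyticCondition h k)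
    (hpos : ∀ p : ℕ, p.Prime → 0 ≤ h p) :
    ∃ C D : ℝ, ∀ u v : ℝ, 2 ≤ u → 2 ≤ v → |u - v| ≤ 1 →
      ‖(corrRem h a u : ℂ) - (corrRem h a v : ℂ)‖ ≤ C * u ^ D * |u - v| := by
  obtain ⟨C, D, hC, hD, hb⟩ := exists_sum_abs_corr_le (a := a) hmul hA hpos
  refine ⟨100 * Real.exp 1 * (C * 2 ^ D), D, fun u v hu hv huv => ?_⟩
  have hu0 : 0 < u := by linarith
  have hσ0 : 0 < 1 / (u + 1) := by positivity
  have hσ1 : 1 / (u + 1) < 1 / 2 := by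
    rw [div_lt_div_iff₀ (by positivity) (by norm_num)]; linarith
  rw [← Complex.ofReal_sub, Complex.norm_real, Real.norm_eq_abs]
  refine (abs_corrRem_sub_le hmul hA hpos huv hσ0 hσ1.le).trans ?_
  have h1 : ∑' m : ℕ, |corr h a m| * (m : ℝ) ^ (-(1 / (u + 1))) ≤ C * (1 / (u + 1)) ^ (-D) :=
    (summable_corr hmul hA hpos hσ0).tsum_le_of_sum_le fun s => hb _ hσ0 hσ1 s
  have h2 : (1 / (u + 1)) ^ (-D) ≤ 2 ^ D * u ^ D := by
    rw [one_div, Real.inv_rpow (by positivity), Real.rpow_neg (by positivity), inv_inv,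
      ← Real.mul_rpow (by norm_num) hu0.le]
    exact Real.rpow_le_rpow (by positivity) (by linarith) hD
  have h3 : Real.exp (1 / (u + 1) * u) ≤ Real.exp 1 := by
    refine Real.exp_le_exp.2 ?_
    rw [div_mul_eq_mul_div, one_mul, div_le_one (by positivity)]; linarith
  calc _ ≤ 100 * |u - v| * Real.exp 1 * (C * (2 ^ D * u ^ D)) := by
        gcongr
        exact h1.trans (by gcongr)
    _ = _ := by ring

/-- The asymptotic expansion of `corrRem`. -/
theorem corrRem_expansion (hmul : h.IsMultiplicative) (hA : AnalyticCondition h k)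
    (hpp : ∀ p : ℕ, p.Prime → ∀ e, 0 ≤ h (p ^ e)) :
    ∃ q : ℕ → ℂ, q 0 = ((1 / 2 * (degenerateProduct h k a * singularProduct h k a) : ℝ) : ℂ) ∧
      ∀ A : ℝ, ∃ N : ℕ, ∃ C : ℝ, ∀ u : ℝ, 3 ≤ u →
        ‖(corrRem h a u : ℂ) - ∑ i ∈ Finset.range (N + 1), q i *
          (((Real.Gamma (-(k + omegaH h a - 2 + i)))⁻¹ *
            u ^ (-(k + omegaH h a - 2 + i) - 1) : ℝ) : ℂ)‖ ≤ C * u ^ (-A) := by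
  have hpos : ∀ p : ℕ, p.Prime → 0 ≤ h p := fun p hp => by simpa using hpp p hp 1
  have hO := isOpen_wideStrip 0
  obtain ⟨K, hK0, hK⟩ := tame_mainFactor hA
  set T : ℂ → ℂ := fun w => 1 / 2 + w * laplace remDefect w with hT
  have hLd := laplaceAdm_remDefect.differentiableOn
  have hLt := tame_laplace_of_expDecay expDecay_remDefect (by norm_num) aestronglyMeasurable_remDefect
  have hTd : DifferentiableOn ℂ T (wideStrip 0) :=
    (differentiableOn_const _).fun_add (differentiableOn_id.fun_mul hLd)
  have hTt : ∀ n, Tame (wideStrip 0) 1 n T := fun n => by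
    have h1 := (Tame.id (r := 0) n).mul hO differentiableOn_id (hLd) (hLt n)
    rw [add_zero] at h1
    exact Tame.add hO (differentiableOn_const _) (differentiableOn_id.fun_mul hLd)
      ((Tame.const (1 / 2)).mono zero_le_one) h1
  have hMd := differentiableOn_mainFactor hA
  have hEd := (differentiableOn_eulerProd (a := a) hmul hA).mono wideStrip_zero_subset
  set Q : ℂ → ℂ := fun w => mainFactor h k w * eulerProd h a w * T w with hQ
  have hQd : DifferentiableOn ℂ Q (wideStrip 0) := (hMd.fun_mul hEd).fun_mul hTd
  have hQt : ∀ n, Tame (wideStrip 0) (K + 0 + 1) n Q := fun n =>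
    ((hK n).mul hO hMd hEd (tame_eulerProd hmul hA n)).mul hO (hMd.fun_mul hEd) hTd (hTt n)
  -- The exponent k - 1 + ω of the Dirichlet series loses 1 to the factor w⁻¹ of the kernel. It is
  -- at least -2, as k ≥ 0.
  obtain ⟨q, hq0, hq⟩ := laplace_expansion (l := k + omegaH h a - 2)
    (by have := hA.1; have : (0 : ℝ) ≤ omegaH h a := Nat.cast_nonneg _; linarith) (by linarith)
    (laplaceAdm_corrRem (a := a) hmul hA hpos) (exists_lipschitz_corrRem hmul hA hpos) hQd hQt
    fun w hw => by
      have hw0 := ne_zero_of_mem_wideStrip hw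
      rw [laplace_corrRem hmul hA hpos hw, LSeries_corr_eq hmul hA hpos hw, laplace_remExp hw]
      have h1 : w ^ ((k + omegaH h a - 2 : ℝ) : ℂ) =
          w ^ ((k - 1 + omegaH h a : ℝ) : ℂ) * w⁻¹ := by
        rw [← Complex.cpow_neg_one, ← Complex.cpow_add _ _ hw0]
        congr 1; push_cast; ring
      rw [h1]; simp only [hQ, hT]; ring
  refine ⟨q, ?_, hq⟩
  obtain ⟨ℓ, hℓ⟩ := hA.2.1
  -- The limit of Q is known to exist within the strip, so it suffices to compute it along the real
  -- axis, where Abel's theorem applies.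
  have hlim := hq0.comp tendsto_ofReal_wideStrip
  refine tendsto_nhds_unique hlim ?_
  have hn : wideStrip (1 / 4) ∈ 𝓝 (0 : ℂ) :=
    (isOpen_wideStrip _).mem_nhds (zero_mem_wideStrip (by norm_num))
  have ht := tendsto_ofReal_wideStrip.mono_right nhdsWithin_le_nhds
  have hE := (((differentiableOn_eulerProd (a := a) hmul hA).differentiableAt
    hn).continuousAt.tendsto).comp ht
  obtain ⟨C, hC0, hC⟩ := (hLt 0).bdd.exists_nonneg (ε := 1) one_pos
  have hTl : Tendsto (fun σ : ℝ => T σ) (𝓝[>] 0) (𝓝 (1 / 2 + 0)) := by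
    refine tendsto_const_nhds.add ?_
    refine squeeze_zero_norm' (a := fun σ : ℝ => σ * (C * 2)) ?_ ?_
    · filter_upwards [Ioo_mem_nhdsGT (show (0 : ℝ) < 1 / 2 by norm_num)] with σ hσ
      have := hC σ ⟨by simpa using hσ.1, by simpa using hσ.2⟩
      simp only [Complex.ofReal_im, abs_zero, add_zero, zero_add, Real.rpow_one] at this
      rw [norm_mul, Complex.norm_real, Real.norm_of_nonneg hσ.1.le]
      exact mul_le_mul_of_nonneg_left this hσ.1.le
    · have : Tendsto (fun σ : ℝ => σ * (C * 2)) (𝓝 0) (𝓝 (0 * (C * 2))) :=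
        (continuous_id.mul continuous_const).tendsto 0
      rw [zero_mul] at this
      exact this.mono_left nhdsWithin_le_nhds
  have h3 := ((tendsto_mainFactor hA hℓ).mul hE).mul hTl
  have h4 := ofReal_degenerateProduct_mul (a := a) hmul hA hpp hℓ
  rw [Complex.ofReal_mul, h4]
  convert! h3 using 2
  push_cast
  ring

end ArithSeq

end

/-! ### Comparison of F(log M) with μ -/

noncomputable section
namespace ArithSeq

variable {h : ArithmeticFunction ℝ} {k : ℝ} {a : ℤ}

theorem mu_eq (M : ℝ) : mu h k a M = -(1 / 2 * (degenerateProduct h k a * singularProduct h k a) *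
    ((Real.Gamma (2 - k - omegaH h a))⁻¹ * Real.log M ^ (1 - k - omegaH h a : ℝ))) := by
  rw [mu]; ring

/-- If 2 - k - ω is a pole of Γ, so is each 2 - k - ω - i. Every coefficient of the expansion
vanishes, and only the arbitrarily small error is left. -/
theorem exists_abs_corrRem_le_of_gamma_eq_zero (hmul : h.IsMultiplicative)
    (hA : AnalyticCondition h k) (hpp : ∀ p : ℕ, p.Prime → ∀ e, 0 ≤ h (p ^ e))
    (hG : Real.Gamma (2 - k - omegaH h a) = 0) (A : ℝ) :
    ∃ C : ℝ, ∀ u : ℝ, 3 ≤ u → |corrRem h a u| ≤ C * u ^ (-A) := by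
  obtain ⟨q, -, hq⟩ := corrRem_expansion (a := a) hmul hA hpp
  obtain ⟨N, C, hC⟩ := hq A
  refine ⟨C, fun u hu => ?_⟩
  have h1 := hC u hu
  obtain ⟨m, hm⟩ := (Real.Gamma_eq_zero_iff _).1 hG
  rw [Finset.sum_eq_zero, sub_zero, Complex.norm_real, Real.norm_eq_abs] at h1
  · exact h1
  · intro i _
    have : Real.Gamma (-(k + omegaH h a - 2 + i)) = 0 :=
      (Real.Gamma_eq_zero_iff _).2 ⟨m + i, by push_cast; linarith⟩
    rw [this]; simp

theorem exists_abs_corrRem_add_mu_le (hmul : h.IsMultiplicative)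
    (hA : AnalyticCondition h k) (hpp : ∀ p : ℕ, p.Prime → ∀ e, 0 ≤ h (p ^ e))
    (hG : Real.Gamma (2 - k - omegaH h a) ≠ 0) :
    ∃ K : ℝ, ∀ M : ℝ, 3 ≤ Real.log M →
      |corrRem h a (Real.log M) + mu h k a M| ≤ K / Real.log M * |mu h k a M| := by
  obtain ⟨q, hq0, hq⟩ := corrRem_expansion (a := a) hmul hA hpp
  set κ := k + (omegaH h a : ℝ) with hκ
  -- Precision u^{-κ} suffices: the leading term has order u^{1-κ} and all later ones are O(u^{-κ}),
  -- a relative saving of one logarithm.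
  obtain ⟨N, C, hC⟩ := hq κ
  set d := degenerateProduct h k a * singularProduct h k a with hd
  set c₀ := |1 / 2 * d * (Real.Gamma (2 - k - omegaH h a))⁻¹| with hc₀
  have hd0 : d ≠ 0 := mul_ne_zero (degenerateProduct_pos hmul hpp).ne'
    (singularProduct_ne_zero hmul hA hpp)
  have hc0 : 0 < c₀ := abs_pos.2 (mul_ne_zero (mul_ne_zero (by norm_num) hd0) (inv_ne_zero hG))
  set K := |C| + ∑ i ∈ Finset.range N,
    ‖q (i + 1)‖ * |(Real.Gamma (-(κ - 2 + ((i + 1 : ℕ) : ℝ))))⁻¹| with hK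
  refine ⟨K / c₀, fun M hM => ?_⟩
  set u := Real.log M with hu
  have hu0 : 0 < u := by linarith
  have hmu : |mu h k a M| = c₀ * u ^ (1 - κ) := by
    rw [mu_eq, abs_neg, ← mul_assoc, abs_mul, abs_of_nonneg (Real.rpow_nonneg hu0.le _),
      sub_sub 1 k]
  have h1 := hC u hM
  rw [Finset.sum_range_succ', hq0] at h1
  set S := ∑ i ∈ Finset.range N, q (i + 1) * (((Real.Gamma (-(κ - 2 + ((i + 1 : ℕ) : ℝ))))⁻¹ *
            u ^ (-(κ - 2 + ((i + 1 : ℕ) : ℝ)) - 1) : ℝ) : ℂ) with hS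
  have hSb : ‖S‖ ≤ (∑ i ∈ Finset.range N,
      ‖q (i + 1)‖ * |(Real.Gamma (-(κ - 2 + ((i + 1 : ℕ) : ℝ))))⁻¹|) * u ^ (-κ) := by
    rw [Finset.sum_mul]
    refine norm_sum_le_of_le _ fun i _ => ?_
    rw [norm_mul, Complex.norm_real, Real.norm_eq_abs, abs_mul,
      abs_of_nonneg (Real.rpow_nonneg hu0.le _), mul_assoc]
    gcongr
    · linarith
    · push_cast
      have : (0 : ℝ) ≤ i := Nat.cast_nonneg i
      linarith
  have e1 : ((corrRem h a u + mu h k a M : ℝ) : ℂ) = ((corrRem h a u : ℂ) - (S +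
      ((1 / 2 * d : ℝ) : ℂ) * (((Real.Gamma (-(κ - 2 + ((0 : ℕ) : ℝ))))⁻¹ *
            u ^ (-(κ - 2 + ((0 : ℕ) : ℝ)) - 1) : ℝ) : ℂ))) + S := by
    rw [mu_eq, ← hd, ← hu]
    have e2 : -(κ - 2 + ((0 : ℕ) : ℝ)) = 2 - k - omegaH h a := by rw [hκ]; push_cast; ring
    have e3 : 2 - k - omegaH h a - 1 = 1 - k - (omegaH h a : ℝ) := by ring
    rw [e2, e3]
    push_cast
    ring
  rw [← Real.norm_eq_abs, ← Complex.norm_real, e1, hmu]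
  calc _ ≤ C * u ^ (-κ) + _ := (norm_add_le _ _).trans (add_le_add h1 hSb)
    _ ≤ K * u ^ (-κ) := by
        rw [hK, add_mul]; gcongr; exact le_abs_self C
    _ = K / c₀ / u * (c₀ * u ^ (1 - κ)) := by
        rw [show (1 - κ) = -κ + 1 by ring, Real.rpow_add hu0, Real.rpow_one]; field_simp

/-- The main asymptotic relation between `corrRem` and `μ_k(a, M)`. -/
theorem corrRem_asymptotic (hmul : h.IsMultiplicative)
    (hA : AnalyticCondition h k) (hpp : ∀ p : ℕ, p.Prime → ∀ e, 0 ≤ h (p ^ e)) :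
    ∃ η : ℝ → ℝ, Tendsto η atTop (𝓝 0) ∧ ∀ A : ℝ, 0 < A → ∃ C : ℝ, ∀ M : ℝ, 1 < M →
      |corrRem h a (Real.log M) + mu h k a M| ≤
        η M * |mu h k a M| + C * (1 / Real.log M ^ A) := by
  have hpos : ∀ p : ℕ, p.Prime → 0 ≤ h p := fun p hp => by simpa using hpp p hp 1
  set S := 5 * ∑' m : ℕ, |corr h a m| * (m : ℝ) ^ (-(1 / 4) : ℝ) with hS
  have hS0 : 0 ≤ S := by positivity
  -- For log M < 3 the remainder is bounded while (3/log M)^A ≥ 1, so everything goes into the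
  -- constant depending on A.
  have hsmall : ∀ A : ℝ, 0 < A → ∀ M : ℝ, 1 < M → Real.log M < 3 →
      |corrRem h a (Real.log M)| ≤ S * Real.exp (3 / 4) * 3 ^ A * (1 / Real.log M ^ A) := by
    intro A hA0 M hM hM3
    have hu0 := Real.log_pos hM
    have h1 := abs_corrRem_le (a := a) hmul hA hpos (σ := 1 / 4) (by norm_num) (by norm_num)
      (Real.log M)
    have h2 : Real.exp (1 / 4 * Real.log M) ≤ Real.exp (3 / 4) :=
      Real.exp_le_exp.2 (by linarith)
    have h3 : 1 ≤ 3 ^ A * (1 / Real.log M ^ A) := by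
      rw [mul_one_div, le_div_iff₀ (by positivity), one_mul]
      exact Real.rpow_le_rpow hu0.le hM3.le hA0.le
    calc _ ≤ S * Real.exp (1 / 4 * Real.log M) := h1
      _ ≤ S * Real.exp (3 / 4) := by gcongr
      _ ≤ S * Real.exp (3 / 4) * (3 ^ A * (1 / Real.log M ^ A)) :=
          le_mul_of_one_le_right (by positivity) h3
      _ = _ := by ring
  by_cases hG : Real.Gamma (2 - k - omegaH h a) = 0
  · have hmu : ∀ M, mu h k a M = 0 := fun M => by rw [mu_eq, hG]; simp
    refine ⟨fun _ => 0, tendsto_const_nhds, fun A hA0 => ?_⟩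
    obtain ⟨C, hC⟩ := exists_abs_corrRem_le_of_gamma_eq_zero hmul hA hpp hG A
    refine ⟨|C| + S * Real.exp (3 / 4) * 3 ^ A, fun M hM => ?_⟩
    have hu0 := Real.log_pos hM
    have hi : 0 ≤ 1 / Real.log M ^ A := by positivity
    rw [hmu, add_zero, zero_mul, zero_add, add_mul]
    rcases lt_or_ge (Real.log M) 3 with h3 | h3
    · exact (hsmall A hA0 M hM h3).trans (le_add_of_nonneg_left (by positivity))
    · refine (hC _ h3).trans ?_
      rw [Real.rpow_neg hu0.le, ← one_div]
      refine le_add_of_le_of_nonneg ?_ (by positivity)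
      gcongr; exact le_abs_self C
  · obtain ⟨K, hK⟩ := exists_abs_corrRem_add_mu_le hmul hA hpp hG
    -- For small M the value 1 lets |μ| absorb itself. The function does not depend on A.
    refine ⟨fun M => if Real.log M < 3 then 1 else K / Real.log M, ?_, fun A hA0 => ?_⟩
    · have h1 : Tendsto (fun M => K / Real.log M) atTop (𝓝 0) :=
        tendsto_const_nhds.div_atTop Real.tendsto_log_atTop
      refine h1.congr' ?_
      filter_upwards [Real.tendsto_log_atTop.eventually_ge_atTop 3] with M hM
      rw [if_neg (not_lt.2 hM)]
    · refine ⟨S * Real.exp (3 / 4) * 3 ^ A, fun M hM => ?_⟩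
      have hu0 := Real.log_pos hM
      dsimp only
      split_ifs with h3
      · have := hsmall A hA0 M hM h3
        have := abs_add_le (corrRem h a (Real.log M)) (mu h k a M)
        linarith
      · have := hK M (not_lt.1 h3)
        have : 0 ≤ S * Real.exp (3 / 4) * 3 ^ A * (1 / Real.log M ^ A) := by positivity
        linarith

end ArithSeq

end

/-! ### Sums of g by convolution -/

noncomputable section
namespace ArithSeq

theorem sum_divisors_mul_eq {R : Type*} [CommRing R] (b φ : ℕ → R) (N : ℕ) :
    ∑ r ∈ Finset.Icc 1 N, (∑ d ∈ r.divisors, b d) * φ r =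
      ∑ m ∈ Finset.Icc 1 N, b m * ∑ n ∈ Finset.Icc 1 (N / m), φ (m * n) := by
  have h1 : ∀ m ∈ Finset.Icc 1 N, b m * ∑ n ∈ Finset.Icc 1 (N / m), φ (m * n) =
      ∑ r ∈ (Finset.Icc 1 N).filter (m ∣ ·), b m * φ r := by
    intro m hm
    have hm0 : 0 < m := (Finset.mem_Icc.1 hm).1
    rw [Finset.mul_sum]
    refine Finset.sum_nbij' (fun n => m * n) (fun r => r / m) ?_ ?_ ?_ ?_ ?_
    · intro n hn
      obtain ⟨h1, h2⟩ := Finset.mem_Icc.1 hn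
      refine Finset.mem_filter.2 ⟨Finset.mem_Icc.2 ⟨Nat.mul_pos hm0 h1, ?_⟩, dvd_mul_right _ _⟩
      rw [mul_comm]; exact (Nat.le_div_iff_mul_le hm0).1 h2
    · intro r hr
      obtain ⟨h1, c, rfl⟩ := Finset.mem_filter.1 hr
      obtain ⟨h2, h3⟩ := Finset.mem_Icc.1 h1
      rw [Nat.mul_div_cancel_left _ hm0]
      exact Finset.mem_Icc.2 ⟨Nat.pos_of_mul_pos_left h2, (Nat.le_div_iff_mul_le hm0).2
        (by rwa [mul_comm])⟩
    · intro n _; exact Nat.mul_div_cancel_left _ hm0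
    · intro r hr
      exact Nat.mul_div_cancel' (Finset.mem_filter.1 hr).2
    · intro n _; rfl
  rw [Finset.sum_congr rfl h1]
  simp_rw [Finset.sum_mul]
  refine Finset.sum_comm' fun r d => ?_
  simp only [Finset.mem_Icc, Nat.mem_divisors, Finset.mem_filter]
  constructor
  · rintro ⟨⟨h1, h2⟩, h3, h4⟩
    exact ⟨⟨⟨h1, h2⟩, h3⟩, Nat.pos_of_dvd_of_pos h3 h1, (Nat.le_of_dvd h1 h3).trans h2⟩
  · rintro ⟨⟨⟨h1, h2⟩, h3⟩, -, -⟩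
    exact ⟨⟨h1, h2⟩, h3, by omega⟩

variable {h : ArithmeticFunction ℝ} {k : ℝ} {a : ℤ}

/-- `∑_{r ≤ t} g(r)`. -/
def gSum (h : ArithmeticFunction ℝ) (a : ℤ) (t : ℝ) : ℝ := ∑ r ∈ Finset.Icc 1 ⌊t⌋₊, g h a r

/-- `∑_{r < t} g(r)`. -/
def gSumLt (h : ArithmeticFunction ℝ) (a : ℤ) (t : ℝ) : ℝ := ∑ r ∈ Finset.Ico 1 ⌈t⌉₊, g h a r

/-- The residue `∑ b(m) / m`. -/
def resid (h : ArithmeticFunction ℝ) (a : ℤ) : ℝ := ∑' m : ℕ, corr h a m * (1 / m)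

/-- The constant term `∑ b(m) (γ - log m) / m`. -/
def constTerm (h : ArithmeticFunction ℝ) (a : ℤ) : ℝ :=
  ∑' m : ℕ, corr h a m * (1 / m * (Real.eulerMascheroniConstant - Real.log m))

theorem g_eq_div {r : ℕ} (hr : 1 ≤ r) : g h a r = (∑ d ∈ r.divisors, corr h a d) * (1 / r) := by
  have : (r : ℝ) ≠ 0 := by exact_mod_cast (by omega : r ≠ 0)
  rw [sum_divisors_corr, weight_apply]; field_simp

/-- Möbius inversion gives g(r) = (1/r) ∑_{d ∣ r} b(d). The sum over m may be infinite because the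
inner range is empty for m > t. -/
theorem sum_g_mul_eq (φ : ℕ → ℝ) (t : ℝ) :
    ∑ r ∈ Finset.Icc 1 ⌊t⌋₊, g h a r * φ r =
      ∑' m : ℕ, corr h a m * ∑ n ∈ Finset.Icc 1 ⌊t / m⌋₊, 1 / ((m * n : ℕ) : ℝ) * φ (m * n) := by
  have h1 : ∑ r ∈ Finset.Icc 1 ⌊t⌋₊, g h a r * φ r =
      ∑ r ∈ Finset.Icc 1 ⌊t⌋₊, (∑ d ∈ r.divisors, corr h a d) * (1 / (r : ℝ) * φ r) :=
    Finset.sum_congr rfl fun r hr => by rw [g_eq_div (Finset.mem_Icc.1 hr).1]; ring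
  rw [h1, sum_divisors_mul_eq (fun d => corr h a d) (fun r => 1 / (r : ℝ) * φ r), eq_comm,
    tsum_eq_sum (s := Finset.Icc 1 ⌊t⌋₊)]
  · refine Finset.sum_congr rfl fun m _ => ?_
    rw [Nat.floor_div_natCast]
  · intro m hm
    rcases Nat.eq_zero_or_pos m with rfl | hm0
    · simp
    · rw [Finset.mem_Icc, not_and, not_le] at hm
      rw [Nat.floor_div_natCast, Nat.div_eq_of_lt (hm hm0)]; simp

theorem exists_abs_g_le (hmul : h.IsMultiplicative) (hA : AnalyticCondition h k)
    (hpos : ∀ p : ℕ, p.Prime → 0 ≤ h p) {ε : ℝ} (hε : 0 < ε) :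
    ∃ C : ℝ, 0 ≤ C ∧ ∀ r : ℕ, 1 ≤ r → |g h a r| ≤ C * (r : ℝ) ^ (ε - 1) := by
  have hs := summable_corr (a := a) hmul hA hpos hε
  refine ⟨∑' m : ℕ, |corr h a m| * (m : ℝ) ^ (-ε), by positivity, fun r hr => ?_⟩
  have hr0 : (0 : ℝ) < r := by exact_mod_cast hr
  rw [g_eq_div hr, abs_mul, abs_of_nonneg (by positivity : (0 : ℝ) ≤ 1 / r), Real.rpow_sub hr0,
    Real.rpow_one, mul_one_div, mul_div_assoc']
  gcongr
  calc |∑ d ∈ r.divisors, corr h a d| ≤ ∑ d ∈ r.divisors, |corr h a d| :=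
        Finset.abs_sum_le_sum_abs _ _
    _ ≤ ∑ d ∈ r.divisors, |corr h a d| * (d : ℝ) ^ (-ε) * (r : ℝ) ^ ε := by
        refine Finset.sum_le_sum fun d hd => ?_
        have hd1 := Nat.pos_of_mem_divisors hd
        have hd0 : (0 : ℝ) < d := by exact_mod_cast hd1
        have hdr : (d : ℝ) ≤ r := by exact_mod_cast Nat.divisor_le hd
        rw [mul_assoc]
        refine le_mul_of_one_le_right (abs_nonneg _) ?_
        rw [Real.rpow_neg hd0.le, inv_mul_eq_div, one_le_div (by positivity)]
        gcongr
    _ ≤ (∑' m : ℕ, |corr h a m| * (m : ℝ) ^ (-ε)) * (r : ℝ) ^ ε := by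
        rw [← Finset.sum_mul]
        gcongr
        exact hs.sum_le_tsum _ fun _ _ => by positivity

theorem summable_corr_div (hmul : h.IsMultiplicative) (hA : AnalyticCondition h k)
    (hpos : ∀ p : ℕ, p.Prime → 0 ≤ h p) : Summable fun m : ℕ => corr h a m * (1 / (m : ℝ)) := by
  refine (summable_corr (a := a) hmul hA hpos one_pos).of_norm_bounded fun m => ?_
  rw [Real.norm_eq_abs, abs_mul, abs_of_nonneg (by positivity : (0 : ℝ) ≤ 1 / m), one_div,
    Real.rpow_neg_one]

theorem abs_log_add_le {ε u c : ℝ} (hε : 0 < ε) (hu : 0 < u) :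
    |Real.log u + c| ≤ (1 / ε + |c|) * (u ^ ε + u ^ (-ε)) := by
  have h1 : 1 ≤ u ^ ε + u ^ (-ε) := by
    rcases le_total 1 u with h | h
    · linarith [Real.one_le_rpow h hε.le, Real.rpow_nonneg hu.le (-ε)]
    · linarith [Real.one_le_rpow_of_pos_of_le_one_of_nonpos hu h (neg_nonpos.2 hε.le),
        Real.rpow_nonneg hu.le ε]
  have h2 : |Real.log u| ≤ 1 / ε * (u ^ ε + u ^ (-ε)) := by
    have h3 := Real.log_le_rpow_div hu.le hε
    have h4 := Real.log_le_rpow_div (inv_pos.2 hu).le hε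
    rw [Real.log_inv, Real.inv_rpow hu.le, ← Real.rpow_neg hu.le] at h4
    have h5 : 1 / ε * (u ^ ε + u ^ (-ε)) = u ^ ε / ε + u ^ (-ε) / ε := by ring
    have h6 : 0 ≤ u ^ ε / ε := by positivity
    have h7 : 0 ≤ u ^ (-ε) / ε := by positivity
    rw [h5, abs_le]; constructor <;> linarith
  calc _ ≤ |Real.log u| + |c| := abs_add_le _ _
    _ ≤ 1 / ε * (u ^ ε + u ^ (-ε)) + |c| * (u ^ ε + u ^ (-ε)) :=
        add_le_add h2 (le_mul_of_one_le_right (abs_nonneg _) h1)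
    _ = _ := by ring

theorem summable_corr_div_log (hmul : h.IsMultiplicative) (hA : AnalyticCondition h k)
    (hpos : ∀ p : ℕ, p.Prime → 0 ≤ h p) :
    Summable fun m : ℕ => corr h a m * (1 / m * (Real.eulerMascheroniConstant - Real.log m)) := by
  set γ := Real.eulerMascheroniConstant
  refine ((summable_corr (a := a) hmul hA hpos (σ := 1 / 2) (by norm_num)).mul_left
    ((2 + |γ|) * 2)).of_norm_bounded fun m => ?_
  rcases Nat.eq_zero_or_pos m with rfl | hm
  · simp
  have hm1 : (1 : ℝ) ≤ m := by exact_mod_cast hm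
  have hm0 : (0 : ℝ) < m := by linarith
  have h1 := abs_log_add_le (ε := 1 / 2) (c := -γ) (by norm_num) hm0
  rw [abs_neg] at h1
  have h2 : (m : ℝ) ^ (-(1 / 2) : ℝ) ≤ (m : ℝ) ^ (1 / 2 : ℝ) :=
    Real.rpow_le_rpow_of_exponent_le hm1 (by norm_num)
  have h3 : |γ - Real.log m| ≤ (2 + |γ|) * 2 * (m : ℝ) ^ (1 / 2 : ℝ) := by
    rw [← abs_neg, neg_sub, sub_eq_add_neg]
    refine h1.trans ?_
    have : (1 : ℝ) / (1 / 2) = 2 := by norm_num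
    rw [this, mul_assoc]
    gcongr; linarith
  have h4 : (m : ℝ) ^ (1 / 2 : ℝ) * (1 / m) = (m : ℝ) ^ (-(1 / 2) : ℝ) := by
    rw [show (1 : ℝ) / m = (m : ℝ) ^ (-1 : ℝ) by rw [Real.rpow_neg_one, one_div],
      ← Real.rpow_add hm0]
    norm_num
  rw [Real.norm_eq_abs, abs_mul, abs_mul, abs_of_nonneg (by positivity : (0 : ℝ) ≤ 1 / m)]
  calc _ ≤ |corr h a m| * (1 / m * ((2 + |γ|) * 2 * (m : ℝ) ^ (1 / 2 : ℝ))) := by gcongr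
    _ = (2 + |γ|) * 2 * (|corr h a m| * ((m : ℝ) ^ (1 / 2 : ℝ) * (1 / m))) := by ring
    _ = _ := by rw [h4]

/-- The bound must also hold for u < 1, where the harmonic sum is empty and log u + γ is the whole
error. Then the tail m > t of the convolution needs no separate treatment. -/
theorem exists_abs_harm_sub_le {ε : ℝ} (hε : 0 < ε) (hε1 : ε ≤ 1 / 2) :
    ∃ C : ℝ, 0 ≤ C ∧ ∀ u : ℝ, 0 < u →
      |harm ⌊u⌋₊ - Real.log u - Real.eulerMascheroniConstant| ≤ C * u ^ (ε - 1) := by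
  set γ := Real.eulerMascheroniConstant
  refine ⟨6 + (1 / ε + |γ|) * 2, by positivity, fun u hu => ?_⟩
  have h5 : 0 ≤ u ^ (ε - 1) := by positivity
  rcases le_or_gt 1 u with h1 | h1
  · refine (abs_harm_sub_le h1).trans ?_
    have h2 : u ^ (-1 : ℝ) ≤ u ^ (ε - 1) := Real.rpow_le_rpow_of_exponent_le h1 (by linarith)
    rw [Real.rpow_neg_one] at h2
    have : 0 ≤ (1 / ε + |γ|) * 2 := by positivity
    rw [div_eq_mul_inv]
    nlinarith
  · rw [Nat.floor_eq_zero.2 h1]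
    have h0 : harm 0 = 0 := by simp [harm]
    rw [h0, zero_sub, ← neg_add', abs_neg]
    refine (abs_log_add_le hε hu).trans ?_
    have h3 : u ^ ε ≤ u ^ (ε - 1) := Real.rpow_le_rpow_of_exponent_ge hu h1.le (by linarith)
    have h4 : u ^ (-ε) ≤ u ^ (ε - 1) := Real.rpow_le_rpow_of_exponent_ge hu h1.le (by linarith)
    calc _ ≤ (1 / ε + |γ|) * (u ^ (ε - 1) + u ^ (ε - 1)) := by gcongr
      _ ≤ _ := by nlinarith

theorem gSum_eq (t : ℝ) :
    gSum h a t = ∑' m : ℕ, corr h a m * (1 / m * harm ⌊t / m⌋₊) := by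
  have h1 := sum_g_mul_eq (h := h) (a := a) (fun _ => 1) t
  simp only [mul_one] at h1
  rw [gSum, h1]
  refine tsum_congr fun m => ?_
  have h2 : 1 / (m : ℝ) * harm ⌊t / m⌋₊ =
      ∑ n ∈ Finset.Icc 1 ⌊t / m⌋₊, 1 / ((m * n : ℕ) : ℝ) := by
    rw [harm, Finset.mul_sum]
    exact Finset.sum_congr rfl fun n _ => by rw [Nat.cast_mul, one_div_mul_one_div]
  rw [h2]

/-- `∑_{r ≤ t} g(r) = c log t + c' + O(t ^ (ε - 1))`. -/
theorem exists_abs_gSum_sub_le (hmul : h.IsMultiplicative) (hA : AnalyticCondition h k)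
    (hpos : ∀ p : ℕ, p.Prime → 0 ≤ h p) {ε : ℝ} (hε : 0 < ε) (hε1 : ε ≤ 1 / 2) :
    ∃ C : ℝ, 0 ≤ C ∧ ∀ t : ℝ, 0 < t →
      |gSum h a t - (resid h a * Real.log t + constTerm h a)| ≤ C * t ^ (ε - 1) := by
  set γ := Real.eulerMascheroniConstant with hγ
  obtain ⟨C, hC, hb⟩ := exists_abs_harm_sub_le hε hε1
  have hs := summable_corr (a := a) hmul hA hpos hε
  have hs1 := summable_corr_div (a := a) hmul hA hpos
  have hs2 := summable_corr_div_log (a := a) hmul hA hpos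
  refine ⟨C * ∑' m : ℕ, |corr h a m| * (m : ℝ) ^ (-ε), by positivity, fun t ht => ?_⟩
  have hbd : ∀ m : ℕ, ‖corr h a m * (1 / m * (harm ⌊t / m⌋₊ - Real.log (t / m) - γ))‖ ≤
      C * t ^ (ε - 1) * (|corr h a m| * (m : ℝ) ^ (-ε)) := by
    intro m
    rcases Nat.eq_zero_or_pos m with rfl | hm
    · simp
    have hm0 : (0 : ℝ) < m := by exact_mod_cast hm
    rw [Real.norm_eq_abs, abs_mul, abs_mul, abs_of_nonneg (by positivity : (0 : ℝ) ≤ 1 / m)]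
    calc _ ≤ |corr h a m| * (1 / m * (C * (t / m) ^ (ε - 1))) := by
          gcongr; exact hb _ (by positivity)
      _ = _ := by
          rw [Real.div_rpow ht.le hm0.le, Real.rpow_sub hm0, Real.rpow_one, Real.rpow_neg hm0.le]
          field_simp
  have hs3 := (hs.mul_left (C * t ^ (ε - 1))).of_norm_bounded hbd
  have h1 : gSum h a t - (resid h a * Real.log t + constTerm h a) =
      ∑' m : ℕ, corr h a m * (1 / m * (harm ⌊t / m⌋₊ - Real.log (t / m) - γ)) := by
    have h2 : gSum h a t = ∑' m : ℕ, (corr h a m * (1 / m * (harm ⌊t / m⌋₊ -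
        Real.log (t / m) - γ)) + (corr h a m * (1 / m) * Real.log t +
          corr h a m * (1 / m * (γ - Real.log m)))) := by
      rw [gSum_eq]
      refine tsum_congr fun m => ?_
      rcases Nat.eq_zero_or_pos m with rfl | hm
      · simp
      have hm0 : (m : ℝ) ≠ 0 := by exact_mod_cast hm.ne'
      rw [Real.log_div ht.ne' hm0]; ring
    rw [h2, hs3.tsum_add ((hs1.mul_right _).add hs2), (hs1.mul_right _).tsum_add hs2,
      tsum_mul_right, resid, constTerm]
    ring
  rw [h1, ← Real.norm_eq_abs]
  refine (tsum_of_norm_bounded (hs.mul_left (C * t ^ (ε - 1))).hasSum hbd).trans_eq ?_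
  rw [tsum_mul_left]; ring

/-- Strict and weak inequality differ only if t is an integer, and then by the single term g(t) =
O(t^{ε-1}). -/
theorem exists_abs_gSumLt_sub_le (hmul : h.IsMultiplicative) (hA : AnalyticCondition h k)
    (hpos : ∀ p : ℕ, p.Prime → 0 ≤ h p) {ε : ℝ} (hε : 0 < ε) (hε1 : ε ≤ 1 / 2) :
    ∃ C : ℝ, 0 ≤ C ∧ ∀ t : ℝ, 0 < t →
      |gSumLt h a t - (resid h a * Real.log t + constTerm h a)| ≤ C * t ^ (ε - 1) := by
  obtain ⟨C, hC, hb⟩ := exists_abs_gSum_sub_le (a := a) hmul hA hpos hε hε1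
  obtain ⟨D, hD, hg⟩ := exists_abs_g_le (a := a) hmul hA hpos hε
  refine ⟨C + D, by positivity, fun t ht => ?_⟩
  have h1 : |gSumLt h a t - gSum h a t| ≤ D * t ^ (ε - 1) := by
    rcases (Nat.floor_le_ceil t).eq_or_lt with h2 | h2
    · have h3 : (⌊t⌋₊ : ℝ) = t :=
        le_antisymm (Nat.floor_le ht.le) (by rw [h2]; exact Nat.le_ceil t)
      have h4 : 1 ≤ ⌊t⌋₊ := by
        rcases Nat.eq_zero_or_pos ⌊t⌋₊ with h5 | h5
        · rw [h5] at h3; simp at h3; linarith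
        · exact h5
      have h5 : gSum h a t = gSumLt h a t + g h a ⌊t⌋₊ := by
        rw [gSum, gSumLt, ← h2, ← Finset.sum_Ico_succ_top h4]; rfl
      rw [h5, sub_add_cancel_left, abs_neg]
      have := hg _ h4
      rwa [h3] at this
    · have h3 : ⌈t⌉₊ = ⌊t⌋₊ + 1 := le_antisymm (Nat.ceil_le_floor_add_one t) h2
      have h4 : gSumLt h a t = gSum h a t := by rw [gSum, gSumLt, h3]; rfl
      rw [h4, sub_self, abs_zero]; positivity
  have := abs_sub_le (gSumLt h a t) (gSum h a t) (resid h a * Real.log t + constTerm h a)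
  nlinarith [hb t ht]

/-- `∑_{r ≤ M} g(r) (1 - r / M) = c log M + c' - c + F(M) / M`. -/
theorem sum_g_mul_one_sub (hmul : h.IsMultiplicative) (hA : AnalyticCondition h k)
    (hpos : ∀ p : ℕ, p.Prime → 0 ≤ h p) {M : ℝ} (hM : 0 < M) :
    ∑ r ∈ Finset.Icc 1 ⌊M⌋₊, g h a r * (1 - r / M) =
      resid h a * Real.log M + constTerm h a - resid h a + corrRem h a (Real.log M) / M := by
  set γ := Real.eulerMascheroniConstant with hγ
  have hs1 := summable_corr_div (a := a) hmul hA hpos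
  have hs2 := summable_corr_div_log (a := a) hmul hA hpos
  have hs3 := summable_corrRem (a := a) hmul hA hpos (Real.log M)
  have h1 : ∑ r ∈ Finset.Icc 1 ⌊M⌋₊, g h a r * (1 - r / M) =
      ∑' m : ℕ, ((corr h a m * (1 / m) * (Real.log M - 1) +
        corr h a m * (1 / m * (γ - Real.log m))) +
        corr h a m * remExp (Real.log M - Real.log m) * (1 / M)) := by
    rw [sum_g_mul_eq (fun r => 1 - (r : ℝ) / M)]
    refine tsum_congr fun m => ?_
    rcases Nat.eq_zero_or_pos m with rfl | hm
    · simp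
    have hm0 : (0 : ℝ) < m := by exact_mod_cast hm
    -- The weight 1 - r/M is chosen by the problem so that the inner sum is exactly the function
    -- whose remainder is P.
    have h2 : ∑ n ∈ Finset.Icc 1 ⌊M / m⌋₊, 1 / ((m * n : ℕ) : ℝ) * (1 - ((m * n : ℕ) : ℝ) / M) =
        hypSum (M / m) * (1 / M) := by
      rw [hypSum, Finset.sum_mul]
      refine Finset.sum_congr rfl fun n hn => ?_
      have hn0 : (n : ℝ) ≠ 0 := by
        have := (Finset.mem_Icc.1 hn).1
        exact_mod_cast (by omega : n ≠ 0)
      push_cast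
      field_simp
    rw [h2, remExp, Real.exp_sub, Real.exp_log hM, Real.exp_log hm0, remKernel,
      Real.log_div hM.ne' hm0.ne']
    field_simp
    ring
  rw [h1, ((hs1.mul_right _).add hs2).tsum_add (hs3.mul_right _), (hs1.mul_right _).tsum_add hs2,
    tsum_mul_right, tsum_mul_right, resid, constTerm, corrRem]
  ring

end ArithSeq

end

/-! ### Growth of the counting function -/

noncomputable section
namespace ArithSeq
open MeasureTheory

section Size

variable {s : ℕ → ℝ} {L : ℝ → ℝ} {a : ℤ} {δ C : ℝ}

theorem count_mono (hs : ∀ n, 1 ≤ n → 0 ≤ s n) : Monotone (count s) := fun _ _ hxy =>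
  Finset.sum_le_sum_of_subset_of_nonneg
    (Finset.Icc_subset_Icc_right (Nat.floor_le_floor hxy))
    fun n hn _ => hs n (Finset.mem_Icc.1 hn).1

theorem count_of_lt_one {x : ℝ} (hx : x < 1) : count s x = 0 := by
  rw [count, Nat.floor_eq_zero.2 hx]; simp

/-- The size hypotheses in the form in which they are used: `δ` is common, and `L` is at most a
power of `x`. -/
structure Regular (s : ℕ → ℝ) (L : ℝ → ℝ) (δ C : ℝ) : Prop where
  nonneg : ∀ n, 1 ≤ n → 0 ≤ s n
  scale : IsScale L
  delta_pos : 0 < δ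
  delta_le : δ ≤ 1
  const_nonneg : 0 ≤ C
  pos : ∀ᶠ x in atTop, 0 < count s x
  pow_le : ∀ᶠ x in atTop, L x ^ (1 + δ) ≤ √x
  ratio : ∀ᶠ x in atTop, ∀ z : ℝ, 1 / L x ≤ z → z ≤ 1 →
    |count s (z * x) - z * count s x| ≤ C * (count s x / L x ^ (1 + δ))
  term : ∀ᶠ x in atTop, ∀ n : ℕ, 1 ≤ n → (n : ℝ) ≤ x → s n ≤ C * (count s x / L x ^ (1 + δ))

namespace Regular

theorem eventually_scale (H : Regular s L δ C) :
    ∀ᶠ x in atTop, 2 ≤ L x ∧ L x ≤ √x ∧ 1 ≤ x := by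
  filter_upwards [H.scale.tendsto.eventually_ge_atTop 2, H.pow_le, eventually_ge_atTop 1] with
    x h1 h2 h3
  refine ⟨h1, le_trans ?_ h2, h3⟩
  exact Real.self_le_rpow_of_one_le (by linarith) (by linarith [H.delta_pos])

theorem one_le (H : Regular s L δ C) {x : ℝ} (hx : 0 ≤ x) : 1 ≤ L x := H.scale.one_le x hx

/-- `𝒜(y) ≪ (y / x) ^ α 𝒜(x)` for `1 ≤ y ≤ x` and every `α < 1`. -/
theorem exists_count_le (H : Regular s L δ C) {α : ℝ} (h0 : 0 ≤ α) (h1 : α < 1) :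
    ∃ K x₀ : ℝ, 0 ≤ K ∧ ∀ x, x₀ ≤ x → ∀ y, 1 ≤ y → y ≤ x →
      count s y ≤ K * (y / x) ^ α * count s x := by
  have hC := H.const_nonneg
  have hev : ∀ᶠ x in atTop, (1 + C) ≤ L x ^ (1 - α) :=
    ((tendsto_rpow_atTop (by linarith : 0 < 1 - α)).comp H.scale.tendsto).eventually_ge_atTop _
  obtain ⟨x₁, hx₁⟩ := eventually_atTop.1 (hev.and (H.eventually_scale.and (H.ratio.and H.pos)))
  set x₀ := max x₁ 2 with hx₀
  have hK1 : 1 + C ≤ max (1 + C) (x₀ ^ α) := le_max_left _ _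
  have hK2 : x₀ ^ α ≤ max (1 + C) (x₀ ^ α) := le_max_right _ _
  -- The first entry serves a single application of the regularity hypothesis, the second the end of
  -- the descent, below x₀.
  set K := max (1 + C) (x₀ ^ α)
  have hx₀2 : 2 ≤ x₀ := le_max_right _ _
  refine ⟨K, x₀, by linarith, ?_⟩
  -- Descent from x to x/L(x). One step costs a factor 1 + C ≤ L(x)^{1-α}, absorbed by using the
  -- exponent α < 1, so the constant does not grow with the number of steps. As L(x) ≥ 2, the dyadic
  -- bound decreases.
  have main : ∀ n : ℕ, ∀ x, x ≤ 2 ^ n → x₀ ≤ x → ∀ y, 1 ≤ y → y ≤ x →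
      count s y ≤ K * (y / x) ^ α * count s x := by
    intro n
    induction n with
    | zero => intro x hx hx'; rw [pow_zero] at hx; linarith
    | succ n ih =>
      intro x hxn hx y hy hyx
      obtain ⟨hL1, ⟨hL2, hL3, hx1⟩, hrat, hApos⟩ := hx₁ x ((le_max_left _ _).trans hx)
      have hx0 : 0 < x := by linarith
      have hL0 : 0 < L x := by linarith
      have hrat' : ∀ z, 1 / L x ≤ z → z ≤ 1 → count s (z * x) ≤ (1 + C) * z * count s x := by
        intro z hz hz1
        have h2 := (abs_le.1 (hrat z hz hz1)).2
        have h3 : count s x / L x ^ (1 + δ) ≤ z * count s x := by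
          have h4 : L x ≤ L x ^ (1 + δ) :=
            Real.self_le_rpow_of_one_le (by linarith) (by linarith [H.delta_pos])
          have h5 : 1 / L x ^ (1 + δ) ≤ z := (one_div_le_one_div_of_le hL0 h4).trans hz
          rw [div_eq_mul_one_div, mul_comm]
          gcongr
        nlinarith
      rcases le_or_gt (x / L x) y with h2 | h2
      · have h3 := hrat' (y / x) (by rwa [div_le_div_iff₀ hL0 hx0, one_mul, ← div_le_iff₀ hL0])
          ((div_le_one hx0).2 hyx)
        rw [div_mul_cancel₀ _ hx0.ne'] at h3
        refine h3.trans ?_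
        have h4 : y / x ≤ (y / x) ^ α :=
          Real.self_le_rpow_of_le_one (by positivity) ((div_le_one hx0).2 hyx) h1.le
        have : 0 ≤ y / x := by positivity
        gcongr
      · have h3 : count s (x / L x) ≤ (1 / L x) ^ α * count s x := by
          have h4 := hrat' (1 / L x) le_rfl ((div_le_one hL0).2 (by linarith))
          rw [one_div_mul_eq_div] at h4
          refine h4.trans ?_
          gcongr
          have h5 : (1 / L x) ^ α = L x ^ (1 - α) * (1 / L x) := by
            rw [Real.rpow_sub hL0, Real.rpow_one, one_div, Real.inv_rpow hL0.le]
            field_simp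
          rw [h5]
          gcongr
        rcases le_or_gt x₀ (x / L x) with h4 | h4
        · have h5 : x / L x ≤ 2 ^ n := by
            rw [div_le_iff₀ hL0]
            calc x ≤ 2 ^ n * 2 := by rwa [← pow_succ]
              _ ≤ _ := by gcongr
          refine (ih _ h5 h4 y hy h2.le).trans ?_
          have h6 : (y / (x / L x)) ^ α * (1 / L x) ^ α = (y / x) ^ α := by
            rw [← Real.mul_rpow (by positivity) (by positivity)]
            congr 1; field_simp
          calc K * (y / (x / L x)) ^ α * count s (x / L x) ≤
                K * (y / (x / L x)) ^ α * ((1 / L x) ^ α * count s x) := by gcongr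
            _ = K * ((y / (x / L x)) ^ α * (1 / L x) ^ α) * count s x := by ring
            _ = _ := by rw [h6]
        · refine (count_mono H.nonneg h2.le).trans (h3.trans ?_)
          gcongr
          have h5 : 1 / L x = (1 / x) * (x / L x) := by field_simp
          calc (1 / L x) ^ α = (1 / x) ^ α * (x / L x) ^ α := by
                rw [h5, Real.mul_rpow (by positivity) (by positivity)]
            _ ≤ (y / x) ^ α * x₀ ^ α := by gcongr
            _ ≤ (y / x) ^ α * K := by gcongr
            _ = _ := mul_comm _ _
  intro x hx
  obtain ⟨n, hn⟩ := pow_unbounded_of_one_lt x one_lt_two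
  exact main n x hn.le hx

/-- `∑_{n ≤ x} s(n) (x / n) ^ β ≪ 𝒜(x)` for every `β < 1`. -/
theorem exists_sum_mul_rpow_le (H : Regular s L δ C) {β : ℝ} (h0 : 0 ≤ β) (h1 : β < 1) :
    ∃ K : ℝ, 0 ≤ K ∧ ∀ᶠ x in atTop,
      ∑ n ∈ Finset.Icc 1 ⌊x⌋₊, s n * (x / n) ^ β ≤ K * count s x := by
  -- Any α strictly between β and 1 works: in the dyadic decomposition by x/n the block at 2^j
  -- contributes a multiple of 2^{j(β-α)}.
  set α := (1 + β) / 2 with hα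
  obtain ⟨K, x₀, hK, hb⟩ := H.exists_count_le (α := α) (by linarith) (by linarith)
  have hq : (2 : ℝ) ^ (β - α) < 1 := Real.rpow_lt_one_of_one_lt_of_neg one_lt_two (by linarith)
  have hq0 : (0 : ℝ) ≤ 2 ^ (β - α) := by positivity
  have hgeo := summable_geometric_of_lt_one hq0 hq
  refine ⟨2 ^ β * K * ∑' j : ℕ, ((2 : ℝ) ^ (β - α)) ^ j, by positivity, ?_⟩
  filter_upwards [eventually_ge_atTop x₀, eventually_ge_atTop 1] with x hx hx1
  have hx0 : 0 < x := by linarith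
  obtain ⟨J, hJ⟩ := pow_unbounded_of_one_lt x (one_lt_two (α := ℝ))
  have hterm : ∀ n ∈ Finset.Icc 1 ⌊x⌋₊, s n * (x / n) ^ β ≤
      ∑ j ∈ Finset.range J, if (n : ℝ) ≤ x / 2 ^ j then s n * (2 ^ β * (2 ^ β) ^ j) else 0 := by
    intro n hn
    obtain ⟨hn1, hn2⟩ := Finset.mem_Icc.1 hn
    have hnx : (n : ℝ) ≤ x := (Nat.le_floor_iff hx0.le).1 hn2
    have hn0 : (0 : ℝ) < n := by exact_mod_cast hn1
    have hsn := H.nonneg n hn1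
    obtain ⟨j, hj1, hj2⟩ := exists_nat_pow_near ((one_le_div hn0).2 hnx) (one_lt_two (α := ℝ))
    have hjJ : j < J := by
      by_contra! hc
      have h3 : x / n ≤ x := div_le_self hx0.le (by exact_mod_cast hn1)
      have h4 : (2 : ℝ) ^ J ≤ 2 ^ j := pow_le_pow_right₀ one_le_two hc
      linarith
    have h2 : (n : ℝ) ≤ x / 2 ^ j := by
      rw [le_div_iff₀ (by positivity)]
      rw [le_div_iff₀ hn0] at hj1; linarith
    calc s n * (x / n) ^ β ≤ s n * (2 ^ (j + 1)) ^ β := by gcongr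
      _ = s n * (2 ^ β * (2 ^ β) ^ j) := by
          rw [pow_succ', Real.mul_rpow (by positivity) (by positivity), ← Real.rpow_natCast_mul
            (by positivity), ← Real.rpow_mul_natCast (by positivity), mul_comm (j : ℝ)]
      _ = if (n : ℝ) ≤ x / 2 ^ j then s n * (2 ^ β * (2 ^ β) ^ j) else 0 := by rw [if_pos h2]
      _ ≤ _ := Finset.single_le_sum (f := fun j : ℕ => if (n : ℝ) ≤ x / 2 ^ j then
          s n * (2 ^ β * (2 ^ β) ^ j) else 0) (fun i _ => by split_ifs <;> positivity) (Finset.mem_range.2 hjJ)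
  refine (Finset.sum_le_sum hterm).trans ?_
  rw [Finset.sum_comm]
  have hj : ∀ j : ℕ, ∑ n ∈ Finset.Icc 1 ⌊x⌋₊,
      (if (n : ℝ) ≤ x / 2 ^ j then s n * (2 ^ β * (2 ^ β) ^ j) else 0) ≤
      2 ^ β * K * count s x * ((2 : ℝ) ^ (β - α)) ^ j := by
    intro j
    have h2 : ∑ n ∈ Finset.Icc 1 ⌊x⌋₊,
        (if (n : ℝ) ≤ x / 2 ^ j then s n * (2 ^ β * (2 ^ β) ^ j) else 0) =
        count s (x / 2 ^ j) * (2 ^ β * (2 ^ β) ^ j) := by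
      rw [← Finset.sum_filter, count, Finset.sum_mul]
      refine Finset.sum_congr ?_ fun _ _ => rfl
      ext n
      rw [Finset.mem_filter, Finset.mem_Icc, Finset.mem_Icc, Nat.le_floor_iff hx0.le,
        Nat.le_floor_iff (by positivity)]
      constructor
      · rintro ⟨⟨h3, -⟩, h4⟩; exact ⟨h3, h4⟩
      · rintro ⟨h3, h4⟩
        exact ⟨⟨h3, h4.trans (div_le_self hx0.le (one_le_pow₀ one_le_two))⟩, h4⟩
    rw [h2]
    rcases lt_or_ge (x / 2 ^ j) 1 with h3 | h3
    · rw [count_of_lt_one h3, zero_mul]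
      have := count_nonneg H.nonneg x
      positivity
    · have h4 := hb x hx _ h3 (div_le_self hx0.le (one_le_pow₀ one_le_two))
      have h5 : (x / 2 ^ j / x) ^ α * (2 ^ β) ^ j = ((2 : ℝ) ^ (β - α)) ^ j := by
        have : x / 2 ^ j / x = ((2 : ℝ) ^ j)⁻¹ := by field_simp
        rw [this, Real.inv_rpow (by positivity), ← Real.rpow_natCast_mul (by positivity),
          mul_comm (j : ℝ), Real.rpow_mul_natCast (by positivity), Real.rpow_sub two_pos, div_pow]
        field_simp
      calc _ ≤ K * (x / 2 ^ j / x) ^ α * count s x * (2 ^ β * (2 ^ β) ^ j) := by gcongr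
        _ = 2 ^ β * K * count s x * ((x / 2 ^ j / x) ^ α * (2 ^ β) ^ j) := by ring
        _ = _ := by rw [h5]
  refine (Finset.sum_le_sum fun j _ => hj j).trans ?_
  rw [← Finset.mul_sum]
  have := count_nonneg H.nonneg x
  calc _ ≤ 2 ^ β * K * count s x * ∑' j : ℕ, ((2 : ℝ) ^ (β - α)) ^ j := by
        gcongr; exact hgeo.sum_le_tsum _ fun _ _ => by positivity
    _ = _ := by ring

end Regular

end Size

end ArithSeq

end

/-! ### The logarithmic mean ∑ s(n) log(x/n) -/

noncomputable section
namespace ArithSeq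
open MeasureTheory

section LogSum

variable {s : ℕ → ℝ} {L : ℝ → ℝ} {a : ℤ} {δ C : ℝ}

/-- `∑_{n ≤ x} s(n) log (x / n)`. -/
def logSum (s : ℕ → ℝ) (x : ℝ) : ℝ := ∑ n ∈ Finset.Icc 1 ⌊x⌋₊, s n * Real.log (x / n)

theorem count_eq_sum_Icc_zero (x : ℝ) :
    count s x = ∑ n ∈ Finset.Icc 0 ⌊x⌋₊, (if n = 0 then 0 else s n) := by
  rw [← Finset.sum_Ioc_add_eq_sum_Icc (Nat.zero_le _), if_pos rfl, add_zero]
  exact Finset.sum_congr rfl fun n hn => by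
    rw [if_neg (Nat.pos_iff_ne_zero.1 (Finset.mem_Icc.1 hn).1)]

theorem integrableOn_count_div {x y : ℝ} (hy : 0 < y) :
    IntegrableOn (fun t => count s t / t) (Set.Ioc y x) := by
  have h1 : IntegrableOn (fun t : ℝ => t⁻¹) (Set.Icc y x) :=
    (continuousOn_inv₀.mono fun t ht => (hy.trans_le ht.1).ne').integrableOn_Icc
  have h2 := (integrableOn_mul_sum_Icc (m := 0) (fun n => if n = 0 then 0 else s n) hy.le h1).mono_set
    Set.Ioc_subset_Icc_self
  refine h2.congr_fun (fun t _ => ?_) measurableSet_Ioc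
  dsimp only
  rw [count_eq_sum_Icc_zero, div_eq_inv_mul]

theorem logSum_sub {x y : ℝ} (hy : 0 < y) (hyx : y ≤ x) :
    logSum s x - logSum s y = ∫ t in Set.Ioc y x, count s t / t := by
  have hx := hy.trans_le hyx
  have h1 := sum_mul_eq_sub_sub_integral_mul (fun n => if n = 0 then 0 else s n) (f := Real.log) hy.le
    hyx (fun t ht => Real.differentiableAt_log (hy.trans_le ht.1).ne') (by
      rw [Real.deriv_log']
      exact (continuousOn_inv₀.mono fun t ht => (hy.trans_le ht.1).ne').integrableOn_Icc)
  rw [← count_eq_sum_Icc_zero, ← count_eq_sum_Icc_zero] at h1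
  have h2 : ∀ z : ℝ, 0 < z → logSum s z = Real.log z * count s z -
      ∑ n ∈ Finset.Ioc 0 ⌊z⌋₊, Real.log n * (if n = 0 then 0 else s n) := by
    intro z hz
    rw [logSum, count, Finset.mul_sum, eq_sub_iff_add_eq]
    have : Finset.Ioc 0 ⌊z⌋₊ = Finset.Icc 1 ⌊z⌋₊ := rfl
    rw [this, ← Finset.sum_add_distrib]
    refine Finset.sum_congr rfl fun n hn => ?_
    have hn1 : n ≠ 0 := Nat.pos_iff_ne_zero.1 (Finset.mem_Icc.1 hn).1
    rw [if_neg hn1, Real.log_div hz.ne' (by exact_mod_cast hn1)]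
    ring
  have h3 := Finset.sum_Ioc_consecutive (fun n : ℕ => Real.log n * (if n = 0 then 0 else s n))
    (Nat.zero_le _) (Nat.floor_le_floor hyx)
  have h4 : ∫ t in Set.Ioc y x, deriv Real.log t * ∑ n ∈ Finset.Icc 0 ⌊t⌋₊,
      (if n = 0 then 0 else s n) = ∫ t in Set.Ioc y x, count s t / t := by
    refine setIntegral_congr_fun measurableSet_Ioc fun t _ => ?_
    rw [count_eq_sum_Icc_zero, Real.deriv_log, div_eq_inv_mul]
  rw [h4] at h1
  rw [h2 x hx, h2 y hy, ← h3, h1]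
  ring

theorem setIntegral_inv_Ioc {x y : ℝ} (hy : 0 < y) (hyx : y ≤ x) :
    ∫ t in Set.Ioc y x, t⁻¹ = Real.log (x / y) := by
  rw [← intervalIntegral.integral_of_le hyx, integral_inv_of_pos hy (hy.trans_le hyx)]

namespace Regular

theorem tendsto_div_scale (H : Regular s L δ C) : Tendsto (fun x => x / L x) atTop atTop := by
  refine tendsto_atTop_mono' _ ?_ Real.tendsto_sqrt_atTop
  filter_upwards [H.eventually_scale] with x ⟨h1, h2, h3⟩
  rw [le_div_iff₀ (by linarith)]
  calc √x * L x ≤ √x * √x := by gcongr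
    _ = x := Real.mul_self_sqrt (by linarith)

theorem eventually_count_div_scale (H : Regular s L δ C) : ∀ᶠ x in atTop,
    |count s (x / L x) - count s x / L x| ≤ C * (count s x / L x ^ (1 + δ)) := by
  filter_upwards [H.ratio, H.eventually_scale] with x h1 ⟨h2, _, _⟩
  have := h1 (1 / L x) le_rfl ((div_le_one (by linarith)).2 (by linarith))
  rwa [one_div_mul_eq_div, one_div_mul_eq_div] at this

/-- Partial summation gives ∫ A(t)/t dt over [x/L(x), x], where the regularity hypothesis makes
A(t)/t nearly the constant A(x)/x. -/
theorem eventually_logSum_sub (H : Regular s L δ C) : ∀ᶠ x in atTop,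
    |logSum s x - logSum s (x / L x) - (1 - 1 / L x) * count s x| ≤
      C * (count s x / L x ^ (1 + δ)) * Real.log (L x) := by
  filter_upwards [H.ratio, H.eventually_scale] with x h1 ⟨h2, _, h3⟩
  have hx0 : 0 < x := by linarith
  have hL0 : 0 < L x := by linarith
  have hy : 0 < x / L x := by positivity
  have hyx : x / L x ≤ x := div_le_self hx0.le (by linarith)
  have hA := count_nonneg H.nonneg x
  have h4 : ∫ _ in Set.Ioc (x / L x) x, count s x / x = (1 - 1 / L x) * count s x := by
    rw [setIntegral_const, Measure.real, Real.volume_Ioc, ENNReal.toReal_ofReal (by linarith),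
      smul_eq_mul]
    field_simp
  have h5 : IntegrableOn (fun t : ℝ => t⁻¹) (Set.Ioc (x / L x) x) :=
    ((continuousOn_inv₀.mono fun t ht => (hy.trans_le ht.1).ne').integrableOn_Icc).mono_set
      Set.Ioc_subset_Icc_self
  rw [logSum_sub hy hyx, ← h4, ← integral_sub (integrableOn_count_div hy)
    (integrableOn_const (by simp))]
  have h6 : ∫ t in Set.Ioc (x / L x) x, C * (count s x / L x ^ (1 + δ)) * t⁻¹ =
      C * (count s x / L x ^ (1 + δ)) * Real.log (L x) := by
    rw [integral_const_mul, setIntegral_inv_Ioc hy hyx]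
    congr 2; field_simp
  rw [← h6, ← Real.norm_eq_abs]
  refine norm_integral_le_of_norm_le (h5.const_mul _) ?_
  rw [ae_restrict_iff' measurableSet_Ioc]
  refine Eventually.of_forall fun t ht => ?_
  have ht0 : 0 < t := hy.trans ht.1
  have h7 := h1 (t / x) (by rw [div_le_div_iff₀ hL0 hx0, one_mul, ← div_le_iff₀ hL0]; exact ht.1.le)
    ((div_le_one hx0).2 ht.2)
  rw [div_mul_cancel₀ _ hx0.ne'] at h7
  have h8 : count s t / t - count s x / x = (count s t - t / x * count s x) * t⁻¹ := by field_simp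
  rw [h8, Real.norm_eq_abs, abs_mul, abs_of_pos (inv_pos.2 ht0)]
  gcongr

theorem logSum_nonneg (H : Regular s L δ C) (x : ℝ) : 0 ≤ logSum s x := by
  refine Finset.sum_nonneg fun n hn => ?_
  obtain ⟨h1, h2⟩ := Finset.mem_Icc.1 hn
  have hn0 : (0 : ℝ) < n := by exact_mod_cast h1
  refine mul_nonneg (H.nonneg n h1) (Real.log_nonneg ((one_le_div hn0).2 ?_))
  exact (Nat.le_floor_iff' (by omega)).1 h2

theorem exists_logSum_le (H : Regular s L δ C) :
    ∃ K : ℝ, 0 ≤ K ∧ ∀ᶠ x in atTop, logSum s x ≤ K * count s x := by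
  obtain ⟨K, hK, hb⟩ := H.exists_sum_mul_rpow_le (β := 1 / 2) (by norm_num) (by norm_num)
  refine ⟨2 * K, by positivity, ?_⟩
  filter_upwards [hb, eventually_ge_atTop 1] with x h1 h2
  rw [mul_assoc]
  refine le_trans ?_ (mul_le_mul_of_nonneg_left h1 two_pos.le)
  rw [logSum, Finset.mul_sum]
  refine Finset.sum_le_sum fun n hn => ?_
  have h3 := H.nonneg n (Finset.mem_Icc.1 hn).1
  have h4 := Real.log_le_rpow_div (x := x / n) (by positivity) (ε := 1 / 2) (by norm_num)
  calc _ ≤ s n * ((x / n) ^ (1 / 2 : ℝ) / (1 / 2)) := by gcongr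
    _ = _ := by ring

theorem log_mul_div_le (H : Regular s L δ C) {x : ℝ} (hx : 0 ≤ x) :
    count s x / L x ^ (1 + δ) * Real.log (L x) ≤ 2 / δ * (count s x / L x ^ (1 + δ / 2)) := by
  have hL := H.one_le hx
  have hL0 : 0 < L x := by linarith
  have hδ := H.delta_pos
  have h1 := Real.log_le_rpow_div hL0.le (half_pos hδ)
  have hA := count_nonneg H.nonneg x
  calc _ ≤ count s x / L x ^ (1 + δ) * (L x ^ (δ / 2) / (δ / 2)) := by gcongr
    _ = 2 / δ * (count s x / (L x ^ (1 + δ) / L x ^ (δ / 2))) := by field_simp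
    _ = _ := by rw [← Real.rpow_sub hL0]; ring_nf

theorem div_rpow_le (H : Regular s L δ C) {x u v : ℝ} (hx : 0 ≤ x) (huv : u ≤ v) :
    count s x / L x ^ v ≤ count s x / L x ^ u := by
  have hL := H.one_le hx
  have hA := count_nonneg H.nonneg x
  have : 0 < L x ^ u := Real.rpow_pos_of_pos (by linarith) _
  gcongr

/-- Bootstrapping: a crude error A(x)/L(x) is proved first, then used again at x/L(x) to gain
another factor L(x/L(x)). That gain is what the growth condition on L makes larger than any power of
log L(x). -/
theorem exists_abs_logSum_sub_le (H : Regular s L δ C) : ∃ K : ℝ, 0 ≤ K ∧ ∀ᶠ x in atTop,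
    |logSum s x - count s x| ≤
      K * (count s x / L x ^ (1 + δ / 2) + count s x / (L x * L (x / L x))) := by
  have hδ := H.delta_pos
  have hC := H.const_nonneg
  obtain ⟨K₁, hK₁, hb⟩ := H.exists_logSum_le
  have crude : ∀ᶠ x in atTop, |logSum s x - count s x| ≤
      (1 + C * (2 / δ) + K₁ * (1 + C)) * (count s x / L x) := by
    filter_upwards [H.eventually_logSum_sub, H.eventually_count_div_scale,
      H.tendsto_div_scale.eventually hb, eventually_ge_atTop 0] with x h1 h2 h3 h4
    have h5 := H.log_mul_div_le h4
    have h6 := H.div_rpow_le h4 (show (1 : ℝ) ≤ 1 + δ / 2 by linarith)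
    have h7 := H.div_rpow_le h4 (show (1 : ℝ) ≤ 1 + δ by linarith)
    rw [Real.rpow_one] at h6 h7
    have h8 := H.logSum_nonneg (x / L x)
    have hA : 0 ≤ count s x / L x := div_nonneg (count_nonneg H.nonneg x)
      (by linarith [H.one_le h4])
    have h9 : C * (count s x / L x ^ (1 + δ)) * Real.log (L x) ≤
        C * (2 / δ) * (count s x / L x) := by
      calc _ = C * (count s x / L x ^ (1 + δ) * Real.log (L x)) := by ring
        _ ≤ C * (2 / δ * (count s x / L x)) :=
          mul_le_mul_of_nonneg_left (h5.trans (by gcongr)) hC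
        _ = _ := by ring
    have h10 : logSum s (x / L x) ≤ K₁ * ((1 + C) * (count s x / L x)) := by
      refine h3.trans ?_
      gcongr
      have := (abs_le.1 h2).2
      nlinarith
    have h11 : (1 - 1 / L x) * count s x = count s x - count s x / L x := by ring
    rw [h11] at h1
    have h12 := abs_le.1 h1
    rw [abs_le]
    constructor <;> nlinarith
  set K₂ := 1 + C * (2 / δ) + K₁ * (1 + C) with hK₂
  have hK₂0 : 0 ≤ K₂ := by positivity
  refine ⟨C * (2 / δ) + C + K₂ * (1 + C), by positivity, ?_⟩
  filter_upwards [H.eventually_logSum_sub, H.eventually_count_div_scale,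
      H.tendsto_div_scale.eventually crude, H.eventually_scale,
      H.tendsto_div_scale.eventually_ge_atTop 0] with x h1 h2 h3 ⟨hL2, _, hx1⟩ hy
  have hx0 : 0 ≤ x := by linarith
  have h5 := H.log_mul_div_le hx0
  have h6 := H.div_rpow_le hx0 (show (1 : ℝ) + δ / 2 ≤ 1 + δ by linarith)
  have h7 := H.div_rpow_le hx0 (show (1 : ℝ) ≤ 1 + δ by linarith)
  rw [Real.rpow_one] at h7
  have hLy := H.one_le hy
  set E₁ := count s x / L x ^ (1 + δ / 2) with hE₁
  set E₂ := count s x / (L x * L (x / L x)) with hE₂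
  have hA := count_nonneg H.nonneg x
  have hE₁0 : 0 ≤ E₁ := by positivity
  have hE₂0 : 0 ≤ E₂ := by positivity
  have h8 : |logSum s (x / L x) - count s (x / L x)| ≤ K₂ * ((1 + C) * E₂) := by
    refine h3.trans ?_
    gcongr
    have h9 : count s (x / L x) ≤ (1 + C) * (count s x / L x) := by
      have := (abs_le.1 h2).2
      nlinarith
    calc count s (x / L x) / L (x / L x) ≤ (1 + C) * (count s x / L x) / L (x / L x) := by gcongr
      _ = _ := by rw [hE₂]; field_simp
  have h9 : C * (count s x / L x ^ (1 + δ)) * Real.log (L x) ≤ C * (2 / δ) * E₁ := by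
    calc _ = C * (count s x / L x ^ (1 + δ) * Real.log (L x)) := by ring
      _ ≤ C * (2 / δ * E₁) := mul_le_mul_of_nonneg_left h5 hC
      _ = _ := by ring
  have h10 : C * (count s x / L x ^ (1 + δ)) ≤ C * E₁ := by gcongr
  have h11 : (1 - 1 / L x) * count s x = count s x - count s x / L x := by ring
  rw [h11] at h1
  have h12 := abs_le.1 h1
  have h13 := abs_le.1 h2
  have h14 := abs_le.1 h8
  have h15 : 0 ≤ K₂ * (1 + C) * E₁ := by positivity
  have h16 : 0 ≤ (C * (2 / δ) + C) * E₂ := by positivity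
  rw [abs_le]
  constructor <;> nlinarith

end Regular

end LogSum

end ArithSeq

end

/-! ### Divisor switching -/

noncomputable section
namespace ArithSeq

section Switch

variable {s : ℕ → ℝ} {h : ArithmeticFunction ℝ} {a : ℤ} {x : ℝ}

/-- The involution r ↦ D/r on divisors turns rc < D into c < D/r. The hypothesis on N only ensures
that no such r is lost. -/
theorem card_divisors_switch {D N : ℕ} (hD : 1 ≤ D) {c : ℝ} (hc : 0 < c) (hN : (D : ℝ) / c ≤ N) :
    ((Finset.Icc 1 N).filter fun r : ℕ => r ∣ D ∧ (r : ℝ) * c < D).card =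
      (D.divisors.filter fun q : ℕ => c < q).card := by
  have hD0 : D ≠ 0 := by omega
  refine Finset.card_nbij' (fun r => D / r) (fun q => D / q) ?_ ?_ ?_ ?_
  · intro r hr
    obtain ⟨h1, ⟨q, rfl⟩, h3⟩ := Finset.mem_filter.1 hr
    have hr0 : 0 < r := (Finset.mem_Icc.1 h1).1
    have hr0' : (0 : ℝ) < r := by exact_mod_cast hr0
    refine Finset.mem_filter.2 ⟨?_, ?_⟩
    · dsimp only
      rw [Nat.mul_div_cancel_left _ hr0]
      exact Nat.mem_divisors.2 ⟨dvd_mul_left _ _, hD0⟩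
    · dsimp only
      rw [Nat.mul_div_cancel_left _ hr0]
      push_cast at h3
      exact lt_of_mul_lt_mul_left h3 hr0'.le
  · intro q hq
    obtain ⟨h1, h2⟩ := Finset.mem_filter.1 hq
    obtain ⟨⟨r, rfl⟩, -⟩ := Nat.mem_divisors.1 h1
    have hq0 : 0 < q := Nat.pos_of_mul_pos_right hD
    have hr0 : 0 < r := Nat.pos_of_mul_pos_left hD
    have hr0' : (0 : ℝ) < r := by exact_mod_cast hr0
    dsimp only
    have h3 : (r : ℝ) * c < ((q * r : ℕ) : ℝ) := by push_cast; rw [mul_comm (q : ℝ)]; gcongr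
    rw [Finset.mem_coe, Nat.mul_div_cancel_left _ hq0, Finset.mem_filter, Finset.mem_Icc]
    refine ⟨⟨hr0, ?_⟩, dvd_mul_left _ _, h3⟩
    rw [← lt_div_iff₀ hc] at h3
    exact_mod_cast (h3.le.trans hN)
  · intro r hr
    obtain ⟨-, h2, -⟩ := Finset.mem_filter.1 hr
    exact Nat.div_div_self h2 hD0
  · intro q hq
    obtain ⟨h1, -⟩ := Finset.mem_filter.1 hq
    exact Nat.div_div_self (Nat.mem_divisors.1 h1).1 hD0

/-- The sum over `r ≤ N` of `𝒜(x; r, a) - 𝒜(a + r c; r, a)`. -/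
def switched (s : ℕ → ℝ) (a : ℤ) (x c : ℝ) (N : ℕ) : ℝ :=
  ∑ r ∈ Finset.Icc 1 N, (countAP s x r a - countAP s (min (a + r * c) x) r a)

theorem countAP_sub {y : ℝ} (hyx : y ≤ x) (q : ℕ) :
    countAP s x q a - countAP s y q a =
      ∑ n ∈ Finset.Icc 1 ⌊x⌋₊, if (n : ℤ) ≡ a [ZMOD (q : ℤ)] ∧ y < n then s n else 0 := by
  rw [countAP, countAP, sub_eq_iff_eq_add, ← Finset.sum_filter]
  have h1 : ((Finset.Icc 1 ⌊x⌋₊).filter fun n : ℕ => (n : ℤ) ≡ a [ZMOD (q : ℤ)]) =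
      ((Finset.Icc 1 ⌊x⌋₊).filter fun n : ℕ => (n : ℤ) ≡ a [ZMOD (q : ℤ)] ∧ y < n) ∪
      ((Finset.Icc 1 ⌊y⌋₊).filter fun n : ℕ => (n : ℤ) ≡ a [ZMOD (q : ℤ)]) := by
    ext n
    simp only [Finset.mem_filter, Finset.mem_union, Finset.mem_Icc]
    constructor
    · rintro ⟨⟨h1, h2⟩, h3⟩
      rcases lt_or_ge y n with h4 | h4
      · exact Or.inl ⟨⟨h1, h2⟩, h3, h4⟩
      · exact Or.inr ⟨⟨h1, (Nat.le_floor_iff' (by omega)).2 h4⟩, h3⟩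
    · rintro (⟨h1, h2, h3⟩ | ⟨⟨h1, h2⟩, h3⟩)
      · exact ⟨h1, h2⟩
      · exact ⟨⟨h1, h2.trans (Nat.floor_le_floor hyx)⟩, h3⟩
  rw [h1, Finset.sum_union]
  refine Finset.disjoint_left.2 fun n hn hn' => ?_
  obtain ⟨-, -, h2⟩ := Finset.mem_filter.1 hn
  obtain ⟨h3, h4⟩ := Finset.mem_Icc.1 (Finset.mem_filter.1 hn').1
  exact absurd ((Nat.le_floor_iff' (by omega)).1 h4) (not_le.2 h2)

theorem count_sub {y : ℝ} (hyx : y ≤ x) :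
    count s x - count s y = ∑ n ∈ Finset.Icc 1 ⌊x⌋₊, if y < n then s n else 0 := by
  have h1 : ∀ z, countAP s z 1 0 = count s z := fun z => by
    rw [countAP, count, Finset.filter_true_of_mem fun n _ => by
      simpa using Int.modEq_one]
  rw [← h1, ← h1, countAP_sub hyx]
  refine Finset.sum_congr rfl fun n _ => ?_
  simp [Int.modEq_one]

theorem min_lt_iff_of_mem {n : ℕ} (hn : n ∈ Finset.Icc 1 ⌊x⌋₊) (w : ℝ) :
    min w x < n ↔ w < n := by
  obtain ⟨h1, h2⟩ := Finset.mem_Icc.1 hn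
  rw [min_lt_iff, or_iff_left (not_lt.2 ((Nat.le_floor_iff' (by omega)).1 h2))]

theorem switched_eq (c : ℝ) (N : ℕ) :
    switched s a x c N = ∑ n ∈ Finset.Icc 1 ⌊x⌋₊, s n *
      (((Finset.Icc 1 N).filter fun r : ℕ =>
        (n : ℤ) ≡ a [ZMOD (r : ℤ)] ∧ (a : ℝ) + r * c < n).card : ℝ) := by
  have h1 : ∀ r ∈ Finset.Icc 1 N, countAP s x r a - countAP s (min (a + r * c) x) r a =
      ∑ n ∈ Finset.Icc 1 ⌊x⌋₊,
        if (n : ℤ) ≡ a [ZMOD (r : ℤ)] ∧ (a : ℝ) + r * c < n then s n else 0 := by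
    intro r _
    rw [countAP_sub (min_le_right _ _)]
    refine Finset.sum_congr rfl fun n hn => ?_
    simp only [min_lt_iff_of_mem hn]
  rw [switched, Finset.sum_congr rfl h1, Finset.sum_comm]
  refine Finset.sum_congr rfl fun n _ => ?_
  rw [← Finset.sum_filter, Finset.sum_const, nsmul_eq_mul, mul_comm]

/-- For n > |a| put n - a = qr > 0. Divisors q in (d, c] are those exceeding d minus those exceeding
c, and each family is counted by its cofactors r. -/
theorem sum_countAPStar_eq_switched {c d : ℝ} (hd : 0 < d) (hdc : d ≤ c)
    (ha : 2 * |(a : ℝ)| ≤ d) {N : ℕ} (hN : (x + |(a : ℝ)|) / d ≤ N) :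
    ∑ q ∈ Finset.Ioc ⌊d⌋₊ ⌊c⌋₊, countAPStar s x q a =
      switched s a x d N - switched s a x c N := by
  have hc : 0 < c := hd.trans_le hdc
  rw [switched_eq, switched_eq, ← Finset.sum_sub_distrib]
  have h1 : ∀ q ∈ Finset.Ioc ⌊d⌋₊ ⌊c⌋₊, countAPStar s x q a =
      ∑ n ∈ Finset.Icc 1 ⌊x⌋₊, if |a| < (n : ℤ) ∧ (n : ℤ) ≡ a [ZMOD (q : ℤ)] then s n else 0 := by
    intro q _
    rw [countAPStar, Finset.sum_filter]
  rw [Finset.sum_congr rfl h1, Finset.sum_comm]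
  refine Finset.sum_congr rfl fun n hn => ?_
  rw [← Finset.sum_filter, Finset.sum_const, nsmul_eq_mul, mul_comm, ← mul_sub]
  congr 1
  obtain ⟨hn1, hn2⟩ := Finset.mem_Icc.1 hn
  have hnx : (n : ℝ) ≤ x := (Nat.le_floor_iff' (by omega)).1 hn2
  rcases le_or_gt (n : ℤ) |a| with h2 | h2
  · have h3 : (n : ℝ) ≤ |(a : ℝ)| := by exact_mod_cast h2
    -- Terms n ≤ |a| are absent from the left side. On the right they vanish since a + re ≥ a + 2|a|
    -- ≥ |a| ≥ n.
    have hempty : ∀ e, d ≤ e → ((Finset.Icc 1 N).filter fun r : ℕ =>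
        (n : ℤ) ≡ a [ZMOD (r : ℤ)] ∧ (a : ℝ) + r * e < n) = ∅ := by
      intro e he
      refine Finset.filter_eq_empty_iff.2 fun r hr hcon => ?_
      have hr1 : (1 : ℝ) ≤ r := by exact_mod_cast (Finset.mem_Icc.1 hr).1
      have := neg_abs_le (a : ℝ)
      nlinarith [hcon.2]
    rw [hempty d le_rfl, hempty c hdc, Finset.filter_false_of_mem fun q _ hq => by omega]
    simp
  · have hapos : 0 < (n : ℤ) - a := by have := le_abs_self a; omega
    obtain ⟨D, hD⟩ := Int.eq_ofNat_of_zero_le hapos.le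
    have hD1 : 1 ≤ D := by omega
    have hDr : (n : ℝ) = a + D := by
      have : (n : ℤ) = a + D := by omega
      exact_mod_cast this
    have hmod : ∀ q : ℕ, (n : ℤ) ≡ a [ZMOD (q : ℤ)] ↔ q ∣ D := by
      intro q
      rw [Int.modEq_comm, Int.modEq_iff_dvd, hD]
      exact Int.natCast_dvd_natCast
    have hsw : ∀ e, d ≤ e → ((Finset.Icc 1 N).filter fun r : ℕ =>
        (n : ℤ) ≡ a [ZMOD (r : ℤ)] ∧ (a : ℝ) + r * e < n).card =
        (D.divisors.filter fun q : ℕ => e < q).card := by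
      intro e he
      rw [← card_divisors_switch hD1 (hd.trans_le he) (N := N)]
      · congr 1
        refine Finset.filter_congr fun r _ => ?_
        rw [hmod, hDr, add_lt_add_iff_left]
      · refine le_trans ?_ hN
        have h3 : (D : ℝ) ≤ x + |(a : ℝ)| := by linarith [neg_abs_le (a : ℝ)]
        have h4 : (0 : ℝ) ≤ x + |(a : ℝ)| := le_trans (by positivity) h3
        gcongr
    rw [hsw d le_rfl, hsw c hdc, eq_sub_iff_add_eq, ← Nat.cast_add, Nat.cast_inj,
      ← Finset.card_union_of_disjoint]
    · congr 1
      ext q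
      simp only [Finset.mem_union, Finset.mem_filter, Finset.mem_Ioc, hmod, Nat.mem_divisors,
        Nat.floor_lt hd.le, Nat.le_floor_iff hc.le]
      constructor
      · rintro (⟨⟨h3, h4⟩, h5, h6⟩ | ⟨h3, h4⟩)
        · exact ⟨⟨h6, by omega⟩, h3⟩
        · exact ⟨h3, hdc.trans_lt h4⟩
      · rintro ⟨⟨h3, h4⟩, h5⟩
        rcases le_or_gt (q : ℝ) c with h6 | h6
        · exact Or.inl ⟨⟨h5, h6⟩, h2, h3⟩
        · exact Or.inr ⟨⟨h3, h4⟩, h6⟩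
    · refine Finset.disjoint_left.2 fun q hq hq' => ?_
      obtain ⟨h3, -⟩ := Finset.mem_filter.1 hq
      obtain ⟨-, h4⟩ := Finset.mem_filter.1 hq'
      exact absurd ((Nat.le_floor_iff hc.le).1 (Finset.mem_Ioc.1 h3).2) (not_le.2 h4)

/-- The expected value of `switched`. -/
def switchedMain (s : ℕ → ℝ) (h : ArithmeticFunction ℝ) (a : ℤ) (x c : ℝ) (N : ℕ) : ℝ :=
  ∑ r ∈ Finset.Icc 1 N, g h a r * (count s x - count s (min (a + r * c) x))

theorem abs_switched_sub_le (hs : ∀ n, 1 ≤ n → 0 ≤ s n) (hlt : ∀ p : ℕ, p.Prime → h p < p)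
    (hx : 0 ≤ x) {c : ℝ} (hc : |(a : ℝ)| ≤ c) (N : ℕ) :
    |switched s a x c N - switchedMain s h a x c N| ≤
      2 * ∑ q ∈ Finset.Icc 1 N, (⨆ y : Set.Icc (0 : ℝ) x,
          |countAP s y q a - f h a q / (q * gam h q) * count s y|) := by
  rw [switched, switchedMain, ← Finset.sum_sub_distrib, Finset.mul_sum]
  refine (Finset.abs_sum_le_sum_abs _ _).trans (Finset.sum_le_sum fun r hr => ?_)
  have hr1 := (Finset.mem_Icc.1 hr).1
  -- Needed because the supremum of an unbounded real family is 0 by convention, and would then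
  -- bound nothing.
  have hbdd : BddAbove (Set.range fun y : Set.Icc (0 : ℝ) x =>
      |countAP s y r a - f h a r / (r * gam h r) * count s y|) := by
    refine ⟨count s x + |f h a r / (r * gam h r)| * count s x, ?_⟩
    rintro _ ⟨y, rfl⟩
    have h1 : count s y ≤ count s x := count_mono hs y.2.2
    have h2 : countAP s y r a ≤ count s y :=
      Finset.sum_le_sum_of_subset_of_nonneg (Finset.filter_subset _ _)
        fun n hn _ => hs n (Finset.mem_Icc.1 hn).1
    refine (abs_sub _ _).trans ?_
    rw [abs_mul, abs_of_nonneg (countAP_nonneg hs y r a), abs_of_nonneg (count_nonneg hs y)]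
    gcongr
    exact h2.trans h1
  have key : ∀ y, 0 ≤ y → y ≤ x → |countAP s y r a - g h a r * count s y| ≤
      ⨆ y : Set.Icc (0 : ℝ) x, |countAP s y r a - f h a r / (r * gam h r) * count s y| := by
    intro y h0 h1
    have := le_ciSup hbdd ⟨y, h0, h1⟩
    rwa [f_div_eq_g hlt hr1] at this ⊢
  have hr1' : (1 : ℝ) ≤ r := by exact_mod_cast hr1
  have h1 := key x hx le_rfl
  have h2 := key (min (a + r * c) x) (le_min (by nlinarith [neg_abs_le (a : ℝ), abs_nonneg (a : ℝ)])
    hx) (min_le_right _ _)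
  rw [abs_le] at h1 h2 ⊢
  constructor <;> linarith [h1.1, h1.2, h2.1, h2.2]

/-- Interchanging the sums over r and n leaves a sum of g up to (n - a)/c, for which a power-saving
asymptotic is available. -/
theorem switchedMain_eq_sum_gSumLt {c : ℝ} (hc : 0 < c) {N : ℕ} (hN : (x + |(a : ℝ)|) / c ≤ N) :
    switchedMain s h a x c N = ∑ n ∈ Finset.Icc 1 ⌊x⌋₊, s n * gSumLt h a ((n - a) / c) := by
  have h1 : ∀ r ∈ Finset.Icc 1 N, g h a r * (count s x - count s (min (a + r * c) x)) =
      ∑ n ∈ Finset.Icc 1 ⌊x⌋₊, if (a : ℝ) + r * c < n then s n * g h a r else 0 := by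
    intro r _
    rw [count_sub (min_le_right _ _), Finset.mul_sum]
    refine Finset.sum_congr rfl fun n hn => ?_
    simp only [min_lt_iff_of_mem hn]
    split_ifs <;> ring
  rw [switchedMain, Finset.sum_congr rfl h1, Finset.sum_comm]
  refine Finset.sum_congr rfl fun n hn => ?_
  rw [← Finset.sum_filter, ← Finset.mul_sum, gSumLt]
  congr 1
  refine Finset.sum_congr ?_ fun _ _ => rfl
  ext r
  obtain ⟨hn1, hn2⟩ := Finset.mem_Icc.1 hn
  have hnx : (n : ℝ) ≤ x := (Nat.le_floor_iff' (by omega)).1 hn2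
  rw [Finset.mem_filter, Finset.mem_Icc, Finset.mem_Ico, Nat.lt_ceil, lt_div_iff₀ hc,
    lt_sub_iff_add_lt']
  constructor
  · rintro ⟨⟨h2, -⟩, h3⟩; exact ⟨h2, h3⟩
  · rintro ⟨h2, h3⟩
    refine ⟨⟨h2, ?_⟩, h3⟩
    have h4 : (r : ℝ) ≤ (x + |(a : ℝ)|) / c := by
      rw [le_div_iff₀ hc]; linarith [neg_abs_le (a : ℝ)]
    exact_mod_cast h4.trans hN

/-- The shift by a is removed at no loss. For n ≤ |a| the sum of g is empty and n/c ≤ 1, so the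
right side dominates. For larger n, n - a is at least n/(|a|+1) and the logarithm moves by O(1/n).
-/
theorem exists_abs_gSumLt_shift_le {k : ℝ} (hmul : h.IsMultiplicative)
    (hA : AnalyticCondition h k) (hpos : ∀ p : ℕ, p.Prime → 0 ≤ h p) {ε : ℝ} (hε : 0 < ε)
    (hε1 : ε ≤ 1 / 2) :
    ∃ K : ℝ, 0 ≤ K ∧ ∀ (n : ℕ) (c : ℝ), 1 ≤ n → 1 ≤ c → 2 * |(a : ℝ)| ≤ c →
      |gSumLt h a ((n - a) / c) - (resid h a * Real.log (n / c) + constTerm h a)| ≤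
        K * (n / c) ^ (ε - 1) := by
  obtain ⟨C, hC, hb⟩ := exists_abs_gSumLt_sub_le (a := a) hmul hA hpos hε hε1
  set b := |(a : ℝ)| with hb'
  have hb0 : 0 ≤ b := abs_nonneg _
  set K₁ := |resid h a| * (1 / ε * 2) + |constTerm h a| with hK₁
  set K₂ := C * (b + 1) + |resid h a| * (b * (b + 1)) with hK₂
  refine ⟨K₁ + K₂, by positivity, fun n c hn hc hac => ?_⟩
  have hn0 : (0 : ℝ) < n := by exact_mod_cast hn
  have hn1 : (1 : ℝ) ≤ n := by exact_mod_cast hn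
  have hc0 : 0 < c := by linarith
  have hu : 0 < (n : ℝ) / c := by positivity
  set u := (n : ℝ) / c with hu'
  have hu0 : 0 ≤ u ^ (ε - 1) := by positivity
  have hab := abs_le.1 (le_refl b)
  rcases le_or_gt (n : ℝ) b with h1 | h1
  · have hu1 : u ≤ 1 := (div_le_one hc0).2 (by linarith)
    have h2 : gSumLt h a ((n - a) / c) = 0 := by
      have h3 : ((n : ℝ) - a) / c ≤ (1 : ℕ) := by
        rw [Nat.cast_one, div_le_one hc0]; linarith [neg_abs_le (a : ℝ)]
      rw [gSumLt, Finset.Ico_eq_empty_of_le (Nat.ceil_le.2 h3), Finset.sum_empty]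
    have h3 : u ^ ε ≤ u ^ (ε - 1) := Real.rpow_le_rpow_of_exponent_ge hu hu1 (by linarith)
    have h4 : u ^ (-ε) ≤ u ^ (ε - 1) := Real.rpow_le_rpow_of_exponent_ge hu hu1 (by linarith)
    have h5 : 1 ≤ u ^ (ε - 1) := Real.one_le_rpow_of_pos_of_le_one_of_nonpos hu hu1 (by linarith)
    have h6 : |Real.log u| ≤ 1 / ε * 2 * u ^ (ε - 1) := by
      have h7 := abs_log_add_le (c := 0) hε hu
      rw [add_zero, abs_zero, add_zero] at h7
      have : 0 ≤ 1 / ε := by positivity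
      nlinarith
    rw [h2, zero_sub, abs_neg]
    calc _ ≤ |resid h a| * |Real.log u| + |constTerm h a| := by
          rw [← abs_mul]; exact abs_add_le _ _
      _ ≤ |resid h a| * (1 / ε * 2 * u ^ (ε - 1)) + |constTerm h a| * u ^ (ε - 1) := by
          gcongr
          exact le_mul_of_one_le_right (abs_nonneg _) h5
      _ = K₁ * u ^ (ε - 1) := by rw [hK₁]; ring
      _ ≤ _ := by
          have : 0 ≤ K₂ := by positivity
          nlinarith
  · have hb1 : b + 1 ≤ n := by
      have h2 : |a| < (n : ℤ) := by
        have : ((|a| : ℤ) : ℝ) < n := by rw [Int.cast_abs]; exact h1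
        exact_mod_cast this
      have h3 : |a| + 1 ≤ (n : ℤ) := h2
      have h4 : ((|a| + 1 : ℤ) : ℝ) ≤ ((n : ℤ) : ℝ) := by exact_mod_cast h3
      push_cast at h4
      exact h4
    have h2 : (n : ℝ) / (b + 1) ≤ n - a := by
      rw [div_le_iff₀ (by positivity)]
      nlinarith [le_abs_self (a : ℝ)]
    have hna : 0 < (n : ℝ) - a := lt_of_lt_of_le (by positivity) h2
    have ht : 0 < ((n : ℝ) - a) / c := by positivity
    have h3 : (((n : ℝ) - a) / c) ^ (ε - 1) ≤ (b + 1) * u ^ (ε - 1) := by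
      have h4 : u / (b + 1) ≤ ((n : ℝ) - a) / c := by
        rw [hu', div_right_comm]; gcongr
      calc _ ≤ (u / (b + 1)) ^ (ε - 1) :=
            Real.rpow_le_rpow_of_nonpos (by positivity) h4 (by linarith)
        _ = (b + 1) ^ (1 - ε) * u ^ (ε - 1) := by
            rw [Real.div_rpow hu.le (by positivity), div_eq_mul_inv, ← Real.rpow_neg (by positivity),
              neg_sub, mul_comm]
        _ ≤ _ := by
            gcongr
            exact Real.rpow_le_self_of_one_le (by linarith) (by linarith)
    have h5 : (1 : ℝ) / n ≤ u ^ (ε - 1) := by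
      rcases le_total u 1 with h6 | h6
      · exact ((div_le_one hn0).2 hn1).trans
          (Real.one_le_rpow_of_pos_of_le_one_of_nonpos hu h6 (by linarith))
      · calc (1 : ℝ) / n ≤ c / n := by gcongr
          _ = u ^ (-1 : ℝ) := by rw [Real.rpow_neg_one, hu', inv_div]
          _ ≤ _ := Real.rpow_le_rpow_of_exponent_le h6 (by linarith)
    have h6 : |Real.log (((n : ℝ) - a) / c) - Real.log u| ≤ b * (b + 1) * u ^ (ε - 1) := by
      have h7 : Real.log (((n : ℝ) - a) / c) - Real.log u = Real.log ((n - a) / n) := by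
        rw [hu', Real.log_div hna.ne' hc0.ne', Real.log_div hn0.ne' hc0.ne',
          Real.log_div hna.ne' hn0.ne']
        ring
      have h8 := Real.log_le_sub_one_of_pos (div_pos hna hn0)
      have h9 := Real.one_sub_inv_le_log_of_pos (div_pos hna hn0)
      have h10 : ((n : ℝ) - a) / n - 1 ≤ b * (b + 1) * (1 / n) := by
        rw [div_sub_one hn0.ne', mul_one_div]
        gcongr
        nlinarith [neg_abs_le (a : ℝ)]
      have h11 : -(b * (b + 1) * (1 / n)) ≤ 1 - (((n : ℝ) - a) / n)⁻¹ := by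
        rw [inv_div, one_sub_div hna.ne', mul_one_div, neg_le, ← neg_div, div_le_div_iff₀ hna hn0]
        rw [div_le_iff₀ (by positivity)] at h2
        have h12 : a * (n : ℝ) ≤ b * n := by gcongr; exact le_abs_self _
        nlinarith
      rw [h7]
      refine (abs_le.2 ⟨h11.trans h9, h8.trans h10⟩).trans ?_
      gcongr
    calc _ = |(gSumLt h a ((n - a) / c) - (resid h a * Real.log ((n - a) / c) + constTerm h a)) +
          resid h a * (Real.log ((n - a) / c) - Real.log u)| := by congr 1; ring
      _ ≤ C * (((n : ℝ) - a) / c) ^ (ε - 1) +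
          |resid h a| * |Real.log ((n - a) / c) - Real.log u| := by
          rw [← abs_mul]
          exact (abs_add_le _ _).trans (add_le_add (hb _ ht) le_rfl)
      _ ≤ C * ((b + 1) * u ^ (ε - 1)) + |resid h a| * (b * (b + 1) * u ^ (ε - 1)) := by gcongr
      _ = K₂ * u ^ (ε - 1) := by rw [hK₂]; ring
      _ ≤ _ := by
          have : 0 ≤ K₁ := by positivity
          nlinarith

end Switch

end ArithSeq

end

/-! ### Main terms of the switched sums -/

noncomputable section
namespace ArithSeq

section Main

variable {s : ℕ → ℝ} {L : ℝ → ℝ} {h : ArithmeticFunction ℝ} {a : ℤ} {δ C k : ℝ}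

/-- Induction, each step being Bernoulli's inequality for exponents at most 1. -/
theorem sum_rpow_sub_one_le {ε : ℝ} (hε : 0 < ε) (hε1 : ε ≤ 1) (N : ℕ) :
    ∑ r ∈ Finset.Icc 1 N, (r : ℝ) ^ (ε - 1) ≤ (N : ℝ) ^ ε / ε := by
  induction N with
  | zero => simp [Real.zero_rpow hε.ne']
  | succ N ih =>
    rw [Finset.sum_Icc_succ_top (by omega)]
    have hN : (0 : ℝ) < (N + 1 : ℕ) := by exact_mod_cast N.succ_pos
    have h1 : (N : ℝ) ^ ε ≤ ((N + 1 : ℕ) : ℝ) ^ ε * (1 + ε * (-(1 / ((N + 1 : ℕ) : ℝ)))) := by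
      have h2 := rpow_one_add_le_one_add_mul_self (s := -(1 / ((N + 1 : ℕ) : ℝ))) (by
        rw [neg_le_neg_iff, div_le_one hN]; push_cast; linarith [(N.cast_nonneg : (0 : ℝ) ≤ N)])
        hε.le hε1
      have h3 : (N : ℝ) = ((N + 1 : ℕ) : ℝ) * (1 + -(1 / ((N + 1 : ℕ) : ℝ))) := by
        field_simp; push_cast; ring
      have h4 : (0 : ℝ) ≤ 1 + -(1 / ((N + 1 : ℕ) : ℝ)) := by
        have : 1 / ((N + 1 : ℕ) : ℝ) ≤ 1 := by
          rw [div_le_one hN]; push_cast; linarith [(N.cast_nonneg : (0 : ℝ) ≤ N)]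
        linarith
      calc (N : ℝ) ^ ε = ((N + 1 : ℕ) : ℝ) ^ ε * (1 + -(1 / ((N + 1 : ℕ) : ℝ))) ^ ε := by
            rw [← Real.mul_rpow hN.le h4, ← h3]
        _ ≤ _ := by gcongr
    have h5 : ((N + 1 : ℕ) : ℝ) ^ (ε - 1) = ((N + 1 : ℕ) : ℝ) ^ ε * (1 / ((N + 1 : ℕ) : ℝ)) := by
      rw [Real.rpow_sub hN, Real.rpow_one, mul_one_div]
    rw [le_div_iff₀ hε] at ih ⊢
    rw [h5]
    nlinarith

namespace Regular

/-- An interval of length b holds at most b + 1 integers, each with a small term by hypothesis 2. A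
bounded displacement of the argument is thus harmless. -/
theorem eventually_count_close (H : Regular s L δ C) (b : ℝ) :
    ∀ᶠ x in atTop, ∀ y z : ℝ, 0 ≤ y → y ≤ x → 1 / L x ≤ z → z ≤ 1 → |y - z * x| ≤ b →
      |count s y - z * count s x| ≤ C * (b + 2) * (count s x / L x ^ (1 + δ)) := by
  filter_upwards [H.ratio, H.term, eventually_ge_atTop 1, H.eventually_scale] with x h1 h2 h3
    ⟨hL, _, _⟩ y z hy0 hyx hz hz1 hyz
  set E := C * (count s x / L x ^ (1 + δ)) with hE
  have hE0 : 0 ≤ E := mul_nonneg H.const_nonneg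
    (div_nonneg (count_nonneg H.nonneg x) (Real.rpow_nonneg (by linarith) _))
  have hx0 : 0 ≤ x := by linarith
  have hz0 : 0 ≤ z := le_trans (by positivity) hz
  have key : ∀ u v : ℝ, 0 ≤ u → u ≤ v → v ≤ x → v - u ≤ b →
      count s v - count s u ≤ (b + 1) * E := by
    intro u v hu huv hv hb'
    rw [count_sub huv, ← Finset.sum_filter]
    have h4 : (Finset.Icc 1 ⌊v⌋₊).filter (fun n : ℕ => u < n) = Finset.Ioc ⌊u⌋₊ ⌊v⌋₊ := by
      ext n
      rw [Finset.mem_filter, Finset.mem_Icc, Finset.mem_Ioc, Nat.floor_lt hu]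
      constructor
      · rintro ⟨⟨h4, h5⟩, h6⟩; exact ⟨h6, h5⟩
      · rintro ⟨h4, h5⟩
        refine ⟨⟨?_, h5⟩, h4⟩
        have : (0 : ℝ) < n := by linarith
        exact_mod_cast this
    rw [h4]
    calc _ ≤ ∑ n ∈ Finset.Ioc ⌊u⌋₊ ⌊v⌋₊, E := Finset.sum_le_sum fun n hn => by
          obtain ⟨h5, h6⟩ := Finset.mem_Ioc.1 hn
          exact h2 n (by omega) (((Nat.le_floor_iff' (by omega)).1 h6).trans hv)
      _ = ((⌊v⌋₊ - ⌊u⌋₊ : ℕ) : ℝ) * E := by rw [Finset.sum_const, Nat.card_Ioc, nsmul_eq_mul]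
      _ ≤ (b + 1) * E := by
          gcongr
          rw [Nat.cast_sub (Nat.floor_le_floor huv)]
          linarith [Nat.floor_le (hu.trans huv), Nat.lt_floor_add_one u]
  have h5 : |count s y - count s (z * x)| ≤ (b + 1) * E := by
    rcases le_total y (z * x) with h6 | h6
    · rw [abs_sub_comm, abs_of_nonneg (sub_nonneg.2 (count_mono H.nonneg h6))]
      exact key _ _ hy0 h6 (mul_le_of_le_one_left hx0 hz1) (by linarith [(abs_le.1 hyz).1])
    · rw [abs_of_nonneg (sub_nonneg.2 (count_mono H.nonneg h6))]
      exact key _ _ (by positivity) h6 hyx (by linarith [(abs_le.1 hyz).2])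
  calc _ ≤ |count s y - count s (z * x)| + |count s (z * x) - z * count s x| := abs_sub_le _ _ _
    _ ≤ (b + 1) * E + E := add_le_add h5 (h1 z hz hz1)
    _ = _ := by rw [hE]; ring

theorem eventually_le_div_scale (H : Regular s L δ C) (b : ℝ) :
    ∀ᶠ x in atTop, ∀ M, 1 < M → M ≤ L x → b ≤ x / M := by
  filter_upwards [H.tendsto_div_scale.eventually_ge_atTop b, eventually_ge_atTop 0] with
    x h1 h2 M hM1 hM2
  exact h1.trans (by gcongr)

/-- The expected value of `switched` for the modulus bound `M ≤ L(x)`. -/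
theorem exists_switchedMain_small (H : Regular s L δ C) (hmul : h.IsMultiplicative)
    (hA : AnalyticCondition h k) (hpos : ∀ p : ℕ, p.Prime → 0 ≤ h p) :
    ∃ K : ℝ, 0 ≤ K ∧ ∀ᶠ x in atTop, ∀ M, 1 < M → M ≤ L x → ∀ N : ℕ, M ≤ N →
      |switchedMain s h a x (x / M) N -
        count s x * ∑ r ∈ Finset.Icc 1 ⌊M⌋₊, g h a r * (1 - r / M)| ≤
      K * (count s x / L x ^ (1 + δ / 2)) := by
  have hδ := H.delta_pos
  have hδ1 := H.delta_le
  have hC := H.const_nonneg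
  obtain ⟨D, hD, hg⟩ := exists_abs_g_le (a := a) hmul hA hpos (half_pos hδ)
  set b := |(a : ℝ)| with hb
  have hb0 : 0 ≤ b := abs_nonneg _
  refine ⟨C * (b + 2) * (D * (2 * (2 / δ))), by positivity, ?_⟩
  filter_upwards [H.eventually_count_close b, H.eventually_le_div_scale b, H.eventually_scale,
    eventually_ge_atTop b] with x h1 h2 ⟨hL2, _, hx1⟩ hxb M hM1 hM2 N hN
  have hx0 : 0 < x := by linarith
  have hM0 : 0 < M := by linarith
  have hL0 : 0 < L x := by linarith
  have hcx := count_nonneg H.nonneg x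
  set E := C * (b + 2) * (count s x / L x ^ (1 + δ)) with hE
  have hE0 : 0 ≤ E := by positivity
  have h3 : ∑ r ∈ Finset.Icc 1 ⌊M⌋₊, g h a r * (1 - r / M) =
      ∑ r ∈ Finset.Icc 1 N, g h a r * (1 - min ((r : ℝ) / M) 1) := by
    rw [← Finset.sum_subset (Finset.Icc_subset_Icc_right
      ((Nat.floor_le_floor hN).trans_eq (Nat.floor_natCast N)))]
    · refine Finset.sum_congr rfl fun r hr => ?_
      have := (Nat.le_floor_iff hM0.le).1 (Finset.mem_Icc.1 hr).2
      rw [min_eq_left ((div_le_one hM0).2 this)]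
    · intro r hr hr'
      have h4 : M < r := by
        by_contra! h5
        exact hr' (Finset.mem_Icc.2 ⟨(Finset.mem_Icc.1 hr).1, (Nat.le_floor_iff hM0.le).2 h5⟩)
      rw [min_eq_right ((one_le_div hM0).2 h4.le), sub_self, mul_zero]
  -- For r > 2L(x) both sides are zero, because a + rx/M already exceeds x. Hence only about L(x)
  -- values of r carry an error, whose total is L(x)^{δ/2} times a single one.
  have h4 : ∀ r ∈ Finset.Icc 1 N, |g h a r * (count s x - count s (min (a + r * (x / M)) x)) -
      count s x * (g h a r * (1 - min ((r : ℝ) / M) 1))| ≤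
      if (r : ℝ) ≤ 2 * L x then D * (r : ℝ) ^ (δ / 2 - 1) * E else 0 := by
    intro r hr
    have hr1 := (Finset.mem_Icc.1 hr).1
    have hr1' : (1 : ℝ) ≤ r := by exact_mod_cast hr1
    have hxM := h2 M hM1 hM2
    have e : g h a r * (count s x - count s (min (a + r * (x / M)) x)) -
      count s x * (g h a r * (1 - min ((r : ℝ) / M) 1)) =
      -(g h a r * (count s (min (a + r * (x / M)) x) - min ((r : ℝ) / M) 1 * count s x)) := by ring
    rw [e, abs_neg, abs_mul]
    split_ifs with h5
    · refine mul_le_mul (hg r hr1) (h1 _ _ ?_ (min_le_right _ _) ?_ (min_le_right _ _) ?_)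
        (abs_nonneg _) (by positivity)
      · exact le_min (by nlinarith [neg_abs_le (a : ℝ)]) hx0.le
      · refine le_min ?_ ((div_le_one hL0).2 (by linarith))
        rw [div_le_div_iff₀ hL0 hM0]; nlinarith
      · have e2 : min ((r : ℝ) / M) 1 * x = min (r * (x / M)) x := by
          rw [min_mul_of_nonneg _ _ hx0.le, one_mul, div_mul_eq_mul_div, mul_div_assoc]
        rw [e2]
        refine (abs_min_sub_min_le_max _ _ _ _).trans ?_
        rw [add_sub_cancel_right, sub_self, abs_zero, max_eq_left hb0]
    · rw [not_le] at h5
      have h6 : 2 ≤ (r : ℝ) / M := by rw [le_div_iff₀ hM0]; linarith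
      have h7 : x ≤ a + r * (x / M) := by
        have : (r : ℝ) * (x / M) = r / M * x := by ring
        rw [this]
        nlinarith [neg_abs_le (a : ℝ)]
      rw [min_eq_right h7, min_eq_right (by linarith), one_mul, sub_self, abs_zero, mul_zero]
  rw [h3, switchedMain, Finset.mul_sum, ← Finset.sum_sub_distrib]
  refine ((Finset.abs_sum_le_sum_abs _ _).trans (Finset.sum_le_sum h4)).trans ?_
  rw [← Finset.sum_filter, ← Finset.sum_mul, ← Finset.mul_sum]
  have h5 : ∑ r ∈ (Finset.Icc 1 N).filter (fun r : ℕ => (r : ℝ) ≤ 2 * L x),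
      (r : ℝ) ^ (δ / 2 - 1) ≤ 2 * L x ^ (δ / 2) / (δ / 2) := by
    calc _ ≤ ∑ r ∈ Finset.Icc 1 ⌊2 * L x⌋₊, (r : ℝ) ^ (δ / 2 - 1) := by
          refine Finset.sum_le_sum_of_subset_of_nonneg (fun r hr => ?_) fun _ _ _ => by positivity
          obtain ⟨h6, h7⟩ := Finset.mem_filter.1 hr
          exact Finset.mem_Icc.2 ⟨(Finset.mem_Icc.1 h6).1, Nat.le_floor h7⟩
      _ ≤ (⌊2 * L x⌋₊ : ℝ) ^ (δ / 2) / (δ / 2) :=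
          sum_rpow_sub_one_le (half_pos hδ) (by linarith) _
      _ ≤ (2 * L x) ^ (δ / 2) / (δ / 2) := by
          gcongr; exact Nat.floor_le (by positivity)
      _ ≤ _ := by
          rw [Real.mul_rpow two_pos.le hL0.le]
          gcongr
          exact Real.rpow_le_self_of_one_le one_le_two (by linarith)
  calc _ ≤ D * (2 * L x ^ (δ / 2) / (δ / 2)) * E := by gcongr
    _ = C * (b + 2) * (D * (2 * (2 / δ))) * (count s x / (L x ^ (1 + δ) / L x ^ (δ / 2))) := by
        rw [hE]; field_simp
    _ = _ := by rw [← Real.rpow_sub hL0]; ring_nf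

/-- The saving from a power `R ^ (ε - 1)` with `L(x) ^ (1 + δ) ≤ R`. -/
theorem rpow_le_of_pow_le (H : Regular s L δ C) {x R : ℝ} (hx : 0 ≤ x)
    (hR : L x ^ (1 + δ) ≤ R) :
    R ^ (δ / 2 / (1 + δ) - 1) ≤ 1 / L x ^ (1 + δ / 2) := by
  have hL := H.one_le hx
  have hδ := H.delta_pos
  have hL0 : 0 < L x := by linarith
  have h1 : δ / 2 / (1 + δ) - 1 ≤ 0 := by
    rw [sub_nonpos, div_le_one (by linarith)]; linarith
  calc _ ≤ (L x ^ (1 + δ)) ^ (δ / 2 / (1 + δ) - 1) :=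
        Real.rpow_le_rpow_of_nonpos (by positivity) hR h1
    _ = L x ^ (-(1 + δ / 2)) := by
        rw [← Real.rpow_mul hL0.le]; congr 1; field_simp; ring
    _ = _ := by rw [Real.rpow_neg hL0.le, one_div]

/-- The expected value of `switched` for the modulus bound `R`. -/
theorem exists_switchedMain_large (H : Regular s L δ C) (hmul : h.IsMultiplicative)
    (hA : AnalyticCondition h k) (hpos : ∀ p : ℕ, p.Prime → 0 ≤ h p) :
    ∃ K : ℝ, 0 ≤ K ∧ ∀ᶠ x in atTop, ∀ R, L x ^ (1 + δ) ≤ R → R ≤ √x → ∀ N : ℕ,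
      (x + |(a : ℝ)|) / (x / R) ≤ N →
      |switchedMain s h a x (x / R) N -
        (count s x * (resid h a * Real.log R + constTerm h a) - resid h a * logSum s x)| ≤
      K * (count s x / L x ^ (1 + δ / 2)) := by
  have hδ := H.delta_pos
  have hδ1 := H.delta_le
  -- Chosen so that (1 + δ)(ε - 1) = -(1 + δ/2): the power saving in R then yields L(x)^{-(1+δ/2)}.
  set ε := δ / 2 / (1 + δ) with hε
  have hε0 : 0 < ε := by positivity
  have hε1 : ε ≤ 1 / 2 := by rw [hε, div_le_iff₀ (by linarith)]; linarith
  obtain ⟨K₁, hK₁, hE⟩ := exists_abs_gSumLt_shift_le (a := a) hmul hA hpos hε0 hε1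
  obtain ⟨K₂, hK₂, hS⟩ := H.exists_sum_mul_rpow_le (β := 1 - ε) (by linarith) (by linarith)
  refine ⟨K₁ * K₂, by positivity, ?_⟩
  filter_upwards [hS, H.eventually_scale, Real.tendsto_sqrt_atTop.eventually_ge_atTop
    (2 * |(a : ℝ)|)] with x h1 ⟨hL2, _, hx1⟩ h2 R hR1 hR2 N hN
  have hx0 : 0 < x := by linarith
  have hR0 : 0 < R := lt_of_lt_of_le (Real.rpow_pos_of_pos (by linarith) _) hR1
  have hc : √x ≤ x / R := by
    rw [le_div_iff₀ hR0]
    calc √x * R ≤ √x * √x := by gcongr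
      _ = x := Real.mul_self_sqrt hx0.le
  have hc1 : 1 ≤ x / R := (Real.one_le_sqrt.2 hx1).trans hc
  have hcx := count_nonneg H.nonneg x
  rw [switchedMain_eq_sum_gSumLt (by linarith) hN]
  have h3 : count s x * (resid h a * Real.log R + constTerm h a) - resid h a * logSum s x =
      ∑ n ∈ Finset.Icc 1 ⌊x⌋₊,
        s n * (resid h a * Real.log (n / (x / R)) + constTerm h a) := by
    rw [count, logSum, Finset.sum_mul, Finset.mul_sum, ← Finset.sum_sub_distrib]
    refine Finset.sum_congr rfl fun n hn => ?_
    have hn0 : (n : ℝ) ≠ 0 := by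
      have := (Finset.mem_Icc.1 hn).1
      exact_mod_cast (by omega : n ≠ 0)
    rw [Real.log_div hn0 (by positivity), Real.log_div hx0.ne' hR0.ne', Real.log_div hx0.ne' hn0]
    ring
  rw [h3, ← Finset.sum_sub_distrib]
  calc _ ≤ ∑ n ∈ Finset.Icc 1 ⌊x⌋₊, K₁ * R ^ (ε - 1) * (s n * (x / n) ^ (1 - ε)) := by
        refine (Finset.abs_sum_le_sum_abs _ _).trans (Finset.sum_le_sum fun n hn => ?_)
        have hn1 := (Finset.mem_Icc.1 hn).1
        have hn0 : (0 : ℝ) < n := by exact_mod_cast hn1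
        have hsn := H.nonneg n hn1
        rw [← mul_sub, abs_mul, abs_of_nonneg hsn]
        calc _ ≤ s n * (K₁ * ((n : ℝ) / (x / R)) ^ (ε - 1)) := by
              gcongr; exact hE n _ hn1 hc1 (h2.trans hc)
          _ = _ := by
              have e : (n : ℝ) / (x / R) = R * (x / n)⁻¹ := by field_simp
              rw [e, Real.mul_rpow hR0.le (by positivity), Real.inv_rpow (by positivity),
                ← Real.rpow_neg (by positivity), neg_sub]
              ring
    _ = K₁ * R ^ (ε - 1) * ∑ n ∈ Finset.Icc 1 ⌊x⌋₊, s n * (x / n) ^ (1 - ε) := by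
        rw [Finset.mul_sum]
    _ ≤ K₁ * (1 / L x ^ (1 + δ / 2)) * (K₂ * count s x) := by
        have := H.rpow_le_of_pow_le hx0.le hR1
        have h4 : 0 ≤ ∑ n ∈ Finset.Icc 1 ⌊x⌋₊, s n * (x / n) ^ (1 - ε) :=
          Finset.sum_nonneg fun n hn => mul_nonneg (H.nonneg n (Finset.mem_Icc.1 hn).1)
            (by positivity)
        gcongr
    _ = _ := by ring

end Regular

end Main

end ArithSeq

end

/-! ### Assembling the estimate for the discrepancy -/

noncomputable section
namespace ArithSeq

section Estimate

variable {s : ℕ → ℝ} {L R : ℝ → ℝ} {h : ArithmeticFunction ℝ} {a : ℤ} {δ C k : ℝ}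

theorem countAP_sub_countAPStar (x : ℝ) (q : ℕ) : countAP s x q a - countAPStar s x q a =
    ∑ n ∈ (Finset.Icc 1 ⌊x⌋₊).filter
      (fun n : ℕ => (n : ℤ) ≤ |a| ∧ (n : ℤ) ≡ a [ZMOD (q : ℤ)]), s n := by
  rw [countAP, countAPStar, sub_eq_iff_eq_add, ← Finset.sum_union]
  · congr 1
    ext n
    simp only [Finset.mem_filter, Finset.mem_union]
    rcases lt_or_ge |a| (n : ℤ) with h1 | h1
    · simp [h1]
    · simp [h1, not_lt.2 h1]
  · refine Finset.disjoint_left.2 fun n hn hn' => ?_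
    have h1 := (Finset.mem_filter.1 hn).2.1
    have h2 := (Finset.mem_filter.1 hn').2.1
    omega

/-- If q > 2|a|, the only n with 1 ≤ n ≤ |a| and n ≡ a mod q is a itself, when it is positive. Hence
the term s(a) is subtracted in the theorem. -/
theorem countAP_sub_countAPStar_eq_termAt {x : ℝ} (hx : |(a : ℝ)| ≤ x) {q : ℕ}
    (hq : 2 * |a| < (q : ℤ)) : countAP s x q a - countAPStar s x q a = termAt s a := by
  have key : ∀ n : ℕ, (n : ℤ) ≤ |a| → (n : ℤ) ≡ a [ZMOD (q : ℤ)] → (n : ℤ) = a := by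
    intro n h1 h2
    have h3 : (q : ℤ) ∣ n - a := Int.ModEq.dvd h2.symm
    have h4 : |(n : ℤ) - a| < q := by
      have := abs_sub (n : ℤ) a
      rw [abs_of_nonneg (Int.natCast_nonneg n)] at this
      omega
    have := Int.eq_zero_of_abs_lt_dvd h3 h4
    omega
  rw [countAP_sub_countAPStar, termAt]
  split_ifs with ha
  · rw [Finset.sum_eq_single a.toNat]
    · intro n hn hne
      obtain ⟨-, h1, h2⟩ := Finset.mem_filter.1 hn
      have := key n h1 h2
      omega
    · intro hn
      refine absurd (Finset.mem_filter.2 ⟨Finset.mem_Icc.2 ⟨by omega, Nat.le_floor ?_⟩, ?_, ?_⟩) hn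
      · have h1 : ((a.toNat : ℤ) : ℝ) = a := by exact_mod_cast Int.toNat_of_nonneg ha.le
        rw [Int.cast_natCast] at h1
        rw [h1]
        exact (le_abs_self _).trans hx
      · rw [Int.toNat_of_nonneg ha.le]; exact le_abs_self _
      · rw [Int.toNat_of_nonneg ha.le]
  · refine Finset.sum_eq_zero fun n hn => ?_
    obtain ⟨h0, h1, h2⟩ := Finset.mem_filter.1 hn
    have := key n h1 h2
    have := (Finset.mem_Icc.1 h0).1
    omega

namespace Regular

/-- Replacing `𝒜(x; q, a) - s(a)` by `𝒜*(x; q, a)` costs `O(𝒜(x) / L(x) ^ (1 + δ))`. -/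
theorem eventually_abs_discrepancy_sub_le (H : Regular s L δ C)
    (hlt : ∀ p : ℕ, p.Prime → h p < p) :
    ∀ᶠ x in atTop, ∀ M : ℝ, |discrepancy s h a x M - ∑ q ∈ Finset.Icc 1 ⌊x / M⌋₊,
        (countAPStar s x q a - g h a q * count s x)| ≤
      2 * a.natAbs * (2 * a.natAbs * C) * (count s x / L x ^ (1 + δ)) := by
  filter_upwards [H.term, eventually_ge_atTop |(a : ℝ)|, H.eventually_scale] with
    x h1 h2 ⟨h3, _, h4⟩ M
  set E := C * (count s x / L x ^ (1 + δ)) with hE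
  have hE0 : 0 ≤ E := mul_nonneg H.const_nonneg
    (div_nonneg (count_nonneg H.nonneg x) (Real.rpow_nonneg (by linarith) _))
  have hab : |(a : ℝ)| = a.natAbs := by rw [Nat.cast_natAbs, Int.cast_abs]
  have hterm : |termAt s a| ≤ a.natAbs * E := by
    rw [termAt]
    split_ifs with ha
    · have h5 : a.toNat = a.natAbs := by omega
      have h6 : 1 ≤ a.natAbs := by omega
      rw [h5, abs_of_nonneg (H.nonneg _ h6)]
      refine (h1 _ h6 (by rw [← hab]; exact h2)).trans (le_mul_of_one_le_left hE0 ?_)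
      exact_mod_cast h6
    · rw [abs_zero]; positivity
  rw [discrepancy, ← Finset.sum_sub_distrib]
  have h5 : ∀ q ∈ Finset.Icc 1 ⌊x / M⌋₊,
      |countAP s x q a - termAt s a - f h a q / (q * gam h q) * count s x -
        (countAPStar s x q a - g h a q * count s x)| ≤
      if q ≤ 2 * a.natAbs then 2 * a.natAbs * E else 0 := by
    intro q hq
    rw [f_div_eq_g hlt (Finset.mem_Icc.1 hq).1]
    have e : countAP s x q a - termAt s a - g h a q * count s x -
        (countAPStar s x q a - g h a q * count s x) =
        (countAP s x q a - countAPStar s x q a) - termAt s a := by ring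
    rw [e]
    split_ifs with h6
    · have h7 : |countAP s x q a - countAPStar s x q a| ≤ a.natAbs * E := by
        rw [countAP_sub_countAPStar]
        calc _ ≤ ∑ n ∈ (Finset.Icc 1 ⌊x⌋₊).filter
              (fun n : ℕ => (n : ℤ) ≤ |a| ∧ (n : ℤ) ≡ a [ZMOD (q : ℤ)]), E := by
              refine (Finset.abs_sum_le_sum_abs _ _).trans (Finset.sum_le_sum fun n hn => ?_)
              obtain ⟨h8, h9⟩ := Finset.mem_Icc.1 (Finset.mem_filter.1 hn).1
              rw [abs_of_nonneg (H.nonneg n h8)]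
              exact h1 n h8 ((Nat.le_floor_iff' (by omega)).1 h9)
          _ ≤ ∑ n ∈ Finset.Icc 1 a.natAbs, E := by
              refine Finset.sum_le_sum_of_subset_of_nonneg (fun n hn => ?_) fun _ _ _ => hE0
              obtain ⟨h8, h9, -⟩ := Finset.mem_filter.1 hn
              exact Finset.mem_Icc.2 ⟨(Finset.mem_Icc.1 h8).1, by rw [Int.abs_eq_natAbs] at h9; omega⟩
          _ = _ := by simp
      refine (abs_sub _ _).trans ?_
      linarith
    · rw [countAP_sub_countAPStar_eq_termAt h2 (by rw [Int.abs_eq_natAbs]; omega), sub_self, abs_zero]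
  refine ((Finset.abs_sum_le_sum_abs _ _).trans (Finset.sum_le_sum h5)).trans ?_
  rw [← Finset.sum_filter]
  calc _ ≤ ∑ q ∈ Finset.Icc 1 (2 * a.natAbs), 2 * a.natAbs * E := by
        refine Finset.sum_le_sum_of_subset_of_nonneg (fun n hn => ?_) fun _ _ _ => by positivity
        obtain ⟨h8, h9⟩ := Finset.mem_filter.1 hn
        exact Finset.mem_Icc.2 ⟨(Finset.mem_Icc.1 h8).1, h9⟩
    _ = _ := by
        rw [Finset.sum_const, Nat.card_Icc, nsmul_eq_mul, hE]; push_cast [Nat.add_sub_cancel]; ring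

/-- The bookkeeping of the cancellation, with X, ρ, m the logarithms of x, R, M and J the
logarithmic mean. The main terms add up to -F + c(A - J), so only F survives. -/
theorem abs_add_le_of_switched {A c c' ρ m X J G₁ G₂ V₁ V₂ W₁ W₂ B D F e₀ e₁ e₂ e₃ e₄ e₅ e₆ : ℝ}
    (hD : |D - (B + ((V₁ - V₂) - A * (G₂ - G₁)))| ≤ e₀) (hB : |B| ≤ e₁)
    (hV₁ : |V₁ - W₁| ≤ e₂) (hV₂ : |V₂ - W₂| ≤ e₂)
    (hW₁ : |W₁ - (A * (c * ρ + c') - c * J)| ≤ e₃)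
    (hW₂ : |W₂ - (A * (c * m + c' - c) + F)| ≤ e₄)
    (hG₁ : |A * G₁ - A * (c * (X - ρ) + c')| ≤ e₅)
    (hG₂ : |A * G₂ - A * (c * (X - m) + c')| ≤ e₅) (hJ : |c * J - c * A| ≤ e₆) :
    |D + F| ≤ e₀ + e₁ + 2 * e₂ + e₃ + e₄ + 2 * e₅ + e₆ := by
  rw [abs_le] at *
  constructor <;> linarith [hD.1, hD.2]

/-- This is the arithmetic half of the theorem: it reduces the sum over q to the remainder F, which
depends on M alone. -/
theorem exists_abs_discrepancy_add_le (H : Regular s L δ C) (hmul : h.IsMultiplicative)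
    (hA : AnalyticCondition h k) (hpos : ∀ p : ℕ, p.Prime → 0 ≤ h p)
    (hR : ∀ᶠ x in atTop, L x ^ (1 + δ) ≤ R x ∧ R x ≤ √x)
    (hBV : ∀ᶠ x in atTop, ∑ q ∈ Finset.Icc 1 ⌊2 * R x⌋₊, (⨆ y : Set.Icc (0 : ℝ) x,
      |countAP s y q a - f h a q / (q * gam h q) * count s y|) ≤
        C * (count s x / L x ^ (1 + δ)))
    (hBFI : ∀ᶠ x in atTop, |∑ q ∈ Finset.Icc 1 ⌊x / R x⌋₊,
      (countAPStar s x q a - f h a q / (q * gam h q) * count s x)| ≤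
        C * (count s x / L x ^ (1 + δ))) :
    ∃ K : ℝ, 0 ≤ K ∧ ∀ᶠ x in atTop, ∀ M, 1 < M → M ≤ L x →
      |discrepancy s h a x M + count s x / M * corrRem h a (Real.log M)| ≤
        K * (count s x / L x ^ (1 + δ / 2) + count s x / (L x * L (x / L x))) := by
  have hδ := H.delta_pos
  have hδ1 := H.delta_le
  have hC := H.const_nonneg
  have hlt := hA.2.2.2.2.1
  set ε := δ / 2 / (1 + δ) with hε
  have hε0 : 0 < ε := by positivity
  have hε1 : ε ≤ 1 / 2 := by rw [hε, div_le_iff₀ (by linarith)]; linarith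
  obtain ⟨K₁, hK₁, hs⟩ := H.exists_switchedMain_small (a := a) hmul hA hpos
  obtain ⟨K₂, hK₂, hl⟩ := H.exists_switchedMain_large (a := a) hmul hA hpos
  obtain ⟨K₃, hK₃, hJ⟩ := H.exists_abs_logSum_sub_le
  obtain ⟨K₄, hK₄, hG⟩ := exists_abs_gSum_sub_le (a := a) hmul hA hpos hε0 hε1
  set K₅ := 2 * a.natAbs * (2 * a.natAbs * C) with hK₅
  have hK₅0 : 0 ≤ K₅ := by positivity
  refine ⟨K₁ + K₂ + |resid h a| * K₃ + 2 * K₄ + K₅ + 5 * C, by positivity, ?_⟩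
  filter_upwards [hs, hl, hJ, H.eventually_abs_discrepancy_sub_le (a := a) hlt, hR, hBV, hBFI,
    H.eventually_scale, H.tendsto_div_scale.eventually_ge_atTop 0,
    Real.tendsto_sqrt_atTop.eventually_ge_atTop (2 * |(a : ℝ)|),
    eventually_ge_atTop (2 * |(a : ℝ)|)] with
    x hs hl hJ hD ⟨hR1, hR2⟩ hBV hBFI ⟨hL2, hLs, hx1⟩ hy hsa hxa M hM1 hM2
  have hx0 : 0 < x := by linarith
  have hL0 : 0 < L x := by linarith
  have hM0 : 0 < M := by linarith
  have hcx := count_nonneg H.nonneg x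
  have hLR : L x ≤ R x := (Real.self_le_rpow_of_one_le (by linarith) (by linarith)).trans hR1
  have hMR : M ≤ R x := hM2.trans hLR
  have hR0 : 0 < R x := by linarith
  have hsR : √x ≤ x / R x := by
    rw [le_div_iff₀ hR0]
    calc √x * R x ≤ √x * √x := by gcongr
      _ = x := Real.mul_self_sqrt hx0.le
  have hRM : x / R x ≤ x / M := by gcongr
  have hs0 : 0 < √x := Real.sqrt_pos.2 hx0
  -- Cofactors reach (x + |a|)/(x/R) = R + R|a|/x, slightly beyond R. This is why hypothesis 1
  -- extends to 2R.
  set N := ⌊2 * R x⌋₊ with hN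
  have hNR : (x + |(a : ℝ)|) / (x / R x) ≤ N := by
    have h1 : 2 * R x - 1 ≤ N := (Nat.sub_one_lt_floor _).le
    have h2 : (x + |(a : ℝ)|) / (x / R x) = R x + R x * (|(a : ℝ)| / x) := by field_simp
    have h3 : |(a : ℝ)| / x ≤ 1 / 2 := by rw [div_le_div_iff₀ hx0 two_pos]; linarith
    rw [h2]
    nlinarith
  have hNM : M ≤ N := by
    have h1 : 2 * R x - 1 ≤ N := (Nat.sub_one_lt_floor _).le
    linarith
  set E := count s x / L x ^ (1 + δ / 2) with hE
  set E' := count s x / (L x * L (x / L x)) with hE'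
  have hE0 : 0 ≤ E := by positivity
  have hE'0 : 0 ≤ E' := div_nonneg hcx (mul_nonneg hL0.le (by linarith [H.one_le hy]))
  have hEE : count s x / L x ^ (1 + δ) ≤ E := H.div_rpow_le hx0.le (by linarith)
  have hbc : |(a : ℝ)| ≤ x / R x := by linarith [abs_nonneg (a : ℝ)]
  -- the switched sums
  have hsw := sum_countAPStar_eq_switched (s := s) (a := a) (x := x) (hs0.trans_le hsR) hRM
    (hsa.trans hsR) hNR
  have hswR := abs_switched_sub_le (h := h) H.nonneg hlt hx0.le hbc N
  have hswM := abs_switched_sub_le (h := h) H.nonneg hlt hx0.le (hbc.trans hRM) N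
  have hmM := hs M hM1 hM2 N hNM
  have hmR := hl (R x) hR1 hR2 N hNR
  rw [sum_g_mul_one_sub hmul hA hpos hM0] at hmM
  -- the sums of `g`
  have hgS : ∀ t, x / R x ≤ t → |count s x * gSum h a t -
      count s x * (resid h a * Real.log t + constTerm h a)| ≤ K₄ * E := by
    intro t ht
    have ht0 : 0 < t := lt_of_lt_of_le (hs0.trans_le hsR) ht
    rw [← mul_sub, abs_mul, abs_of_nonneg hcx]
    have h1 := H.rpow_le_of_pow_le hx0.le ((hR1.trans hR2).trans (hsR.trans ht))
    calc _ ≤ count s x * (K₄ * (1 / L x ^ (1 + δ / 2))) := by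
          gcongr; exact (hG t ht0).trans (by gcongr)
      _ = _ := by rw [hE]; ring
  have hgR := hgS _ le_rfl
  have hgM := hgS _ hRM
  rw [Real.log_div hx0.ne' hR0.ne'] at hgR
  rw [Real.log_div hx0.ne' hM0.ne'] at hgM
  have hJ' : |resid h a * logSum s x - resid h a * count s x| ≤
      |resid h a| * K₃ * (E + E') := by
    rw [← mul_sub, abs_mul, mul_assoc]; gcongr
  -- the splitting of the range
  have hsplit : ∑ q ∈ Finset.Icc 1 ⌊x / M⌋₊, (countAPStar s x q a - g h a q * count s x) =
      (∑ q ∈ Finset.Icc 1 ⌊x / R x⌋₊,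
        (countAPStar s x q a - f h a q / (q * gam h q) * count s x)) +
      ((switched s a x (x / R x) N - switched s a x (x / M) N) -
        count s x * (gSum h a (x / M) - gSum h a (x / R x))) := by
    have h1 : ∀ F : ℕ → ℝ, ∑ q ∈ Finset.Icc 1 ⌊x / M⌋₊, F q =
        ∑ q ∈ Finset.Icc 1 ⌊x / R x⌋₊, F q + ∑ q ∈ Finset.Ioc ⌊x / R x⌋₊ ⌊x / M⌋₊, F q := fun F =>
      (Finset.sum_Ioc_consecutive F (Nat.zero_le _) (Nat.floor_le_floor hRM)).symm
    have h2 : gSum h a (x / M) - gSum h a (x / R x) =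
        ∑ q ∈ Finset.Ioc ⌊x / R x⌋₊ ⌊x / M⌋₊, g h a q := by
      rw [gSum, gSum, h1 fun q => g h a q, add_sub_cancel_left]
    rw [h1, h2, ← hsw, Finset.sum_sub_distrib (s := Finset.Ioc _ _), ← Finset.sum_mul,
      mul_comm (count s x)]
    congr 1
    refine Finset.sum_congr rfl fun q hq => ?_
    rw [f_div_eq_g hlt (Finset.mem_Icc.1 hq).1]
  have hD := hD M
  rw [hsplit] at hD
  have e1 : C * (count s x / L x ^ (1 + δ)) ≤ C * E := by gcongr
  have e2 : K₅ * (count s x / L x ^ (1 + δ)) ≤ K₅ * E := by gcongr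
  have e3 : 0 ≤ (K₁ + K₂ + 2 * K₄ + K₅ + 5 * C) * E' := by positivity
  have e4 : count s x * (resid h a * Real.log M + constTerm h a - resid h a +
      corrRem h a (Real.log M) / M) = count s x * (resid h a * Real.log M + constTerm h a -
        resid h a) + count s x / M * corrRem h a (Real.log M) := by ring
  rw [e4] at hmM
  refine (abs_add_le_of_switched hD (hBFI.trans e1) (hswR.trans
    (mul_le_mul_of_nonneg_left (hBV.trans e1) two_pos.le)) (hswM.trans
    (mul_le_mul_of_nonneg_left (hBV.trans e1) two_pos.le)) hmR hmM hgR hgM hJ').trans ?_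
  linarith

end Regular

end Estimate

end ArithSeq

end

/-! ### Common constants, error terms and conclusion -/

noncomputable section
namespace ArithSeq

variable {s : ℕ → ℝ} {L R : ℝ → ℝ} {h : ArithmeticFunction ℝ} {a : ℤ} {δ C k : ℝ}

/-- Since L ≥ 1, all the bounds survive with the smallest δ, capped at 1, and the largest constant.
The chain L^{1+δ} ≤ R ≤ √x shows that L is small compared with x. -/
theorem exists_regular (hs : ∀ n, 1 ≤ n → 0 ≤ s n) (hL : IsScale L)
    (hyp1 : BombieriVinogradov s h a L R) (hyp2 : RegularSize s a L)
    (hyp4 : BombieriFriedlanderIwaniec s h a L R) :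
    ∃ δ C : ℝ, Regular s L δ C ∧
    (∀ᶠ x in atTop, L x ^ (1 + δ) ≤ R x ∧ R x ≤ √x) ∧
    (∀ᶠ x in atTop, ∑ q ∈ Finset.Icc 1 ⌊2 * R x⌋₊, (⨆ y : Set.Icc (0 : ℝ) x,
      |countAP s y q a - f h a q / (q * gam h q) * count s y|) ≤
        C * (count s x / L x ^ (1 + δ))) ∧
    (∀ᶠ x in atTop, |∑ q ∈ Finset.Icc 1 ⌊x / R x⌋₊,
      (countAPStar s x q a - f h a q / (q * gam h q) * count s x)| ≤
        C * (count s x / L x ^ (1 + δ))) := by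
  have hpos := eventually_count_pos hs hL hyp2
  obtain ⟨-, -, δ₁, hδ₁, C₁, h1⟩ := hyp1
  obtain ⟨δ₂, hδ₂, C₂, h2⟩ := hyp2
  obtain ⟨δ₄, hδ₄, C₄, h4⟩ := hyp4
  set δ := min (min δ₁ δ₂) (min δ₄ 1) with hδ
  have hd1 : δ ≤ δ₁ := (min_le_left _ _).trans (min_le_left _ _)
  have hd2 : δ ≤ δ₂ := (min_le_left _ _).trans (min_le_right _ _)
  have hd4 : δ ≤ δ₄ := (min_le_right _ _).trans (min_le_left _ _)
  have hd0 : 0 < δ := lt_min (lt_min hδ₁ hδ₂) (lt_min hδ₄ one_pos)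
  set C := max (max |C₁| |C₂|) |C₄| with hC
  have hc1 : C₁ ≤ C := (le_abs_self _).trans ((le_max_left _ _).trans (le_max_left _ _))
  have hc2 : C₂ ≤ C := (le_abs_self _).trans ((le_max_right _ _).trans (le_max_left _ _))
  have hc4 : C₄ ≤ C := (le_abs_self _).trans (le_max_right _ _)
  have hC0 : 0 ≤ C := (abs_nonneg _).trans (le_max_right _ _)
  have weak : ∀ {c d x : ℝ}, c ≤ C → δ ≤ d → 0 ≤ x →
      c * (count s x / L x ^ (1 + d)) ≤ C * (count s x / L x ^ (1 + δ)) := by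
    intro c d x hc hd hx
    have hLx := hL.one_le x hx
    have hcx := count_nonneg hs x
    have h0 : 0 < L x ^ (1 + δ) := Real.rpow_pos_of_pos (by linarith) _
    gcongr
  have hpow : ∀ᶠ x in atTop, L x ^ (1 + δ) ≤ R x ∧ R x ≤ √x := by
    filter_upwards [h1, eventually_ge_atTop 0] with x ⟨h5, h6, _⟩ hx
    have hLx := hL.one_le x hx
    exact ⟨le_trans (by gcongr) h5, h6⟩
  refine ⟨δ, C, ⟨hs, hL, hd0, (min_le_right _ _).trans (min_le_right _ _), hC0, hpos,
    hpow.mono fun x hx => hx.1.trans hx.2, ?_, ?_⟩, hpow, ?_, ?_⟩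
  · filter_upwards [h2, hpos, eventually_ge_atTop 0] with x ⟨h5, _⟩ hp hx z hz hz1
    have h6 := h5 z hz (hz1.trans (le_add_of_nonneg_right (by positivity)))
    have e : count s (z * x) - z * count s x =
        (count s (z * x) / count s x - z) * count s x := by field_simp
    rw [e, abs_mul, abs_of_pos hp]
    calc _ ≤ C₂ * (1 / L x ^ (1 + δ₂)) * count s x := by gcongr
      _ = C₂ * (count s x / L x ^ (1 + δ₂)) := by ring
      _ ≤ _ := weak hc2 hd2 hx
  · filter_upwards [h2, eventually_ge_atTop 0] with x ⟨_, h6⟩ hx n hn hnx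
    exact (h6 n hn hnx).trans (weak hc2 hd2 hx)
  · filter_upwards [h1, eventually_ge_atTop 0] with x ⟨_, _, h6⟩ hx
    exact h6.trans (weak hc1 hd1 hx)
  · filter_upwards [h4, eventually_ge_atTop 0] with x h6 hx
    exact h6.trans (weak hc4 hd4 hx)

/-- A power of `log L(x)` is at most a constant multiple of `L(x) ^ δ'` and of `L(x / L(x))`. -/
theorem IsScale.exists_log_rpow_le (hL : IsScale L) {B d : ℝ} (hB : 0 < B) (hd : 0 < d) :
    ∃ K : ℝ, 0 ≤ K ∧ ∀ x, 0 ≤ x →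
      Real.log (L x) ^ B ≤ K * L x ^ d ∧ Real.log (L x) ^ B ≤ K * L (x / L x) := by
  obtain ⟨x₁, hx₁⟩ := eventually_atTop.1 (hL.regular B hB)
  set y := max x₁ 0 with hy
  set K₁ := (1 / (d / B)) ^ B with hK₁
  set K₂ := max 1 (Real.log (L y) ^ B) with hK₂
  have hK₁0 : 0 ≤ K₁ := by positivity
  have hK₂1 : 1 ≤ K₂ := le_max_left _ _
  refine ⟨K₁ + K₂, by positivity, fun x hx => ?_⟩
  have hLx := hL.one_le x hx
  have hL0 : 0 < L x := by linarith
  have hLy : 1 ≤ L (x / L x) := hL.one_le _ (by positivity)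
  have hlog := Real.log_nonneg hLx
  constructor
  · have h1 := Real.log_le_rpow_div hL0.le (div_pos hd hB)
    calc _ ≤ (L x ^ (d / B) / (d / B)) ^ B := by gcongr
      _ = K₁ * L x ^ d := by
          rw [div_eq_mul_one_div, Real.mul_rpow (by positivity) (by positivity),
            ← Real.rpow_mul hL0.le, div_mul_cancel₀ _ hB.ne', mul_comm]
      _ ≤ _ := by gcongr; linarith
  · rcases le_total x₁ x with h1 | h1
    · refine (hx₁ x h1).trans (le_mul_of_one_le_left (by linarith) (by linarith))
    -- Below the threshold, monotonicity bounds log L(x) by a constant. Hence the estimate holds for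
    -- all x ≥ 0.
    · have h2 : L x ≤ L y :=
        hL.mono (Set.mem_Ici.2 hx) (Set.mem_Ici.2 (le_max_right _ _)) (h1.trans (le_max_left _ _))
      calc _ ≤ Real.log (L y) ^ B := by gcongr
        _ ≤ K₂ := le_max_right _ _
        _ ≤ _ := by nlinarith

/-- The error terms are `O(1 / (M log ^ B M))` for `1 < M ≤ L(x)`. -/
theorem IsScale.exists_error_le (hL : IsScale L) {B d : ℝ} (hB : 0 < B) (hd : 0 < d) :
    ∃ K : ℝ, 0 ≤ K ∧ ∀ x, 0 ≤ x → ∀ M, 1 < M → M ≤ L x →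
      1 / L x ^ (1 + d) + 1 / (L x * L (x / L x)) ≤ K * (1 / M * (1 / Real.log M ^ B)) := by
  obtain ⟨K, hK, hb⟩ := hL.exists_log_rpow_le hB hd
  refine ⟨2 * K, by positivity, fun x hx M hM1 hM2 => ?_⟩
  have hM0 : 0 < M := by linarith
  have hL0 : 0 < L x := by linarith
  have hLy : 1 ≤ L (x / L x) := hL.one_le _ (by positivity)
  have hlM := Real.log_pos hM1
  have hlogB : 0 < Real.log M ^ B := Real.rpow_pos_of_pos hlM _
  have hle : Real.log M ^ B ≤ Real.log (L x) ^ B := by gcongr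
  obtain ⟨h1, h2⟩ := hb x hx
  have key : ∀ w : ℝ, 0 < w → Real.log (L x) ^ B ≤ K * w →
      1 / (L x * w) ≤ K * (1 / M * (1 / Real.log M ^ B)) := by
    intro w hw hwK
    rw [one_div_mul_one_div, mul_one_div, div_le_div_iff₀ (by positivity) (by positivity), one_mul]
    calc M * Real.log M ^ B ≤ L x * (K * w) := by
          gcongr; exact hle.trans hwK
      _ = _ := by ring
  have h3 := key _ (Real.rpow_pos_of_pos hL0 d) h1
  have h4 := key _ (by linarith) h2
  rw [Real.rpow_add hL0, Real.rpow_one]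
  linarith

end ArithSeq

end

theorem theorem4p1 (s : ℕ → ℝ) (hs : ∀ n, 1 ≤ n → 0 ≤ s n)
    (h : ArithmeticFunction ℝ) (hmul : h.IsMultiplicative)
    (heq : ArithSeq.Equidistributed s h)
    (a : ℤ) (ha : a ≠ 0) (k : ℝ) (L R : ℝ → ℝ) (hL : ArithSeq.IsScale L)
    (hyp1 : ArithSeq.BombieriVinogradov s h a L R)
    (hyp2 : ArithSeq.RegularSize s a L)
    (hyp3 : ArithSeq.AnalyticCondition h k)
    (hyp4 : ArithSeq.BombieriFriedlanderIwaniec s h a L R) :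
    Tendsto (ArithSeq.partialProduct h k a) atTop (𝓝 (ArithSeq.singularProduct h k a)) ∧
    ∃ η : ℝ → ℝ, Tendsto η atTop (𝓝 0) ∧ ∃ x₀ : ℝ, ∀ A : ℝ, 0 < A → ∃ C : ℝ,
      ∀ x : ℝ, x₀ ≤ x → ∀ M : ℝ, 1 < M → M ≤ L x →
        |ArithSeq.discrepancy s h a x M - ArithSeq.count s x / M * ArithSeq.mu h k a M| ≤
          ArithSeq.count s x / M *
            (η M * |ArithSeq.mu h k a M| + C * (1 / Real.log M ^ A)) := by
  have hcount := ArithSeq.eventually_count_pos hs hL hyp2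
  have hpp : ∀ p : ℕ, p.Prime → ∀ e, 0 ≤ h (p ^ e) := fun p hp e =>
    ArithSeq.nonneg_prime_pow hs hmul heq hyp3.2.2.2.2.1 hcount hp e
  have hpos : ∀ p : ℕ, p.Prime → 0 ≤ h p := fun p hp => by simpa using hpp p hp 1
  refine ⟨ArithSeq.tendsto_partialProduct hmul hyp3 hpp, ?_⟩
  obtain ⟨δ, C₀, H, hR, hBV, hBFI⟩ := ArithSeq.exists_regular hs hL hyp1 hyp2 hyp4
  obtain ⟨K, hK, hmain⟩ := H.exists_abs_discrepancy_add_le hmul hyp3 hpos hR hBV hBFI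
  obtain ⟨η, hη, hF⟩ := ArithSeq.corrRem_asymptotic (a := a) hmul hyp3 hpp
  -- The threshold is fixed before A. This is possible because the arithmetic estimate does not
  -- involve A and the later error bound holds for every x ≥ 0.
  obtain ⟨x₀, hx₀⟩ := eventually_atTop.1 (hmain.and (eventually_ge_atTop 0))
  refine ⟨η, hη, x₀, fun A hA => ?_⟩
  obtain ⟨C₁, hC₁⟩ := hF A hA
  obtain ⟨K₁, hK₁, herr⟩ := hL.exists_error_le hA (half_pos H.delta_pos)
  refine ⟨C₁ + K * K₁, fun x hx M hM1 hM2 => ?_⟩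
  obtain ⟨h1, hx0⟩ := hx₀ x hx
  have hM0 : 0 < M := by linarith
  have hcx := ArithSeq.count_nonneg hs x
  have h2 := h1 M hM1 hM2
  have h3 := hC₁ M hM1
  have h4 := herr x hx0 M hM1 hM2
  have h5 : 0 ≤ ArithSeq.count s x / M := by positivity
  -- The remainder F(log M) is inserted between the discrepancy and μ, separating the arithmetic
  -- error from the analytic one.
  have e : ArithSeq.discrepancy s h a x M - ArithSeq.count s x / M * ArithSeq.mu h k a M =
      (ArithSeq.discrepancy s h a x M +
        ArithSeq.count s x / M * ArithSeq.corrRem h a (Real.log M)) -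
      ArithSeq.count s x / M * (ArithSeq.corrRem h a (Real.log M) + ArithSeq.mu h k a M) := by ring
  rw [e]
  refine (abs_sub _ _).trans ?_
  rw [abs_mul, abs_of_nonneg h5]
  have h6 : ArithSeq.count s x / L x ^ (1 + δ / 2) + ArithSeq.count s x / (L x * L (x / L x)) ≤
      ArithSeq.count s x / M * (K₁ * (1 / Real.log M ^ A)) := by
    calc _ = ArithSeq.count s x * (1 / L x ^ (1 + δ / 2) + 1 / (L x * L (x / L x))) := by ring
      _ ≤ ArithSeq.count s x * (K₁ * (1 / M * (1 / Real.log M ^ A))) := by gcongr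
      _ = _ := by ring
  calc _ ≤ K * (ArithSeq.count s x / M * (K₁ * (1 / Real.log M ^ A))) +
        ArithSeq.count s x / M * (η M * |ArithSeq.mu h k a M| + C₁ * (1 / Real.log M ^ A)) := by
        gcongr
        exact h2.trans (by gcongr)
    _ = _ := by ring
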